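/- Let $0<n<3$, let $\Omega=(\alpha,\beta)$ be a bounded open interval, let $0<T<\infty$, $1\le p<\infty$, and let $u_{in}\in H^1(\Omega)$, $u_{in}\ge 0$. Put $$B(s)=\int_0^s\int_r^\infty\frac{dv}{v^{n-1}+v^2}\,dr,\qquad B^\varepsilon(s)=\frac{1}{|\ln\varepsilon|}B(s/\varepsilon).$$ For $0<\varepsilon<1$, a *solution* $u^\varepsilon$ means a continuous non-negative weak solution on $[0,\infty)\times\overline\Omega$ of the thin film equation $$|\ln\varepsilon|^{-1}\partial_t u+\partial_x\big((\varepsilon^{3-n}u^n+u^3)\,u_{xxx}\big)=0\ \text{ in }(0,\infty)\times\Omega,\qquad (\varepsilon^{3-n}u^n+u^3)u_{xxx}=0,\ \ u_x=0\ \text{ on }\partial\Omega,\qquad u(0,\cdot)=u_{in},$$ which has the following properties. For every $t>0$, $u(t,\cdot)\in H^1(\Omega)$; for a.e. $t$, $u(t,\cdot)\in C^1(\overline\Omega)$, and $u_{xx}$, $u_{xxx}$ exist as weak derivatives in $\{u(t,\cdot)>0\}$; $u\,u_{xxx}\in L^2((0,S)\times\Omega)$ for all $S>0$ (products with a factor $u$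 are understood to be $0$ on $\{u=0\}$). For every $t>0$, $$\int_\Omega u(t)\,dx=\int_\Omega u_{in}\,dx,\qquad \int_\Omega\tfrac12 u_x(t)^2dx+\int_0^t\!\!\int_{\{u>0\}}|\ln\varepsilon|(\varepsilon^{3-n}u^n+u^3)u_{xxx}^2\,dx\,ds\le\int_\Omega\tfrac12 (u_{in}')^2dx,$$ $$\int_\Omega B^\varepsilon(u(t))\,dx\ \ge\ \int_0^t\!\!\int_\Omega u\,u_{xx}^2\,dx\,ds+\int_\Omega B^\varepsilon(u_{in})\,dx .$$ Finally, $\rho^\varepsilon=B^\varepsilon(u^\varepsilon)$ satisfies $\partial_t\rho^\varepsilon=T^\varepsilon+\partial_xR^\varepsilon$ in the sense of distributions (initial value $B^\varepsilon(u_{in})$, test functions smooth on $[0,\infty)\times\overline\Omega$ with compact support), where $T^\varepsilon=-u\,u_x\,u_{xxx}$ and $R^\varepsilon=-|\ln\varepsilon|\,(B^{\varepsilon})'(u)\,(\varepsilon^{3-n}u^{n-1}+u^2)\,u\,u_{xxx}$, and for a.e. $t$ and all $\varphi\in C^\infty(\overline\Omega)$ $$\int_\Omega T^\varepsilon\varphi\,dx=\int_\Omega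 u\,u_{xx}^2\varphi\,dx-\tfrac56\int_\Omega u_x^3\varphi'\,dx-\tfrac12\int_\Omega u\,u_x^2\varphi''\,dx .$$ Let $\varepsilon_k\in(0,1)$, $\varepsilon_k\to0$, let $u^{\varepsilon_k}$ be solutions with the same initial datum $u_{in}$, and suppose that $\rho^{\varepsilon_k}=B^{\varepsilon_k}(u^{\varepsilon_k})$ converges in $L^p(0,T;W^{-1,1}(\Omega))$ to an (integrable) function $\rho(t,x)$. Let $$\Sigma(t)=\Big\{x\in\Omega:\ \exists r>0,\ \int_{B_r(x)\cap\Omega}(1-\rho(t,y))\,dy=0\Big\},$$ and assume that for a.e. $t\in(0,T)$ the set $\Sigma(t)$ is a single (non-empty, open) interval. (a) If $\Sigma(t)$ is compactly contained in $\Omega$ for a.e. $t\in(0,T)$, then there is a subsequence $\varepsilon_k'$ of $\varepsilon_k$ such that for a.e. $t\in(0,T)$, $u^{\varepsilon_k'}(t,\cdot)$ converges, uniformly and weakly in $H^1(\Omega)$, to the continuous function $w(t,\cdot)\in H^1(\Omega)$ that is positive in $\Sigma(t)$, vanishes outside $\Sigma(t)$, satisfies $w_{xx}=-\lambda(t)$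 in $\Sigma(t)$ with $\lambda(t)$ constant in $x$, and has $\int_\Omega w(t,x)\,dx=\int_\Omega u_{in}\,dx$. (b) Whenever $\varepsilon_k'$ is a subsequence of $\varepsilon_k$ such that, for a.e. $t\in(0,T)$, $u^{\varepsilon_k'}(t,\cdot)$ converges uniformly in $\Omega$ to a function $w(t,\cdot)$, and such that $$\lim_{k\to\infty}\int_0^T\!\!\int_\Omega u^{\varepsilon_k'}(u^{\varepsilon_k'}_{xx})^2\,dx\,dt=\int_0^T\!\!\int_{\{w>0\}}w\,(w_{xx})^2\,dx\,dt ,$$ then $\rho(t,\cdot)=\chi_{\Sigma(t)}$ a.e. in $\Omega$ for a.e. $t\in(0,T)$, and $\rho$ is a solution in the sense of distributions of $$\partial_t\rho=\tfrac13|w_x|^3\,d\mathcal H^0|_{\partial\{w>0\}}\ \text{ in }\Omega\times(0,T),\qquad \rho(t=0)=\chi_{\{u_{in}>0\}}\ \text{ in }\Omega ,$$ that is, for every $\psi\in C_c^\infty((-\infty,T)\times\Omega)$ the function $t\mapsto\int_{\partial\{w(t)>0\}}|w_x|^3\psi\,d\mathcal H^0$ is integrable on $(0,T)$ and $$-\int_0^T\!\!\int_\Omega\rho\,\partial_t\psi\,dx\,dt=\int_{\{u_{in}>0\}}\psi(0,x)\,dx+\frac13\int_0^T\!\!\int_{\partial\{w(t)>0\}}|w_x(t,x)|^3\psi(t,x)\,d\mathcal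 H^0(x)\,dt ,$$ where $w_x$ on $\partial\{w(t)>0\}$ is the one-sided derivative from within $\{w(t)>0\}$. This is the weak form of Tanner's law $V=\frac13|w_x|^3$. -/

import Mathlib

open MeasureTheory Set Filter Topology
open scoped ContDiff ENNReal

namespace TannerLaw

/-- Smooth test functions of one variable whose support is a compact subset of `U`. -/
def IsTest (U : Set ℝ) (φ : ℝ → ℝ) : Prop :=
  ContDiff ℝ ∞ φ ∧ HasCompactSupport φ ∧ tsupport φ ⊆ U

/-- Smooth test functions of `(t, x)` whose support is a compact subset of `W ⊆ ℝ × ℝ`. -/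
def IsTest₂ (W : Set (ℝ × ℝ)) (ψ : ℝ → ℝ → ℝ) : Prop :=
  ContDiff ℝ ∞ (Function.uncurry ψ) ∧ HasCompactSupport (Function.uncurry ψ) ∧
    tsupport (Function.uncurry ψ) ⊆ W

/-- `g` is the weak (distributional) derivative of `f` in the open set `U`. -/
def HasWeakDeriv (U : Set ℝ) (f g : ℝ → ℝ) : Prop :=
  LocallyIntegrableOn f U ∧ LocallyIntegrableOn g U ∧
    ∀ φ : ℝ → ℝ, IsTest U φ → ∫ x in U, f x * deriv φ x = - ∫ x in U, g x * φ x

/-- The derivative of `B`:  `B'(r) = ∫_r^∞ dv / (v^(n-1) + v^2)`. -/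
noncomputable def dB (n r : ℝ) : ℝ :=
  ∫ v in Ioi r, 1 / (v ^ (n - 1) + v ^ 2)

/-- `B(s) = ∫_0^s ∫_r^∞ dv / (v^(n-1) + v^2) dr`. -/
noncomputable def B (n s : ℝ) : ℝ :=
  ∫ r in (0 : ℝ)..s, dB n r

/-- `B^ε(s) = B(s / ε) / |ln ε|`. -/
noncomputable def Beps (n ε s : ℝ) : ℝ :=
  B n (s / ε) / |Real.log ε|

/-- The derivative of `B^ε`. -/
noncomputable def dBeps (n ε s : ℝ) : ℝ :=
  dB n (s / ε) / (ε * |Real.log ε|)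

/-- The mobility `ε^(3-n) s^n + s^3`. -/
noncomputable def mobility (n ε s : ℝ) : ℝ :=
  ε ^ (3 - n) * s ^ n + s ^ 3

/-- `T^ε = - u u_x u_xxx`, as a function of the values of `u`, `u_x` and `u_xxx`
(it vanishes where `u = 0`). -/
noncomputable def Tterm (u ux uxxx : ℝ) : ℝ :=
  -(u * ux * uxxx)

/-- `R^ε = - |ln ε| (B^ε)'(u) (ε^(3-n) u^(n-1) + u^2) u u_xxx`, as a function of the values
of `u` and `u_xxx` (it vanishes where `u = 0`). -/
noncomputable def Rterm (n ε u uxxx : ℝ) : ℝ :=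
  -(|Real.log ε| * dBeps n ε u * (ε ^ (3 - n) * u ^ (n - 1) + u ^ 2) * (u * uxxx))

/-- Non-negative weak solutions, with the usual a priori estimates, of
`|ln ε|⁻¹ u_t + ((ε^(3-n) u^n + u^3) u_xxx)_x = 0` in `(0,∞) × (α,β)`, with zero flux and
`u_x = 0` at `x = α, β`, and with initial datum `uin` (whose weak derivative is `duin`).
The functions `ux`, `uxx`, `uxxx` are the derivatives of `u` in `x`; the last two are only
prescribed in `{u > 0}`, and in every expression below they come with a factor that vanishes
in `{u = 0}`. -/
structure IsSolution (n ε α β : ℝ) (uin duin : ℝ → ℝ) (u ux uxx uxxx : ℝ → ℝ → ℝ) : Prop where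
  cont : ContinuousOn (Function.uncurry u) (Ici 0 ×ˢ Icc α β)
  nonneg : ∀ t, 0 ≤ t → ∀ x ∈ Icc α β, 0 ≤ u t x
  initial : ∀ x ∈ Icc α β, u 0 x = uin x
  meas_ux : AEMeasurable (Function.uncurry ux) (volume.restrict (Ioi 0 ×ˢ Ioo α β))
  meas_uxx : AEMeasurable (Function.uncurry uxx) (volume.restrict (Ioi 0 ×ˢ Ioo α β))
  meas_uxxx : AEMeasurable (Function.uncurry uxxx) (volume.restrict (Ioi 0 ×ˢ Ioo α β))
  /-- `ux t` is the derivative of `u t` in the interval. -/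
  weak_ux : ∀ t, 0 < t → HasWeakDeriv (Ioo α β) (u t) (ux t)
  /-- For a.e. `t`, `u t` is `C¹` up to the boundary, with `u_x = 0` there. -/
  neumann : ∀ᵐ t ∂(volume.restrict (Ioi (0 : ℝ))),
    ContinuousOn (ux t) (Icc α β) ∧ ux t α = 0 ∧ ux t β = 0
  /-- Second and third derivatives in `{u > 0}`. -/
  weak_uxx : ∀ᵐ t ∂(volume.restrict (Ioi (0 : ℝ))),
    HasWeakDeriv {x ∈ Ioo α β | 0 < u t x} (ux t) (uxx t)
  weak_uxxx : ∀ᵐ t ∂(volume.restrict (Ioi (0 : ℝ))),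
    HasWeakDeriv {x ∈ Ioo α β | 0 < u t x} (uxx t) (uxxx t)
  /-- `u u_xxx ∈ L²((0,T) × (α,β))` for all `T`. -/
  u_uxxx_L2 : ∀ T : ℝ, 0 < T → MemLp (fun z : ℝ × ℝ => u z.1 z.2 * uxxx z.1 z.2) 2
    (volume.restrict (Ioo 0 T ×ˢ Ioo α β))
  /-- Weak form of the equation with zero flux at the boundary. -/
  equation : ∀ ψ : ℝ → ℝ → ℝ, IsTest₂ univ ψ →
    |Real.log ε|⁻¹ * ((∫ x in Ioo α β, uin x * ψ 0 x) +
        ∫ t in Ioi (0 : ℝ), ∫ x in Ioo α β, u t x * deriv (fun s => ψ s x) t) +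
      ∫ t in Ioi (0 : ℝ), ∫ x in Ioo α β,
        mobility n ε (u t x) * uxxx t x * deriv (ψ t) x = 0
  /-- Conservation of mass. -/
  mass : ∀ t, 0 < t → ∫ x in Ioo α β, u t x = ∫ x in Ioo α β, uin x
  /-- Energy inequality. -/
  energy : ∀ t, 0 < t →
    (∫⁻ x in Ioo α β, ENNReal.ofReal (1 / 2 * (ux t x) ^ 2)) +
      (∫⁻ s in Ioo 0 t, ∫⁻ x in {x ∈ Ioo α β | 0 < u s x},
        ENNReal.ofReal (|Real.log ε| * mobility n ε (u s x) * (uxxx s x) ^ 2)) ≤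
    ∫⁻ x in Ioo α β, ENNReal.ofReal (1 / 2 * (duin x) ^ 2)
  /-- Entropy inequality. -/
  entropy : ∀ t, 0 < t →
    (∫⁻ s in Ioo 0 t, ∫⁻ x in Ioo α β, ENNReal.ofReal (u s x * (uxx s x) ^ 2)) +
      ENNReal.ofReal (∫ x in Ioo α β, Beps n ε (uin x)) ≤
    ENNReal.ofReal (∫ x in Ioo α β, Beps n ε (u t x))
  /-- `ρ^ε = B^ε(u)` solves `∂_t ρ^ε = T^ε + ∂_x R^ε` in the sense of distributions. -/
  rho_equation : ∀ ψ : ℝ → ℝ → ℝ, IsTest₂ univ ψ →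
    (∫ x in Ioo α β, Beps n ε (uin x) * ψ 0 x) +
      (∫ t in Ioi (0 : ℝ), ∫ x in Ioo α β, Beps n ε (u t x) * deriv (fun s => ψ s x) t) +
      (∫ t in Ioi (0 : ℝ), ∫ x in Ioo α β, Tterm (u t x) (ux t x) (uxxx t x) * ψ t x) -
      (∫ t in Ioi (0 : ℝ), ∫ x in Ioo α β, Rterm n ε (u t x) (uxxx t x) * deriv (ψ t) x) = 0
  /-- The integrated form of `T^ε`, against test functions on the closed interval. -/
  T_formula : ∀ᵐ t ∂(volume.restrict (Ioi (0 : ℝ))), ∀ φ : ℝ → ℝ, ContDiff ℝ ∞ φ →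
    ∫ x in Ioo α β, Tterm (u t x) (ux t x) (uxxx t x) * φ x =
      (∫ x in Ioo α β, u t x * (uxx t x) ^ 2 * φ x) -
      5 / 6 * (∫ x in Ioo α β, (ux t x) ^ 3 * deriv φ x) -
      1 / 2 * (∫ x in Ioo α β, u t x * (ux t x) ^ 2 * deriv (deriv φ) x)

/-- The norm of `W^{-1,1}(α,β)` of an integrable function `g`, computed by duality with
`W^{1,∞}_0(α,β)` (smooth compactly supported test functions suffice); it is also the infimum
of `‖f₀‖_{L¹} + ‖f₁‖_{L¹}` over all decompositions `g = f₀ + ∂ₓ f₁`. -/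
noncomputable def negNorm (α β : ℝ) (g : ℝ → ℝ) : ℝ≥0∞ :=
  ⨆ φ : {φ : ℝ → ℝ // IsTest (Ioo α β) φ ∧ ∀ x, |φ x| ≤ 1 ∧ |deriv φ x| ≤ 1},
    ENNReal.ofReal |∫ x in Ioo α β, g x * φ.1 x|

/-- The open set `Σ`, complement in `(α,β)` of the support of the measure `(1 - ρ) dx`,
for a function `ρ` of `x` with values in `[0,1]`. -/
def wetSet (α β : ℝ) (ρ : ℝ → ℝ) : Set ℝ :=
  {x ∈ Ioo α β | ∃ r > 0, ∫ y in Metric.ball x r ∩ Ioo α β, (1 - ρ y) = 0}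

/-- The set `{w > 0}` in `(α,β)`. -/
def posSet (α β : ℝ) (w : ℝ → ℝ) : Set ℝ :=
  {x ∈ Ioo α β | 0 < w x}

/-- The slope `w_x` at a point of `∂{w > 0}`, taken from within `{w > 0}`. -/
noncomputable def slope (α β : ℝ) (w : ℝ → ℝ) (x : ℝ) : ℝ :=
  derivWithin w (closure (posSet α β w)) x

/-- `f k → g` weakly in `H¹(α,β)`, where `f' k` and `g'` are the weak derivatives. -/
def TendstoH1Weakly (α β : ℝ) (f f' : ℕ → ℝ → ℝ) (g g' : ℝ → ℝ) : Prop :=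
  ∀ h : ℝ → ℝ, MemLp h 2 (volume.restrict (Ioo α β)) →
    Tendsto (fun k => ∫ x in Ioo α β, f k x * h x) atTop (𝓝 (∫ x in Ioo α β, g x * h x)) ∧
    Tendsto (fun k => ∫ x in Ioo α β, f' k x * h x) atTop (𝓝 (∫ x in Ioo α β, g' x * h x))

/-- `w` is the droplet profile of mass `m` on the open set `S` in `(α,β)`: it is continuous,
`w'' = -λ` in `S` for a constant `λ`, `w > 0` exactly in `S`, `w = 0` elsewhere, and
`∫ w = m`. -/
def IsProfile (α β m : ℝ) (S : Set ℝ) (w : ℝ → ℝ) : Prop :=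
  ContinuousOn w (Icc α β) ∧
  (∃ (lam : ℝ) (w₁ : ℝ → ℝ), ∀ x ∈ S, HasDerivAt w (w₁ x) x ∧ HasDerivAt w₁ (-lam) x) ∧
  (∀ x ∈ S, 0 < w x) ∧ (∀ x ∈ Icc α β \ S, w x = 0) ∧
  ∫ x in Ioo α β, w x = m

/-- `ρ` is a distributional solution of `∂_t ρ = (1/3) |w_x|³ dH⁰|_{∂{w>0}}` in
`(α,β) × (0,T)` with initial value the indicator function of `{uin > 0}`. -/
def SolvesTannerLaw (α β T : ℝ) (uin : ℝ → ℝ) (w ρ : ℝ → ℝ → ℝ) : Prop :=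
  ∀ ψ : ℝ → ℝ → ℝ, IsTest₂ (Iio T ×ˢ Ioo α β) ψ →
    IntegrableOn (fun t => ∫ x in frontier (posSet α β (w t)),
      |slope α β (w t) x| ^ 3 * ψ t x ∂(Measure.hausdorffMeasure 0)) (Ioo 0 T) ∧
    -(∫ t in Ioo 0 T, ∫ x in Ioo α β, ρ t x * deriv (fun s => ψ s x) t) =
      (∫ x in Ioo α β, (posSet α β uin).indicator 1 x * ψ 0 x) +
      ∫ t in Ioo 0 T, 1 / 3 * ∫ x in frontier (posSet α β (w t)),
        |slope α β (w t) x| ^ 3 * ψ t x ∂(Measure.hausdorffMeasure 0)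

end TannerLaw

namespace TannerLaw

/-! ### The function `B` and its rescalings -/

/-! Two facts drive the limit. Since `B s` grows like `log s`, the function `B^ε` tends to `1` at
every positive argument and vanishes at `0`, so `ρ^ε` is asymptotically an indicator of positivity
(`tendsto_Beps`). The factor `|ln ε|` in the energy inequality makes the space-time integral of
`(ε^(3-n) u^n + u^3) u_xxx²` of order `1 / |ln ε|`. By `exists_sq_Rterm_le` the flux `R^ε` then
vanishes in `L¹`, so only `T^ε` can contribute to `∂_t ρ`. Moreover, along a subsequence and for
a.e. `t`, the integral of `u³ u_xxx²` tends to zero, so every limit `w` of the profiles is a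
quadratic polynomial on each component of `{w > 0}` (`exists_quadratic`).

For such a `w` the density in the integrated form of `T` is an exact derivative, and a component
`(a, b)` contributes `(w_x(a)³ φ(a) - w_x(b)³ φ(b)) / 3`, which is non-negative for `φ ≥ 0`
(`integral_quadratic`, `SliceLimit.setIntegral_comp`). The terms with `u_x³` and `u u_x²` pass to
the limit because a weighted interpolation estimate excludes concentration where `u` is small
(`Slice.setIntegral_cube_le`). The term with `u u_xx²` is only lower semicontinuous. So, tested
against squares `η²`, the lower limit of `T^ε` is at least the Tanner source, hence non-negative
(`SliceLimit.liminf_Tfun`).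

Consequently `ρ` cannot decrease in time. Where it has reached its maximal value `1` it cannot
increase either, so `T^ε` tested against `η²` tends to zero in `L¹` in time there
(`ProfileLimit.le_of_balance`). Semicontinuity then forces `w_x³ η² = 0` at the end points of the
components. The slopes at interior end points are not zero: a quadratic with a double zero at one
end point stays positive up to the boundary of `(α, β)` and violates the Neumann condition there.
Hence no end point of `{w(t) > 0}` was wet before time `t`, while for a.e. `t` every point of `Σ(t)`
was (`ProfileLimit.ae_exists_earlier`). As `{w(t) > 0}` is contained in `Σ(t)`, is non-empty by
conservation of mass, and `Σ(t)` is connected, the two sets coincide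
(`ProfileLimit.exists_subseq_posSet_eq`).

For (a), a quadratic vanishing at both ends of `Σ(t)` is fixed by its mass, so all subsequential
limits agree. For (b), convergence of the total of `u u_xx²` gives, by a Scheffé argument,
convergence at a.e. time with a majorant (`exists_subseq_dominated`). Semicontinuity becomes
convergence, and the limit of `T^ε` is exactly the Tanner source. Away from the closure of `Σ(t)`
there has been no source before `t`, so `ρ(t)` is still the initial indicator there. That indicator
must vanish there, since points with `ρ = 1` nearby are wet. Hence `ρ(t)` is the indicator of
`Σ(t)`. -/

lemma measurable_integrand (n : ℝ) : Measurable fun v : ℝ => 1 / (v ^ (n - 1) + v ^ 2) := by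
  fun_prop

lemma integrand_nonneg (n : ℝ) {v : ℝ} (hv : 0 < v) : 0 ≤ 1 / (v ^ (n - 1) + v ^ 2) := by
  positivity

lemma integrand_le (n : ℝ) {v : ℝ} (hv : 0 < v) :
    1 / (v ^ (n - 1) + v ^ 2) ≤ v ^ (-2 : ℝ) := by
  have h : v ^ (-2 : ℝ) = 1 / v ^ 2 := by
    rw [Real.rpow_neg hv.le, one_div]; norm_num
  rw [h]
  have : 0 < v ^ (n - 1) := Real.rpow_pos_of_pos hv _
  exact one_div_le_one_div_of_le (by positivity) (by linarith)

lemma integrableOn_integrand (n : ℝ) {r : ℝ} (hr : 0 < r) :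
    IntegrableOn (fun v : ℝ => 1 / (v ^ (n - 1) + v ^ 2)) (Ioi r) := by
  refine Integrable.mono' (integrableOn_Ioi_rpow_of_lt (a := -2) (by norm_num) hr)
    (measurable_integrand n).aestronglyMeasurable ?_
  refine (ae_restrict_mem measurableSet_Ioi).mono fun v hv => ?_
  have hv0 : 0 < v := hr.trans hv
  rw [Real.norm_of_nonneg (integrand_nonneg n hv0)]
  exact integrand_le n hv0

lemma dB_nonneg (n : ℝ) {r : ℝ} (hr : 0 ≤ r) : 0 ≤ dB n r :=
  setIntegral_nonneg measurableSet_Ioi fun _ hv => integrand_nonneg n (hr.trans_lt hv)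

lemma dB_le_inv (n : ℝ) {r : ℝ} (hr : 0 < r) : dB n r ≤ 1 / r := by
  have h := integral_Ioi_rpow_of_lt (a := -2) (by norm_num) hr
  have h2 : -r ^ ((-2 : ℝ) + 1) / (-2 + 1) = 1 / r := by
    norm_num [Real.rpow_neg_one]
  rw [h2] at h
  rw [← h]
  exact setIntegral_mono_on (integrableOn_integrand n hr)
    (integrableOn_Ioi_rpow_of_lt (a := -2) (by norm_num) hr) measurableSet_Ioi
    fun v hv => integrand_le n (hr.trans hv)

/-- Near zero the function is at most `v ^ (1 - 2n/3)`, and at infinity at most `v ^ (n/3 - 2)`.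
Both are integrable precisely because `n < 3`. -/
lemma integrableOn_weighted_integrand {n : ℝ} (hn3 : n < 3) :
    IntegrableOn (fun v : ℝ => v ^ (n / 3) * (1 / (v ^ (n - 1) + v ^ 2))) (Ioi 0) := by
  have hmeas : Measurable fun v : ℝ => v ^ (n / 3) * (1 / (v ^ (n - 1) + v ^ 2)) := by fun_prop
  rw [← Ioc_union_Ioi_eq_Ioi (zero_le_one (α := ℝ))]
  refine IntegrableOn.union ?_ ?_
  · have h1 : IntegrableOn (fun v : ℝ => v ^ (1 - 2 * n / 3)) (Ioc 0 1) := by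
      have := intervalIntegral.intervalIntegrable_rpow' (a := 0) (b := 1)
        (r := 1 - 2 * n / 3) (by linarith)
      rwa [intervalIntegrable_iff_integrableOn_Ioc_of_le zero_le_one] at this
    refine Integrable.mono' h1 hmeas.aestronglyMeasurable ?_
    refine (ae_restrict_mem measurableSet_Ioc).mono fun v hv => ?_
    have hv0 : 0 < v := hv.1
    rw [Real.norm_of_nonneg (mul_nonneg (Real.rpow_nonneg hv0.le _) (integrand_nonneg n hv0))]
    have : v ^ (1 - 2 * n / 3) = v ^ (n / 3) * (1 / v ^ (n - 1)) := by
      rw [one_div, ← Real.rpow_neg hv0.le, ← Real.rpow_add hv0]; congr 1; ring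
    rw [this]
    have h3 : 0 < v ^ (n - 1) := Real.rpow_pos_of_pos hv0 _
    refine mul_le_mul_of_nonneg_left ?_ (Real.rpow_nonneg hv0.le _)
    exact one_div_le_one_div_of_le h3 (by nlinarith [sq_nonneg v])
  · refine Integrable.mono' (integrableOn_Ioi_rpow_of_lt (a := n / 3 - 2) (c := 1)
      (by linarith) one_pos) hmeas.aestronglyMeasurable ?_
    refine (ae_restrict_mem measurableSet_Ioi).mono fun v hv => ?_
    have hv0 : 0 < v := one_pos.trans hv
    rw [Real.norm_of_nonneg (mul_nonneg (Real.rpow_nonneg hv0.le _) (integrand_nonneg n hv0)),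
      show v ^ (n / 3 - 2) = v ^ (n / 3) * v ^ (-2 : ℝ) by rw [← Real.rpow_add hv0]; rfl]
    exact mul_le_mul_of_nonneg_left (integrand_le n hv0) (Real.rpow_nonneg hv0.le _)

/-- A Chebyshev bound: on `v > r` the weight `v ^ (n/3)` is at least `r ^ (n/3)`. The exponent is
below `1`, so `B'` is integrable at zero, and small enough that `B'(r)² r^n` stays bounded there. -/
lemma exists_dB_le_rpow {n : ℝ} (hn : 0 < n) (hn3 : n < 3) :
    ∃ C : ℝ, 0 ≤ C ∧ ∀ r : ℝ, 0 < r → dB n r ≤ C * r ^ (-(n / 3)) := by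
  refine ⟨∫ v in Ioi 0, v ^ (n / 3) * (1 / (v ^ (n - 1) + v ^ 2)),
    setIntegral_nonneg measurableSet_Ioi fun v (hv : 0 < v) =>
      mul_nonneg (Real.rpow_nonneg hv.le _) (integrand_nonneg n hv), fun r hr => ?_⟩
  have hsub : Ioi r ⊆ Ioi (0 : ℝ) := Ioi_subset_Ioi hr.le
  have hI := integrableOn_weighted_integrand hn3
  calc dB n r ≤ ∫ v in Ioi r, r ^ (-(n / 3)) * (v ^ (n / 3) * (1 / (v ^ (n - 1) + v ^ 2))) := by
        refine setIntegral_mono_on (integrableOn_integrand n hr)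
          ((hI.mono_set hsub).const_mul _) measurableSet_Ioi fun v hv => ?_
        have hv0 : 0 < v := hr.trans hv
        rw [← mul_assoc]
        refine le_mul_of_one_le_left (integrand_nonneg n hv0) ?_
        rw [Real.rpow_neg hr.le, ← div_eq_inv_mul, one_le_div (Real.rpow_pos_of_pos hr _)]
        exact Real.rpow_le_rpow hr.le (le_of_lt hv) (by positivity)
    _ = r ^ (-(n / 3)) * ∫ v in Ioi r, v ^ (n / 3) * (1 / (v ^ (n - 1) + v ^ 2)) :=
        integral_const_mul _ _
    _ ≤ _ := by
        rw [mul_comm]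
        refine mul_le_mul_of_nonneg_right ?_ (Real.rpow_nonneg hr.le _)
        refine setIntegral_mono_set hI ?_ hsub.eventuallyLE
        exact (ae_restrict_mem measurableSet_Ioi).mono fun v (hv : 0 < v) =>
          mul_nonneg (Real.rpow_nonneg hv.le _) (integrand_nonneg n hv)

lemma measurable_dB (n : ℝ) : Measurable (dB n) := by
  have h : StronglyMeasurable fun r : ℝ =>
      ∫ v, (Ioi r).indicator (fun v : ℝ => 1 / (v ^ (n - 1) + v ^ 2)) v := by
    refine StronglyMeasurable.integral_prod_right
      (f := fun r v : ℝ => (Ioi r).indicator (fun v : ℝ => 1 / (v ^ (n - 1) + v ^ 2)) v) ?_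
    have : (Function.uncurry fun r v : ℝ =>
        (Ioi r).indicator (fun v : ℝ => 1 / (v ^ (n - 1) + v ^ 2)) v) =
        {z : ℝ × ℝ | z.1 < z.2}.indicator
          (fun z => 1 / (z.2 ^ (n - 1) + z.2 ^ 2)) := by
      ext ⟨r, v⟩
      simp [indicator, Function.uncurry]
    rw [this]
    refine (Measurable.indicator ?_ (measurableSet_lt measurable_fst measurable_snd)).stronglyMeasurable
    exact (measurable_integrand n).comp measurable_snd
  have h2 : dB n = fun r : ℝ =>
      ∫ v, (Ioi r).indicator (fun v : ℝ => 1 / (v ^ (n - 1) + v ^ 2)) v := by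
    ext r
    rw [dB, integral_indicator measurableSet_Ioi]
  rw [h2]
  exact h.measurable

lemma intervalIntegrable_dB {n : ℝ} (hn : 0 < n) (hn3 : n < 3) {a b : ℝ} (ha : 0 ≤ a)
    (hb : 0 ≤ b) : IntervalIntegrable (dB n) volume a b := by
  obtain ⟨C, hC, h⟩ := exists_dB_le_rpow hn hn3
  have h1 : IntervalIntegrable (fun r : ℝ => C * r ^ (-(n / 3))) volume a b :=
    (intervalIntegral.intervalIntegrable_rpow' (by linarith)).const_mul C
  refine h1.mono_fun' (measurable_dB n).aestronglyMeasurable ?_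
  refine (ae_restrict_mem measurableSet_uIoc).mono fun r hr => ?_
  have hr0 : 0 < r := lt_of_le_of_lt (le_min ha hb) hr.1
  simpa only [Real.norm_of_nonneg (dB_nonneg n hr0.le)] using h r hr0

@[simp] lemma B_zero (n : ℝ) : B n 0 = 0 := by simp [B]

lemma B_sub {n : ℝ} (hn : 0 < n) (hn3 : n < 3) {a b : ℝ} (ha : 0 ≤ a) (hb : 0 ≤ b) :
    B n b - B n a = ∫ r in a..b, dB n r :=
  intervalIntegral.integral_interval_sub_left (intervalIntegrable_dB hn hn3 le_rfl hb)
    (intervalIntegrable_dB hn hn3 le_rfl ha)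

lemma B_mono {n : ℝ} (hn : 0 < n) (hn3 : n < 3) {a b : ℝ} (ha : 0 ≤ a) (hab : a ≤ b) :
    B n a ≤ B n b := by
  rw [← sub_nonneg, B_sub hn hn3 ha (ha.trans hab)]
  exact intervalIntegral.integral_nonneg hab fun r hr => dB_nonneg n (ha.trans hr.1)

lemma continuousOn_B {n : ℝ} (hn : 0 < n) (hn3 : n < 3) : ContinuousOn (B n) (Ici 0) := by
  intro x (hx : 0 ≤ x)
  have hc : ContinuousOn (B n) (uIcc 0 (x + 1)) :=
    intervalIntegral.continuousOn_primitive_interval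
      ((intervalIntegrable_iff').1 (intervalIntegrable_dB hn hn3 le_rfl (by linarith)))
  rw [uIcc_of_le (by linarith)] at hc
  refine (hc x ⟨hx, by linarith⟩).mono_of_mem_nhdsWithin ?_
  exact mem_nhdsWithin.2 ⟨Iio (x + 1), isOpen_Iio, by simp, fun y hy => ⟨hy.2, le_of_lt hy.1⟩⟩

lemma B_le_log {n : ℝ} (hn : 0 < n) (hn3 : n < 3) {s : ℝ} (hs : 1 ≤ s) :
    B n s ≤ B n 1 + Real.log s := by
  have h := B_sub hn hn3 (zero_le_one (α := ℝ)) (zero_le_one.trans hs)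
  have h2 : ∫ r in (1 : ℝ)..s, dB n r ≤ ∫ r in (1 : ℝ)..s, 1 / r := by
    refine intervalIntegral.integral_mono_on hs
      (intervalIntegrable_dB hn hn3 zero_le_one (zero_le_one.trans hs)) ?_
      fun r hr => dB_le_inv n (one_pos.trans_le hr.1)
    refine intervalIntegral.intervalIntegrable_one_div (fun r hr => ?_) continuousOn_id
    rw [uIcc_of_le hs] at hr
    exact (one_pos.trans_le hr.1).ne'
  rw [integral_one_div_of_pos one_pos (one_pos.trans_le hs), div_one] at h2
  linarith

/-- For large `v` the term `v ^ (n-1) = v² v ^ (-(3-n))` is at most `(1/θ - 1) v²`, so `B'(r) ≥ θ /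
r` beyond some `R`. Together with `B_le_log` this says that `B s` is asymptotic to `log s`. -/
lemma exists_log_le_B {n : ℝ} (hn : 0 < n) (hn3 : n < 3) {θ : ℝ} (hθ : θ ∈ Ioo (0 : ℝ) 1) :
    ∃ R : ℝ, 1 ≤ R ∧ ∀ s, R ≤ s → θ * Real.log (s / R) ≤ B n s := by
  have ht : Tendsto (fun v : ℝ => v ^ (-(3 - n))) atTop (𝓝 0) :=
    tendsto_rpow_neg_atTop (by linarith)
  have hpos : 0 < 1 / θ - 1 := by
    rw [sub_pos, lt_div_iff₀ hθ.1]; linarith [hθ.2]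
  obtain ⟨R, hR⟩ := eventually_atTop.1 (ht.eventually (ge_mem_nhds hpos))
  refine ⟨max R 1, le_max_right _ _, fun s hs => ?_⟩
  set R' := max R 1
  have hR'1 : 1 ≤ R' := le_max_right _ _
  have hg : ∀ v, R' ≤ v → θ * v ^ (-2 : ℝ) ≤ 1 / (v ^ (n - 1) + v ^ 2) := fun v hv => by
    have hv0 : 0 < v := by linarith
    have h1 := hR v ((le_max_left _ _).trans hv)
    have h2 : v ^ (n - 1) = v ^ 2 * v ^ (-(3 - n)) := by
      rw [← Real.rpow_natCast v 2, ← Real.rpow_add hv0]; congr 1; push_cast; ring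
    have h3 : v ^ (-2 : ℝ) = 1 / v ^ 2 := by
      rw [Real.rpow_neg hv0.le, one_div]; norm_num
    rw [h2, h3, mul_one_div, div_le_div_iff₀ (by positivity) (by positivity)]
    have h4 : θ * (v ^ (-(3 - n)) + 1) ≤ 1 := by
      calc θ * (v ^ (-(3 - n)) + 1) ≤ θ * (1 / θ) := by
            gcongr
            · exact hθ.1.le
            · linarith
        _ = 1 := by field_simp [hθ.1.ne']
    nlinarith [sq_nonneg v]
  have hdB : ∀ r, R' ≤ r → θ * (1 / r) ≤ dB n r := fun r hr => by
    have hr0 : 0 < r := by linarith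
    have h := integral_Ioi_rpow_of_lt (a := -2) (by norm_num) hr0
    have h2 : -r ^ ((-2 : ℝ) + 1) / (-2 + 1) = 1 / r := by
      norm_num [Real.rpow_neg_one]
    rw [h2] at h
    rw [← h, ← integral_const_mul]
    exact setIntegral_mono_on
      ((integrableOn_Ioi_rpow_of_lt (a := -2) (by norm_num) hr0).const_mul _)
      (integrableOn_integrand n hr0) measurableSet_Ioi fun v hv => hg v (hr.trans (le_of_lt hv))
  have hR'0 : 0 < R' := by linarith
  have hs0 : 0 < s := by linarith
  have h2 : ∫ r in R'..s, θ * (1 / r) ≤ ∫ r in R'..s, dB n r := by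
    refine intervalIntegral.integral_mono_on hs ?_
      (intervalIntegrable_dB hn hn3 hR'0.le hs0.le) fun r hr => hdB r hr.1
    refine (intervalIntegral.intervalIntegrable_one_div (fun r hr => ?_) continuousOn_id).const_mul _
    rw [uIcc_of_le hs] at hr
    exact (hR'0.trans_le hr.1).ne'
  rw [intervalIntegral.integral_const_mul, integral_one_div_of_pos hR'0 hs0,
    ← B_sub hn hn3 hR'0.le hs0.le] at h2
  have := B_mono hn hn3 le_rfl hR'0.le
  rw [B_zero] at this
  linarith

lemma abs_log_pos {ε : ℝ} (hε : ε ∈ Ioo (0 : ℝ) 1) : 0 < |Real.log ε| :=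
  abs_pos.2 (Real.log_neg hε.1 hε.2).ne

lemma abs_log_eq {ε : ℝ} (hε : ε ∈ Ioo (0 : ℝ) 1) : |Real.log ε| = -Real.log ε :=
  abs_of_neg (Real.log_neg hε.1 hε.2)

@[simp] lemma Beps_zero (n ε : ℝ) : Beps n ε 0 = 0 := by simp [Beps]

lemma Beps_mono {n ε : ℝ} (hn : 0 < n) (hn3 : n < 3) (hε : ε ∈ Ioo (0 : ℝ) 1) {a b : ℝ}
    (ha : 0 ≤ a) (hab : a ≤ b) : Beps n ε a ≤ Beps n ε b := by
  unfold Beps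
  have hε0 := hε.1
  gcongr
  exact B_mono hn hn3 (by positivity) (by gcongr)

lemma Beps_nonneg {n ε : ℝ} (hn : 0 < n) (hn3 : n < 3) (hε : ε ∈ Ioo (0 : ℝ) 1) {a : ℝ}
    (ha : 0 ≤ a) : 0 ≤ Beps n ε a := by
  simpa using Beps_mono hn hn3 hε le_rfl ha

lemma continuousOn_Beps {n ε : ℝ} (hn : 0 < n) (hn3 : n < 3) (hε : ε ∈ Ioo (0 : ℝ) 1) :
    ContinuousOn (Beps n ε) (Ici 0) := by
  unfold Beps
  refine ContinuousOn.div_const ((continuousOn_B hn hn3).comp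
    (continuousOn_id.div_const ε) fun x (hx : 0 ≤ x) => ?_) _
  exact div_nonneg hx hε.1.le

lemma tendsto_abs_log {ε : ℕ → ℝ} (hε : ∀ k, ε k ∈ Ioo (0 : ℝ) 1)
    (hε0 : Tendsto ε atTop (𝓝 0)) : Tendsto (fun k => |Real.log (ε k)|) atTop atTop := by
  have h1 : Tendsto ε atTop (𝓝[>] 0) :=
    tendsto_nhdsWithin_iff.2 ⟨hε0, Eventually.of_forall fun k => (hε k).1⟩
  have h2 : Tendsto (fun k => -Real.log (ε k)) atTop atTop :=
    tendsto_neg_atBot_atTop.comp (Real.tendsto_log_nhdsGT_zero.comp h1)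
  exact h2.congr fun k => (abs_log_eq (hε k)).symm

/-- A bound of `B^ε` on `[0, M]` that tends to `1`. -/
lemma exists_Beps_le {n : ℝ} (hn : 0 < n) (hn3 : n < 3) {M : ℝ} (hM : 1 ≤ M) :
    ∃ C : ℝ, 0 ≤ C ∧ ∀ ε ∈ Ioo (0 : ℝ) 1, ∀ s ∈ Icc 0 M, Beps n ε s ≤ 1 + C / |Real.log ε| := by
  refine ⟨B n 1 + Real.log M, add_nonneg ?_ (Real.log_nonneg hM), fun ε hε s hs => ?_⟩
  · simpa using B_mono hn hn3 le_rfl (zero_le_one (α := ℝ))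
  have hL := abs_log_pos hε
  refine (Beps_mono hn hn3 hε hs.1 hs.2).trans ?_
  have hMε : 1 ≤ M / ε := by
    rw [le_div_iff₀ hε.1]; linarith [hε.2]
  have h := B_le_log hn hn3 hMε
  rw [Real.log_div (by linarith) hε.1.ne'] at h
  rw [Beps, div_le_iff₀ hL, add_mul, div_mul_cancel₀ _ hL.ne', abs_log_eq hε]
  linarith

/-- Because `log (s / ε) = log s + |ln ε|`, the dependence on `s` is lost after division by `|ln
ε|`. The lower bound holds with any factor `θ < 1`, the upper one with `1 + O(1 / |ln ε|)`. -/
lemma tendsto_Beps {n : ℝ} (hn : 0 < n) (hn3 : n < 3) {ε : ℕ → ℝ}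
    (hε : ∀ k, ε k ∈ Ioo (0 : ℝ) 1) (hε0 : Tendsto ε atTop (𝓝 0)) {s : ℝ} (hs : 0 < s) :
    Tendsto (fun k => Beps n (ε k) s) atTop (𝓝 1) := by
  have hL := tendsto_abs_log hε hε0
  obtain ⟨C, _, hC⟩ := exists_Beps_le hn hn3 (le_max_right s 1)
  rw [tendsto_order]
  constructor
  · intro a ha
    obtain ⟨θ, hθ1, hθ2⟩ := exists_between (max_lt ha (zero_lt_one (α := ℝ)))
    have hθ0 : 0 < θ := (le_max_right _ _).trans_lt hθ1
    obtain ⟨R, hR, hB⟩ := exists_log_le_B hn hn3 ⟨hθ0, hθ2⟩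
    have h1 : Tendsto (fun k => θ + θ * Real.log (s / R) / |Real.log (ε k)|) atTop (𝓝 (θ + 0)) :=
      tendsto_const_nhds.add (tendsto_const_nhds.div_atTop hL)
    rw [add_zero] at h1
    have h2 : ∀ᶠ k in atTop, R ≤ s / ε k := by
      have : ∀ᶠ k in atTop, ε k < s / R := hε0.eventually (gt_mem_nhds (by positivity))
      refine this.mono fun k hk => ?_
      rw [le_div_iff₀ (hε k).1]
      rw [lt_div_iff₀ (by linarith)] at hk
      linarith
    filter_upwards [h1.eventually (lt_mem_nhds ((le_max_left _ _).trans_lt hθ1)), h2] with k hk1 hk2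
    refine hk1.trans_le ?_
    have hLk := abs_log_pos (hε k)
    have h3 := hB _ hk2
    have h4 : Real.log (s / ε k / R) = Real.log (s / R) + |Real.log (ε k)| := by
      rw [abs_log_eq (hε k), show s / ε k / R = s / R / ε k by ring,
        Real.log_div (by positivity) (hε k).1.ne']
      ring
    rw [h4] at h3
    rw [Beps, le_div_iff₀ hLk, add_mul, div_mul_cancel₀ _ hLk.ne']
    linarith
  · intro a ha
    have h1 : Tendsto (fun k => 1 + C / |Real.log (ε k)|) atTop (𝓝 (1 + 0)) :=
      tendsto_const_nhds.add (tendsto_const_nhds.div_atTop hL)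
    rw [add_zero] at h1
    filter_upwards [h1.eventually (gt_mem_nhds ha)] with k hk
    exact (hC _ (hε k) s ⟨hs.le, le_max_left _ _⟩).trans_lt hk

lemma mobility_nonneg {n ε s : ℝ} (hε : ε ∈ Ioo (0 : ℝ) 1) (hs : 0 ≤ s) :
    0 ≤ mobility n ε s := by
  have := hε.1
  unfold mobility
  positivity

/-- In the scaled variable `r = u / ε` one has `R = -B'(r) ε² (r^n + r³) z`, while the mobility is
`ε³ (r^n + r³)`. So the claim amounts to `B'(r)² (r^n + r³) ≤ K (1 + r)`, which follows from `B' ≤ C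
r ^ (-n/3)` for `r ≤ 1` and from `B' ≤ 1 / r` for `r ≥ 1`. -/
lemma exists_sq_Rterm_le {n : ℝ} (hn : 0 < n) (hn3 : n < 3) :
    ∃ K : ℝ, 0 ≤ K ∧ ∀ ε ∈ Ioo (0 : ℝ) 1, ∀ u z : ℝ, 0 ≤ u →
      Rterm n ε u z ^ 2 ≤ K * (ε + u) * (mobility n ε u * z ^ 2) := by
  obtain ⟨C, hC0, hC⟩ := exists_dB_le_rpow hn hn3
  have key : ∀ r : ℝ, 0 < r → dB n r ^ 2 * (r ^ n + r ^ 3) ≤ (2 + 2 * C ^ 2) * (1 + r) := by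
    intro r hr
    have hd0 := dB_nonneg n hr.le
    have e3 : r ^ (3 : ℝ) = r ^ 3 := by norm_cast
    rcases le_total r 1 with h1 | h1
    · have hr3 : r ^ 3 ≤ r ^ n := by
        rw [← e3]; exact Real.rpow_le_rpow_of_exponent_ge hr h1 hn3.le
      have hsq : dB n r ^ 2 ≤ C ^ 2 * r ^ (-(2 * n / 3)) := by
        calc dB n r ^ 2 ≤ (C * r ^ (-(n / 3))) ^ 2 := pow_le_pow_left₀ hd0 (hC r hr) 2
          _ = C ^ 2 * r ^ (-(2 * n / 3)) := by
            rw [mul_pow, ← Real.rpow_natCast (r ^ _), ← Real.rpow_mul hr.le]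
            congr 2; push_cast; ring
      calc dB n r ^ 2 * (r ^ n + r ^ 3) ≤ (C ^ 2 * r ^ (-(2 * n / 3))) * (2 * r ^ n) := by
            gcongr; linarith
        _ = 2 * C ^ 2 * r ^ (n / 3) := by
            have : r ^ (n / 3) = r ^ (-(2 * n / 3)) * r ^ n := by
              rw [← Real.rpow_add hr]; congr 1; ring
            rw [this]; ring
        _ ≤ 2 * C ^ 2 * 1 := by
            gcongr; exact Real.rpow_le_one hr.le h1 (by positivity)
        _ ≤ _ := by nlinarith [sq_nonneg C, mul_nonneg (sq_nonneg C) hr.le]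
    · have hr3 : r ^ n ≤ r ^ 3 := by
        rw [← e3]; exact Real.rpow_le_rpow_of_exponent_le h1 hn3.le
      calc dB n r ^ 2 * (r ^ n + r ^ 3) ≤ (1 / r) ^ 2 * (2 * r ^ 3) := by
            gcongr
            · exact dB_le_inv n hr
            · linarith
        _ = 2 * r := by field_simp
        _ ≤ _ := by nlinarith [sq_nonneg C, mul_nonneg (sq_nonneg C) hr.le]
  refine ⟨2 + 2 * C ^ 2, by positivity, fun ε hε u z hu => ?_⟩
  have hε0 := hε.1
  rcases hu.eq_or_lt with rfl | hu
  · simp [Rterm, mobility, Real.zero_rpow hn.ne']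
  · have hL := abs_log_pos hε
    obtain ⟨r, hr, rfl⟩ : ∃ r, 0 < r ∧ u = ε * r := ⟨u / ε, by positivity, by field_simp⟩
    have e1 : ε ^ (3 - n) * (ε * r) ^ n = ε ^ 3 * r ^ n := by
      rw [Real.mul_rpow hε0.le hr.le, ← mul_assoc, ← Real.rpow_add hε0, sub_add_cancel]
      norm_cast
    have e2 : ε ^ (3 - n) * (ε * r) ^ (n - 1) = ε ^ 2 * r ^ (n - 1) := by
      rw [Real.mul_rpow hε0.le hr.le, ← mul_assoc, ← Real.rpow_add hε0,
        show 3 - n + (n - 1) = (2 : ℝ) by ring]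
      norm_cast
    have e4 : r ^ (n - 1) * r = r ^ n := by
      rw [← Real.rpow_add_one hr.ne']; congr 1; ring
    have hR : Rterm n ε (ε * r) z = -(dB n r * ε ^ 2 * (r ^ n + r ^ 3) * z) := by
      rw [Rterm, dBeps, e2, ← e4, show ε * r / ε = r by field_simp]
      field_simp
    have hm : mobility n ε (ε * r) = ε ^ 3 * (r ^ n + r ^ 3) := by
      rw [mobility, e1]; ring
    rw [hR, hm]
    have h0 : 0 ≤ r ^ n + r ^ 3 := by positivity
    have := mul_le_mul_of_nonneg_right (key r hr)
      (show 0 ≤ ε * (ε ^ 3 * (r ^ n + r ^ 3) * z ^ 2) by positivity)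
    nlinarith [this]

/-! ### Test functions and weak derivatives on the line -/

lemma IsTest.continuous {U : Set ℝ} {φ : ℝ → ℝ} (h : IsTest U φ) : Continuous φ :=
  h.1.continuous

lemma IsTest.continuous_deriv {U : Set ℝ} {φ : ℝ → ℝ} (h : IsTest U φ) : Continuous (deriv φ) :=
  h.1.continuous_deriv (by simp)

lemma IsTest.eq_zero {U : Set ℝ} {φ : ℝ → ℝ} (h : IsTest U φ) {x : ℝ} (hx : x ∉ U) : φ x = 0 :=
  image_eq_zero_of_notMem_tsupport fun h' => hx (h.2.2 h')

lemma IsTest.mono {U V : Set ℝ} {φ : ℝ → ℝ} (h : IsTest U φ) (hUV : U ⊆ V) : IsTest V φ :=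
  ⟨h.1, h.2.1, h.2.2.trans hUV⟩

lemma IsTest.deriv {U : Set ℝ} {φ : ℝ → ℝ} (h : IsTest U φ) : IsTest U (deriv φ) :=
  ⟨((contDiff_infty_iff_deriv.1 h.1).2), h.2.1.deriv, (tsupport_deriv_subset (𝕜 := ℝ)).trans h.2.2⟩

lemma IsTest.integrable {U : Set ℝ} {φ : ℝ → ℝ} (h : IsTest U φ) : Integrable φ :=
  h.continuous.integrable_of_hasCompactSupport h.2.1

/-- The support of a test function on `(a, b)` stays away from the end points. -/
lemma IsTest.exists_Icc {a b : ℝ} (hab : a < b) {φ : ℝ → ℝ} (h : IsTest (Ioo a b) φ) :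
    ∃ a' b', a < a' ∧ a' < b' ∧ b' < b ∧ tsupport φ ⊆ Icc a' b' := by
  rcases (tsupport φ).eq_empty_or_nonempty with he | hne
  · exact ⟨(2 * a + b) / 3, (a + 2 * b) / 3, by linarith, by linarith, by linarith, by simp [he]⟩
  · have hc : IsCompact (tsupport φ) := h.2.1
    have h1 := h.2.2 (hc.sInf_mem hne)
    have h2 := h.2.2 (hc.sSup_mem hne)
    refine ⟨(a + sInf (tsupport φ)) / 2, (b + sSup (tsupport φ)) / 2, by linarith [h1.1], ?_,
      by linarith [h2.2], fun x hx => ?_⟩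
    · have := csInf_le_csSup hne hc.bddBelow hc.bddAbove
      linarith [h1.1, h2.2]
    · have := csInf_le hc.bddBelow hx
      have := le_csSup hc.bddAbove hx
      constructor <;> linarith [h1.1, h2.2]

/-- The mean value zero is what makes the primitive vanish again to the right of the support. -/
lemma IsTest.exists_primitive {a b : ℝ} (hab : a < b) {κ : ℝ → ℝ} (hκ : IsTest (Ioo a b) κ)
    (h0 : ∫ x, κ x = 0) : ∃ θ : ℝ → ℝ, IsTest (Ioo a b) θ ∧ _root_.deriv θ = κ := by
  obtain ⟨a', b', ha, hab', hb, hs⟩ := hκ.exists_Icc hab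
  have hd : ∀ x, HasDerivAt (fun x => ∫ y in a..x, κ y) (κ x) x := fun x =>
    hκ.continuous.integral_hasStrictDerivAt a x |>.hasDerivAt
  have hderiv : _root_.deriv (fun x => ∫ y in a..x, κ y) = κ := funext fun x => (hd x).deriv
  have hsupp : tsupport (fun x => ∫ y in a..x, κ y) ⊆ Icc a' b' := by
    refine closure_minimal (fun x hx => ?_) isClosed_Icc
    by_contra hx'
    refine hx ?_
    have hz : ∀ y, y ∉ Icc a' b' → κ y = 0 := fun y hy =>
      image_eq_zero_of_notMem_tsupport fun h => hy (hs h)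
    rw [mem_Icc, not_and_or, not_le, not_le] at hx'
    rcases hx' with hx' | hx'
    · have : ∫ y in a..x, κ y = ∫ y in a..x, (0 : ℝ) := by
        refine intervalIntegral.integral_congr fun y hy => hz y fun h => ?_
        have := hy.2
        rcases le_total a x with h' | h' <;> simp [h'] at this <;> linarith [h.1]
      simpa using this
    · change ∫ y in a..x, κ y = 0
      rw [intervalIntegral.integral_eq_integral_of_support_subset, h0]
      intro y hy
      have := hs (subset_tsupport _ hy)
      exact ⟨by linarith [this.1], by linarith [this.2]⟩
  refine ⟨fun x => ∫ y in a..x, κ y, ⟨?_, ?_, ?_⟩, hderiv⟩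
  · rw [contDiff_infty_iff_deriv, hderiv]
    exact ⟨fun x => (hd x).differentiableAt, hκ.1⟩
  · exact HasCompactSupport.of_support_subset_isCompact isCompact_Icc
      ((subset_tsupport _).trans hsupp)
  · exact hsupp.trans fun x hx => ⟨by linarith [hx.1], by linarith [hx.2]⟩

lemma exists_test_integral_eq_one {a b : ℝ} (hab : a < b) :
    ∃ φ : ℝ → ℝ, IsTest (Ioo a b) φ ∧ ∫ x, φ x = 1 := by
  let f : ContDiffBump ((a + b) / 2) := ⟨(b - a) / 8, (b - a) / 4, by linarith, by linarith⟩
  refine ⟨f.normed volume, ⟨f.contDiff_normed, f.hasCompactSupport_normed, ?_⟩, f.integral_normed⟩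
  rw [f.tsupport_normed_eq, Real.closedBall_eq_Icc]
  intro x hx
  simp only [f] at hx
  exact ⟨by linarith [hx.1], by linarith [hx.2]⟩

/-- A function whose distributional derivative in an interval vanishes is constant. -/
lemma ae_const_of_integral_deriv_eq_zero {a b : ℝ} (hab : a < b) {f : ℝ → ℝ}
    (hf : IntegrableOn f (Ioo a b))
    (h : ∀ φ, IsTest (Ioo a b) φ → ∫ x in Ioo a b, f x * deriv φ x = 0) :
    ∃ c, ∀ᵐ x ∂volume.restrict (Ioo a b), f x = c := by
  obtain ⟨φ₀, hφ₀, h1⟩ := exists_test_integral_eq_one hab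
  set c := ∫ x in Ioo a b, f x * φ₀ x
  have hbd : ∀ {φ : ℝ → ℝ}, IsTest (Ioo a b) φ → IntegrableOn (fun x => f x * φ x) (Ioo a b) :=
    fun {φ} hφ => by
      obtain ⟨C, hC⟩ := hφ.2.1.exists_bound_of_continuous hφ.continuous
      exact hf.mul_bdd hφ.continuous.aestronglyMeasurable (Eventually.of_forall hC)
  refine ⟨c, ?_⟩
  have hli : LocallyIntegrableOn (fun x => f x - c) (Ioo a b) :=
    (hf.sub (integrableOn_const (by simp))).locallyIntegrableOn
  have := isOpen_Ioo.ae_eq_zero_of_integral_contDiff_smul_eq_zero hli fun g hg1 hg2 hg3 => ?_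
  · rw [ae_restrict_iff' measurableSet_Ioo]
    exact this.mono fun x hx hx' => sub_eq_zero.1 (hx hx')
  · have hg : IsTest (Ioo a b) g := ⟨hg1, hg2, hg3⟩
    -- Subtracting a multiple of a fixed bump of integral one gives mean value zero, hence the
    -- derivative of a test function.
    have hκ : IsTest (Ioo a b) (fun x => g x - (∫ y, g y) * φ₀ x) := by
      refine ⟨hg1.sub (contDiff_const.mul hφ₀.1), hg2.sub hφ₀.2.1.mul_left, ?_⟩
      refine (tsupport_sub _ _).trans (union_subset hg3 ?_)
      exact (tsupport_mul_subset_right).trans hφ₀.2.2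
    obtain ⟨θ, hθ, hθ'⟩ := hκ.exists_primitive hab (by
      rw [integral_sub hg.integrable (hφ₀.integrable.const_mul _), integral_const_mul, h1]; ring)
    have h2 := h θ hθ
    simp only [hθ', mul_sub] at h2
    have e1 : ∀ x, f x * ((∫ y, g y) * φ₀ x) = (∫ y, g y) * (f x * φ₀ x) := fun x => by ring
    simp only [e1] at h2
    rw [integral_sub (hbd hg) ((hbd hφ₀).const_mul _), integral_const_mul] at h2
    have e2 : ∫ x, g x • (f x - c) = ∫ x in Ioo a b, g x • (f x - c) := by
      refine (setIntegral_eq_integral_of_forall_compl_eq_zero fun x hx => ?_).symm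
      rw [hg.eq_zero hx, zero_smul]
    have e3 : ∫ x, g x = ∫ x in Ioo a b, g x :=
      (setIntegral_eq_integral_of_forall_compl_eq_zero fun x hx => hg.eq_zero hx).symm
    rw [e2]
    have e4 : ∀ x, g x • (f x - c) = f x * g x - c * g x := fun x => by
      rw [smul_eq_mul]; ring
    simp only [e4]
    rw [integral_sub (hbd hg) (hg.integrable.integrableOn.const_mul _), integral_const_mul, ← e3]
    change _ - (∫ y, g y) * c = 0 at h2
    linarith

/-- Du Bois-Reymond: the primitive of `g` is absolutely continuous and may be integrated by parts,
so the difference of `f` and this primitive has vanishing distributional derivative. -/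
lemma HasWeakDeriv.exists_primitive {U : Set ℝ} {f g : ℝ → ℝ} (h : HasWeakDeriv U f g)
    {a b : ℝ} (hab : a < b) (hsub : Icc a b ⊆ U) :
    IntervalIntegrable g volume a b ∧
    ∃ c, ∀ᵐ x ∂volume.restrict (Ioo a b), f x = c + ∫ y in a..x, g y := by
  have hf : IntegrableOn f (Icc a b) := h.1.integrableOn_compact_subset hsub isCompact_Icc
  have hg : IntegrableOn g (Icc a b) := h.2.1.integrableOn_compact_subset hsub isCompact_Icc
  have hgi : IntervalIntegrable g volume a b := by
    rw [intervalIntegrable_iff_integrableOn_Icc_of_le hab.le]; exact hg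
  refine ⟨hgi, ?_⟩
  have hac := hgi.absolutelyContinuousOnInterval_intervalIntegral (c := a) left_mem_uIcc
  have hGc : ContinuousOn (fun x => ∫ y in a..x, g y) (Icc a b) := by
    have := hac.continuousOn; rwa [uIcc_of_le hab.le] at this
  have hG : IntegrableOn (fun x => ∫ y in a..x, g y) (Ioo a b) :=
    (hGc.integrableOn_Icc).mono_set Ioo_subset_Icc_self
  have hf' := hf.mono_set Ioo_subset_Icc_self
  suffices key : ∀ φ, IsTest (Ioo a b) φ →
      ∫ x in Ioo a b, (f - fun x => ∫ y in a..x, g y) x * deriv φ x = 0 by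
    obtain ⟨c, hc⟩ := ae_const_of_integral_deriv_eq_zero hab (hf'.sub hG) key
    exact ⟨c, hc.mono fun x hx => by simp only [Pi.sub_apply] at hx; linarith⟩
  intro φ hφ
  have hφ' := hφ.deriv
  have hbd : ∀ {F φ : ℝ → ℝ}, IntegrableOn F (Ioo a b) → IsTest (Ioo a b) φ →
      IntegrableOn (fun x => F x * φ x) (Ioo a b) := fun {F φ} hF hφ => by
    obtain ⟨C, hC⟩ := hφ.2.1.exists_bound_of_continuous hφ.continuous
    exact hF.mul_bdd hφ.continuous.aestronglyMeasurable (Eventually.of_forall hC)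
  simp only [Pi.sub_apply, sub_mul]
  rw [integral_sub (hbd hf' hφ') (hbd hG hφ')]
  have e := h.2.2 φ (hφ.mono (Ioo_subset_Icc_self.trans hsub))
  have hUm : ∀ (F ψ : ℝ → ℝ), IsTest (Ioo a b) ψ →
      ∫ x in U, F x * ψ x = ∫ x in Ioo a b, F x * ψ x := fun F ψ hψ => by
      rw [setIntegral_eq_integral_of_forall_compl_eq_zero fun x hx => by
          rw [hψ.eq_zero fun h => hx (hsub (Ioo_subset_Icc_self h)), mul_zero],
        setIntegral_eq_integral_of_forall_compl_eq_zero fun x hx => by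
          rw [hψ.eq_zero hx, mul_zero]]
  rw [hUm _ _ hφ', hUm _ _ hφ] at e
  have hφac : AbsolutelyContinuousOnInterval φ a b :=
    (hφ.1.of_le (by simp)).contDiffOn.absolutelyContinuousOnInterval
  have ibp := hac.integral_mul_deriv_eq_deriv_mul hφac
  rw [hφ.eq_zero (x := a) (by simp), hφ.eq_zero (x := b) (by simp)] at ibp
  have e5 : ∫ x in a..b, deriv (fun x => ∫ y in a..x, g y) x * φ x = ∫ x in a..b, g x * φ x := by
    refine intervalIntegral.integral_congr_ae ?_
    filter_upwards [hgi.ae_hasDerivAt_integral] with x hx hx'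
    rw [(hx (uIoc_subset_uIcc hx') a left_mem_uIcc).deriv]
  rw [e5] at ibp
  simp only [intervalIntegral.integral_of_le hab.le, integral_Ioc_eq_integral_Ioo] at ibp
  rw [e, ibp]
  simp

lemma HasWeakDeriv.eq_add_integral {U : Set ℝ} {f g : ℝ → ℝ} (h : HasWeakDeriv U f g)
    (hf : ContinuousOn f U) {a b : ℝ} (hab : a ≤ b) (hsub : Icc a b ⊆ U) :
    IntervalIntegrable g volume a b ∧ f b - f a = ∫ y in a..b, g y := by
  rcases hab.eq_or_lt with rfl | hab
  · simp
  obtain ⟨hgi, c, hc⟩ := h.exists_primitive hab hsub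
  refine ⟨hgi, ?_⟩
  have hGc : ContinuousOn (fun x => ∫ y in a..x, g y) (Icc a b) := by
    have := (hgi.absolutelyContinuousOnInterval_intervalIntegral (c := a) left_mem_uIcc).continuousOn
    rwa [uIcc_of_le hab.le] at this
  have heq : EqOn f (fun x => c + ∫ y in a..x, g y) (Icc a b) :=
    Measure.eqOn_Icc_of_ae_eq volume hab.ne
      (by rwa [Measure.restrict_congr_set (μ := volume) (Ioo_ae_eq_Icc (a := a) (b := b))] at hc)
      (hf.mono hsub) (continuousOn_const.add hGc)
  have ha := heq (left_mem_Icc.2 hab.le)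
  have hb := heq (right_mem_Icc.2 hab.le)
  simp only [intervalIntegral.integral_same] at ha
  rw [ha, hb]; ring

lemma hasDerivAt_of_forall_integral {f g : ℝ → ℝ} {a b x : ℝ} (hx : x ∈ Ioo a b)
    (hg : ContinuousOn g (Ioo a b))
    (h : ∀ y ∈ Ioo a b, ∀ z ∈ Ioo a b, y ≤ z → f z - f y = ∫ t in y..z, g t) :
    HasDerivAt f (g x) x := by
  have h1 : HasDerivAt (fun z => f x + ∫ t in x..z, g t) (g x) x := by
    refine HasDerivAt.const_add _ ?_
    refine intervalIntegral.integral_hasDerivAt_right (by simp) ?_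
      (hg.continuousAt (isOpen_Ioo.mem_nhds hx))
    exact hg.stronglyMeasurableAtFilter isOpen_Ioo x hx
  refine h1.congr_of_eventuallyEq ?_
  filter_upwards [isOpen_Ioo.mem_nhds hx] with z hz
  rcases le_total x z with hxz | hxz
  · rw [← h x hx z hz hxz]; ring
  · rw [intervalIntegral.integral_symm, ← h z hz x hx hxz]; ring

/-- A function with a continuous weak derivative is continuously differentiable. -/
lemma HasWeakDeriv.hasDerivAt {U : Set ℝ} (hU : IsOpen U) {f g : ℝ → ℝ} (h : HasWeakDeriv U f g)
    (hf : ContinuousOn f U) (hg : ContinuousOn g U) {x : ℝ} (hx : x ∈ U) :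
    HasDerivAt f (g x) x := by
  obtain ⟨δ, hδ, hs⟩ := Metric.isOpen_iff.1 hU x hx
  rw [Real.ball_eq_Ioo] at hs
  refine hasDerivAt_of_forall_integral (a := x - δ) (b := x + δ) ⟨by linarith, by linarith⟩
    (hg.mono hs) fun y hy z hz hyz => ?_
  exact (h.eq_add_integral hf hyz ((Icc_subset_Ioo hy.1 hz.2).trans hs)).2

/-- If `f` is continuous and has two successive weak derivatives `g`, `h` in an open set, then
`g` has a representative which is locally absolutely continuous. -/
lemma HasWeakDeriv.regularity {U : Set ℝ} (hU : IsOpen U) {f g h : ℝ → ℝ}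
    (hfg : HasWeakDeriv U f g) (hgh : HasWeakDeriv U g h) (hf : ContinuousOn f U) :
    (∀ x ∈ U, HasDerivAt f (deriv f x) x) ∧ ContinuousOn (deriv f) U ∧
    (∀ᵐ x ∂volume.restrict U, deriv f x = g x) ∧
    ∀ c d, c ≤ d → Icc c d ⊆ U →
      IntervalIntegrable h volume c d ∧ deriv f d - deriv f c = ∫ y in c..d, h y := by
  -- On a compact interval `g` agrees almost everywhere with the continuous function `c + ∫ h`.
  -- Integrating this makes `f` continuously differentiable, so `deriv f` is the regular
  -- representative of `g`.
  have loc : ∀ a b, a < b → Icc a b ⊆ U → IntervalIntegrable h volume a b ∧ ∃ c : ℝ,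
      (∀ x ∈ Ioo a b, HasDerivAt f (c + ∫ y in a..x, h y) x) ∧
      ∀ᵐ x ∂volume.restrict (Ioo a b), g x = c + ∫ y in a..x, h y := fun a b hab hs => by
    obtain ⟨hi, c, hc⟩ := hgh.exists_primitive hab hs
    refine ⟨hi, c, fun x hx => ?_, hc⟩
    have hGc : ContinuousOn (fun x => ∫ y in a..x, h y) (Icc a b) := by
      have := (hi.absolutelyContinuousOnInterval_intervalIntegral (c := a) left_mem_uIcc).continuousOn
      rwa [uIcc_of_le hab.le] at this
    refine hasDerivAt_of_forall_integral (g := fun x => c + ∫ y in a..x, h y) hx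
      (continuousOn_const.add (hGc.mono Ioo_subset_Icc_self)) fun y hy z hz hyz => ?_
    have hsub : Ioc y z ⊆ Ioo a b := fun t ht => ⟨hy.1.trans ht.1, ht.2.trans_lt hz.2⟩
    rw [(hfg.eq_add_integral hf hyz
      (((Icc_subset_Icc hy.1.le hz.2.le)).trans hs)).2]
    rw [intervalIntegral.integral_of_le hyz, intervalIntegral.integral_of_le hyz]
    exact integral_congr_ae (ae_restrict_of_ae_restrict_of_subset hsub hc)
  have nbd : ∀ c d, c ≤ d → Icc c d ⊆ U → ∃ δ > 0, Icc (c - δ) (d + δ) ⊆ U := fun c d hcd hs => by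
    obtain ⟨δ₁, hδ₁, h1⟩ := Metric.isOpen_iff.1 hU c (hs (left_mem_Icc.2 hcd))
    obtain ⟨δ₂, hδ₂, h2⟩ := Metric.isOpen_iff.1 hU d (hs (right_mem_Icc.2 hcd))
    rw [Real.ball_eq_Ioo] at h1 h2
    have hm := lt_min hδ₁ hδ₂
    refine ⟨min δ₁ δ₂ / 2, by linarith, fun y hy => ?_⟩
    have m1 := min_le_left δ₁ δ₂
    have m2 := min_le_right δ₁ δ₂
    rcases lt_or_ge y c with h | h
    · exact h1 ⟨by linarith [hy.1], by linarith⟩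
    rcases le_or_gt y d with h' | h'
    · exact hs ⟨h, h'⟩
    · exact h2 ⟨by linarith, by linarith [hy.2]⟩
  have pt : ∀ x ∈ U, ∃ a b, x ∈ Ioo a b ∧ a < b ∧ Icc a b ⊆ U := fun x hx => by
    obtain ⟨δ, hδ, hs⟩ := nbd x x le_rfl (by simpa using hx)
    exact ⟨x - δ, x + δ, ⟨by linarith, by linarith⟩, by linarith, hs⟩
  refine ⟨fun x hx => ?_, fun x hx => ?_, ?_, fun c d hcd hs => ?_⟩
  · obtain ⟨a, b, hxab, hab, hs⟩ := pt x hx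
    obtain ⟨_, c, hc, _⟩ := loc a b hab hs
    exact (hc x hxab).differentiableAt.hasDerivAt
  · obtain ⟨a, b, hxab, hab, hs⟩ := pt x hx
    obtain ⟨hi, c, hc, _⟩ := loc a b hab hs
    have hGc : ContinuousOn (fun x => ∫ y in a..x, h y) (Icc a b) := by
      have := (hi.absolutelyContinuousOnInterval_intervalIntegral (c := a) left_mem_uIcc).continuousOn
      rwa [uIcc_of_le hab.le] at this
    have h1 : ContinuousAt (fun x => c + ∫ y in a..x, h y) x :=
      (continuousOn_const.add hGc).continuousAt (Icc_mem_nhds hxab.1 hxab.2)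
    refine (h1.congr ?_).continuousWithinAt
    filter_upwards [isOpen_Ioo.mem_nhds hxab] with y hy using (hc y hy).deriv.symm
  · rw [ae_restrict_iff' hU.measurableSet, ae_iff]
    refine measure_null_of_locally_null _ fun x hx => ?_
    simp only [mem_ofPred_eq, Classical.not_imp] at hx
    obtain ⟨a, b, hxab, hab, hs⟩ := pt x hx.1
    obtain ⟨_, c, hc, hae⟩ := loc a b hab hs
    refine ⟨_, inter_mem self_mem_nhdsWithin (mem_nhdsWithin_of_mem_nhds (isOpen_Ioo.mem_nhds hxab)), ?_⟩
    rw [ae_restrict_iff' measurableSet_Ioo, ae_iff] at hae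
    refine measure_mono_null (fun y hy => ?_) hae
    simp only [mem_ofPred_eq, Classical.not_imp, mem_inter_iff] at hy ⊢
    exact ⟨hy.2, fun h => hy.1.2 (by rw [h, (hc y hy.2).deriv])⟩
  · obtain ⟨δ, hδ, hs'⟩ := nbd c d hcd hs
    obtain ⟨hi, C, hC, _⟩ := loc (c - δ) (d + δ) (by linarith) hs'
    have hsub : ∀ x ∈ Icc c d, uIcc (c - δ) x ⊆ uIcc (c - δ) (d + δ) := fun x hx => by
      rw [uIcc_of_le (by linarith [hx.1]), uIcc_of_le (by linarith)]
      exact Icc_subset_Icc le_rfl (by linarith [hx.2])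
    have hic := hi.mono_set (hsub c (left_mem_Icc.2 hcd))
    have hid := hi.mono_set (hsub d (right_mem_Icc.2 hcd))
    refine ⟨hic.symm.trans hid, ?_⟩
    rw [(hC c ⟨by linarith, by linarith⟩).deriv, (hC d ⟨by linarith, by linarith⟩).deriv,
      ← intervalIntegral.integral_interval_sub_left hid hic]
    ring

/-! ### Regular profiles at a fixed time -/

/-- A non-negative `C¹` profile `v` on `[α, β]` with derivative `v₁` vanishing at the end points,
such that `v₁` is twice weakly differentiable in `{v > 0}`, with derivatives `v₂` and `v₃`, and such
that `v v₂²` is integrable. -/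
structure Slice (α β : ℝ) (v v₁ v₂ v₃ : ℝ → ℝ) : Prop where
  cont : ContinuousOn v (Icc α β)
  nonneg : ∀ x ∈ Icc α β, 0 ≤ v x
  cont₁ : ContinuousOn v₁ (Icc α β)
  left : v₁ α = 0
  right : v₁ β = 0
  hasDerivAt : ∀ x ∈ Ioo α β, HasDerivAt v (v₁ x) x
  hasDerivAt₁ : ∀ x ∈ posSet α β v, HasDerivAt v₁ (deriv v₁ x) x
  ae_eq : ∀ᵐ x ∂volume.restrict (posSet α β v), deriv v₁ x = v₂ x
  sub_eq : ∀ c d, c ≤ d → Icc c d ⊆ posSet α β v →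
    IntervalIntegrable v₃ volume c d ∧ deriv v₁ d - deriv v₁ c = ∫ y in c..d, v₃ y
  meas₂ : AEStronglyMeasurable v₂ (volume.restrict (Ioo α β))
  integrable : IntegrableOn (fun x => v x * v₂ x ^ 2) (Ioo α β)

lemma isOpen_posSet {α β : ℝ} {w : ℝ → ℝ} (hw : ContinuousOn w (Ioo α β)) :
    IsOpen (posSet α β w) :=
  hw.isOpen_inter_preimage isOpen_Ioo isOpen_Ioi

lemma posSet_subset {α β : ℝ} {w : ℝ → ℝ} : posSet α β w ⊆ Ioo α β := fun _ h => h.1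

/-- The product `v₁ |v₁|` is chosen so that one more factor `v₁` yields `|v₁|³`. It is
differentiable across the zeros of `v₁` as well. -/
lemma hasDerivAt_mul_abs (y : ℝ) : HasDerivAt (fun y : ℝ => y * |y|) (2 * |y|) y := by
  rcases lt_trichotomy y 0 with h | rfl | h
  · have h1 : HasDerivAt (fun y : ℝ => -y ^ 2) (-(2 * y)) y := by
      simpa using (hasDerivAt_pow 2 y).fun_neg
    rw [abs_of_neg h, mul_neg]
    refine h1.congr_of_eventuallyEq ?_
    filter_upwards [gt_mem_nhds h] with z hz
    rw [abs_of_neg hz]; ring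
  · rw [hasDerivAt_iff_isLittleO]
    simp only [abs_zero, mul_zero, sub_zero, smul_zero]
    have : (fun x : ℝ => x * |x|) =o[𝓝 0] fun x : ℝ => x * 1 :=
      (Asymptotics.isBigO_refl _ _).mul_isLittleO
        ((Asymptotics.isLittleO_one_iff ℝ).2 (by simpa using (continuous_abs.tendsto (0 : ℝ))))
    simpa using this
  · have h1 : HasDerivAt (fun y : ℝ => y ^ 2) (2 * y) y := by
      simpa using hasDerivAt_pow 2 y
    rw [abs_of_pos h]
    refine h1.congr_of_eventuallyEq ?_
    filter_upwards [lt_mem_nhds h] with z hz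
    rw [abs_of_pos hz]; ring

/-- A factor vanishing together with its derivative makes the product differentiable whenever the
other factor is merely continuous. This covers the points with `v = 0`, where nothing is known about
a derivative of `v₁`. -/
lemma hasDerivAt_mul_of_continuousAt {f g : ℝ → ℝ} {x : ℝ} (hf : HasDerivAt f 0 x) (hfx : f x = 0)
    (hg : ContinuousAt g x) : HasDerivAt (fun y => f y * g y) 0 x := by
  rw [hasDerivAt_iff_isLittleO] at hf ⊢
  simp only [hfx, sub_zero, smul_zero, zero_mul] at hf ⊢
  have := hf.mul_isBigO (hg.norm.isBoundedUnder_le.isBigO_one ℝ)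
  simpa using this

namespace Slice

variable {α β : ℝ} {v v₁ v₂ v₃ : ℝ → ℝ}

lemma contIoo (S : Slice α β v v₁ v₂ v₃) : ContinuousOn v (Ioo α β) := S.cont.mono Ioo_subset_Icc_self

lemma isOpen_pos (S : Slice α β v v₁ v₂ v₃) : IsOpen (posSet α β v) := isOpen_posSet S.contIoo

lemma deriv_eq_zero (S : Slice α β v v₁ v₂ v₃) {x : ℝ} (hx : x ∈ Ioo α β) (hv : v x = 0) :
    v₁ x = 0 := by
  refine IsLocalMin.hasDerivAt_eq_zero ?_ (S.hasDerivAt x hx)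
  filter_upwards [isOpen_Ioo.mem_nhds hx] with y hy
  rw [hv]; exact S.nonneg y (Ioo_subset_Icc_self hy)

lemma mul_deriv_ae (S : Slice α β v v₁ v₂ v₃) :
    ∀ᵐ x ∂volume.restrict (Ioo α β), v x * deriv v₁ x = v x * v₂ x := by
  have h := S.ae_eq
  rw [ae_restrict_iff' S.isOpen_pos.measurableSet] at h
  rw [ae_restrict_iff' measurableSet_Ioo]
  filter_upwards [h] with x hx hx'
  rcases (S.nonneg x (Ioo_subset_Icc_self hx')).eq_or_lt with h0 | h0
  · rw [← h0]; simp
  · rw [hx ⟨hx', h0⟩]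

/-- The factor `v / (v + s)` plays two roles: it vanishes where `v₁` may fail to be differentiable,
and its derivative `s v₁ / (v + s)²` is concentrated where `v` is at most of order `s`. -/
lemma hasDerivAt_flux (S : Slice α β v v₁ v₂ v₃) {η : ℝ → ℝ} (hη : ContDiff ℝ ∞ η) {s : ℝ}
    (hs : 0 < s) {x : ℝ} (hx : x ∈ Ioo α β) :
    HasDerivAt (fun x => v x * ((v x + s)⁻¹ * (v₁ x * |v₁ x|) * η x))
      (s / (v x + s) ^ 2 * (v₁ x * (v₁ x * |v₁ x|)) * η x
        + 2 * (v x + s)⁻¹ * |v₁ x| * η x * (v x * deriv v₁ x)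
        + v x * (v x + s)⁻¹ * (v₁ x * |v₁ x|) * deriv η x) x := by
  have hv0 := S.nonneg x (Ioo_subset_Icc_self hx)
  have hvs : v x + s ≠ 0 := by positivity
  have hη' : HasDerivAt η (deriv η x) x := (hη.differentiable (by simp)).differentiableAt.hasDerivAt
  rcases hv0.eq_or_lt with h0 | h0
  · have h1 := S.deriv_eq_zero hx h0.symm
    have hc1 : ContinuousAt v₁ x := S.cont₁.continuousAt (Icc_mem_nhds hx.1 hx.2)
    have hc : ContinuousAt v x := S.cont.continuousAt (Icc_mem_nhds hx.1 hx.2)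
    have hd := S.hasDerivAt x hx
    rw [h1] at hd
    rw [h1, ← h0]
    refine (hasDerivAt_mul_of_continuousAt hd h0.symm (g := fun x =>
      (v x + s)⁻¹ * (v₁ x * |v₁ x|) * η x) ?_).congr_deriv (by simp)
    exact (((hc.add continuousAt_const).inv₀ hvs).mul (hc1.mul hc1.abs)).mul hη.continuous.continuousAt
  · have hd := S.hasDerivAt x hx
    have hd1 := (hasDerivAt_mul_abs (v₁ x)).comp x (S.hasDerivAt₁ x ⟨hx, h0⟩)
    have := hd.mul ((((hd.add_const s).inv hvs).mul hd1).mul hη')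
    refine this.congr_deriv ?_
    simp only [Function.comp, Pi.mul_apply, Pi.inv_apply]
    field_simp
    ring

lemma abs_cube (y : ℝ) : |y| ^ 3 = y * (y * |y|) := by
  rw [← mul_assoc, ← sq, ← sq_abs]; ring

lemma integrable_of_continuousOn {f : ℝ → ℝ} (hf : ContinuousOn f (Icc α β)) :
    IntegrableOn f (Ioo α β) :=
  hf.integrableOn_Icc.mono_set Ioo_subset_Icc_self

lemma integrable_mul_v₂ (S : Slice α β v v₁ v₂ v₃) :
    IntegrableOn (fun x => v x * v₂ x) (Ioo α β) := by
  refine Integrable.mono' ((integrable_of_continuousOn S.cont).add S.integrable)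
    ((S.contIoo.aestronglyMeasurable measurableSet_Ioo).mul S.meas₂) ?_
  refine (ae_restrict_mem measurableSet_Ioo).mono fun x hx => ?_
  have h0 := S.nonneg x (Ioo_subset_Icc_self hx)
  rw [Real.norm_eq_abs, abs_mul, abs_of_nonneg h0, Pi.add_apply]
  nlinarith [sq_nonneg (|v₂ x| - 1), sq_abs (v₂ x)]

lemma integrable_mul_sq (S : Slice α β v v₁ v₂ v₃) {φ : ℝ → ℝ} (hφ : ContinuousOn φ (Icc α β)) :
    IntegrableOn (fun x => v x * v₂ x ^ 2 * φ x) (Ioo α β) := by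
  obtain ⟨C, hC⟩ := isCompact_Icc.exists_bound_of_continuousOn hφ
  exact S.integrable.mul_bdd (hφ.mono Ioo_subset_Icc_self |>.aestronglyMeasurable measurableSet_Ioo)
    ((ae_restrict_mem measurableSet_Ioo).mono fun x hx => hC x (Ioo_subset_Icc_self hx))

/-- Weighted interpolation estimate for `|v₁|³`. -/
lemma integral_cube_le (S : Slice α β v v₁ v₂ v₃) (hαβ : α < β) {η : ℝ → ℝ} (hη : ContDiff ℝ ∞ η)
    (hη0 : ∀ x, 0 ≤ η x) {C s τ : ℝ} (hC : ∀ x ∈ Icc α β, |deriv η x| ≤ C) (hs : 0 < s)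
    (hτ : 0 < τ) :
    ∫ x in Ioo α β, s / (v x + s) ^ 2 * |v₁ x| ^ 3 * η x ≤
      (τ * (∫ x in Ioo α β, v x * v₂ x ^ 2 * η x ^ 2) + (∫ x in Ioo α β, v₁ x ^ 2) / τ) /
        (2 * √s) + C * ∫ x in Ioo α β, v₁ x ^ 2 := by
  have hηc : ContinuousOn η (Icc α β) := hη.continuous.continuousOn
  have hη'c : ContinuousOn (deriv η) (Icc α β) := (hη.continuous_deriv (by simp)).continuousOn
  have hvs : ∀ x ∈ Icc α β, v x + s ≠ 0 := fun x hx => by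
    have := S.nonneg x hx; positivity
  have hinv : ContinuousOn (fun x => (v x + s)⁻¹) (Icc α β) :=
    (S.cont.add continuousOn_const).inv₀ hvs
  have hd2 : ContinuousOn (fun x => s / (v x + s) ^ 2) (Icc α β) :=
    continuousOn_const.div ((S.cont.add continuousOn_const).pow 2) fun x hx => pow_ne_zero _ (hvs x hx)
  have hva : ContinuousOn (fun x => v₁ x * |v₁ x|) (Icc α β) := S.cont₁.mul S.cont₁.abs
  have i1 : IntegrableOn (fun x => s / (v x + s) ^ 2 * (v₁ x * (v₁ x * |v₁ x|)) * η x) (Ioo α β) :=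
    integrable_of_continuousOn ((hd2.mul (S.cont₁.mul hva)).mul hηc)
  have i3 : IntegrableOn (fun x => v x * (v x + s)⁻¹ * (v₁ x * |v₁ x|) * deriv η x) (Ioo α β) :=
    integrable_of_continuousOn (((S.cont.mul hinv).mul hva).mul hη'c)
  have c2 : ContinuousOn (fun x => 2 * (v x + s)⁻¹ * |v₁ x| * η x) (Icc α β) :=
    ((continuousOn_const.mul hinv).mul S.cont₁.abs).mul hηc
  obtain ⟨C2, hC2⟩ := isCompact_Icc.exists_bound_of_continuousOn c2
  have i2 : IntegrableOn (fun x => 2 * (v x + s)⁻¹ * |v₁ x| * η x * (v x * v₂ x)) (Ioo α β) :=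
    S.integrable_mul_v₂.bdd_mul
      (c2.mono Ioo_subset_Icc_self |>.aestronglyMeasurable measurableSet_Ioo)
      ((ae_restrict_mem measurableSet_Ioo).mono fun x hx => hC2 x (Ioo_subset_Icc_self hx))
  have ae2 : (fun x => 2 * (v x + s)⁻¹ * |v₁ x| * η x * (v x * deriv v₁ x))
      =ᵐ[volume.restrict (Ioo α β)] (fun x => 2 * (v x + s)⁻¹ * |v₁ x| * η x * (v x * v₂ x)) :=
    S.mul_deriv_ae.mono fun x hx => by simp only [hx]
  -- The boundary terms disappear because `v₁` vanishes at `α` and `β`; neither `v` nor `η` has to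
  -- vanish there.
  have ftc := intervalIntegral.integral_eq_sub_of_hasDerivAt_of_le hαβ.le
    (S.cont.mul ((hinv.mul hva).mul hηc)) (fun x hx => S.hasDerivAt_flux hη hs hx) (by
      rw [intervalIntegrable_iff_integrableOn_Ioo_of_le hαβ.le]
      exact (i1.add (i2.congr ae2.symm)).add i3)
  simp only [Pi.mul_apply, S.left, S.right, abs_zero, mul_zero, zero_mul, sub_zero] at ftc
  rw [intervalIntegral.integral_of_le hαβ.le, integral_Ioc_eq_integral_Ioo,
    integral_add (i1.fun_add (i2.congr ae2.symm)) i3, integral_add i1 (i2.congr ae2.symm),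
    integral_congr_ae ae2] at ftc
  simp only [abs_cube]
  have iv : IntegrableOn (fun x => v₁ x ^ 2) (Ioo α β) := integrable_of_continuousOn (S.cont₁.pow 2)
  have iX : IntegrableOn (fun x => v x * v₂ x ^ 2 * η x ^ 2) (Ioo α β) :=
    S.integrable_mul_sq (hηc.pow 2)
  have hss : 0 < √s := Real.sqrt_pos.2 hs
  have hfrac : ∀ x ∈ Ioo α β, 0 ≤ v x * (v x + s)⁻¹ ∧ v x * (v x + s)⁻¹ ≤ 1 := fun x hx => by
    have h0 := S.nonneg x (Ioo_subset_Icc_self hx)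
    refine ⟨by positivity, ?_⟩
    rw [← div_eq_mul_inv, div_le_one (by positivity)]; linarith
  have b2 : -∫ x in Ioo α β, 2 * (v x + s)⁻¹ * |v₁ x| * η x * (v x * v₂ x) ≤
      ∫ x in Ioo α β, (τ * (v x * v₂ x ^ 2 * η x ^ 2) + v₁ x ^ 2 / τ) / (2 * √s) := by
    rw [← integral_neg]
    refine setIntegral_mono_on i2.neg (((iX.const_mul τ).add (iv.div_const τ)).div_const _)
      measurableSet_Ioo fun x hx => ?_
    have h0 := S.nonneg x (Ioo_subset_Icc_self hx)
    have e1 : v x = √(v x) ^ 2 := (Real.sq_sqrt h0).symm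
    have e2 : s = √s ^ 2 := (Real.sq_sqrt hs.le).symm
    have hq := Real.sqrt_nonneg (v x)
    have h1 : -(2 * (v x + s)⁻¹ * |v₁ x| * η x * (v x * v₂ x)) ≤
        2 * (v x + s)⁻¹ * |v₁ x| * η x * (v x * |v₂ x|) := by
      have h2 : 0 ≤ 2 * (v x + s)⁻¹ * |v₁ x| * η x * v x := by
        have := hη0 x; positivity
      nlinarith [neg_abs_le (v₂ x)]
    refine h1.trans ?_
    have h3 : 2 * (v x + s)⁻¹ * |v₁ x| * η x * (v x * |v₂ x|) ≤
        (√s)⁻¹ * (|v₁ x| * (√(v x) * |v₂ x| * η x)) := by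
      -- This is `2 √v √s ≤ v + s`, the source of the factor `1 / √s`. Young's inequality with the
      -- free parameter `τ` does the rest.
      have : (v x + s)⁻¹ * √(v x) ≤ (2 * √s)⁻¹ := by
        rw [inv_mul_le_iff₀ (by positivity), ← div_eq_mul_inv, le_div_iff₀ (by positivity)]
        nlinarith [sq_nonneg (√(v x) - √s)]
      calc 2 * (v x + s)⁻¹ * |v₁ x| * η x * (v x * |v₂ x|)
          = 2 * ((v x + s)⁻¹ * √(v x)) * (|v₁ x| * (√(v x) * |v₂ x| * η x)) := by
            rw [show v x * |v₂ x| = √(v x) ^ 2 * |v₂ x| by rw [← e1]]; ring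
        _ ≤ 2 * (2 * √s)⁻¹ * (|v₁ x| * (√(v x) * |v₂ x| * η x)) := by
            have := hη0 x; gcongr
        _ = _ := by field_simp
    refine h3.trans ?_
    have h4 : |v₁ x| * (√(v x) * |v₂ x| * η x) ≤
        (τ * (v x * v₂ x ^ 2 * η x ^ 2) + v₁ x ^ 2 / τ) / 2 := by
      have e3 : v x * v₂ x ^ 2 * η x ^ 2 = (√(v x) * |v₂ x| * η x) ^ 2 := by
        rw [mul_pow, mul_pow, ← e1, sq_abs]
      rw [e3, ← sq_abs (v₁ x)]
      set a := √(v x) * |v₂ x| * η x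
      set b := |v₁ x|
      rw [le_div_iff₀ two_pos]
      have : τ * a ^ 2 + b ^ 2 / τ - b * a * 2 = (τ * a - b) ^ 2 / τ := by field_simp; ring
      have h5 : 0 ≤ (τ * a - b) ^ 2 / τ := by positivity
      linarith
    calc _ ≤ (√s)⁻¹ * ((τ * (v x * v₂ x ^ 2 * η x ^ 2) + v₁ x ^ 2 / τ) / 2) := by gcongr
      _ = _ := by field_simp
  have b3 : -∫ x in Ioo α β, v x * (v x + s)⁻¹ * (v₁ x * |v₁ x|) * deriv η x ≤
      ∫ x in Ioo α β, C * v₁ x ^ 2 := by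
    rw [← integral_neg]
    refine setIntegral_mono_on i3.neg (iv.const_mul C) measurableSet_Ioo fun x hx => ?_
    have hx' := Ioo_subset_Icc_self hx
    refine (neg_le_abs _).trans ?_
    rw [abs_mul, abs_mul, abs_mul (v₁ x), abs_abs, ← sq, sq_abs, abs_of_nonneg (hfrac x hx).1]
    calc _ ≤ 1 * v₁ x ^ 2 * C := by
          have := (hfrac x hx).2; have := (hfrac x hx).1; have := hC x hx'; gcongr
      _ = _ := by ring
  rw [integral_div, integral_add (iX.const_mul τ) (iv.div_const τ), integral_const_mul,
    integral_div] at b2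
  rw [integral_const_mul] at b3
  linarith

/-- Where `v ≤ s` the weight `s / (v + s)²` is at least `1 / (4 s)`. Multiplying the interpolation
estimate by `4 s` leaves a bound of order `√s`: the cube of the slope does not concentrate near the
zero set. -/
lemma setIntegral_cube_le (S : Slice α β v v₁ v₂ v₃) (hαβ : α < β) {η : ℝ → ℝ}
    (hη : ContDiff ℝ ∞ η) (hη0 : ∀ x, 0 ≤ η x) {C E s τ : ℝ} (hC : ∀ x ∈ Icc α β, |deriv η x| ≤ C)
    (hs : 0 < s) (hτ : 0 < τ) (hE : ∫ x in Ioo α β, v₁ x ^ 2 ≤ E) {A : Set ℝ}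
    (hA : MeasurableSet A) (hAs : A ⊆ Ioo α β) (hvA : ∀ x ∈ A, v x ≤ s) :
    ∫ x in A, |v₁ x| ^ 3 * η x ≤
      2 * √s * (τ * (∫ x in Ioo α β, v x * v₂ x ^ 2 * η x ^ 2) + E / τ) + 4 * s * (C * E) := by
  have hηc : ContinuousOn η (Icc α β) := hη.continuous.continuousOn
  have hC0 : 0 ≤ C := (abs_nonneg _).trans (hC α (left_mem_Icc.2 hαβ.le))
  have h := S.integral_cube_le hαβ hη hη0 hC hs hτ
  have hvs : ∀ x ∈ Icc α β, v x + s ≠ 0 := fun x hx => by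
    have := S.nonneg x hx; positivity
  have i1 : IntegrableOn (fun x => s / (v x + s) ^ 2 * |v₁ x| ^ 3 * η x) (Ioo α β) :=
    integrable_of_continuousOn (((continuousOn_const.div
      ((S.cont.add continuousOn_const).pow 2) fun x hx => pow_ne_zero _ (hvs x hx)).mul
      (S.cont₁.abs.pow 3)).mul hηc)
  have i2 : IntegrableOn (fun x => |v₁ x| ^ 3 * η x) (Ioo α β) :=
    integrable_of_continuousOn ((S.cont₁.abs.pow 3).mul hηc)
  have hss : √s ^ 2 = s := Real.sq_sqrt hs.le
  have hsp : 0 < √s := Real.sqrt_pos.2 hs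
  calc ∫ x in A, |v₁ x| ^ 3 * η x
      ≤ ∫ x in A, 4 * s * (s / (v x + s) ^ 2 * |v₁ x| ^ 3 * η x) := by
        refine setIntegral_mono_on (i2.mono_set hAs) ((i1.mono_set hAs).const_mul _) hA
          fun x hx => ?_
        have h0 := S.nonneg x (Ioo_subset_Icc_self (hAs hx))
        have h1 := hvA x hx
        have h2 : 1 ≤ 4 * s * (s / (v x + s) ^ 2) := by
          rw [mul_div_assoc', le_div_iff₀ (by positivity)]; nlinarith
        have h3 : 0 ≤ |v₁ x| ^ 3 * η x := mul_nonneg (by positivity) (hη0 x)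
        nlinarith
    _ ≤ 4 * s * ∫ x in Ioo α β, s / (v x + s) ^ 2 * |v₁ x| ^ 3 * η x := by
        rw [integral_const_mul]
        refine mul_le_mul_of_nonneg_left (setIntegral_mono_set i1 ?_ hAs.eventuallyLE)
          (by positivity)
        exact (ae_restrict_mem measurableSet_Ioo).mono fun x hx => by
          have := hη0 x
          simp only [Pi.zero_apply]; positivity
    _ ≤ 4 * s * ((τ * (∫ x in Ioo α β, v x * v₂ x ^ 2 * η x ^ 2) + E / τ) / (2 * √s) + C * E) := by
        refine mul_le_mul_of_nonneg_left (h.trans ?_) (by positivity)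
        gcongr
    _ = _ := by
        rw [show 4 * s = 4 * √s ^ 2 by rw [hss]]
        field_simp
        ring

end Slice

/-! ### Bounds for the source term at a fixed time -/

lemma abs_setIntegral_le {s : Set ℝ} (hs : MeasurableSet s) {f g : ℝ → ℝ} (hg : IntegrableOn g s)
    (h : ∀ x ∈ s, |f x| ≤ g x) : |∫ x in s, f x| ≤ ∫ x in s, g x :=
  norm_integral_le_of_norm_le (f := f) hg ((ae_restrict_mem hs).mono h)

/-- The right-hand side of the integrated form of `T^ε`. -/
noncomputable def Tfun (α β : ℝ) (v v₁ v₂ φ : ℝ → ℝ) : ℝ :=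
  (∫ x in Ioo α β, v x * v₂ x ^ 2 * φ x) - 5 / 6 * (∫ x in Ioo α β, v₁ x ^ 3 * deriv φ x) -
    1 / 2 * (∫ x in Ioo α β, v x * v₁ x ^ 2 * deriv (deriv φ) x)

lemma deriv_sq {η : ℝ → ℝ} (hη : ContDiff ℝ ∞ η) (x : ℝ) :
    deriv (fun x => η x ^ 2) x = 2 * η x * deriv η x := by
  have := (hη.differentiable (by simp)).differentiableAt (x := x) |>.hasDerivAt.fun_pow 2
  simpa using this.deriv

lemma exists_deriv_bounds (α β : ℝ) {φ : ℝ → ℝ} (hφ : ContDiff ℝ ∞ φ) :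
    ∃ L, 0 < L ∧ ∀ x ∈ Icc α β, |φ x| ≤ L ∧ |deriv φ x| ≤ L ∧ |deriv (deriv φ) x| ≤ L := by
  have h1 := (contDiff_infty_iff_deriv.1 hφ).2
  have h2 := (contDiff_infty_iff_deriv.1 h1).2
  obtain ⟨C0, hC0⟩ := isCompact_Icc.exists_bound_of_continuousOn (s := Icc α β)
    hφ.continuous.continuousOn
  obtain ⟨C1, hC1⟩ := isCompact_Icc.exists_bound_of_continuousOn (s := Icc α β)
    h1.continuous.continuousOn
  obtain ⟨C2, hC2⟩ := isCompact_Icc.exists_bound_of_continuousOn (s := Icc α β)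
    h2.continuous.continuousOn
  simp only [Real.norm_eq_abs] at hC0 hC1 hC2
  refine ⟨|C0| + |C1| + |C2| + 1, by positivity, fun x hx => ⟨?_, ?_, ?_⟩⟩
  · linarith [hC0 x hx, le_abs_self C0, abs_nonneg C1, abs_nonneg C2]
  · linarith [hC1 x hx, le_abs_self C1, abs_nonneg C0, abs_nonneg C2]
  · linarith [hC2 x hx, le_abs_self C2, abs_nonneg C0, abs_nonneg C1]

lemma Slice.abs_integral_mul_sq_le {α β : ℝ} {v v₁ v₂ v₃ : ℝ → ℝ} (S : Slice α β v v₁ v₂ v₃)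
    {M E L : ℝ} (hM : ∀ x ∈ Icc α β, v x ≤ M) (hM0 : 0 ≤ M) (hE : ∫ x in Ioo α β, v₁ x ^ 2 ≤ E)
    {g : ℝ → ℝ} (hg : ∀ x ∈ Icc α β, |g x| ≤ L) (hL : 0 ≤ L) :
    |∫ x in Ioo α β, v x * v₁ x ^ 2 * g x| ≤ M * L * E := by
  have iv : IntegrableOn (fun x => v₁ x ^ 2) (Ioo α β) :=
    Slice.integrable_of_continuousOn (S.cont₁.pow 2)
  calc |∫ x in Ioo α β, v x * v₁ x ^ 2 * g x| ≤ ∫ x in Ioo α β, M * L * v₁ x ^ 2 := by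
        refine abs_setIntegral_le measurableSet_Ioo (iv.const_mul _) fun x hx => ?_
        have hx := Ioo_subset_Icc_self hx
        have h0 := S.nonneg x hx
        rw [abs_mul, abs_of_nonneg (by positivity)]
        have := hM x hx
        have := hg x hx
        calc _ ≤ M * v₁ x ^ 2 * L := by gcongr
          _ = _ := by ring
    _ ≤ _ := by
        rw [integral_const_mul]; gcongr

/-- `Tfun` tested against a square controls the weighted integral of `v v₂²`. -/
lemma exists_le_Tfun_sq {α β : ℝ} (hαβ : α < β) {M E : ℝ} (hM : 0 < M) (hE : 0 ≤ E) {η : ℝ → ℝ}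
    (hη : ContDiff ℝ ∞ η) (hη0 : ∀ x, 0 ≤ η x) :
    ∃ K, 0 ≤ K ∧ ∀ v v₁ v₂ v₃ : ℝ → ℝ, Slice α β v v₁ v₂ v₃ → (∀ x ∈ Icc α β, v x ≤ M) →
      ∫ x in Ioo α β, v₁ x ^ 2 ≤ E →
      (∫ x in Ioo α β, v x * v₂ x ^ 2 * η x ^ 2) / 2 - K ≤
        Tfun α β v v₁ v₂ (fun x => η x ^ 2) := by
  obtain ⟨C, hC0, hC⟩ := exists_deriv_bounds α β hη
  obtain ⟨L, hL0, hL⟩ := exists_deriv_bounds α β (hη.pow 2)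
  -- Chosen so that the coefficient `(5/3) C · 2 √M τ ≤ 10/21` is below `1/2`: the cubic term is
  -- absorbed by half of the second order term.
  set τ := 1 / (7 * (C * √M + 1)) with hτ
  have hτ0 : 0 < τ := by positivity
  refine ⟨5 / 3 * C * (2 * √M * (E / τ) + 4 * M * (C * E)) + 1 / 2 * (M * L * E), by positivity,
    fun v v₁ v₂ v₃ S hvM hvE => ?_⟩
  have h1 := S.setIntegral_cube_le hαβ hη hη0 (fun x hx => (hC x hx).2.1) hM hτ0 hvE
    measurableSet_Ioo Subset.rfl (fun x hx => hvM x (Ioo_subset_Icc_self hx))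
  have h2 := S.abs_integral_mul_sq_le hvM hM.le hvE (g := deriv (deriv fun x => η x ^ 2))
    (fun x hx => (hL x hx).2.2) hL0.le
  -- The derivative `2 η η'` of a square keeps a factor `η`, which matches the weight in the
  -- interpolation estimate. This is why the test functions are squares.
  have h3 : |∫ x in Ioo α β, v₁ x ^ 3 * deriv (fun x => η x ^ 2) x| ≤
      2 * C * ∫ x in Ioo α β, |v₁ x| ^ 3 * η x := by
    rw [← integral_const_mul]
    refine abs_setIntegral_le measurableSet_Ioo ((Slice.integrable_of_continuousOn
      ((S.cont₁.abs.pow 3).mul hη.continuous.continuousOn)).const_mul _) fun x hx => ?_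
    rw [deriv_sq hη, abs_mul, abs_mul, abs_pow, abs_mul, abs_two,
      abs_of_nonneg (hη0 x)]
    have h4 := (hC x (Ioo_subset_Icc_self hx)).2.1
    have h5 : 0 ≤ |v₁ x| ^ 3 * η x := mul_nonneg (by positivity) (hη0 x)
    nlinarith
  set X := ∫ x in Ioo α β, v x * v₂ x ^ 2 * η x ^ 2
  have hX : 0 ≤ X := setIntegral_nonneg measurableSet_Ioo fun x hx => by
    have := S.nonneg x (Ioo_subset_Icc_self hx)
    positivity
  have h6 : 5 / 3 * C * (2 * √M * (τ * X)) ≤ X / 2 := by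
    have : 5 / 3 * C * (2 * √M * τ) ≤ 1 / 2 := by
      rw [hτ, mul_one_div, mul_div_assoc', div_le_iff₀ (by positivity)]
      nlinarith [mul_nonneg hC0.le (Real.sqrt_nonneg M)]
    nlinarith
  have h7 : 5 / 6 * (∫ x in Ioo α β, v₁ x ^ 3 * deriv (fun x => η x ^ 2) x) ≤
      5 / 3 * C * (2 * √M * (τ * X + E / τ) + 4 * M * (C * E)) := by
    have h8 := (le_abs_self _).trans h3
    have h9 := mul_le_mul_of_nonneg_left h1 (show (0 : ℝ) ≤ 2 * C by positivity)
    linarith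
  have h10 := le_of_abs_le h2
  unfold Tfun
  change X / 2 - _ ≤ X - _ - _
  linarith

/-- The interpolation estimate with constant weight and threshold `s = M` controls the whole cubic
term. The bound supplies the majorant in time once the integral of `v v₂²` has one. -/
lemma exists_abs_Tfun_le {α β : ℝ} (hαβ : α < β) {M E L : ℝ} (hM : 0 < M) (hE : 0 ≤ E)
    (hL : 0 ≤ L) :
    ∃ K, 0 ≤ K ∧ ∀ v v₁ v₂ v₃ : ℝ → ℝ, Slice α β v v₁ v₂ v₃ → (∀ x ∈ Icc α β, v x ≤ M) →
      ∫ x in Ioo α β, v₁ x ^ 2 ≤ E → ∀ φ : ℝ → ℝ, ContDiff ℝ ∞ φ →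
      (∀ x ∈ Icc α β, |φ x| ≤ L ∧ |deriv φ x| ≤ L ∧ |deriv (deriv φ) x| ≤ L) →
      |Tfun α β v v₁ v₂ φ| ≤ K * (1 + ∫ x in Ioo α β, v x * v₂ x ^ 2) := by
  refine ⟨L + L * (2 * √M) + (L * (2 * √M * E) + M * L * E), by positivity,
    fun v v₁ v₂ v₃ S hvM hvE φ hφ hφL => ?_⟩
  have h1 := S.setIntegral_cube_le hαβ (η := fun _ => 1) contDiff_const (fun _ => zero_le_one)
    (C := 0) (by simp) hM one_pos hvE
    measurableSet_Ioo Subset.rfl (fun x hx => hvM x (Ioo_subset_Icc_self hx))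
  simp only [mul_one, one_pow, one_mul, div_one, zero_mul, mul_zero, add_zero] at h1
  have h2 := S.abs_integral_mul_sq_le hvM hM.le hvE (g := deriv (deriv φ))
    (fun x hx => (hφL x hx).2.2) hL
  have h3 : |∫ x in Ioo α β, v₁ x ^ 3 * deriv φ x| ≤ L * ∫ x in Ioo α β, |v₁ x| ^ 3 := by
    rw [← integral_const_mul]
    refine abs_setIntegral_le measurableSet_Ioo ((Slice.integrable_of_continuousOn
      (S.cont₁.abs.pow 3)).const_mul _) fun x hx => ?_
    rw [abs_mul, abs_pow, mul_comm]
    exact mul_le_mul_of_nonneg_right (hφL x (Ioo_subset_Icc_self hx)).2.1 (by positivity)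
  have h4 : |∫ x in Ioo α β, v x * v₂ x ^ 2 * φ x| ≤ L * ∫ x in Ioo α β, v x * v₂ x ^ 2 := by
    rw [← integral_const_mul]
    refine abs_setIntegral_le measurableSet_Ioo (S.integrable.const_mul _) fun x hx => ?_
    have := S.nonneg x (Ioo_subset_Icc_self hx)
    rw [abs_mul, abs_of_nonneg (a := v x * v₂ x ^ 2) (by positivity), mul_comm]
    exact mul_le_mul_of_nonneg_right (hφL x (Ioo_subset_Icc_self hx)).1 (by positivity)
  set X := ∫ x in Ioo α β, v x * v₂ x ^ 2
  have hX : 0 ≤ X := setIntegral_nonneg measurableSet_Ioo fun x hx => by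
    have := S.nonneg x (Ioo_subset_Icc_self hx)
    positivity
  have h5 := mul_le_mul_of_nonneg_left h1 hL
  unfold Tfun
  set a := ∫ x in Ioo α β, v x * v₂ x ^ 2 * φ x
  set b := ∫ x in Ioo α β, v₁ x ^ 3 * deriv φ x
  set c := ∫ x in Ioo α β, v x * v₁ x ^ 2 * deriv (deriv φ) x
  have h6 : |a - 5 / 6 * b - 1 / 2 * c| ≤ |a| + |b| + |c| := by
    refine abs_le.2 ⟨?_, ?_⟩ <;>
      linarith [neg_abs_le a, neg_abs_le b, neg_abs_le c, le_abs_self a, le_abs_self b,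
        le_abs_self c, abs_nonneg b, abs_nonneg c]
  have h7 : 0 ≤ (L * (2 * √M * E) + M * L * E) * X := by positivity
  have h8 : 0 ≤ L * (2 * √M) := by positivity
  nlinarith

/-! ### Convergence of profiles where the limit is positive -/

/-- The mean value theorem is applied twice, the second time to the Taylor remainder itself. The
resulting constant `e` in place of `e / 2` is harmless. -/
lemma taylor_bounds {f f₁ f₂ : ℝ → ℝ} {c d K e : ℝ} (hcd : c < d) (hf : ContinuousOn f (Icc c d))
    (hf₁ : ContinuousOn f₁ (Icc c d)) (h : ∀ x ∈ Ioo c d, HasDerivAt f (f₁ x) x)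
    (h₁ : ∀ x ∈ Ioo c d, HasDerivAt f₁ (f₂ x) x) (he : ∀ x ∈ Ioo c d, |f₂ x - K| ≤ e) :
    ∀ x ∈ Icc c d, |f₁ x - f₁ c - K * (x - c)| ≤ e * (x - c) ∧
      |f x - f c - f₁ c * (x - c) - K / 2 * (x - c) ^ 2| ≤ e * (x - c) ^ 2 := by
  have he0 : 0 ≤ e := (abs_nonneg _).trans (he ((c + d) / 2) ⟨by linarith, by linarith⟩)
  have key : ∀ x ∈ Icc c d, |f₁ x - f₁ c - K * (x - c)| ≤ e * (x - c) := fun x hx => by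
    rcases hx.1.eq_or_lt with rfl | hcx
    · simp
    · obtain ⟨ξ, hξ, hξ'⟩ := exists_hasDerivAt_eq_slope f₁ f₂ hcx
        (hf₁.mono (Icc_subset_Icc le_rfl hx.2)) fun y hy => h₁ y ⟨hy.1, hy.2.trans_le hx.2⟩
      have hb := he ξ ⟨hξ.1, hξ.2.trans_le hx.2⟩
      have hp : 0 < x - c := sub_pos.2 hcx
      have : f₁ x - f₁ c - K * (x - c) = (f₂ ξ - K) * (x - c) := by
        rw [hξ']; field_simp
      rw [this, abs_mul, abs_of_pos hp]
      gcongr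
  refine fun x hx => ⟨key x hx, ?_⟩
  rcases hx.1.eq_or_lt with rfl | hcx
  · simp
  · have hp : 0 < x - c := sub_pos.2 hcx
    obtain ⟨ξ, hξ, hξ'⟩ := exists_hasDerivAt_eq_slope
      (fun y => f y - f₁ c * (y - c) - K / 2 * (y - c) ^ 2)
      (fun y => f₁ y - f₁ c - K * (y - c)) hcx
      (((hf.mono (Icc_subset_Icc le_rfl hx.2)).sub (by fun_prop)).sub (by fun_prop)) fun y hy => by
        have h1 := h y ⟨hy.1, hy.2.trans_le hx.2⟩
        have h2 : HasDerivAt (fun y => y - c) 1 y := (hasDerivAt_id y).sub_const c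
        refine ((h1.sub (h2.const_mul (f₁ c))).sub ((h2.pow 2).const_mul (K / 2))).congr_deriv ?_
        simp; ring
    have hb := key ξ ⟨hξ.1.le, hξ.2.le.trans hx.2⟩
    have hb2 : e * (ξ - c) ≤ e * (x - c) := by gcongr; exact hξ.2.le
    have : f x - f c - f₁ c * (x - c) - K / 2 * (x - c) ^ 2 =
        (f₁ ξ - f₁ c - K * (ξ - c)) * (x - c) := by
      rw [hξ']; field_simp; ring
    rw [this, abs_mul, abs_of_pos hp]
    calc _ ≤ (e * (x - c)) * (x - c) := by gcongr; exact hb.trans hb2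
      _ = _ := by ring

/-- The dissipation at a fixed time. -/
noncomputable def dissip (α β : ℝ) (v v₃ : ℝ → ℝ) : ℝ≥0∞ :=
  ∫⁻ x in posSet α β v, ENNReal.ofReal (v x ^ 3 * v₃ x ^ 2)

/-- Young's inequality `|v₃| ≤ τ + v₃² / τ` and `v₃² ≤ v³ v₃² / δ³` where `v ≥ δ`. Working with
extended non-negative values avoids any finiteness assumption on the dissipation. -/
lemma Slice.abs_deriv_sub_le {α β : ℝ} {v v₁ v₂ v₃ : ℝ → ℝ} (S : Slice α β v v₁ v₂ v₃)
    {x y δ τ : ℝ} (hxy : x ≤ y) (hsub : Icc x y ⊆ posSet α β v) (hδ : 0 < δ)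
    (hv : ∀ z ∈ Icc x y, δ ≤ v z) (hτ : 0 < τ) :
    ENNReal.ofReal |deriv v₁ y - deriv v₁ x| ≤
      ENNReal.ofReal (τ * (y - x)) + ENNReal.ofReal (1 / (τ * δ ^ 3)) * dissip α β v v₃ := by
  obtain ⟨hi, he⟩ := S.sub_eq x y hxy hsub
  rw [he, ← Real.norm_eq_abs, ofReal_norm]
  calc ‖∫ z in x..y, v₃ z‖ₑ ≤ ∫⁻ z in Ioc x y, ‖v₃ z‖ₑ := by
        rw [intervalIntegral.integral_of_le hxy]
        exact enorm_integral_le_lintegral_enorm _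
    _ ≤ ∫⁻ z in Ioc x y, (ENNReal.ofReal τ +
          ENNReal.ofReal (1 / (τ * δ ^ 3)) * ENNReal.ofReal (v z ^ 3 * v₃ z ^ 2)) := by
        refine setLIntegral_mono' measurableSet_Ioc fun z hz => ?_
        have hvz := hv z (Ioc_subset_Icc_self hz)
        have hvz0 : 0 < v z := hδ.trans_le hvz
        rw [← ofReal_norm, ← ENNReal.ofReal_mul (by positivity),
          ← ENNReal.ofReal_add hτ.le (by positivity)]
        refine ENNReal.ofReal_le_ofReal ?_
        have h1 : 1 / (τ * δ ^ 3) * (δ ^ 3 * v₃ z ^ 2) ≤ 1 / (τ * δ ^ 3) * (v z ^ 3 * v₃ z ^ 2) := by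
          gcongr
        have h2 : 1 / (τ * δ ^ 3) * (δ ^ 3 * v₃ z ^ 2) = v₃ z ^ 2 / τ := by field_simp
        have h3 : |v₃ z| ≤ τ + v₃ z ^ 2 / τ := by
          rw [← sub_nonneg]
          have : τ + v₃ z ^ 2 / τ - |v₃ z| = ((τ - |v₃ z|) ^ 2 + τ * |v₃ z|) / τ := by
            field_simp; rw [← sq_abs (v₃ z)]; ring
          rw [this]; positivity
        rw [Real.norm_eq_abs]
        linarith
    _ = ENNReal.ofReal (τ * (y - x)) + ENNReal.ofReal (1 / (τ * δ ^ 3)) *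
          ∫⁻ z in Ioc x y, ENNReal.ofReal (v z ^ 3 * v₃ z ^ 2) := by
        rw [lintegral_add_left measurable_const, lintegral_const_mul' _ _ ENNReal.ofReal_ne_top,
          setLIntegral_const, Real.volume_Ioc, ENNReal.ofReal_mul hτ.le]
    _ ≤ _ := by
        gcongr
        exact lintegral_mono_set (Ioc_subset_Icc_self.trans hsub)

section Sequence

variable {α β : ℝ} {v v₁ v₂ v₃ : ℕ → ℝ → ℝ}

/-- On a compact interval the limit has a positive minimum, so the profiles are eventually bounded
below by half of it. The term with `τ` is made at most `e / 2` by the choice of `τ`, and the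
vanishing dissipation takes care of the other half. -/
lemma eventually_osc_le (S : ∀ k, Slice α β (v k) (v₁ k) (v₂ k) (v₃ k))
    (hD : Tendsto (fun k => dissip α β (v k) (v₃ k)) atTop (𝓝 0)) {c d : ℝ}
    (hs : Icc c d ⊆ Icc α β) {w : ℝ → ℝ}
    (hw : TendstoUniformlyOn v w atTop (Icc c d)) (hpos : ∀ x ∈ Icc c d, 0 < w x) {e : ℝ}
    (he : 0 < e) :
    ∀ᶠ k in atTop, ∀ x ∈ Ioo c d, ∀ y ∈ Ioo c d, |deriv (v₁ k) y - deriv (v₁ k) x| ≤ e := by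
  rcases le_or_gt d c with hdc | hcd
  · exact Eventually.of_forall fun k x hx => absurd (hx.1.trans hx.2) hdc.not_gt
  have hcs : c ∈ Icc α β := hs (left_mem_Icc.2 hcd.le)
  have hds : d ∈ Icc α β := hs (right_mem_Icc.2 hcd.le)
  have hwc : ContinuousOn w (Icc c d) :=
    hw.continuousOn (Eventually.of_forall fun k => (S k).cont.mono hs).frequently
  obtain ⟨m, hm, hmin⟩ := isCompact_Icc.exists_isMinOn (nonempty_Icc.2 hcd.le) hwc
  set δ := w m / 2
  have hδ : 0 < δ := half_pos (hpos m hm)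
  have hv : ∀ᶠ k in atTop, ∀ z ∈ Icc c d, δ ≤ v k z := by
    filter_upwards [Metric.tendstoUniformlyOn_iff.1 hw δ hδ] with k hk z hz
    have h1 := hk z hz
    have h2 : w m ≤ w z := hmin hz
    rw [Real.dist_eq] at h1
    have := (abs_lt.1 h1).2
    have h3 : δ = w m / 2 := rfl
    linarith
  set τ := e / (2 * (d - c))
  have hτ : 0 < τ := by have := sub_pos.2 hcd; positivity
  have hD2 : Tendsto (fun k => ENNReal.ofReal (1 / (τ * δ ^ 3)) * dissip α β (v k) (v₃ k)) atTop
      (𝓝 0) := by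
    have := ENNReal.Tendsto.const_mul (a := ENNReal.ofReal (1 / (τ * δ ^ 3))) hD
      (Or.inr ENNReal.ofReal_ne_top)
    rwa [mul_zero] at this
  have hD3 := hD2.eventually (ge_mem_nhds (show 0 < ENNReal.ofReal (e / 2) by simpa using he))
  filter_upwards [hv, hD3] with k hk1 hk2
  have main : ∀ x ∈ Ioo c d, ∀ y ∈ Ioo c d, x ≤ y → |deriv (v₁ k) y - deriv (v₁ k) x| ≤ e := by
    intro x hx y hy hxy
    have hsub : Icc x y ⊆ Icc c d := Icc_subset_Icc hx.1.le hy.2.le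
    have h := (S k).abs_deriv_sub_le hxy (fun z hz => ⟨⟨hcs.1.trans_lt (hx.1.trans_le hz.1),
      (hz.2.trans_lt hy.2).trans_le hds.2⟩, hδ.trans_le (hk1 z (hsub hz))⟩) hδ
      (fun z hz => hk1 z (hsub hz)) hτ
    have h2 : ENNReal.ofReal (τ * (y - x)) ≤ ENNReal.ofReal (e / 2) := by
      refine ENNReal.ofReal_le_ofReal ?_
      calc τ * (y - x) ≤ τ * (d - c) := by gcongr <;> [exact hy.2.le; exact hx.1.le]
        _ = e / 2 := by have := (sub_pos.2 hcd).ne'; simp only [τ]; field_simp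
    have h3 := h.trans (add_le_add h2 hk2)
    rw [← ENNReal.ofReal_add (by positivity) (by positivity), add_halves,
      ENNReal.ofReal_le_ofReal_iff he.le] at h3
    exact h3
  intro x hx y hy
  rcases le_total x y with h | h
  · exact main x hx y hy h
  · rw [abs_sub_comm]; exact main y hy x hx h

/-- Where the limit is positive, it is a quadratic polynomial, and the first two derivatives
converge uniformly. -/
lemma exists_quadratic (S : ∀ k, Slice α β (v k) (v₁ k) (v₂ k) (v₃ k))
    (hD : Tendsto (fun k => dissip α β (v k) (v₃ k)) atTop (𝓝 0)) {c d : ℝ} (hcd : c < d)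
    (hs : Icc c d ⊆ Icc α β) {w : ℝ → ℝ}
    (hw : TendstoUniformlyOn v w atTop (Icc c d)) (hpos : ∀ x ∈ Icc c d, 0 < w x) :
    ∃ A K : ℝ, (∀ x ∈ Icc c d, w x = w c + A * (x - c) + K / 2 * (x - c) ^ 2) ∧
      TendstoUniformlyOn v₁ (fun x => A + K * (x - c)) atTop (Icc c d) ∧
      TendstoUniformlyOn (fun k => deriv (v₁ k)) (fun _ => K) atTop (Ioo c d) := by
  set h := (d - c) / 2
  have hh : 0 < h := half_pos (sub_pos.2 hcd)
  have hdc : d - c = 2 * h := by simp only [h]; ring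
  set m := c + h
  have hm : m ∈ Ioo c d := ⟨by linarith, by simp only [m]; linarith⟩
  have hcs : c ∈ Icc α β := hs (left_mem_Icc.2 hcd.le)
  have hds : d ∈ Icc α β := hs (right_mem_Icc.2 hcd.le)
  have hlim : ∀ x ∈ Icc c d, Tendsto (fun k => v k x) atTop (𝓝 (w x)) := fun x hx =>
    hw.tendsto_at hx
  have hc := left_mem_Icc.2 hcd.le
  have hd := right_mem_Icc.2 hcd.le
  have hwc : ContinuousOn w (Icc c d) :=
    hw.continuousOn (Eventually.of_forall fun k => (S k).cont.mono hs).frequently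
  obtain ⟨m₀, hm₀, hmin⟩ := isCompact_Icc.exists_isMinOn (nonempty_Icc.2 hcd.le) hwc
  have hvpos : ∀ᶠ k in atTop, Ioo c d ⊆ posSet α β (v k) := by
    filter_upwards [Metric.tendstoUniformlyOn_iff.1 hw _ (hpos m₀ hm₀)] with k hk z hz
    have h1 := hk z (Ioo_subset_Icc_self hz)
    have h2 : w m₀ ≤ w z := hmin (Ioo_subset_Icc_self hz)
    rw [Real.dist_eq] at h1
    exact ⟨⟨hcs.1.trans_lt hz.1, hz.2.trans_le hds.2⟩, by linarith [(abs_lt.1 h1).2]⟩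
  have taylor : ∀ e > 0, ∀ᶠ k in atTop, ∀ x ∈ Icc c d,
      |v₁ k x - v₁ k c - deriv (v₁ k) m * (x - c)| ≤ e * (x - c) ∧
      |v k x - v k c - v₁ k c * (x - c) - deriv (v₁ k) m / 2 * (x - c) ^ 2| ≤ e * (x - c) ^ 2 := by
    intro e he
    filter_upwards [eventually_osc_le S hD hs hw hpos he, hvpos] with k hk hk2
    exact taylor_bounds hcd ((S k).cont.mono hs) ((S k).cont₁.mono hs)
      (fun x hx => (S k).hasDerivAt x (hk2 hx).1) (fun x hx => (S k).hasDerivAt₁ x (hk2 hx))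
      fun x hx => hk m hm x hx
  -- The only candidate for the limit of the second derivatives is the second difference quotient of
  -- `w`, since those of `v k` converge and the Taylor bounds relate them to the value at the
  -- midpoint.
  set K := (w d - 2 * w m + w c) / h ^ 2
  have hK : Tendsto (fun k => deriv (v₁ k) m) atTop (𝓝 K) := by
    have h1 : Tendsto (fun k => (v k d - 2 * v k m + v k c) / h ^ 2) atTop (𝓝 K) :=
      (((hlim d hd).sub ((hlim m (Ioo_subset_Icc_self hm)).const_mul 2)).add (hlim c hc)).div_const _
    have h2 : Tendsto (fun k => deriv (v₁ k) m - (v k d - 2 * v k m + v k c) / h ^ 2) atTop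
        (𝓝 0) := by
      rw [Metric.tendsto_atTop']
      have : ∀ e > 0, ∀ᶠ k in atTop,
          dist (deriv (v₁ k) m - (v k d - 2 * v k m + v k c) / h ^ 2) 0 < e := by
        intro e he
        -- The Taylor errors at `d` and, counted twice, at `m` add up to `(4 + 2) h²` times the
        -- tolerance, hence the `7`.
        filter_upwards [taylor (e / 7) (by positivity)] with k hk
        have t1 := abs_le.1 (hk m (Ioo_subset_Icc_self hm)).2
        have t2 := abs_le.1 (hk d hd).2
        rw [hdc] at t2
        rw [show m - c = h by simp only [m]; ring] at t1
        set q := deriv (v₁ k) m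
        have e1 : q - (v k d - 2 * v k m + v k c) / h ^ 2 =
            (q * h ^ 2 - (v k d - 2 * v k m + v k c)) / h ^ 2 := by field_simp
        rw [dist_zero_right, Real.norm_eq_abs, e1, abs_div, abs_of_pos (a := h ^ 2) (by positivity),
          div_lt_iff₀ (by positivity), abs_lt]
        have hh2 : 0 < e * h ^ 2 := by positivity
        constructor <;> nlinarith
      intro e he
      obtain ⟨N, hN⟩ := eventually_atTop.1 (this e he)
      exact ⟨N, fun n hn => hN n hn.le⟩
    simpa using h2.add h1
  set A := (w m - w c) / h - K / 2 * h
  have hA : Tendsto (fun k => v₁ k c) atTop (𝓝 A) := by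
    have h1 : Tendsto (fun k => (v k m - v k c) / h - deriv (v₁ k) m / 2 * h) atTop (𝓝 A) :=
      (((hlim m (Ioo_subset_Icc_self hm)).sub (hlim c hc)).div_const _).sub
        ((hK.div_const 2).mul_const h)
    have h2 : Tendsto (fun k => v₁ k c - ((v k m - v k c) / h - deriv (v₁ k) m / 2 * h)) atTop
        (𝓝 0) := by
      refine Metric.tendsto_nhds.2 fun e he => ?_
      filter_upwards [taylor (e / (2 * h)) (by positivity)] with k hk
      have t1 := (hk m (Ioo_subset_Icc_self hm)).2
      rw [show m - c = h by simp only [m]; ring] at t1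
      set q := deriv (v₁ k) m
      have e1 : v₁ k c - ((v k m - v k c) / h - q / 2 * h) =
            -(v k m - v k c - v₁ k c * h - q / 2 * h ^ 2) / h := by field_simp; ring
      rw [dist_zero_right, Real.norm_eq_abs, e1, abs_div, abs_neg, abs_of_pos hh, div_lt_iff₀ hh]
      refine t1.trans_lt ?_
      have : e / (2 * h) * h ^ 2 = e * h / 2 := by field_simp
      rw [this]
      nlinarith [mul_pos he hh]
    simpa using h2.add h1
  refine ⟨A, K, fun x hx => ?_, ?_, ?_⟩
  · have h1 : Tendsto (fun k => v k x - v k c - v₁ k c * (x - c) -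
        deriv (v₁ k) m / 2 * (x - c) ^ 2) atTop
        (𝓝 (w x - w c - A * (x - c) - K / 2 * (x - c) ^ 2)) :=
      (((hlim x hx).sub (hlim c hc)).sub (hA.mul_const _)).sub ((hK.div_const 2).mul_const _)
    have h2 : Tendsto (fun k => v k x - v k c - v₁ k c * (x - c) -
        deriv (v₁ k) m / 2 * (x - c) ^ 2) atTop (𝓝 0) := by
      refine Metric.tendsto_nhds.2 fun e he => ?_
      filter_upwards [taylor (e / ((x - c) ^ 2 + 1)) (by positivity)] with k hk
      rw [dist_zero_right, Real.norm_eq_abs]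
      refine (hk x hx).2.trans_lt ?_
      rw [div_mul_eq_mul_div, div_lt_iff₀ (by positivity)]
      nlinarith
    linarith [tendsto_nhds_unique h1 h2]
  · refine Metric.tendstoUniformlyOn_iff.2 fun e he => ?_
    filter_upwards [taylor (e / (6 * h)) (by positivity), Metric.tendsto_nhds.1 hA (e / 3)
      (by positivity), Metric.tendsto_nhds.1 hK (e / (6 * h)) (by positivity)] with k hk hkA hkK x hx
    have t := (hk x hx).1
    rw [Real.dist_eq] at hkA hkK ⊢
    have hxc : 0 ≤ x - c := sub_nonneg.2 hx.1
    have hxc2 : x - c ≤ 2 * h := by rw [← hdc]; linarith [hx.2]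
    have e1 : e / (6 * h) * (x - c) ≤ e / 3 := by
      calc e / (6 * h) * (x - c) ≤ e / (6 * h) * (2 * h) := by gcongr
        _ = e / 3 := by field_simp; norm_num
    have e2 : |deriv (v₁ k) m - K| * (x - c) ≤ e / 3 :=
      (mul_le_mul_of_nonneg_right hkK.le hxc).trans e1
    have e3 : A + K * (x - c) - v₁ k x = -(v₁ k x - v₁ k c - deriv (v₁ k) m * (x - c)) -
        (v₁ k c - A) - (deriv (v₁ k) m - K) * (x - c) := by ring
    rw [e3]
    refine ((abs_sub _ _).trans (add_le_add (abs_sub _ _) le_rfl)).trans_lt ?_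
    rw [abs_neg, abs_mul, abs_of_nonneg hxc]
    linarith
  · refine Metric.tendstoUniformlyOn_iff.2 fun e he => ?_
    filter_upwards [eventually_osc_le S hD hs hw hpos (half_pos he),
      Metric.tendsto_nhds.1 hK (e / 2) (by positivity)] with k hk hkK x hx
    rw [Real.dist_eq, abs_sub_comm] at hkK ⊢
    have h1 := abs_sub_le (deriv (v₁ k) x) (deriv (v₁ k) m) K
    have := hk m hm x hx
    rw [abs_sub_comm K] at hkK
    linarith

end Sequence

/-! ### Components of open sets of the line -/

/-- `(a, b)` is a connected component of `P`. -/
structure IsComp (P : Set ℝ) (a b : ℝ) : Prop where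
  lt : a < b
  subset : Ioo a b ⊆ P
  left : a ∉ P
  right : b ∉ P

lemma exists_isComp {P : Set ℝ} (hP : IsOpen P) {α β : ℝ} (hs : P ⊆ Ioo α β) {x : ℝ} (hx : x ∈ P) :
    ∃ a b, IsComp P a b ∧ x ∈ Ioo a b ∧ α ≤ a ∧ b ≤ β := by
  have hcl : IsClosed Pᶜ := hP.isClosed_compl
  have hxs := hs hx
  have h1 : (Pᶜ ∩ Icc x β).Nonempty := ⟨β, fun h => (hs h).2.false, hxs.2.le, le_rfl⟩
  have h2 : (Pᶜ ∩ Icc α x).Nonempty := ⟨α, fun h => (hs h).1.false, le_rfl, hxs.1.le⟩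
  have c1 : IsCompact (Pᶜ ∩ Icc x β) := isCompact_Icc.inter_left hcl
  have c2 : IsCompact (Pᶜ ∩ Icc α x) := isCompact_Icc.inter_left hcl
  have m1 := c1.sInf_mem h1
  have m2 := c2.sSup_mem h2
  set b := sInf (Pᶜ ∩ Icc x β)
  set a := sSup (Pᶜ ∩ Icc α x)
  have hxb : x < b := m1.2.1.lt_of_ne fun h => m1.1 (h ▸ hx)
  have hax : a < x := m2.2.2.lt_of_ne fun h => m2.1 (h ▸ hx)
  refine ⟨a, b, ⟨hax.trans hxb, fun y hy => ?_, m2.1, m1.1⟩, ⟨hax, hxb⟩, m2.2.1, m1.2.2⟩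
  by_contra hyP
  rcases le_total y x with h | h
  · exact absurd (le_csSup c2.bddAbove ⟨hyP, m2.2.1.trans hy.1.le, h⟩) (not_le.2 hy.1)
  · exact absurd (csInf_le c1.bddBelow ⟨hyP, h, hy.2.le.trans m1.2.2⟩) (not_le.2 hy.2)

lemma IsComp.eq_of_mem {P : Set ℝ} {a b a' b' x : ℝ} (h : IsComp P a b) (h' : IsComp P a' b')
    (hx : x ∈ Ioo a b) (hx' : x ∈ Ioo a' b') : a = a' ∧ b = b' := by
  constructor
  · rcases lt_trichotomy a a' with hl | he | hl
    · exact absurd (h.subset ⟨hl, hx'.1.trans hx.2⟩) h'.left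
    · exact he
    · exact absurd (h'.subset ⟨hl, hx.1.trans hx'.2⟩) h.left
  · rcases lt_trichotomy b b' with hl | he | hl
    · exact absurd (h'.subset ⟨hx'.1.trans hx.2, hl⟩) h.right
    · exact he
    · exact absurd (h.subset ⟨hx.1.trans hx'.2, hl⟩) h'.right

/-- An open set of the line is a countable disjoint union of its components, so an integral over it
is the sum of the integrals over the components. -/
lemma setIntegral_nonneg_of_isComp {P : Set ℝ} (hP : IsOpen P) {α β : ℝ} (hs : P ⊆ Ioo α β)
    {f : ℝ → ℝ} (hf : IntegrableOn f P)
    (h : ∀ a b, IsComp P a b → 0 ≤ ∫ x in Ioo a b, f x) : 0 ≤ ∫ x in P, f x := by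
  let 𝒞 : Set (ℝ × ℝ) := {z | IsComp P z.1 z.2}
  have hdisj : 𝒞.PairwiseDisjoint fun z => Ioo z.1 z.2 := by
    intro z hz z' hz' hne
    refine Set.disjoint_left.2 fun x hx hx' => hne ?_
    exact Prod.ext_iff.2 (hz.eq_of_mem hz' hx hx')
  have hcount : 𝒞.Countable := hdisj.countable_of_isOpen (fun _ _ => isOpen_Ioo)
    fun z hz => nonempty_Ioo.2 hz.lt
  have hU : P = ⋃ z : 𝒞, Ioo z.1.1 z.1.2 := by
    refine Subset.antisymm (fun x hx => ?_) (iUnion_subset fun z => z.2.subset)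
    obtain ⟨a, b, hab, hxab, _⟩ := exists_isComp hP hs hx
    exact mem_iUnion.2 ⟨⟨(a, b), hab⟩, hxab⟩
  have : Countable 𝒞 := hcount
  have hsum : HasSum (fun z : 𝒞 => ∫ x in Ioo z.1.1 z.1.2, f x) (∫ x in ⋃ z : 𝒞, Ioo z.1.1 z.1.2, f x) := by
    refine hasSum_integral_iUnion (fun _ => measurableSet_Ioo) ?_ (hU ▸ hf)
    exact (pairwise_subtype_iff_pairwise_set 𝒞 _).2 hdisj
  rw [← hU] at hsum
  exact hsum.nonneg fun z => h _ _ z.2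

lemma le_setIntegral_of_isComp {P : Set ℝ} (hP : IsOpen P) {α β : ℝ} (hs : P ⊆ Ioo α β)
    {f : ℝ → ℝ} (hf : IntegrableOn f P)
    (h : ∀ a b, IsComp P a b → 0 ≤ ∫ x in Ioo a b, f x) {a b : ℝ} (hab : IsComp P a b) :
    ∫ x in Ioo a b, f x ≤ ∫ x in P, f x := by
  -- The end points of a component are not in `P`, so removing the component removes a closed
  -- interval. What remains is open, and its components are the other components of `P`.
  have h1 : P \ Ioo a b = P \ Icc a b := by
    ext x
    refine ⟨fun hx => ⟨hx.1, fun hx' => ?_⟩, fun hx => ⟨hx.1, fun h => hx.2 (Ioo_subset_Icc_self h)⟩⟩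
    rcases hx'.1.eq_or_lt with rfl | h1
    · exact hab.left hx.1
    rcases hx'.2.eq_or_lt with rfl | h2
    · exact hab.right hx.1
    exact hx.2 ⟨h1, h2⟩
  have ho : IsOpen (P \ Ioo a b) := h1 ▸ hP.sdiff isClosed_Icc
  have h2 := setIntegral_nonneg_of_isComp ho (sdiff_subset.trans hs) (hf.mono_set sdiff_subset)
    fun a' b' h' => by
      refine h a' b' ⟨h'.lt, h'.subset.trans sdiff_subset, ?_, ?_⟩
      · intro ha'
        have hm : a' ∈ Ioo a b := by by_contra hc; exact h'.left ⟨ha', hc⟩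
        obtain ⟨y, hy1, hy2⟩ := exists_between (lt_min h'.lt hm.2)
        exact (h'.subset ⟨hy1, hy2.trans_le (min_le_left _ _)⟩).2
          ⟨hm.1.trans hy1, hy2.trans_le (min_le_right _ _)⟩
      · intro hb'
        have hm : b' ∈ Ioo a b := by by_contra hc; exact h'.right ⟨hb', hc⟩
        obtain ⟨y, hy1, hy2⟩ := exists_between (max_lt h'.lt hm.1)
        exact (h'.subset ⟨(le_max_left _ _).trans_lt hy1, hy2⟩).2
          ⟨(le_max_right _ _).trans_lt hy1, hy2.trans hm.2⟩
  have h3 := setIntegral_sdiff measurableSet_Ioo hf hab.subset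
  linarith

/-! ### Convergence of integrals -/

/-- Convergence of integrals when the integrands converge on the open set `P`, are bounded away from
its complement, and are small near its complement. -/
lemma tendsto_setIntegral_of_small {I P : Set ℝ} (hI : MeasurableSet I) (hP : MeasurableSet P)
    (hIfin : volume I ≠ ⊤) (hPI : P ⊆ I) {Z : ℝ → Set ℝ} (hZm : ∀ s, MeasurableSet (Z s))
    (hZP : ∀ s > 0, I \ Z s ⊆ P) {h : ℕ → ℝ → ℝ} {g : ℝ → ℝ}
    (hint : ∀ k, IntegrableOn (h k) I) (hg : AEStronglyMeasurable g (volume.restrict P))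
    (hlim : ∀ x ∈ P, Tendsto (fun k => h k x) atTop (𝓝 (g x)))
    (hbd : ∀ s > 0, ∃ B, ∀ᶠ k in atTop, ∀ x ∈ I \ Z s, |h k x| ≤ B)
    {θ : ℝ → ℝ} (hθ : Tendsto θ (𝓝[>] 0) (𝓝 0))
    (hsmall : ∀ s > 0, ∀ᶠ k in atTop, ∫ x in I ∩ Z s, |h k x| ≤ θ s) :
    IntegrableOn g P ∧ Tendsto (fun k => ∫ x in I, h k x) atTop (𝓝 (∫ x in P, g x)) := by
  have hdisj : ∀ s > 0, P = (P ∩ Z s) ∪ (I \ Z s) := fun s hs => by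
    ext x
    constructor
    · intro hx
      by_cases hz : x ∈ Z s
      · exact Or.inl ⟨hx, hz⟩
      · exact Or.inr ⟨hPI hx, hz⟩
    · rintro (hx | hx)
      · exact hx.1
      · exact hZP s hs hx
  -- Fatou's lemma transfers the smallness near the complement of `P` from the sequence to `g`. It
  -- also yields the integrability of `g`, which is not assumed.
  have fatou : ∀ s > 0, ∫⁻ x in P ∩ Z s, ‖g x‖ₑ ≤ ENNReal.ofReal (θ s) := fun s hs => by
    have hsub : P ∩ Z s ⊆ I ∩ Z s := inter_subset_inter_left _ hPI
    calc ∫⁻ x in P ∩ Z s, ‖g x‖ₑ = ∫⁻ x in P ∩ Z s, liminf (fun k => ‖h k x‖ₑ) atTop := by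
          refine setLIntegral_congr_fun (hP.inter (hZm s)) fun x hx => ?_
          exact ((hlim x hx.1).enorm.liminf_eq).symm
      _ ≤ liminf (fun k => ∫⁻ x in P ∩ Z s, ‖h k x‖ₑ) atTop :=
          lintegral_liminf_le' fun k =>
            ((hint k).mono_set (hsub.trans inter_subset_left)).aestronglyMeasurable.enorm
      _ ≤ ENNReal.ofReal (θ s) := by
          refine liminf_le_of_frequently_le' (Eventually.frequently ?_)
          filter_upwards [hsmall s hs] with k hk
          refine (lintegral_mono_set hsub).trans ?_
          rw [← ofReal_integral_norm_eq_lintegral_enorm ((hint k).mono_set inter_subset_left)]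
          exact ENNReal.ofReal_le_ofReal hk
  have bdg : ∀ s > 0, ∃ B, ∀ x ∈ I \ Z s, |g x| ≤ B := fun s hs => by
    obtain ⟨B, hB⟩ := hbd s hs
    refine ⟨B, fun x hx => le_of_tendsto (hlim x (hZP s hs hx)).abs ?_⟩
    filter_upwards [hB] with k hk using hk x hx
  have hfin : ∀ s, volume (I \ Z s) < ⊤ := fun s =>
    (measure_mono sdiff_subset).trans_lt hIfin.lt_top
  have hgI : ∀ s > 0, IntegrableOn g (I \ Z s) := fun s hs => by
    obtain ⟨B, hB⟩ := bdg s hs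
    have : IsFiniteMeasure (volume.restrict (I \ Z s)) := ⟨by simpa using hfin s⟩
    exact Integrable.of_bound (hg.mono_set (hZP s hs)) B
      ((ae_restrict_mem (hI.diff (hZm s))).mono hB)
  have hgint : IntegrableOn g P := by
    rw [hdisj 1 one_pos]
    refine IntegrableOn.union ⟨hg.mono_set inter_subset_left, ?_⟩
      (hgI 1 one_pos)
    exact (fatou 1 one_pos).trans_lt ENNReal.ofReal_lt_top
  refine ⟨hgint, Metric.tendsto_nhds.2 fun e he => ?_⟩
  have hθe : ∀ᶠ s in 𝓝[>] (0 : ℝ), θ s < e / 3 ∧ 0 < s :=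
    (hθ.eventually (gt_mem_nhds (by positivity))).and self_mem_nhdsWithin
  obtain ⟨s, hs1, hs⟩ := hθe.exists
  have hconv : Tendsto (fun k => ∫ x in I \ Z s, h k x) atTop (𝓝 (∫ x in I \ Z s, g x)) := by
    obtain ⟨B, hB⟩ := hbd s hs
    refine tendsto_integral_filter_of_dominated_convergence (fun _ => B)
      (Eventually.of_forall fun k => ((hint k).mono_set sdiff_subset).aestronglyMeasurable) ?_
      (integrableOn_const (hfin s).ne) ?_
    · filter_upwards [hB] with k hk
      exact (ae_restrict_mem (hI.diff (hZm s))).mono hk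
    · exact (ae_restrict_mem (hI.diff (hZm s))).mono fun x hx => hlim x (hZP s hs hx)
  filter_upwards [hsmall s hs, Metric.tendsto_nhds.1 hconv (e / 3) (by positivity)] with k hk1 hk2
  have e1 : ∫ x in I, h k x = (∫ x in I ∩ Z s, h k x) + ∫ x in I \ Z s, h k x :=
    (integral_inter_add_sdiff (hZm s) (hint k)).symm
  have e2 : ∫ x in P, g x = (∫ x in P ∩ Z s, g x) + ∫ x in I \ Z s, g x := by
    conv_lhs => rw [hdisj s hs]
    refine setIntegral_union ?_ (hI.diff (hZm s)) (hgint.mono_set inter_subset_left) (hgI s hs)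
    exact Set.disjoint_left.2 fun x hx hx' => hx'.2 hx.2
  have e3 : |∫ x in I ∩ Z s, h k x| ≤ θ s := (abs_integral_le_integral_abs).trans hk1
  have hθ0 : 0 ≤ θ s := (integral_nonneg fun _ => abs_nonneg _).trans hk1
  have e4 : |∫ x in P ∩ Z s, g x| ≤ θ s := by
    have h1 := (enorm_integral_le_lintegral_enorm (μ := volume.restrict (P ∩ Z s)) g).trans (fatou s hs)
    rw [← ofReal_norm, ENNReal.ofReal_le_ofReal_iff hθ0] at h1
    exact h1
  rw [Real.dist_eq] at hk2 ⊢
  rw [e1, e2, show ∀ a b c d : ℝ, a + b - (c + d) = a + (b - d) - c from fun _ _ _ _ => by ring]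
  refine ((abs_sub _ _).trans (add_le_add (abs_add_le _ _) le_rfl)).trans_lt ?_
  linarith

/-! ### The limit profile -/

/-- The profiles `v k` converge uniformly to `w` in the open interval, and their dissipation tends
to zero. -/
structure SliceLimit (α β : ℝ) (v v₁ v₂ v₃ : ℕ → ℝ → ℝ) (w : ℝ → ℝ) : Prop where
  slice : ∀ k, Slice α β (v k) (v₁ k) (v₂ k) (v₃ k)
  dissip : Tendsto (fun k => dissip α β (v k) (v₃ k)) atTop (𝓝 0)
  unif : TendstoUniformlyOn v w atTop (Ioo α β)

/-- The integrand of the limit functional. -/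
noncomputable def limitDensity (w φ : ℝ → ℝ) (x : ℝ) : ℝ :=
  w x * deriv (deriv w) x ^ 2 * φ x - 5 / 6 * (deriv w x ^ 3 * deriv φ x) -
    1 / 2 * (w x * deriv w x ^ 2 * deriv (deriv φ) x)

/-- With `p` the quadratic, `q = p'` and `K = p''`, the density is the derivative of `p q K φ - p q²
φ' / 2 - q³ φ / 3`. Where `p` vanishes only the last term survives, and it is the cubic law. The
alternative hypotheses on `φ` serve end points of components on the boundary of the domain. -/
lemma integral_quadratic {W A K m a b : ℝ} (hab : a < b) {w φ : ℝ → ℝ} (hφ : ContDiff ℝ ∞ φ)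
    (hw : ∀ x ∈ Ioo a b, w x = W + A * (x - m) + K / 2 * (x - m) ^ 2)
    (hw₁ : ∀ x ∈ Ioo a b, deriv w x = A + K * (x - m))
    (hw₂ : ∀ x ∈ Ioo a b, deriv (deriv w) x = K)
    (ha : W + A * (a - m) + K / 2 * (a - m) ^ 2 = 0 ∨ (φ a = 0 ∧ deriv φ a = 0))
    (hb : W + A * (b - m) + K / 2 * (b - m) ^ 2 = 0 ∨ (φ b = 0 ∧ deriv φ b = 0)) :
    ∫ x in Ioo a b, limitDensity w φ x =
      1 / 3 * ((A + K * (a - m)) ^ 3 * φ a - (A + K * (b - m)) ^ 3 * φ b) := by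
  have hφ1 := (contDiff_infty_iff_deriv.1 hφ).2
  have hφ2 := (contDiff_infty_iff_deriv.1 hφ1).2
  have hd0 : ∀ x, HasDerivAt φ (deriv φ x) x := fun x =>
    (hφ.differentiable (by simp)).differentiableAt.hasDerivAt
  have hd1 : ∀ x, HasDerivAt (deriv φ) (deriv (deriv φ) x) x := fun x =>
    (hφ1.differentiable (by simp)).differentiableAt.hasDerivAt
  set q : ℝ → ℝ := fun x => A + K * (x - m) with hq
  set p : ℝ → ℝ := fun x => W + A * (x - m) + K / 2 * (x - m) ^ 2 with hp
  have hdq : ∀ x, HasDerivAt q K x := fun x => by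
    have h2 : HasDerivAt (fun y => y - m) 1 x := (hasDerivAt_id x).sub_const m
    exact ((h2.const_mul K).const_add A).congr_deriv (mul_one K)
  have hdp : ∀ x, HasDerivAt p (q x) x := fun x => by
    have h2 : HasDerivAt (fun y => y - m) 1 x := (hasDerivAt_id x).sub_const m
    refine (((h2.const_mul A).const_add W).add ((h2.pow 2).const_mul (K / 2))).congr_deriv ?_
    simp [hq]; ring
  have hF : ∀ x ∈ uIcc a b, HasDerivAt
      (fun x => p x * q x * K * φ x - 1 / 2 * (p x * q x ^ 2 * deriv φ x) - 1 / 3 * (q x ^ 3 * φ x))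
      (p x * K ^ 2 * φ x - 5 / 6 * (q x ^ 3 * deriv φ x) - 1 / 2 * (p x * q x ^ 2 * deriv (deriv φ) x))
      x := fun x _ => by
    refine ((((((hdp x).mul (hdq x)).mul_const K).mul (hd0 x)).sub
      ((((hdp x).mul ((hdq x).pow 2)).mul (hd1 x)).const_mul (1 / 2))).sub
      ((((hdq x).pow 3).mul (hd0 x)).const_mul (1 / 3))).congr_deriv ?_
    simp
    ring
  have hcp : Continuous p := by fun_prop
  have hcq : Continuous q := by fun_prop
  have ftc := intervalIntegral.integral_eq_sub_of_hasDerivAt hF (by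
    refine Continuous.intervalIntegrable ?_ _ _
    have := hφ.continuous
    have := hφ1.continuous
    have := hφ2.continuous
    fun_prop)
  rw [intervalIntegral.integral_of_le hab.le, integral_Ioc_eq_integral_Ioo] at ftc
  have e : ∫ x in Ioo a b, limitDensity w φ x = ∫ x in Ioo a b, (p x * K ^ 2 * φ x -
      5 / 6 * (q x ^ 3 * deriv φ x) - 1 / 2 * (p x * q x ^ 2 * deriv (deriv φ) x)) := by
    refine setIntegral_congr_fun measurableSet_Ioo fun x hx => ?_
    simp only [limitDensity, hw x hx, hw₁ x hx, hw₂ x hx, hp, hq]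
  rw [e, ftc]
  have ha' : p a * q a * K * φ a - 1 / 2 * (p a * q a ^ 2 * deriv φ a) = 0 := by
    rcases ha with h | ⟨h1, h2⟩
    · have : p a = 0 := h
      rw [this]; ring
    · rw [h1, h2]; ring
  have hb' : p b * q b * K * φ b - 1 / 2 * (p b * q b ^ 2 * deriv φ b) = 0 := by
    rcases hb with h | ⟨h1, h2⟩
    · have : p b = 0 := h
      rw [this]; ring
    · rw [h1, h2]; ring
  rw [ha', hb']
  simp only [hq]; ring

namespace SliceLimit

variable {α β : ℝ} {v v₁ v₂ v₃ : ℕ → ℝ → ℝ} {w : ℝ → ℝ}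

lemma comp (H : SliceLimit α β v v₁ v₂ v₃ w) {σ : ℕ → ℕ} (hσ : Tendsto σ atTop atTop) :
    SliceLimit α β (fun k => v (σ k)) (fun k => v₁ (σ k)) (fun k => v₂ (σ k))
      (fun k => v₃ (σ k)) w :=
  ⟨fun k => H.slice (σ k), H.dissip.comp hσ, fun s hs => hσ.eventually (H.unif s hs)⟩

lemma cont (H : SliceLimit α β v v₁ v₂ v₃ w) : ContinuousOn w (Ioo α β) :=
  H.unif.continuousOn (Eventually.of_forall fun k => (H.slice k).contIoo).frequently

lemma nonneg (H : SliceLimit α β v v₁ v₂ v₃ w) {x : ℝ} (hx : x ∈ Ioo α β) : 0 ≤ w x :=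
  ge_of_tendsto' (H.unif.tendsto_at hx) fun k => (H.slice k).nonneg x (Ioo_subset_Icc_self hx)

lemma isOpen (H : SliceLimit α β v v₁ v₂ v₃ w) : IsOpen (posSet α β w) := isOpen_posSet H.cont

lemma eq_zero (H : SliceLimit α β v v₁ v₂ v₃ w) {x : ℝ} (hx : x ∈ Ioo α β)
    (h : x ∉ posSet α β w) : w x = 0 :=
  le_antisymm (not_lt.1 fun h' => h ⟨hx, h'⟩) (H.nonneg hx)

lemma quadratic (H : SliceLimit α β v v₁ v₂ v₃ w) {c d : ℝ} (hcd : c < d)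
    (hs : Icc c d ⊆ posSet α β w) : ∃ A K : ℝ,
      (∀ x ∈ Ioo c d, w x = w c + A * (x - c) + K / 2 * (x - c) ^ 2) ∧
      (∀ x ∈ Ioo c d, HasDerivAt w (A + K * (x - c)) x ∧ deriv w x = A + K * (x - c)) ∧
      (∀ x ∈ Ioo c d, HasDerivAt (deriv w) K x ∧ deriv (deriv w) x = K) ∧
      TendstoUniformlyOn v₁ (deriv w) atTop (Ioo c d) ∧
      TendstoUniformlyOn (fun k => deriv (v₁ k)) (deriv (deriv w)) atTop (Ioo c d) := by
  obtain ⟨A, K, h1, h2, h3⟩ := exists_quadratic H.slice H.dissip hcd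
    (hs.trans (posSet_subset.trans Ioo_subset_Icc_self))
    (H.unif.mono (hs.trans posSet_subset)) fun x hx => (hs hx).2
  have hd : ∀ x ∈ Ioo c d, HasDerivAt w (A + K * (x - c)) x := fun x hx => by
    have h2 : HasDerivAt (fun y => y - c) 1 x := (hasDerivAt_id x).sub_const c
    have h4 : HasDerivAt (fun x => w c + A * (x - c) + K / 2 * (x - c) ^ 2) (A + K * (x - c)) x := by
      refine (((h2.const_mul A).const_add (w c)).add ((h2.pow 2).const_mul (K / 2))).congr_deriv ?_
      simp; ring
    refine h4.congr_of_eventuallyEq ?_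
    filter_upwards [isOpen_Ioo.mem_nhds hx] with y hy using h1 y (Ioo_subset_Icc_self hy)
  have hd2 : ∀ x ∈ Ioo c d, HasDerivAt (deriv w) K x := fun x hx => by
    have h2 : HasDerivAt (fun y => y - c) 1 x := (hasDerivAt_id x).sub_const c
    have h4 : HasDerivAt (fun x => A + K * (x - c)) K x := by
      simpa using (h2.const_mul K).const_add A
    refine h4.congr_of_eventuallyEq ?_
    filter_upwards [isOpen_Ioo.mem_nhds hx] with y hy using (hd y hy).deriv
  refine ⟨A, K, fun x hx => h1 x (Ioo_subset_Icc_self hx), fun x hx => ⟨hd x hx, (hd x hx).deriv⟩,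
    fun x hx => ⟨hd2 x hx, (hd2 x hx).deriv⟩, ?_, ?_⟩
  · exact (h2.mono Ioo_subset_Icc_self).congr_right fun x hx => (hd x hx).deriv.symm
  · exact h3.congr_right fun x hx => (hd2 x hx).deriv.symm

lemma exists_Icc (H : SliceLimit α β v v₁ v₂ v₃ w) {x : ℝ} (hx : x ∈ posSet α β w) :
    ∃ c d, x ∈ Ioo c d ∧ Icc c d ⊆ posSet α β w := by
  obtain ⟨δ, hδ, hs⟩ := Metric.isOpen_iff.1 H.isOpen x hx
  rw [Real.ball_eq_Ioo] at hs
  exact ⟨x - δ / 2, x + δ / 2, ⟨by linarith, by linarith⟩,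
    (Icc_subset_Ioo (by linarith) (by linarith)).trans hs⟩

lemma hasDerivAt (H : SliceLimit α β v v₁ v₂ v₃ w) {x : ℝ} (hx : x ∈ posSet α β w) :
    HasDerivAt w (deriv w x) x ∧ HasDerivAt (deriv w) (deriv (deriv w) x) x ∧
      ContinuousAt (deriv (deriv w)) x := by
  obtain ⟨c, d, hxc, hs⟩ := H.exists_Icc hx
  obtain ⟨A, K, -, h1, h2, -⟩ := H.quadratic (hxc.1.trans hxc.2) hs
  refine ⟨(h1 x hxc).1.differentiableAt.hasDerivAt, (h2 x hxc).1.differentiableAt.hasDerivAt, ?_⟩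
  refine continuousAt_const.congr (f := fun _ => K) ?_
  filter_upwards [isOpen_Ioo.mem_nhds hxc] with y hy using (h2 y hy).2.symm

lemma contOn₁ (H : SliceLimit α β v v₁ v₂ v₃ w) : ContinuousOn (deriv w) (posSet α β w) :=
  fun _ hx => (H.hasDerivAt hx).2.1.continuousAt.continuousWithinAt

lemma contOn₂ (H : SliceLimit α β v v₁ v₂ v₃ w) : ContinuousOn (deriv (deriv w)) (posSet α β w) :=
  fun _ hx => (H.hasDerivAt hx).2.2.continuousWithinAt

lemma locUnif₁ (H : SliceLimit α β v v₁ v₂ v₃ w) :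
    TendstoLocallyUniformlyOn v₁ (deriv w) atTop (posSet α β w) := by
  intro s hs x hx
  obtain ⟨c, d, hxc, hsub⟩ := H.exists_Icc hx
  obtain ⟨A, K, -, -, -, h, -⟩ := H.quadratic (hxc.1.trans hxc.2) hsub
  exact ⟨Ioo c d, mem_nhdsWithin_of_mem_nhds (isOpen_Ioo.mem_nhds hxc), h s hs⟩

lemma tendsto₁ (H : SliceLimit α β v v₁ v₂ v₃ w) {x : ℝ} (hx : x ∈ posSet α β w) :
    Tendsto (fun k => v₁ k x) atTop (𝓝 (deriv w x)) :=
  H.locUnif₁.tendsto_at hx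

lemma tendsto₂ (H : SliceLimit α β v v₁ v₂ v₃ w) {x : ℝ} (hx : x ∈ posSet α β w) :
    Tendsto (fun k => deriv (v₁ k) x) atTop (𝓝 (deriv (deriv w) x)) := by
  obtain ⟨c, d, hxc, hs⟩ := H.exists_Icc hx
  obtain ⟨A, K, -, -, -, -, h⟩ := H.quadratic (hxc.1.trans hxc.2) hs
  exact h.tendsto_at hxc

/-- Any point and `m` lie in a common compact subinterval, and expanding around `m` makes the
coefficients independent of that subinterval. So a single polynomial serves a whole component. -/
lemma quadratic_of_Ioo_subset (H : SliceLimit α β v v₁ v₂ v₃ w) {a b m : ℝ}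
    (hs : Ioo a b ⊆ posSet α β w) (hm : m ∈ Ioo a b) : ∀ x ∈ Ioo a b,
      w x = w m + deriv w m * (x - m) + deriv (deriv w) m / 2 * (x - m) ^ 2 ∧
      deriv w x = deriv w m + deriv (deriv w) m * (x - m) ∧
      deriv (deriv w) x = deriv (deriv w) m := by
  intro x hx
  obtain ⟨c, hc1, hc2⟩ := exists_between (lt_min hm.1 hx.1)
  obtain ⟨d, hd1, hd2⟩ := exists_between (max_lt hm.2 hx.2)
  have hmc : m ∈ Ioo c d := ⟨hc2.trans_le (min_le_left _ _), (le_max_left _ _).trans_lt hd1⟩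
  have hxc : x ∈ Ioo c d := ⟨hc2.trans_le (min_le_right _ _), (le_max_right _ _).trans_lt hd1⟩
  obtain ⟨A, K, h0, h1, h2, -⟩ := H.quadratic (hmc.1.trans hmc.2)
    ((Icc_subset_Ioo hc1 hd2).trans hs)
  rw [h0 x hxc, h0 m hmc, (h1 x hxc).2, (h1 m hmc).2, (h2 x hxc).2, (h2 m hmc).2]
  exact ⟨by ring, by ring, rfl⟩

end SliceLimit

/-! ### Passage to the limit in the three terms of the source -/

namespace SliceLimit

variable {α β : ℝ} {v v₁ v₂ v₃ : ℕ → ℝ → ℝ} {w : ℝ → ℝ}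

lemma isOpen_sublevel (H : SliceLimit α β v v₁ v₂ v₃ w) (s : ℝ) :
    IsOpen {x ∈ Ioo α β | w x < s} :=
  H.cont.isOpen_inter_preimage isOpen_Ioo isOpen_Iio

lemma diff_sublevel_subset {s : ℝ} (hs : 0 < s) :
    Ioo α β \ {x ∈ Ioo α β | w x < s} ⊆ posSet α β w := fun _ hx =>
  ⟨hx.1, hs.trans_le (not_lt.1 fun h => hx.2 ⟨hx.1, h⟩)⟩

lemma eventually_le_on_sublevel (H : SliceLimit α β v v₁ v₂ v₃ w) {s : ℝ} (hs : 0 < s) :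
    ∀ᶠ k in atTop, ∀ x ∈ Ioo α β ∩ {x ∈ Ioo α β | w x < s}, v k x ≤ 2 * s := by
  filter_upwards [Metric.tendstoUniformlyOn_iff.1 H.unif s hs] with k hk x hx
  have h1 := (abs_lt.1 (hk x hx.1)).1
  linarith [hx.2.2]

/-- Away from the zero set of the limit, and in a compact set, the first derivatives are bounded. -/
lemma exists_bound₁ (H : SliceLimit α β v v₁ v₂ v₃ w) {K : Set ℝ} (hK : IsCompact K)
    (hKs : K ⊆ Ioo α β) {s : ℝ} (hs : 0 < s) :
    ∃ B, 0 ≤ B ∧ ∀ᶠ k in atTop, ∀ x ∈ (Ioo α β \ {x ∈ Ioo α β | w x < s}) ∩ K, |v₁ k x| ≤ B := by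
  set L := K ∩ w ⁻¹' Ici s
  have hL : IsCompact L :=
    hK.of_isClosed_subset ((H.cont.mono hKs).preimage_isClosed_of_isClosed hK.isClosed isClosed_Ici)
      inter_subset_left
  have hLP : L ⊆ posSet α β w := fun x hx => ⟨hKs hx.1, hs.trans_le hx.2⟩
  obtain ⟨B, hB⟩ := hL.exists_bound_of_continuousOn (H.contOn₁.mono hLP)
  have hu := (tendstoLocallyUniformlyOn_iff_forall_isCompact H.isOpen).1 H.locUnif₁ L hLP hL
  refine ⟨|B| + 1, by positivity, ?_⟩
  filter_upwards [Metric.tendstoUniformlyOn_iff.1 hu 1 one_pos] with k hk x hx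
  have hxL : x ∈ L := ⟨hx.2, not_lt.1 fun h => hx.1.2 ⟨hx.1.1, h⟩⟩
  have h1 := hk x hxL
  have h2 := hB x hxL
  rw [Real.dist_eq] at h1
  rw [Real.norm_eq_abs] at h2
  have h3 : |v₁ k x| ≤ |deriv w x| + |deriv w x - v₁ k x| := by
    have := abs_sub_abs_le_abs_sub (v₁ k x) (deriv w x)
    rw [abs_sub_comm] at this
    linarith
  linarith [le_abs_self B]

/-- Away from `{w < s}` the slopes converge and are bounded on the support of `η`. On `{w < s}`
eventually `v k ≤ 2 s`, and the interpolation estimate bounds the contribution by a multiple of `√s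
+ s`. Only the weighted bound on `v v₂² η²` is needed. -/
lemma tendsto_cube (H : SliceLimit α β v v₁ v₂ v₃ w) (hαβ : α < β) {η : ℝ → ℝ}
    (hη : IsTest (Ioo α β) η) (hη0 : ∀ x, 0 ≤ η x) {E X : ℝ}
    (hE : ∀ k, ∫ x in Ioo α β, v₁ k x ^ 2 ≤ E)
    (hX : ∀ k, ∫ x in Ioo α β, v k x * v₂ k x ^ 2 * η x ^ 2 ≤ X) {g : ℝ → ℝ} (hg : Continuous g)
    {C : ℝ} (hC : 0 ≤ C) (hgη : ∀ x, |g x| ≤ C * η x) :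
    IntegrableOn (fun x => deriv w x ^ 3 * g x) (posSet α β w) ∧
    Tendsto (fun k => ∫ x in Ioo α β, v₁ k x ^ 3 * g x) atTop
      (𝓝 (∫ x in posSet α β w, deriv w x ^ 3 * g x)) := by
  obtain ⟨L, hL0, hL⟩ := exists_deriv_bounds α β hη.1
  have hcont : ∀ k, ContinuousOn (fun x => v₁ k x ^ 3 * g x) (Icc α β) := fun k =>
    ((H.slice k).cont₁.pow 3).mul hg.continuousOn
  refine tendsto_setIntegral_of_small (Z := fun s => {x ∈ Ioo α β | w x < s})
    (θ := fun s => C * (2 * √(2 * s) * (X + E) + 4 * (2 * s) * (L * E))) measurableSet_Ioo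
    H.isOpen.measurableSet (by simp) posSet_subset (fun s => (H.isOpen_sublevel s).measurableSet)
    (fun s hs => diff_sublevel_subset hs)
    (fun k => Slice.integrable_of_continuousOn (hcont k)) ?_ ?_ ?_ ?_ ?_
  · exact ((H.contOn₁.pow 3).mul hg.continuousOn).aestronglyMeasurable H.isOpen.measurableSet
  · exact fun x hx => ((H.tendsto₁ hx).pow 3).mul_const _
  · intro s hs
    obtain ⟨B, hB0, hB⟩ := H.exists_bound₁ hη.2.1 hη.2.2 hs
    refine ⟨B ^ 3 * (C * L), ?_⟩
    filter_upwards [hB] with k hk x hx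
    by_cases hxη : x ∈ tsupport η
    · rw [abs_mul, abs_pow]
      have := hk x ⟨hx, hxη⟩
      have h2 : |g x| ≤ C * L := (hgη x).trans (by
        gcongr; exact (le_abs_self _).trans (hL x (Ioo_subset_Icc_self hx.1)).1)
      gcongr
    · have : g x = 0 := by
        have := hgη x
        rw [image_eq_zero_of_notMem_tsupport hxη, mul_zero] at this
        exact abs_nonpos_iff.1 this
      rw [this, mul_zero, abs_zero]
      positivity
  · have : Continuous fun s : ℝ => C * (2 * √(2 * s) * (X + E) + 4 * (2 * s) * (L * E)) := by
      fun_prop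
    have h0 := this.tendsto 0
    simp only [mul_zero, Real.sqrt_zero, zero_mul, add_zero] at h0
    exact h0.mono_left nhdsWithin_le_nhds
  · intro s hs
    filter_upwards [H.eventually_le_on_sublevel hs] with k hk
    have hm : MeasurableSet (Ioo α β ∩ {x ∈ Ioo α β | w x < s}) :=
      measurableSet_Ioo.inter (H.isOpen_sublevel s).measurableSet
    have h1 := (H.slice k).setIntegral_cube_le hαβ hη.1 hη0 (fun x hx => (hL x hx).2.1)
      (show 0 < 2 * s by linarith) one_pos (hE k) hm inter_subset_left hk
    calc ∫ x in Ioo α β ∩ {x ∈ Ioo α β | w x < s}, |v₁ k x ^ 3 * g x|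
        ≤ ∫ x in Ioo α β ∩ {x ∈ Ioo α β | w x < s}, C * (|v₁ k x| ^ 3 * η x) := by
          refine setIntegral_mono_on ?_ ?_ hm fun x hx => ?_
          · exact (Slice.integrable_of_continuousOn (hcont k).abs).mono_set inter_subset_left
          · exact ((Slice.integrable_of_continuousOn (((H.slice k).cont₁.abs.pow 3).mul
              hη.continuous.continuousOn)).mono_set inter_subset_left).const_mul C
          · rw [abs_mul, abs_pow]
            have := hgη x
            calc _ ≤ |v₁ k x| ^ 3 * (C * η x) := by gcongr
              _ = _ := by ring
      _ ≤ _ := by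
          rw [integral_const_mul]
          refine mul_le_mul_of_nonneg_left (h1.trans ?_) hC
          have := hX k
          rw [one_mul, div_one]
          gcongr

/-- Near the zero set the factor `v k ≤ 2 s` suffices, in combination with the energy bound. No
information on second derivatives enters the smallness. -/
lemma tendsto_sq (H : SliceLimit α β v v₁ v₂ v₃ w) {K : Set ℝ} (hK : IsCompact K)
    (hKs : K ⊆ Ioo α β) {E : ℝ} (hE : ∀ k, ∫ x in Ioo α β, v₁ k x ^ 2 ≤ E) {M : ℝ}
    (hM : ∀ k, ∀ x ∈ Icc α β, v k x ≤ M) {g : ℝ → ℝ} (hg : Continuous g)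
    (hgK : ∀ x ∉ K, g x = 0) :
    IntegrableOn (fun x => w x * deriv w x ^ 2 * g x) (posSet α β w) ∧
    Tendsto (fun k => ∫ x in Ioo α β, v k x * v₁ k x ^ 2 * g x) atTop
      (𝓝 (∫ x in posSet α β w, w x * deriv w x ^ 2 * g x)) := by
  obtain ⟨L, hL⟩ := isCompact_Icc.exists_bound_of_continuousOn (s := Icc α β) hg.continuousOn
  simp only [Real.norm_eq_abs] at hL
  have hcont : ∀ k, ContinuousOn (fun x => v k x * v₁ k x ^ 2 * g x) (Icc α β) := fun k =>
    ((H.slice k).cont.mul ((H.slice k).cont₁.pow 2)).mul hg.continuousOn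
  refine tendsto_setIntegral_of_small (Z := fun s => {x ∈ Ioo α β | w x < s})
    (θ := fun s => 2 * s * |L| * E) measurableSet_Ioo
    H.isOpen.measurableSet (by simp) posSet_subset (fun s => (H.isOpen_sublevel s).measurableSet)
    (fun s hs => diff_sublevel_subset hs)
    (fun k => Slice.integrable_of_continuousOn (hcont k)) ?_ ?_ ?_ ?_ ?_
  · exact (((H.cont.mono posSet_subset).mul (H.contOn₁.pow 2)).mul
      hg.continuousOn).aestronglyMeasurable H.isOpen.measurableSet
  · exact fun x hx => ((H.unif.tendsto_at hx.1).mul ((H.tendsto₁ hx).pow 2)).mul_const _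
  · intro s hs
    obtain ⟨B, hB0, hB⟩ := H.exists_bound₁ hK hKs hs
    refine ⟨|M| * B ^ 2 * |L|, ?_⟩
    filter_upwards [hB] with k hk x hx
    by_cases hxη : x ∈ K
    · have hx' := Ioo_subset_Icc_self hx.1
      rw [abs_mul, abs_mul, abs_pow, abs_of_nonneg ((H.slice k).nonneg x hx')]
      have := hk x ⟨hx, hxη⟩
      have h2 := (hL x hx').trans (le_abs_self L)
      have h3 := (hM k x hx').trans (le_abs_self M)
      gcongr
    · rw [hgK x hxη, mul_zero, abs_zero]
      positivity
  · have : Continuous fun s : ℝ => 2 * s * |L| * E := by fun_prop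
    have h0 := this.tendsto 0
    simp only [mul_zero, zero_mul] at h0
    exact h0.mono_left nhdsWithin_le_nhds
  · intro s hs
    filter_upwards [H.eventually_le_on_sublevel hs] with k hk
    have hm : MeasurableSet (Ioo α β ∩ {x ∈ Ioo α β | w x < s}) :=
      measurableSet_Ioo.inter (H.isOpen_sublevel s).measurableSet
    have iv : IntegrableOn (fun x => v₁ k x ^ 2) (Ioo α β) :=
      Slice.integrable_of_continuousOn ((H.slice k).cont₁.pow 2)
    calc ∫ x in Ioo α β ∩ {x ∈ Ioo α β | w x < s}, |v k x * v₁ k x ^ 2 * g x|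
        ≤ ∫ x in Ioo α β ∩ {x ∈ Ioo α β | w x < s}, 2 * s * |L| * v₁ k x ^ 2 := by
          refine setIntegral_mono_on
            ((Slice.integrable_of_continuousOn (hcont k).abs).mono_set inter_subset_left)
            ((iv.mono_set inter_subset_left).const_mul _) hm fun x hx => ?_
          have hx' := Ioo_subset_Icc_self hx.1
          have h0 := (H.slice k).nonneg x hx'
          rw [abs_mul, abs_of_nonneg (a := v k x * v₁ k x ^ 2) (by positivity)]
          have h2 := (hL x hx').trans (le_abs_self L)
          have h3 := hk x hx
          calc _ ≤ 2 * s * v₁ k x ^ 2 * |L| := by gcongr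
            _ = _ := by ring
      _ ≤ 2 * s * |L| * ∫ x in Ioo α β, v₁ k x ^ 2 := by
          rw [integral_const_mul]
          refine mul_le_mul_of_nonneg_left (setIntegral_mono_set iv ?_
            inter_subset_left.eventuallyLE) (by positivity)
          exact Eventually.of_forall fun x => by simp only [Pi.zero_apply]; positivity
      _ ≤ _ := by
          have := hE k
          gcongr

/-- Lower semicontinuity of the second order term. -/
lemma liminf_energy (H : SliceLimit α β v v₁ v₂ v₃ w) {φ : ℝ → ℝ} (hφ : Continuous φ)
    (hφ0 : ∀ x ∈ Ioo α β, 0 ≤ φ x) {X : ℝ}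
    (hX : ∃ᶠ k in atTop, ∫ x in Ioo α β, v k x * v₂ k x ^ 2 * φ x ≤ X) :
    IntegrableOn (fun x => w x * deriv (deriv w) x ^ 2 * φ x) (posSet α β w) ∧
    ∀ e > 0, ∀ᶠ k in atTop, (∫ x in posSet α β w, w x * deriv (deriv w) x ^ 2 * φ x) - e ≤
      ∫ x in Ioo α β, v k x * v₂ k x ^ 2 * φ x := by
  set P := posSet α β w
  have hPm : MeasurableSet P := H.isOpen.measurableSet
  have hint : ∀ k, IntegrableOn (fun x => v k x * v₂ k x ^ 2 * φ x) (Ioo α β) := fun k =>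
    (H.slice k).integrable_mul_sq hφ.continuousOn
  have hnn : ∀ k, ∀ x ∈ Ioo α β, 0 ≤ v k x * v₂ k x ^ 2 * φ x := fun k x hx =>
    mul_nonneg (mul_nonneg ((H.slice k).nonneg x (Ioo_subset_Icc_self hx)) (sq_nonneg _)) (hφ0 x hx)
  have hlim : ∀ᵐ x ∂volume.restrict P, Tendsto (fun k => v k x * v₂ k x ^ 2 * φ x) atTop
      (𝓝 (w x * deriv (deriv w) x ^ 2 * φ x)) := by
    have h1 : ∀ᵐ x ∂volume.restrict P, ∀ k, v k x * deriv (v₁ k) x = v k x * v₂ k x :=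
      ae_restrict_of_ae_restrict_of_subset posSet_subset
        (ae_all_iff.2 fun k => (H.slice k).mul_deriv_ae)
    filter_upwards [h1, ae_restrict_mem hPm] with x hx hxP
    have h2 := ((H.unif.tendsto_at hxP.1).mul ((H.tendsto₂ hxP).pow 2)).mul_const (φ x)
    have h3 : ∀ᶠ k in atTop, 0 < v k x :=
      (H.unif.tendsto_at hxP.1).eventually (lt_mem_nhds hxP.2)
    refine h2.congr' ?_
    filter_upwards [h3] with k hk
    rw [mul_left_cancel₀ hk.ne' (hx k)]
  have hle : ∫⁻ x in P, ENNReal.ofReal (w x * deriv (deriv w) x ^ 2 * φ x) ≤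
      liminf (fun k => ENNReal.ofReal (∫ x in Ioo α β, v k x * v₂ k x ^ 2 * φ x)) atTop := by
    calc _ = ∫⁻ x in P, liminf (fun k => ENNReal.ofReal (v k x * v₂ k x ^ 2 * φ x)) atTop :=
          lintegral_congr_ae (hlim.mono fun x hx => (ENNReal.tendsto_ofReal hx).liminf_eq.symm)
      _ ≤ liminf (fun k => ∫⁻ x in P, ENNReal.ofReal (v k x * v₂ k x ^ 2 * φ x)) atTop :=
          lintegral_liminf_le' fun k =>
            ((hint k).mono_set posSet_subset).aestronglyMeasurable.aemeasurable.ennreal_ofReal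
      _ ≤ _ := by
          refine liminf_le_liminf (Eventually.of_forall fun k => ?_)
          rw [ofReal_integral_eq_lintegral_ofReal (hint k)
            ((ae_restrict_mem measurableSet_Ioo).mono (hnn k))]
          exact lintegral_mono_set posSet_subset
  have hwnn : ∀ x ∈ P, 0 ≤ w x * deriv (deriv w) x ^ 2 * φ x := fun x hx =>
    mul_nonneg (mul_nonneg hx.2.le (sq_nonneg _)) (hφ0 x hx.1)
  have hmeas : AEStronglyMeasurable (fun x => w x * deriv (deriv w) x ^ 2 * φ x)
      (volume.restrict P) :=
    (((H.cont.mono posSet_subset).mul (H.contOn₂.pow 2)).mul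
      hφ.continuousOn).aestronglyMeasurable hPm
  have hwint : IntegrableOn (fun x => w x * deriv (deriv w) x ^ 2 * φ x) P := by
    refine ⟨hmeas, ?_⟩
    rw [hasFiniteIntegral_iff_ofReal ((ae_restrict_mem hPm).mono hwnn)]
    refine hle.trans_lt (lt_of_le_of_lt ?_ (ENNReal.ofReal_lt_top (r := X)))
    refine liminf_le_of_frequently_le' (hX.mono fun k hk => ENNReal.ofReal_le_ofReal hk)
  refine ⟨hwint, fun e he => ?_⟩
  rw [← ofReal_integral_eq_lintegral_ofReal hwint ((ae_restrict_mem hPm).mono hwnn)] at hle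
  set J := ∫ x in P, w x * deriv (deriv w) x ^ 2 * φ x
  have hJ : 0 ≤ J := setIntegral_nonneg hPm hwnn
  rcases hJ.eq_or_lt with h0 | h0
  · refine Eventually.of_forall fun k => ?_
    have := setIntegral_nonneg (μ := volume) measurableSet_Ioo (hnn k)
    linarith
  · have h1 : ENNReal.ofReal (J - e) < ENNReal.ofReal J :=
      (ENNReal.ofReal_lt_ofReal_iff h0).2 (by linarith)
    filter_upwards [eventually_lt_of_lt_liminf (h1.trans_le hle)] with k hk
    by_contra hc
    exact absurd (ENNReal.ofReal_le_ofReal (not_le.1 hc).le) (not_le.2 hk)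

end SliceLimit

lemma IsTest.sq {U : Set ℝ} {η : ℝ → ℝ} (hη : IsTest U η) : IsTest U fun x => η x ^ 2 := by
  refine ⟨hη.1.pow 2, hη.2.1.comp_left (g := fun y => y ^ 2) (by simp), ?_⟩
  have : Function.support (fun x => η x ^ 2) ⊆ Function.support η := fun x hx => by
    simp only [Function.mem_support] at hx ⊢
    exact fun h => hx (by simp [h])
  exact (closure_mono this).trans hη.2.2

/-! ### Semicontinuity of the source and slopes at the end points of components -/

namespace SliceLimit

variable {α β : ℝ} {v v₁ v₂ v₃ : ℕ → ℝ → ℝ} {w : ℝ → ℝ}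

/-- Lower semicontinuity of `Tfun` tested against a square. -/
lemma liminf_Tfun (H : SliceLimit α β v v₁ v₂ v₃ w) (hαβ : α < β) {η : ℝ → ℝ}
    (hη : IsTest (Ioo α β) η) (hη0 : ∀ x, 0 ≤ η x) {E M T : ℝ} (hM0 : 0 < M) (hE0 : 0 ≤ E)
    (hE : ∀ k, ∫ x in Ioo α β, v₁ k x ^ 2 ≤ E) (hM : ∀ k, ∀ x ∈ Icc α β, v k x ≤ M)
    (hT : ∀ k, Tfun α β (v k) (v₁ k) (v₂ k) (fun x => η x ^ 2) ≤ T) :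
    IntegrableOn (limitDensity w fun x => η x ^ 2) (posSet α β w) ∧
    ∀ e > 0, ∀ᶠ k in atTop, (∫ x in posSet α β w, limitDensity w (fun x => η x ^ 2) x) - e ≤
      Tfun α β (v k) (v₁ k) (v₂ k) fun x => η x ^ 2 := by
  obtain ⟨K, hK0, hK⟩ := exists_le_Tfun_sq hαβ hM0 hE0 hη.1 hη0
  -- An upper bound on the source already bounds the weighted second order term, because the other
  -- terms are absorbed when testing with squares.
  have hX : ∀ k, ∫ x in Ioo α β, v k x * v₂ k x ^ 2 * η x ^ 2 ≤ 2 * (T + K) := fun k => by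
    have := hK _ _ _ _ (H.slice k) (hM k) (hE k)
    linarith [hT k]
  obtain ⟨C, hC⟩ := hη.deriv.2.1.exists_bound_of_continuous hη.deriv.continuous
  have hC0 : 0 ≤ C := (norm_nonneg _).trans (hC 0)
  have h2 := hη.sq
  obtain ⟨i2, t2⟩ := H.tendsto_cube hαβ hη hη0 hE hX h2.deriv.continuous (C := 2 * C)
    (by positivity) (fun x => by
      rw [deriv_sq hη.1, abs_mul, abs_mul, abs_two, abs_of_nonneg (hη0 x)]
      have := hC x
      rw [Real.norm_eq_abs] at this
      nlinarith [hη0 x])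
  obtain ⟨i3, t3⟩ := H.tendsto_sq h2.2.1 h2.2.2 hE hM h2.deriv.deriv.continuous fun x hx => by
    refine image_eq_zero_of_notMem_tsupport fun h => hx ?_
    exact tsupport_deriv_subset (𝕜 := ℝ) (tsupport_deriv_subset (𝕜 := ℝ) h)
  obtain ⟨i1, l1⟩ := H.liminf_energy (φ := fun x => η x ^ 2) h2.continuous
    (fun x _ => sq_nonneg _) (Eventually.of_forall hX).frequently
  have hi : IntegrableOn (limitDensity w fun x => η x ^ 2) (posSet α β w) :=
    (i1.sub (i2.const_mul (5 / 6))).sub (i3.const_mul (1 / 2))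
  refine ⟨hi, fun e he => ?_⟩
  have e1 : ∫ x in posSet α β w, limitDensity w (fun x => η x ^ 2) x =
      (∫ x in posSet α β w, w x * deriv (deriv w) x ^ 2 * η x ^ 2) -
      5 / 6 * (∫ x in posSet α β w, deriv w x ^ 3 * deriv (fun x => η x ^ 2) x) -
      1 / 2 * (∫ x in posSet α β w, w x * deriv w x ^ 2 * deriv (deriv fun x => η x ^ 2) x) := by
    unfold limitDensity
    have j2 := i2.const_mul (5 / 6)
    have j3 := i3.const_mul (1 / 2)
    have j12 : IntegrableOn (fun x => w x * deriv (deriv w) x ^ 2 * η x ^ 2 -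
      5 / 6 * (deriv w x ^ 3 * deriv (fun x => η x ^ 2) x)) (posSet α β w) := i1.sub j2
    rw [integral_sub j12 j3, integral_sub i1 j2, integral_const_mul, integral_const_mul]
  filter_upwards [l1 (e / 3) (by positivity), Metric.tendsto_nhds.1 t2 (e / 3) (by positivity),
    Metric.tendsto_nhds.1 t3 (e / 3) (by positivity)] with k hk1 hk2 hk3
  rw [Real.dist_eq] at hk2 hk3
  rw [e1, Tfun]
  have := (abs_lt.1 hk2).2
  have := (abs_lt.1 hk3).2
  linarith

/-- The slope at the end points of a component of the positivity set, extended linearly. -/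
noncomputable def _root_.TannerLaw.compSlope (w : ℝ → ℝ) (a b x : ℝ) : ℝ :=
  deriv w ((a + b) / 2) + deriv (deriv w) ((a + b) / 2) * (x - (a + b) / 2)

/-- The quadratic polynomial that agrees with the limit in a component. -/
noncomputable def _root_.TannerLaw.compPoly (w : ℝ → ℝ) (a b x : ℝ) : ℝ :=
  w ((a + b) / 2) + deriv w ((a + b) / 2) * (x - (a + b) / 2) +
    deriv (deriv w) ((a + b) / 2) / 2 * (x - (a + b) / 2) ^ 2

lemma eqOn_comp (H : SliceLimit α β v v₁ v₂ v₃ w) {a b : ℝ} (hc : IsComp (posSet α β w) a b) :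
    ∀ x ∈ Ioo a b, w x = compPoly w a b x ∧ deriv w x = compSlope w a b x ∧
      deriv (deriv w) x = deriv (deriv w) ((a + b) / 2) :=
  H.quadratic_of_Ioo_subset hc.subset ⟨by linarith [hc.lt], by linarith [hc.lt]⟩

lemma _root_.TannerLaw.continuous_compPoly (w : ℝ → ℝ) (a b : ℝ) : Continuous (compPoly w a b) := by
  unfold compPoly; fun_prop

lemma _root_.TannerLaw.compPoly_eq (w : ℝ → ℝ) (a b x y : ℝ) : compPoly w a b x =
    compPoly w a b y + compSlope w a b y * (x - y) +
      deriv (deriv w) ((a + b) / 2) / 2 * (x - y) ^ 2 := by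
  unfold compPoly compSlope; ring

lemma _root_.TannerLaw.IsComp.mem_closure {P : Set ℝ} {a b : ℝ} (hc : IsComp P a b) {y : ℝ}
    (hy : y ∈ Icc a b) : y ∈ closure (Ioo a b) := by
  rwa [closure_Ioo hc.lt.ne]

lemma compPoly_eq_of_continuousWithinAt (H : SliceLimit α β v v₁ v₂ v₃ w) {a b : ℝ}
    (hc : IsComp (posSet α β w) a b) {y : ℝ} (hy : y ∈ Icc a b)
    (hw : ContinuousWithinAt w (Ioo a b) y) : compPoly w a b y = w y := by
  have : (𝓝[Ioo a b] y).NeBot := mem_closure_iff_nhdsWithin_neBot.1 (hc.mem_closure hy)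
  refine tendsto_nhds_unique ((continuous_compPoly w a b).continuousWithinAt (s := Ioo a b)) ?_
  refine hw.tendsto.congr' ?_
  filter_upwards [self_mem_nhdsWithin] with x hx using (H.eqOn_comp hc x hx).1

lemma _root_.TannerLaw.IsComp.Icc_subset {w : ℝ → ℝ} {a b : ℝ}
    (hc : IsComp (posSet α β w) a b) : α ≤ a ∧ b ≤ β := by
  constructor
  · by_contra! h
    obtain ⟨y, h1, h2⟩ := exists_between (lt_min h hc.lt)
    exact absurd (hc.subset ⟨h1, h2.trans_le (min_le_right _ _)⟩).1.1
      (h2.trans_le (min_le_left _ _)).not_gt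
  · by_contra! h
    obtain ⟨y, h1, h2⟩ := exists_between (max_lt h hc.lt)
    exact absurd (hc.subset ⟨(le_max_right _ _).trans_lt h1, h2⟩).1.2
      ((le_max_left _ _).trans_lt h1).not_gt

/-- Positivity of `w` to the right of `a` gives positivity of the quotient `w / (x - a)`, which
tends to the slope at `a`. -/
lemma compPoly_left (H : SliceLimit α β v v₁ v₂ v₃ w) {a b : ℝ} (hc : IsComp (posSet α β w) a b)
    (ha : a ∈ Ioo α β) : compPoly w a b a = 0 ∧ 0 ≤ compSlope w a b a := by
  have h0 : compPoly w a b a = 0 := by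
    rw [H.compPoly_eq_of_continuousWithinAt hc (left_mem_Icc.2 hc.lt.le)
      (H.cont.continuousAt (isOpen_Ioo.mem_nhds ha)).continuousWithinAt]
    exact H.eq_zero ha hc.left
  refine ⟨h0, ?_⟩
  have ht : Tendsto (fun x => compSlope w a b a + deriv (deriv w) ((a + b) / 2) / 2 * (x - a))
      (𝓝[>] a) (𝓝 (compSlope w a b a)) := by
    have : Continuous fun x =>
        compSlope w a b a + deriv (deriv w) ((a + b) / 2) / 2 * (x - a) := by fun_prop
    simpa using (this.tendsto a).mono_left nhdsWithin_le_nhds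
  refine ge_of_tendsto ht ?_
  filter_upwards [Ioo_mem_nhdsGT hc.lt] with x hx
  have h1 := (hc.subset hx).2
  rw [(H.eqOn_comp hc x hx).1, compPoly_eq w a b x a, h0] at h1
  by_contra! h
  nlinarith [hx.1]

lemma compPoly_right (H : SliceLimit α β v v₁ v₂ v₃ w) {a b : ℝ} (hc : IsComp (posSet α β w) a b)
    (hb : b ∈ Ioo α β) : compPoly w a b b = 0 ∧ compSlope w a b b ≤ 0 := by
  have h0 : compPoly w a b b = 0 := by
    rw [H.compPoly_eq_of_continuousWithinAt hc (right_mem_Icc.2 hc.lt.le)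
      (H.cont.continuousAt (isOpen_Ioo.mem_nhds hb)).continuousWithinAt]
    exact H.eq_zero hb hc.right
  refine ⟨h0, ?_⟩
  have ht : Tendsto (fun x => compSlope w a b b + deriv (deriv w) ((a + b) / 2) / 2 * (x - b))
      (𝓝[<] b) (𝓝 (compSlope w a b b)) := by
    have : Continuous fun x =>
        compSlope w a b b + deriv (deriv w) ((a + b) / 2) / 2 * (x - b) := by fun_prop
    simpa using (this.tendsto b).mono_left nhdsWithin_le_nhds
  refine le_of_tendsto ht ?_
  filter_upwards [Ioo_mem_nhdsLT hc.lt] with x hx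
  have h1 := (hc.subset hx).2
  rw [(H.eqOn_comp hc x hx).1, compPoly_eq w a b x b, h0] at h1
  by_contra! h
  nlinarith [hx.2]

/-- At an end point inside `(α, β)` the quadratic vanishes. At one on the boundary, the test
function and its derivative do. -/
lemma setIntegral_comp (H : SliceLimit α β v v₁ v₂ v₃ w) {a b : ℝ}
    (hc : IsComp (posSet α β w) a b) {φ : ℝ → ℝ} (hφ : IsTest (Ioo α β) φ) :
    ∫ x in Ioo a b, limitDensity w φ x =
      1 / 3 * (compSlope w a b a ^ 3 * φ a - compSlope w a b b ^ 3 * φ b) := by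
  have hφa : ∀ y, y ∉ Ioo α β → φ y = 0 ∧ deriv φ y = 0 := fun y hy =>
    ⟨hφ.eq_zero hy, hφ.deriv.eq_zero hy⟩
  refine integral_quadratic hc.lt hφ.1 (fun x hx => (H.eqOn_comp hc x hx).1)
    (fun x hx => (H.eqOn_comp hc x hx).2.1) (fun x hx => (H.eqOn_comp hc x hx).2.2) ?_ ?_
  · by_cases ha : a ∈ Ioo α β
    · exact Or.inl (H.compPoly_left hc ha).1
    · exact Or.inr (hφa a ha)
  · by_cases hb : b ∈ Ioo α β
    · exact Or.inl (H.compPoly_right hc hb).1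
    · exact Or.inr (hφa b hb)

lemma setIntegral_comp_nonneg (H : SliceLimit α β v v₁ v₂ v₃ w) {a b : ℝ}
    (hc : IsComp (posSet α β w) a b) {φ : ℝ → ℝ} (hφ : IsTest (Ioo α β) φ) (hφ0 : ∀ x, 0 ≤ φ x) :
    0 ≤ compSlope w a b a ^ 3 * φ a ∧ compSlope w a b b ^ 3 * φ b ≤ 0 := by
  constructor
  · by_cases ha : a ∈ Ioo α β
    · exact mul_nonneg (pow_nonneg (H.compPoly_left hc ha).2 3) (hφ0 a)
    · rw [hφ.eq_zero ha, mul_zero]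
  · by_cases hb : b ∈ Ioo α β
    · exact mul_nonpos_of_nonpos_of_nonneg
        (Odd.pow_nonpos (by decide) (H.compPoly_right hc hb).2) (hφ0 b)
    · rw [hφ.eq_zero hb, mul_zero]

lemma setIntegral_limitDensity_nonneg (H : SliceLimit α β v v₁ v₂ v₃ w) {φ : ℝ → ℝ}
    (hφ : IsTest (Ioo α β) φ) (hφ0 : ∀ x, 0 ≤ φ x)
    (hi : IntegrableOn (limitDensity w φ) (posSet α β w)) :
    0 ≤ ∫ x in posSet α β w, limitDensity w φ x :=
  setIntegral_nonneg_of_isComp H.isOpen posSet_subset hi fun a b hc => by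
    have := H.setIntegral_comp_nonneg hc hφ hφ0
    rw [H.setIntegral_comp hc hφ]
    linarith

lemma le_setIntegral_limitDensity (H : SliceLimit α β v v₁ v₂ v₃ w) {φ : ℝ → ℝ}
    (hφ : IsTest (Ioo α β) φ) (hφ0 : ∀ x, 0 ≤ φ x)
    (hi : IntegrableOn (limitDensity w φ) (posSet α β w)) {a b : ℝ}
    (hc : IsComp (posSet α β w) a b) :
    1 / 3 * (compSlope w a b a ^ 3 * φ a - compSlope w a b b ^ 3 * φ b) ≤
      ∫ x in posSet α β w, limitDensity w φ x := by
  rw [← H.setIntegral_comp hc hφ]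
  refine le_setIntegral_of_isComp H.isOpen posSet_subset hi (fun a b hc => ?_) hc
  have := H.setIntegral_comp_nonneg hc hφ hφ0
  rw [H.setIntegral_comp hc hφ]
  linarith

/-- In the limit, `Tfun` tested against a square is non-negative. -/
lemma eventually_neg_le_Tfun (H : SliceLimit α β v v₁ v₂ v₃ w) (hαβ : α < β) {η : ℝ → ℝ}
    (hη : IsTest (Ioo α β) η) (hη0 : ∀ x, 0 ≤ η x) {E M : ℝ} (hM0 : 0 < M) (hE0 : 0 ≤ E)
    (hE : ∀ k, ∫ x in Ioo α β, v₁ k x ^ 2 ≤ E) (hM : ∀ k, ∀ x ∈ Icc α β, v k x ≤ M)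
    {e : ℝ} (he : 0 < e) :
    ∀ᶠ k in atTop, -e ≤ Tfun α β (v k) (v₁ k) (v₂ k) fun x => η x ^ 2 := by
  -- On a subsequence violating the bound, the source is bounded above by `0`. This is the upper
  -- bound that semicontinuity requires.
  by_contra hcon
  obtain ⟨σ, hσ, hlt⟩ := extraction_of_frequently_atTop (not_eventually.1 hcon)
  have H' := H.comp hσ.tendsto_atTop
  obtain ⟨hi, hl⟩ := H'.liminf_Tfun hαβ hη hη0 hM0 hE0 (fun k => hE _) (fun k => hM _) (T := 0)
    fun k => by linarith [hlt k]
  have h0 := H'.setIntegral_limitDensity_nonneg hη.sq (fun x => sq_nonneg _) hi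
  obtain ⟨k, hk⟩ := (hl (e / 2) (by positivity)).exists
  linarith [hlt k]

/-- The slopes at the end points of a component do not vanish. -/
lemma compSlope_left_pos (H : SliceLimit α β v v₁ v₂ v₃ w)
    (hu : TendstoUniformlyOn v w atTop (Icc α β)) {a b : ℝ} (hc : IsComp (posSet α β w) a b)
    (ha : a ∈ Ioo α β) : 0 < compSlope w a b a := by
  obtain ⟨h0, h1⟩ := H.compPoly_left hc ha
  refine h1.lt_of_ne' fun hz => ?_
  set m := (a + b) / 2 with hm
  have hmab : m ∈ Ioo a b := ⟨by linarith [hc.lt], by linarith [hc.lt]⟩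
  set κ := deriv (deriv w) m with hκ
  have hp : ∀ x, compPoly w a b x = κ / 2 * (x - a) ^ 2 := fun x => by
    rw [compPoly_eq w a b x a, h0, hz]; ring
  have hκ0 : κ ≠ 0 := fun h => by
    have h2 := (hc.subset hmab).2
    rw [(H.eqOn_comp hc m hmab).1, hp, h] at h2
    simp at h2
  have hwc : ContinuousOn w (Icc α β) :=
    hu.continuousOn (Eventually.of_forall fun k => (H.slice k).cont).frequently
  obtain ⟨hαa, hbβ⟩ := hc.Icc_subset
  have hb : b ∈ Icc α β := ⟨hαa.trans hc.lt.le, hbβ⟩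
  have hpb := H.compPoly_eq_of_continuousWithinAt hc (right_mem_Icc.2 hc.lt.le)
    ((hwc b hb).mono fun x hx => ⟨hαa.trans hx.1.le, hx.2.le.trans hbβ⟩)
  have hwb : w b ≠ 0 := by
    rw [← hpb, hp]
    have := (sub_pos.2 hc.lt).ne'
    positivity
  -- The double zero at `a` makes the quadratic non-zero at `b`. An interior end point of a
  -- component is a zero of `w`, so `b` is the boundary point, where the Neumann condition is
  -- available.
  have hbeq : b = β := by
    by_contra hne
    exact hwb (H.eq_zero ⟨ha.1.trans hc.lt, hbβ.lt_of_ne hne⟩ hc.right)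
  have hwb0 : 0 < w b :=
    (ge_of_tendsto' (hu.tendsto_at hb) fun k => (H.slice k).nonneg b hb).lt_of_ne' hwb
  have hsub : Icc m b ⊆ Icc α β := Icc_subset_Icc (hαa.trans hmab.1.le) hbβ
  -- The limit is positive up to `b`, so the slopes converge uniformly up to the boundary and the
  -- Neumann condition passes to the limit.
  obtain ⟨A, K, -, hv₁, -⟩ := exists_quadratic H.slice H.dissip hmab.2 hsub (hu.mono hsub)
    fun x hx => by
      rcases hx.2.eq_or_lt with rfl | h
      · exact hwb0
      · exact (hc.subset ⟨hmab.1.trans_le hx.1, h⟩).2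
  have heq : ∀ x ∈ Ico m b, κ * (x - a) = A + K * (x - m) := fun x hx => by
    have hx' : x ∈ Ioo a b := ⟨hmab.1.trans_le hx.1, hx.2⟩
    have e := tendsto_nhds_unique (H.tendsto₁ (hc.subset hx'))
      (hv₁.tendsto_at (Ico_subset_Icc_self hx))
    rw [(H.eqOn_comp hc x hx').2.1] at e
    rw [← e]
    have hz' : compSlope w a b a = 0 := hz
    unfold compSlope at hz' ⊢
    rw [← hm, ← hκ] at hz' ⊢
    linear_combination -hz'
  have hend : A + K * (b - m) = 0 := by
    have e := tendsto_nhds_unique (hv₁.tendsto_at (right_mem_Icc.2 hmab.2.le))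
      (tendsto_const_nhds.congr fun k => (by rw [hbeq]; exact (H.slice k).right.symm :
        (0 : ℝ) = v₁ k b))
    exact e
  have e1 := heq m ⟨le_rfl, hmab.2⟩
  have hm2 : (m + b) / 2 ∈ Ico m b := ⟨by linarith [hmab.2], by linarith [hmab.2]⟩
  have e2 := heq _ hm2
  -- Two affine functions agreeing at `m` and at `(m + b) / 2` are extrapolated to `b`, where one of
  -- them vanishes.
  have e3 : κ * (b - a) = 0 := by linear_combination 2 * e2 - e1 + hend
  rcases mul_eq_zero.1 e3 with h | h
  · exact hκ0 h
  · exact (sub_pos.2 hc.lt).ne' h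

lemma compSlope_right_neg (H : SliceLimit α β v v₁ v₂ v₃ w)
    (hu : TendstoUniformlyOn v w atTop (Icc α β)) {a b : ℝ} (hc : IsComp (posSet α β w) a b)
    (hb : b ∈ Ioo α β) : compSlope w a b b < 0 := by
  obtain ⟨h0, h1⟩ := H.compPoly_right hc hb
  refine h1.lt_of_ne fun hz => ?_
  set m := (a + b) / 2 with hm
  have hmab : m ∈ Ioo a b := ⟨by linarith [hc.lt], by linarith [hc.lt]⟩
  set κ := deriv (deriv w) m with hκ
  have hp : ∀ x, compPoly w a b x = κ / 2 * (x - b) ^ 2 := fun x => by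
    rw [compPoly_eq w a b x b, h0, hz]; ring
  have hκ0 : κ ≠ 0 := fun h => by
    have h2 := (hc.subset hmab).2
    rw [(H.eqOn_comp hc m hmab).1, hp, h] at h2
    simp at h2
  have hwc : ContinuousOn w (Icc α β) :=
    hu.continuousOn (Eventually.of_forall fun k => (H.slice k).cont).frequently
  obtain ⟨hαa, hbβ⟩ := hc.Icc_subset
  have ha : a ∈ Icc α β := ⟨hαa, hc.lt.le.trans hbβ⟩
  have hpa := H.compPoly_eq_of_continuousWithinAt hc (left_mem_Icc.2 hc.lt.le)
    ((hwc a ha).mono fun x hx => ⟨hαa.trans hx.1.le, hx.2.le.trans hbβ⟩)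
  have hwa : w a ≠ 0 := by
    rw [← hpa, hp]
    have := (sub_neg.2 hc.lt).ne
    positivity
  have haeq : a = α := by
    by_contra hne
    exact hwa (H.eq_zero ⟨hαa.lt_of_ne' hne, hc.lt.trans hb.2⟩ hc.left)
  have hwa0 : 0 < w a :=
    (ge_of_tendsto' (hu.tendsto_at ha) fun k => (H.slice k).nonneg a ha).lt_of_ne' hwa
  have hsub : Icc a m ⊆ Icc α β := Icc_subset_Icc hαa (hmab.2.le.trans hbβ)
  obtain ⟨A, K, -, hv₁, -⟩ := exists_quadratic H.slice H.dissip hmab.1 hsub (hu.mono hsub)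
    fun x hx => by
      rcases hx.1.eq_or_lt with rfl | h
      · exact hwa0
      · exact (hc.subset ⟨h, hx.2.trans_lt hmab.2⟩).2
  have heq : ∀ x ∈ Ioc a m, κ * (x - b) = A + K * (x - a) := fun x hx => by
    have hx' : x ∈ Ioo a b := ⟨hx.1, hx.2.trans_lt hmab.2⟩
    have e := tendsto_nhds_unique (H.tendsto₁ (hc.subset hx'))
      (hv₁.tendsto_at (Ioc_subset_Icc_self hx))
    rw [(H.eqOn_comp hc x hx').2.1] at e
    rw [← e]
    have hz' : compSlope w a b b = 0 := hz
    unfold compSlope at hz' ⊢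
    rw [← hm, ← hκ] at hz' ⊢
    linear_combination -hz'
  have hend : A + K * (a - a) = 0 := by
    have e := tendsto_nhds_unique (hv₁.tendsto_at (left_mem_Icc.2 hmab.1.le))
      (tendsto_const_nhds.congr fun k => (by rw [haeq]; exact (H.slice k).left.symm :
        (0 : ℝ) = v₁ k a))
    exact e
  have e1 := heq m ⟨hmab.1, le_rfl⟩
  have hm2 : (m + a) / 2 ∈ Ioc a m := ⟨by linarith [hmab.1], by linarith [hmab.1]⟩
  have e2 := heq _ hm2
  have e3 : κ * (a - b) = 0 := by linear_combination 2 * e2 - e1 + hend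
  rcases mul_eq_zero.1 e3 with h | h
  · exact hκ0 h
  · exact (sub_neg.2 hc.lt).ne h

/-- If `Tfun` tested against `η²` tends to zero, then `η` vanishes at the interior end points of the
components of the positivity set. -/
lemma eq_zero_of_tendsto_Tfun (H : SliceLimit α β v v₁ v₂ v₃ w)
    (hu : TendstoUniformlyOn v w atTop (Icc α β)) (hαβ : α < β) {η : ℝ → ℝ}
    (hη : IsTest (Ioo α β) η) (hη0 : ∀ x, 0 ≤ η x) {E M : ℝ} (hM0 : 0 < M) (hE0 : 0 ≤ E)
    (hE : ∀ k, ∫ x in Ioo α β, v₁ k x ^ 2 ≤ E) (hM : ∀ k, ∀ x ∈ Icc α β, v k x ≤ M)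
    (hT : Tendsto (fun k => Tfun α β (v k) (v₁ k) (v₂ k) fun x => η x ^ 2) atTop (𝓝 0)) {a b : ℝ}
    (hc : IsComp (posSet α β w) a b) : η a = 0 ∧ η b = 0 := by
  obtain ⟨T, hT'⟩ := hT.bddAbove_range
  obtain ⟨hi, hl⟩ := H.liminf_Tfun hαβ hη hη0 hM0 hE0 hE hM (T := T) fun k =>
    hT' (mem_range_self k)
  -- The contributions of the two end points of this component are non-negative and bounded by the
  -- total source of the limit, which is at most `lim Tfun = 0`.
  have h1 := H.le_setIntegral_limitDensity hη.sq (fun x => sq_nonneg _) hi hc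
  have h2 : ∫ x in posSet α β w, limitDensity w (fun x => η x ^ 2) x ≤ 0 := by
    refine le_of_forall_pos_le_add fun e he => ?_
    have := ge_of_tendsto hT (hl e he)
    linarith
  obtain ⟨h3, h4⟩ := H.setIntegral_comp_nonneg hc hη.sq (fun x => sq_nonneg _)
  constructor
  · by_cases ha : a ∈ Ioo α β
    · have h5 : compSlope w a b a ^ 3 * η a ^ 2 = 0 := by linarith
      have := (H.compSlope_left_pos hu hc ha).ne'
      simpa [this] using h5
    · exact hη.eq_zero ha
  · by_cases hb : b ∈ Ioo α β
    · have h5 : compSlope w a b b ^ 3 * η b ^ 2 = 0 := by linarith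
      have := (H.compSlope_right_neg hu hc hb).ne
      simpa [this] using h5
    · exact hη.eq_zero hb

end SliceLimit

/-! ### Compactness -/

lemma exists_subseq_tendstoUniformlyOn {α β : ℝ} (hαβ : α ≤ β) {f : ℕ → ℝ → ℝ} {M C : ℝ}
    (hM : ∀ k, ∀ x ∈ Icc α β, |f k x| ≤ M)
    (hC : ∀ k, ∀ x ∈ Icc α β, ∀ y ∈ Icc α β, |f k x - f k y| ≤ C * √|x - y|) :
    ∃ σ : ℕ → ℕ, StrictMono σ ∧ ∃ w : ℝ → ℝ,
      TendstoUniformlyOn (fun k => f (σ k)) w atTop (Icc α β) := by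
  have hlim : Tendsto (fun r : ℝ => C * √r) (𝓝 0) (𝓝 0) := by
    have : Continuous fun r : ℝ => C * √r := by fun_prop
    simpa using this.tendsto 0
  have hcont : ∀ k, Continuous fun x : Icc α β => f k x := fun k => by
    have := Metric.equicontinuous_of_continuity_modulus (fun r => C * √r) hlim
      (fun (_ : Unit) (x : Icc α β) => f k x) fun x y _ => by
        rw [Real.dist_eq, Subtype.dist_eq, Real.dist_eq]; exact hC k x x.2 y y.2
    exact this.continuous ()
  let F : ℕ → BoundedContinuousFunction (Icc α β) ℝ := fun k =>
    BoundedContinuousFunction.mkOfCompact ⟨_, hcont k⟩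
  have hcomp : IsCompact (closure (range F)) := by
    refine BoundedContinuousFunction.arzela_ascoli (Icc (-M) M) isCompact_Icc (range F) ?_ ?_
    · rintro _ x ⟨k, rfl⟩
      exact abs_le.1 (hM k x x.2)
    · refine Metric.equicontinuous_of_continuity_modulus (fun r => C * √r) hlim _ ?_
      rintro x y ⟨_, k, rfl⟩
      change dist (f k x) (f k y) ≤ _
      rw [Real.dist_eq, Subtype.dist_eq, Real.dist_eq]; exact hC k x x.2 y y.2
  obtain ⟨g, -, σ, hσ, hg⟩ := hcomp.tendsto_subseq fun k => subset_closure (mem_range_self k)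
  refine ⟨σ, hσ, IccExtend hαβ g, ?_⟩
  rw [tendstoUniformlyOn_iff_tendstoUniformly_comp_coe]
  have := BoundedContinuousFunction.tendsto_iff_tendstoUniformly.1 hg
  convert! this using 1
  ext x
  simp [IccExtend_val]

/-! ### A priori bounds for solutions -/

lemma integral_sq_of_lintegral_le {s : Set ℝ} {f : ℝ → ℝ} {E : ℝ} (hE : 0 ≤ E)
    (hf : AEStronglyMeasurable f (volume.restrict s))
    (h : ∫⁻ x in s, ENNReal.ofReal (1 / 2 * f x ^ 2) ≤ ENNReal.ofReal (1 / 2 * E)) :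
    IntegrableOn (fun x => f x ^ 2) s ∧ ∫ x in s, f x ^ 2 ≤ E := by
  have hnn : ∀ᵐ x ∂volume.restrict s, 0 ≤ 1 / 2 * f x ^ 2 :=
    Eventually.of_forall fun x => by positivity
  have hi : IntegrableOn (fun x => 1 / 2 * f x ^ 2) s := by
    refine ⟨(hf.pow 2).const_mul _, ?_⟩
    rw [hasFiniteIntegral_iff_ofReal hnn]
    exact h.trans_lt ENNReal.ofReal_lt_top
  have hi2 : IntegrableOn (fun x => f x ^ 2) s := by
    refine (hi.const_mul 2).congr (Eventually.of_forall fun x => ?_)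
    simp only []
    ring
  refine ⟨hi2, ?_⟩
  rw [← ofReal_integral_eq_lintegral_ofReal hi hnn, ENNReal.ofReal_le_ofReal_iff (by positivity),
    integral_const_mul] at h
  linarith

/-- Young's inequality `|f| ≤ r⁻¹ + r f²` with `r = √(y - x)` replaces Cauchy-Schwarz, whence the
constant `1 + E`. -/
lemma abs_intervalIntegral_le_sqrt {f : ℝ → ℝ} {x y E : ℝ} (hxy : x ≤ y) {s : Set ℝ}
    (hs : Ioc x y ⊆ s) (hf : IntegrableOn (fun x => f x ^ 2) s) (hE : ∫ x in s, f x ^ 2 ≤ E) :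
    |∫ z in x..y, f z| ≤ (1 + E) * √(y - x) := by
  rcases hxy.eq_or_lt with rfl | hxy
  · simp
  have hp : 0 < √(y - x) := Real.sqrt_pos.2 (sub_pos.2 hxy)
  have hsq : √(y - x) ^ 2 = y - x := Real.sq_sqrt (sub_pos.2 hxy).le
  rw [intervalIntegral.integral_of_le hxy.le]
  have hc1 : IntegrableOn (fun _ : ℝ => (√(y - x))⁻¹) (Ioc x y) := integrableOn_const (by simp)
  have hi : IntegrableOn (fun z => (√(y - x))⁻¹ + √(y - x) * f z ^ 2) (Ioc x y) :=
    hc1.add ((hf.mono_set hs).const_mul _)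
  refine (abs_setIntegral_le measurableSet_Ioc hi fun z _ => ?_).trans ?_
  · set r := √(y - x)
    have : r⁻¹ + r * f z ^ 2 - |f z| = r⁻¹ * ((1 - r * |f z|) ^ 2 + r * |f z|) := by
      rw [← sq_abs (f z)]; field_simp; ring
    have h2 : 0 ≤ r⁻¹ * ((1 - r * |f z|) ^ 2 + r * |f z|) := by positivity
    linarith
  · rw [integral_add hc1 ((hf.mono_set hs).const_mul _),
      integral_const_mul]
    have h1 : ∫ z in Ioc x y, f z ^ 2 ≤ E :=
      (setIntegral_mono_set hf (Eventually.of_forall fun z => by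
        simp only [Pi.zero_apply]; positivity) hs.eventuallyLE).trans hE
    have h3 : ∫ z in Ioc x y, (√(y - x))⁻¹ = √(y - x) := by
      simp [hxy.le]
      rw [← div_eq_mul_inv, div_eq_iff hp.ne', ← sq, hsq]
    rw [h3]
    nlinarith

section Solution

variable {n ε α β : ℝ} {uin duin : ℝ → ℝ} {u ux uxx uxxx : ℝ → ℝ → ℝ}

lemma IsSolution.cont_slice (hu : IsSolution n ε α β uin duin u ux uxx uxxx) {t : ℝ} (ht : 0 ≤ t) :
    ContinuousOn (u t) (Icc α β) :=
  hu.cont.comp (f := fun x => (t, x)) (by fun_prop) fun _ hx => ⟨ht, hx⟩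

lemma aestronglyMeasurable_of_hasWeakDeriv {U : Set ℝ} {f g : ℝ → ℝ}
    (h : HasWeakDeriv U f g) : AEStronglyMeasurable g (volume.restrict U) :=
  h.2.1.aestronglyMeasurable

lemma IsSolution.integral_sq_le (hu : IsSolution n ε α β uin duin u ux uxx uxxx)
    (hduin : MemLp duin 2 (volume.restrict (Ioo α β))) {t : ℝ} (ht : 0 < t) :
    IntegrableOn (fun x => ux t x ^ 2) (Ioo α β) ∧
      ∫ x in Ioo α β, ux t x ^ 2 ≤ ∫ x in Ioo α β, duin x ^ 2 := by
  have hi : IntegrableOn (fun x => duin x ^ 2) (Ioo α β) := hduin.integrable_sq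
  refine integral_sq_of_lintegral_le (integral_nonneg fun _ => sq_nonneg _)
    (aestronglyMeasurable_of_hasWeakDeriv (hu.weak_ux t ht)) ?_
  have h := le_self_add.trans (hu.energy t ht)
  rwa [← ofReal_integral_eq_lintegral_ofReal (hi.const_mul _)
    (Eventually.of_forall fun x => by positivity), integral_const_mul] at h

lemma IsSolution.holder (hu : IsSolution n ε α β uin duin u ux uxx uxxx) (hαβ : α < β)
    (hduin : MemLp duin 2 (volume.restrict (Ioo α β))) {t : ℝ} (ht : 0 < t) :
    ∀ x ∈ Icc α β, ∀ y ∈ Icc α β,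
      |u t x - u t y| ≤ (1 + ∫ x in Ioo α β, duin x ^ 2) * √|x - y| := by
  have hc := hu.cont_slice ht.le
  obtain ⟨hi, hE⟩ := hu.integral_sq_le hduin ht
  have hint : ∀ x ∈ Ioo α β, ∀ y ∈ Ioo α β, x ≤ y →
      |u t x - u t y| ≤ (1 + ∫ x in Ioo α β, duin x ^ 2) * √|x - y| := fun x hx y hy hxy => by
    have hsub : Icc x y ⊆ Ioo α β := Icc_subset_Ioo hx.1 hy.2
    have h := (hu.weak_ux t ht).eq_add_integral (hc.mono Ioo_subset_Icc_self) hxy hsub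
    rw [abs_sub_comm, h.2, abs_sub_comm, abs_of_nonneg (sub_nonneg.2 hxy)]
    exact abs_intervalIntegral_le_sqrt hxy (Ioc_subset_Icc_self.trans hsub) hi hE
  have hint2 : ∀ z ∈ Ioo α β ×ˢ Ioo α β,
      |u t z.1 - u t z.2| ≤ (1 + ∫ x in Ioo α β, duin x ^ 2) * √|z.1 - z.2| := fun z hz => by
    rcases le_total z.1 z.2 with h | h
    · exact hint _ hz.1 _ hz.2 h
    · have := hint _ hz.2 _ hz.1 h
      rwa [abs_sub_comm, abs_sub_comm z.2] at this
  intro x hx y hy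
  have hcl : closure (Ioo α β ×ˢ Ioo α β) = Icc α β ×ˢ Icc α β := by
    rw [closure_prod_eq, closure_Ioo hαβ.ne]
  have hm : (x, y) ∈ closure (Ioo α β ×ˢ Ioo α β) := hcl ▸ ⟨hx, hy⟩
  refine le_on_closure hint2 ?_ ?_ hm (f := fun z : ℝ × ℝ => |u t z.1 - u t z.2|)
    (g := fun z : ℝ × ℝ => (1 + ∫ x in Ioo α β, duin x ^ 2) * √|z.1 - z.2|)
  · rw [hcl]
    exact ((hc.comp continuousOn_fst fun z hz => hz.1).sub
      (hc.comp continuousOn_snd fun z hz => hz.2)).abs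
  · exact Continuous.continuousOn (by fun_prop)

/-- A uniform bound for solutions. -/
noncomputable def supBound (α β : ℝ) (uin duin : ℝ → ℝ) : ℝ :=
  1 + |∫ x in Ioo α β, uin x| / (β - α) + (1 + ∫ x in Ioo α β, duin x ^ 2) * √(β - α)

lemma one_le_supBound (hαβ : α < β) : 1 ≤ supBound α β uin duin := by
  have : 0 ≤ ∫ x in Ioo α β, duin x ^ 2 := integral_nonneg fun _ => sq_nonneg _
  have h2 := sub_pos.2 hαβ
  have : 0 ≤ |∫ x in Ioo α β, uin x| / (β - α) := by positivity
  have : 0 ≤ (1 + ∫ x in Ioo α β, duin x ^ 2) * √(β - α) := by positivity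
  unfold supBound
  linarith

/-- If the bound fails at one point, the Hölder estimate keeps `u` above `1 + |mass| / (β - α)`
throughout the interval, which contradicts conservation of mass. -/
lemma IsSolution.le_supBound (hu : IsSolution n ε α β uin duin u ux uxx uxxx) (hαβ : α < β)
    (hduin : MemLp duin 2 (volume.restrict (Ioo α β))) {t : ℝ} (ht : 0 < t) :
    ∀ x ∈ Icc α β, u t x ≤ supBound α β uin duin := by
  intro x hx
  have hc := hu.cont_slice ht.le
  have hE : 0 ≤ ∫ x in Ioo α β, duin x ^ 2 := integral_nonneg fun _ => sq_nonneg _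
  by_contra! hlt
  have hlow : ∀ y ∈ Ioo α β, 1 + |∫ x in Ioo α β, uin x| / (β - α) ≤ u t y := fun y hy => by
    have h1 := hu.holder hαβ hduin ht x hx y (Ioo_subset_Icc_self hy)
    have h2 : √|x - y| ≤ √(β - α) :=
      Real.sqrt_le_sqrt (abs_le.2 ⟨by linarith [hx.1, hy.2], by linarith [hx.2, hy.1]⟩)
    have h3 := (le_abs_self _).trans (h1.trans (mul_le_mul_of_nonneg_left h2 (by linarith)))
    unfold supBound at hlt
    linarith
  have h4 := setIntegral_mono_on (integrableOn_const (by simp))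
    (Slice.integrable_of_continuousOn hc) measurableSet_Ioo hlow
  rw [hu.mass t ht] at h4
  simp [hαβ.le] at h4
  have h5 := sub_pos.2 hαβ
  rw [mul_add, mul_div_cancel₀ _ h5.ne'] at h4
  linarith [le_abs_self (∫ x in Ioo α β, uin x)]

lemma restrict_prod_eq (s t : Set ℝ) : (volume : Measure (ℝ × ℝ)).restrict (s ×ˢ t) =
    (volume.restrict s).prod (volume.restrict t) := by
  rw [Measure.prod_restrict]; rfl

lemma IsSolution.meas_u (hu : IsSolution n ε α β uin duin u ux uxx uxxx) :
    AEMeasurable (Function.uncurry u) (volume.restrict (Ioi 0 ×ˢ Ioo α β)) :=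
  (hu.cont.mono (prod_mono Ioi_subset_Ici_self Ioo_subset_Icc_self)).aemeasurable
    (measurableSet_Ioi.prod measurableSet_Ioo)

/-- For almost every time, a solution is a regular profile. -/
lemma IsSolution.ae_slice
    (hu : IsSolution n ε α β uin duin u ux uxx uxxx) :
    ∀ᵐ t ∂volume.restrict (Ioi (0 : ℝ)), Slice α β (u t) (ux t) (uxx t) (uxxx t) := by
  have hm : ∀ᵐ t ∂volume.restrict (Ioi (0 : ℝ)),
      AEStronglyMeasurable (uxx t) (volume.restrict (Ioo α β)) := by
    have := hu.meas_uxx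
    rw [restrict_prod_eq] at this
    exact this.aestronglyMeasurable.prodMk_left
  have hmu := hu.meas_u
  have hmx := hu.meas_uxx
  rw [restrict_prod_eq] at hmu hmx
  have hmi : AEMeasurable (fun t => ∫⁻ x in Ioo α β, ENNReal.ofReal (u t x * uxx t x ^ 2))
      (volume.restrict (Ioi 0)) :=
    AEMeasurable.lintegral_prod_right' (f := fun z : ℝ × ℝ =>
      ENNReal.ofReal (u z.1 z.2 * uxx z.1 z.2 ^ 2)) (hmu.mul (hmx.pow_const 2)).ennreal_ofReal
  -- The right-hand side of the entropy inequality is an `ENNReal.ofReal`, hence finite. So the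
  -- energy term is finite for a.e. time in each bounded interval.
  have hfin : ∀ᵐ t ∂volume.restrict (Ioi (0 : ℝ)),
      ∫⁻ x in Ioo α β, ENNReal.ofReal (u t x * uxx t x ^ 2) < ⊤ := by
    have h1 : ∀ j : ℕ, ∀ᵐ t ∂volume, t ∈ Ioo (0 : ℝ) (j + 1) →
        ∫⁻ x in Ioo α β, ENNReal.ofReal (u t x * uxx t x ^ 2) < ⊤ := fun j => by
      rw [← ae_restrict_iff' measurableSet_Ioo]
      refine ae_lt_top' (hmi.mono_set Ioo_subset_Ioi_self) ?_
      exact ((le_self_add.trans (hu.entropy (j + 1) (by positivity))).trans_lt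
        ENNReal.ofReal_lt_top).ne
    rw [ae_restrict_iff' measurableSet_Ioi]
    filter_upwards [ae_all_iff.2 h1] with t ht ht0
    obtain ⟨j, hj⟩ := exists_nat_gt t
    exact ht j ⟨ht0, by linarith⟩
  filter_upwards [hm, hfin, hu.neumann, hu.weak_uxx, hu.weak_uxxx, ae_restrict_mem measurableSet_Ioi]
    with t h1 h2 h3 h4 h5 (ht : 0 < t)
  have hc := hu.cont_slice ht.le
  have hcI := hc.mono Ioo_subset_Icc_self
  have hP : IsOpen (posSet α β (u t)) := isOpen_posSet hcI
  obtain ⟨r1, -, r3, r4⟩ := h4.regularity hP h5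
    (h3.1.mono (posSet_subset.trans Ioo_subset_Icc_self))
  refine ⟨hc, hu.nonneg t ht.le, h3.1, h3.2.1, h3.2.2, fun x hx =>
    (hu.weak_ux t ht).hasDerivAt isOpen_Ioo hcI (h3.1.mono Ioo_subset_Icc_self) hx, r1, r3, r4,
    h1, ⟨((hcI.aestronglyMeasurable measurableSet_Ioo).mul (h1.pow 2)), ?_⟩⟩
  rw [hasFiniteIntegral_iff_ofReal]
  · exact h2
  · exact (ae_restrict_mem measurableSet_Ioo).mono fun x hx =>
      mul_nonneg (hu.nonneg t ht.le x (Ioo_subset_Icc_self hx)) (sq_nonneg _)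

end Solution

/-! ### Test functions and subsequences -/

/-- Subsets of the separable metric space of continuous functions on `[α, β]` are separable. Uniform
approximation is enough because the densities are bounded. -/
lemma exists_countable_dense_tests (α β : ℝ) (S : Set (ℝ → ℝ))
    (hS : ∀ φ ∈ S, Continuous φ) : ∃ D ⊆ S, D.Countable ∧
      ∀ φ ∈ S, ∀ e > 0, ∃ χ ∈ D, ∀ x ∈ Icc α β, |φ x - χ x| ≤ e := by
  let F : S → C(Icc α β, ℝ) := fun φ => ⟨fun x => φ.1 x, by
    have := hS φ φ.2
    fun_prop⟩
  obtain ⟨D, hDc, hDd⟩ := TopologicalSpace.exists_countable_dense (range F)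
  choose g hg using fun y : range F => y.2
  refine ⟨(fun y => (g y).1) '' D, ?_, hDc.image _, fun φ hφ e he => ?_⟩
  · rintro _ ⟨y, -, rfl⟩
    exact (g y).2
  · obtain ⟨y, hy, hd⟩ := hDd.exists_dist_lt ⟨F ⟨φ, hφ⟩, mem_range_self _⟩ he
    refine ⟨_, ⟨y, hy, rfl⟩, fun x hx => ?_⟩
    rw [Subtype.dist_eq, ← hg y] at hd
    have := (ContinuousMap.dist_apply_le_dist (⟨x, hx⟩ : Icc α β)).trans hd.le
    rwa [Real.dist_eq] at this

/-- Mollifications of `g` with small non-negative bumps converge to `g` almost everywhere, and at an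
interior point each is eventually the integral of `g` against an admissible test function. -/
lemma ae_nonneg_of_integral_test_nonneg {α β : ℝ} {g : ℝ → ℝ} (hg : IntegrableOn g (Ioo α β))
    (h : ∀ φ : ℝ → ℝ, IsTest (Ioo α β) φ → (∀ x, 0 ≤ φ x) → 0 ≤ ∫ x in Ioo α β, g x * φ x) :
    ∀ᵐ x ∂volume.restrict (Ioo α β), 0 ≤ g x := by
  have hr : ∀ i : ℕ, (0 : ℝ) < ((i : ℝ) + 1)⁻¹ := fun i => by positivity
  let φ : ℕ → ContDiffBump (0 : ℝ) := fun i =>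
    ⟨((i : ℝ) + 1)⁻¹, 2 * ((i : ℝ) + 1)⁻¹, hr i, by linarith [hr i]⟩
  have hout : Tendsto (fun i => (φ i).rOut) atTop (𝓝 0) := by
    simpa [one_div] using (tendsto_one_div_add_atTop_nhds_zero_nat (𝕜 := ℝ)).const_mul 2
  have hG := (hg.integrable_indicator measurableSet_Ioo).locallyIntegrable
  rw [ae_restrict_iff' measurableSet_Ioo]
  filter_upwards [ContDiffBump.ae_convolution_tendsto_right_of_locallyIntegrable hout
    (K := 2) (Eventually.of_forall fun i => le_rfl) hG] with x hx hxI
  rw [indicator_of_mem hxI] at hx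
  refine ge_of_tendsto hx ?_
  obtain ⟨r, hr0, hrs⟩ := Metric.isOpen_iff.1 isOpen_Ioo x hxI
  filter_upwards [hout.eventually_lt_const hr0] with i hi
  rw [convolution_eq_swap]
  have heq : ∀ y, (ContinuousLinearMap.lsmul ℝ ℝ) ((φ i).normed volume (x - y))
      ((Ioo α β).indicator g y) = (Ioo α β).indicator (fun y => g y * (φ i).normed volume (x - y)) y :=
    fun y => by
      by_cases hy : y ∈ Ioo α β
      · simp [indicator_of_mem hy, mul_comm]
      · simp [indicator_of_notMem hy]
  simp_rw [heq]
  rw [integral_indicator measurableSet_Ioo]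
  have hsub : tsupport (fun y => (φ i).normed volume (x - y)) ⊆ Metric.closedBall x (φ i).rOut := by
    refine closure_minimal (fun y hy => ?_) Metric.isClosed_closedBall
    have : x - y ∈ Function.support ((φ i).normed volume) := hy
    rw [ContDiffBump.support_normed_eq, mem_ball_zero_iff] at this
    rw [Metric.mem_closedBall, Real.dist_eq, abs_sub_comm]
    exact this.le
  refine h _ ⟨?_, ?_, hsub.trans ((Metric.closedBall_subset_ball hi).trans hrs)⟩
    fun y => (φ i).nonneg_normed _
  · exact (φ i).contDiff_normed.comp (contDiff_const.sub contDiff_id)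
  · exact HasCompactSupport.of_support_subset_isCompact (isCompact_closedBall x (φ i).rOut)
      (subset_closure.trans hsub)

/-- One subsequence serves countably many sequences: its `j`-th member makes the integrals of the
first finitely many of them at most `2⁻ʲ`. Summable integrals force a.e. convergence to zero. -/
lemma exists_subseq_ae_tendsto_zero {ι Ω : Type*} [Countable ι] [MeasurableSpace Ω]
    {μ : Measure Ω} {g : ι → ℕ → Ω → ℝ≥0∞} (hm : ∀ i k, AEMeasurable (g i k) μ)
    (h : ∀ i, Tendsto (fun k => ∫⁻ t, g i k t ∂μ) atTop (𝓝 0)) :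
    ∃ σ : ℕ → ℕ, StrictMono σ ∧ ∀ᵐ t ∂μ, ∀ i, Tendsto (fun j => g i (σ j) t) atTop (𝓝 0) := by
  obtain ⟨e, he⟩ := Countable.exists_injective_nat ι
  have hev : ∀ j : ℕ, ∀ᶠ k in atTop, ∀ i ∈ {i | e i ≤ j}, ∫⁻ t, g i k t ∂μ ≤ 2⁻¹ ^ j := fun j => by
    have hfin : {i | e i ≤ j}.Finite := (Set.finite_Iic j).preimage he.injOn
    rw [hfin.eventually_all]
    exact fun i _ => (h i).eventually_le_const (ENNReal.pow_pos (by simp) j)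
  obtain ⟨σ, hσ, hp⟩ := extraction_forall_of_eventually hev
  refine ⟨σ, hσ, ae_all_iff.2 fun i => ?_⟩
  -- The bound for the index `i` is available only from `j = e i` on, so the sum is shifted.
  have hfin : ∫⁻ t, ∑' j, g i (σ (j + e i)) t ∂μ ≠ ⊤ := by
    rw [lintegral_tsum fun j => hm i _]
    refine ne_top_of_le_ne_top ?_ (ENNReal.tsum_le_tsum fun j =>
      (hp (j + e i) i (Nat.le_add_left _ _)).trans
        (pow_le_pow_right_of_le_one' (by simp) (Nat.le_add_right j (e i))))
    rw [ENNReal.tsum_geometric]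
    simp
  filter_upwards [ae_lt_top' (AEMeasurable.tsum fun j => hm i _) hfin] with t ht
  exact (tendsto_add_atTop_iff_nat (e i)).1 (ENNReal.tendsto_atTop_zero_of_tsum_ne_top ht.ne)

/-! ### Evolution of the density of a solution -/

section Solution

variable {n ε α β : ℝ} {uin duin : ℝ → ℝ} {u ux uxx uxxx : ℝ → ℝ → ℝ}

lemma IsSolution.le_supBound_of_nonneg (hu : IsSolution n ε α β uin duin u ux uxx uxxx)
    (hαβ : α < β) (hduin : MemLp duin 2 (volume.restrict (Ioo α β))) {t : ℝ} (ht : 0 ≤ t) :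
    ∀ x ∈ Icc α β, u t x ≤ supBound α β uin duin := by
  intro x hx
  rcases ht.eq_or_lt with rfl | ht
  · have hc : ContinuousOn (fun s => u s x) (Ici 0) :=
      hu.cont.comp (f := fun s => (s, x)) (by fun_prop) fun s hs => ⟨hs, hx⟩
    have h1 : Tendsto (fun s => u s x) (𝓝[>] 0) (𝓝 (u 0 x)) :=
      ((hc 0 self_mem_Ici).mono Ioi_subset_Ici_self).tendsto
    refine le_of_tendsto h1 ?_
    filter_upwards [self_mem_nhdsWithin] with s hs using hu.le_supBound hαβ hduin hs x hx
  · exact hu.le_supBound hαβ hduin ht x hx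

lemma IsSolution.continuousOn_Beps (hu : IsSolution n ε α β uin duin u ux uxx uxxx) (hn : 0 < n)
    (hn3 : n < 3) (hε : ε ∈ Ioo (0 : ℝ) 1) :
    ContinuousOn (fun z : ℝ × ℝ => Beps n ε (u z.1 z.2)) (Ici 0 ×ˢ Icc α β) :=
  (TannerLaw.continuousOn_Beps hn hn3 hε).comp hu.cont fun _ hz => hu.nonneg _ hz.1 _ hz.2

lemma IsSolution.abs_Beps_le (hu : IsSolution n ε α β uin duin u ux uxx uxxx) (hn : 0 < n)
    (hn3 : n < 3) (hε : ε ∈ Ioo (0 : ℝ) 1) (hαβ : α < β)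
    (hduin : MemLp duin 2 (volume.restrict (Ioo α β))) {t : ℝ} (ht : 0 ≤ t) :
    ∀ x ∈ Icc α β, |Beps n ε (u t x)| ≤ Beps n ε (supBound α β uin duin) := fun x hx => by
  rw [abs_of_nonneg (Beps_nonneg hn hn3 hε (hu.nonneg t ht x hx))]
  exact Beps_mono hn hn3 hε (hu.nonneg t ht x hx) (hu.le_supBound_of_nonneg hαβ hduin ht x hx)

/-- The pairing of the density with a test function. -/
noncomputable def pairing (n ε α β : ℝ) (u : ℝ → ℝ → ℝ) (φ : ℝ → ℝ) (t : ℝ) : ℝ :=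
  ∫ x in Ioo α β, Beps n ε (u t x) * φ x

lemma IsSolution.continuousOn_pairing (hu : IsSolution n ε α β uin duin u ux uxx uxxx)
    (hn : 0 < n) (hn3 : n < 3) (hε : ε ∈ Ioo (0 : ℝ) 1) (hαβ : α < β)
    (hduin : MemLp duin 2 (volume.restrict (Ioo α β))) {φ : ℝ → ℝ} (hφ : Continuous φ) :
    ContinuousOn (pairing n ε α β u φ) (Ici 0) := by
  obtain ⟨L, hL⟩ := isCompact_Icc.exists_bound_of_continuousOn (hφ.continuousOn (s := Icc α β))
  have hc := hu.continuousOn_Beps hn hn3 hε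
  refine continuousOn_of_dominated (bound := fun _ => Beps n ε (supBound α β uin duin) * L)
    (fun t ht => ?_) (fun t ht => ?_) (integrable_const _) ?_
  · refine ContinuousOn.aestronglyMeasurable ?_ measurableSet_Ioo
    exact (hc.comp (f := fun x => (t, x)) (by fun_prop)
      fun x hx => ⟨ht, Ioo_subset_Icc_self hx⟩).mul hφ.continuousOn
  · filter_upwards [ae_restrict_mem measurableSet_Ioo] with x hx
    rw [norm_mul]
    have h1 := hu.abs_Beps_le hn hn3 hε hαβ hduin ht x (Ioo_subset_Icc_self hx)
    exact mul_le_mul h1 (hL x (Ioo_subset_Icc_self hx)) (norm_nonneg _)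
      ((abs_nonneg _).trans h1)
  · filter_upwards [ae_restrict_mem measurableSet_Ioo] with x hx
    exact (hc.comp (f := fun t => (t, x)) (by fun_prop)
      fun t ht => ⟨ht, Ioo_subset_Icc_self hx⟩).mul continuousOn_const

lemma IsSolution.aemeasurable (hu : IsSolution n ε α β uin duin u ux uxx uxxx) {S : ℝ} :
    AEMeasurable (Function.uncurry u) ((volume.restrict (Ioo 0 S)).prod (volume.restrict (Ioo α β)))
    ∧ AEMeasurable (Function.uncurry ux)
      ((volume.restrict (Ioo 0 S)).prod (volume.restrict (Ioo α β)))
    ∧ AEMeasurable (Function.uncurry uxx)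
      ((volume.restrict (Ioo 0 S)).prod (volume.restrict (Ioo α β)))
    ∧ AEMeasurable (Function.uncurry uxxx)
      ((volume.restrict (Ioo 0 S)).prod (volume.restrict (Ioo α β))) := by
  have hsub : Ioo 0 S ×ˢ Ioo α β ⊆ Ioi 0 ×ˢ Ioo α β := prod_mono Ioo_subset_Ioi_self le_rfl
  simp only [← restrict_prod_eq]
  exact ⟨hu.meas_u.mono_set hsub, hu.meas_ux.mono_set hsub, hu.meas_uxx.mono_set hsub,
    hu.meas_uxxx.mono_set hsub⟩

/-- Here `T^ε` is the product of `u u_xxx`, square integrable by assumption, and `u_x`, square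
integrable in space uniformly in time. -/
lemma IsSolution.integrable_Tterm (hu : IsSolution n ε α β uin duin u ux uxx uxxx)
    (hduin : MemLp duin 2 (volume.restrict (Ioo α β))) {S : ℝ} (hS : 0 < S) :
    Integrable (fun z : ℝ × ℝ => Tterm (u z.1 z.2) (ux z.1 z.2) (uxxx z.1 z.2))
      ((volume.restrict (Ioo 0 S)).prod (volume.restrict (Ioo α β))) := by
  obtain ⟨m0, m1, m2, m3⟩ := hu.aemeasurable (S := S)
  have h2 := hu.u_uxxx_L2 S hS
  rw [restrict_prod_eq] at h2
  have h1 : MemLp (Function.uncurry ux) 2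
      ((volume.restrict (Ioo 0 S)).prod (volume.restrict (Ioo α β))) := by
    rw [memLp_two_iff_integrable_sq m1.aestronglyMeasurable,
      integrable_prod_iff (m1.pow_const 2).aestronglyMeasurable]
    constructor
    · filter_upwards [ae_restrict_mem measurableSet_Ioo] with t ht
      exact (hu.integral_sq_le hduin ht.1).1
    · refine Integrable.of_bound (C := ∫ x in Ioo α β, duin x ^ 2)
        ((m1.pow_const 2).aestronglyMeasurable.norm.integral_prod_right') ?_
      filter_upwards [ae_restrict_mem measurableSet_Ioo] with t ht
      have := (hu.integral_sq_le hduin ht.1).2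
      rw [Real.norm_of_nonneg (integral_nonneg fun _ => norm_nonneg _)]
      refine le_trans (le_of_eq ?_) this
      simp [Function.uncurry]
  have := (h1.integrable_mul h2).neg
  refine this.congr (Eventually.of_forall fun z => ?_)
  simp only [Pi.neg_apply, Pi.mul_apply, Function.uncurry, Tterm]
  ring

lemma IsSolution.dissip_eq (hu : IsSolution n ε α β uin duin u ux uxx uxxx) {t : ℝ} (ht : 0 ≤ t) :
    dissip α β (u t) (uxxx t) = ∫⁻ x in Ioo α β, ENNReal.ofReal (u t x ^ 3 * uxxx t x ^ 2) := by
  unfold dissip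
  rw [← lintegral_indicator (isOpen_posSet ((hu.cont_slice ht).mono
    Ioo_subset_Icc_self)).measurableSet, ← lintegral_indicator measurableSet_Ioo]
  congr 1
  ext x
  by_cases hx : x ∈ Ioo α β
  · rw [indicator_of_mem hx]
    by_cases hp : x ∈ posSet α β (u t)
    · rw [indicator_of_mem hp]
    · rw [indicator_of_notMem hp]
      have : u t x = 0 := le_antisymm (not_lt.1 fun h => hp ⟨hx, h⟩)
        (hu.nonneg t ht x (Ioo_subset_Icc_self hx))
      simp [this]
  · rw [indicator_of_notMem hx, indicator_of_notMem fun h => hx (posSet_subset h)]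

lemma IsSolution.aemeasurable_dissip (hu : IsSolution n ε α β uin duin u ux uxx uxxx) {S : ℝ} :
    AEMeasurable (fun t => dissip α β (u t) (uxxx t)) (volume.restrict (Ioo 0 S)) := by
  obtain ⟨m0, m1, m2, m3⟩ := hu.aemeasurable (S := S)
  have hm : AEMeasurable (fun z : ℝ × ℝ => ENNReal.ofReal
      (Function.uncurry u z ^ 3 * Function.uncurry uxxx z ^ 2))
      ((volume.restrict (Ioo 0 S)).prod (volume.restrict (Ioo α β))) := by fun_prop
  have := hm.lintegral_prod_right'
  refine this.congr ?_
  filter_upwards [ae_restrict_mem measurableSet_Ioo] with t ht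
  exact (hu.dissip_eq ht.1.le).symm

/-- The total dissipation, without the factor `|ln ε|`. -/
lemma IsSolution.lintegral_mobility_le (hu : IsSolution n ε α β uin duin u ux uxx uxxx)
    (hε : ε ∈ Ioo (0 : ℝ) 1) (hduin : MemLp duin 2 (volume.restrict (Ioo α β))) {S : ℝ}
    (hS : 0 < S) :
    ∫⁻ t in Ioo 0 S, ∫⁻ x in posSet α β (u t),
      ENNReal.ofReal (mobility n ε (u t x) * uxxx t x ^ 2) ≤
    ENNReal.ofReal ((∫ x in Ioo α β, duin x ^ 2) / |Real.log ε|) := by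
  have hl := abs_log_pos hε
  have hi : IntegrableOn (fun x => duin x ^ 2) (Ioo α β) := hduin.integrable_sq
  have h := le_add_self.trans (hu.energy S hS)
  rw [← ofReal_integral_eq_lintegral_ofReal (hi.const_mul _)
    (Eventually.of_forall fun x => by positivity), integral_const_mul] at h
  have heq : ∀ t x, ENNReal.ofReal (|Real.log ε| * mobility n ε (u t x) * uxxx t x ^ 2) =
      ENNReal.ofReal |Real.log ε| * ENNReal.ofReal (mobility n ε (u t x) * uxxx t x ^ 2) :=
    fun t x => by rw [mul_assoc, ENNReal.ofReal_mul hl.le]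
  simp_rw [heq] at h
  simp_rw [lintegral_const_mul' _ _ ENNReal.ofReal_ne_top] at h
  rw [ENNReal.ofReal_div_of_pos hl, ENNReal.le_div_iff_mul_le (Or.inl (ENNReal.ofReal_pos.2 hl).ne')
    (Or.inl ENNReal.ofReal_ne_top), mul_comm]
  refine h.trans (ENNReal.ofReal_le_ofReal ?_)
  have : 0 ≤ ∫ x in Ioo α β, duin x ^ 2 := integral_nonneg fun _ => sq_nonneg _
  linarith

lemma IsSolution.lintegral_dissip_le (hu : IsSolution n ε α β uin duin u ux uxx uxxx)
    (hε : ε ∈ Ioo (0 : ℝ) 1) (hduin : MemLp duin 2 (volume.restrict (Ioo α β))) {S : ℝ}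
    (hS : 0 < S) :
    ∫⁻ t in Ioo 0 S, dissip α β (u t) (uxxx t) ≤
    ENNReal.ofReal ((∫ x in Ioo α β, duin x ^ 2) / |Real.log ε|) := by
  refine le_trans (setLIntegral_mono' measurableSet_Ioo fun t ht => ?_)
    (hu.lintegral_mobility_le hε hduin hS)
  refine setLIntegral_mono' (isOpen_posSet ((hu.cont_slice ht.1.le).mono
    Ioo_subset_Icc_self)).measurableSet fun x hx => ENNReal.ofReal_le_ofReal ?_
  refine mul_le_mul_of_nonneg_right ?_ (sq_nonneg _)
  unfold mobility
  have := mul_nonneg (Real.rpow_nonneg hε.1.le (3 - n)) (Real.rpow_nonneg hx.2.le n)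
  linarith

end Solution

section Solution

variable {n ε α β : ℝ} {uin duin : ℝ → ℝ} {u ux uxx uxxx : ℝ → ℝ → ℝ}

lemma IsSolution.aemeasurable_Rterm (hu : IsSolution n ε α β uin duin u ux uxx uxxx) {S : ℝ} :
    AEMeasurable (fun z : ℝ × ℝ => Rterm n ε (u z.1 z.2) (uxxx z.1 z.2))
      ((volume.restrict (Ioo 0 S)).prod (volume.restrict (Ioo α β))) := by
  obtain ⟨m0, -, -, m3⟩ := hu.aemeasurable (S := S)
  have hB : Measurable (dBeps n ε) := by
    have := measurable_dB n
    unfold dBeps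
    fun_prop
  have h1 : AEMeasurable (fun z => -(|Real.log ε| * dBeps n ε (Function.uncurry u z) *
      (ε ^ (3 - n) * Function.uncurry u z ^ (n - 1) + Function.uncurry u z ^ 2) *
      (Function.uncurry u z * Function.uncurry uxxx z)))
      ((volume.restrict (Ioo 0 S)).prod (volume.restrict (Ioo α β))) := by
    have := hB.comp_aemeasurable m0
    fun_prop
  exact h1

lemma IsSolution.lintegral_Rterm_sq_le (hu : IsSolution n ε α β uin duin u ux uxx uxxx)
    (hε : ε ∈ Ioo (0 : ℝ) 1) (hαβ : α < β) (hduin : MemLp duin 2 (volume.restrict (Ioo α β)))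
    {K : ℝ} (hK0 : 0 ≤ K) (hK : ∀ u z : ℝ, 0 ≤ u →
      Rterm n ε u z ^ 2 ≤ K * (ε + u) * (mobility n ε u * z ^ 2)) {S : ℝ} (hS : 0 < S) :
    ∫⁻ t in Ioo 0 S, ∫⁻ x in Ioo α β, ENNReal.ofReal (Rterm n ε (u t x) (uxxx t x) ^ 2) ≤
      ENNReal.ofReal (K * (1 + supBound α β uin duin) *
        ((∫ x in Ioo α β, duin x ^ 2) / |Real.log ε|)) := by
  set C := K * (1 + supBound α β uin duin)
  have hC : 0 ≤ C := mul_nonneg hK0 (by linarith [one_le_supBound (uin := uin) (duin := duin) hαβ])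
  rw [ENNReal.ofReal_mul hC]
  refine le_trans ?_ (mul_le_mul_right (hu.lintegral_mobility_le hε hduin hS) _)
  rw [← lintegral_const_mul' _ _ ENNReal.ofReal_ne_top]
  refine setLIntegral_mono' measurableSet_Ioo fun t ht => ?_
  rw [← lintegral_const_mul' _ _ ENNReal.ofReal_ne_top]
  have hP := (isOpen_posSet ((hu.cont_slice ht.1.le).mono Ioo_subset_Icc_self)).measurableSet
  rw [← lintegral_indicator hP, ← lintegral_indicator measurableSet_Ioo]
  refine lintegral_mono fun x => ?_
  by_cases hx : x ∈ Ioo α β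
  · rw [indicator_of_mem hx]
    have hx' := Ioo_subset_Icc_self hx
    by_cases hp : x ∈ posSet α β (u t)
    · rw [indicator_of_mem hp, ← ENNReal.ofReal_mul hC]
      refine ENNReal.ofReal_le_ofReal ((hK _ _ (hu.nonneg t ht.1.le x hx')).trans ?_)
      refine mul_le_mul_of_nonneg_right (mul_le_mul_of_nonneg_left ?_ hK0)
        (mul_nonneg (mobility_nonneg hε (hu.nonneg t ht.1.le x hx')) (sq_nonneg _))
      linarith [hu.le_supBound hαβ hduin ht.1 x hx', hε.2]
    · have : u t x = 0 := le_antisymm (not_lt.1 fun h => hp ⟨hx, h⟩) (hu.nonneg t ht.1.le x hx')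
      simp [this, Rterm]
  · rw [indicator_of_notMem hx]
    exact zero_le

lemma IsSolution.integral_abs_Rterm_le (hu : IsSolution n ε α β uin duin u ux uxx uxxx)
    (hε : ε ∈ Ioo (0 : ℝ) 1) (hαβ : α < β) (hduin : MemLp duin 2 (volume.restrict (Ioo α β)))
    {K : ℝ} (hK0 : 0 ≤ K) (hK : ∀ u z : ℝ, 0 ≤ u →
      Rterm n ε u z ^ 2 ≤ K * (ε + u) * (mobility n ε u * z ^ 2)) {S : ℝ} (hS : 0 < S) :
    Integrable (fun z : ℝ × ℝ => Rterm n ε (u z.1 z.2) (uxxx z.1 z.2))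
      ((volume.restrict (Ioo 0 S)).prod (volume.restrict (Ioo α β))) ∧
    ∀ e > 0, ∫ t in Ioo 0 S, ∫ x in Ioo α β, |Rterm n ε (u t x) (uxxx t x)| ≤
      e * (S * (β - α)) + e⁻¹ * (K * (1 + supBound α β uin duin) *
        ((∫ x in Ioo α β, duin x ^ 2) / |Real.log ε|)) := by
  set μ := (volume.restrict (Ioo 0 S)).prod (volume.restrict (Ioo α β))
  set X := K * (1 + supBound α β uin duin) * ((∫ x in Ioo α β, duin x ^ 2) / |Real.log ε|)
  have hX : 0 ≤ X := mul_nonneg (mul_nonneg hK0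
    (by linarith [one_le_supBound (uin := uin) (duin := duin) hαβ]))
    (div_nonneg (integral_nonneg fun _ => sq_nonneg _) (abs_nonneg _))
  have hm := hu.aemeasurable_Rterm (S := S)
  have hle := hu.lintegral_Rterm_sq_le hε hαβ hduin hK0 hK hS
  rw [← lintegral_prod (fun z : ℝ × ℝ => ENNReal.ofReal (Rterm n ε (u z.1 z.2) (uxxx z.1 z.2) ^ 2))
    (hm.pow_const 2).ennreal_ofReal] at hle
  have hi2 : Integrable (fun z : ℝ × ℝ => Rterm n ε (u z.1 z.2) (uxxx z.1 z.2) ^ 2) μ := by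
    refine ⟨(hm.pow_const 2).aestronglyMeasurable, ?_⟩
    rw [hasFiniteIntegral_iff_ofReal (Eventually.of_forall fun _ => sq_nonneg _)]
    exact hle.trans_lt ENNReal.ofReal_lt_top
  have h2 : ∫ z, Rterm n ε (u z.1 z.2) (uxxx z.1 z.2) ^ 2 ∂μ ≤ X := by
    rw [← ofReal_integral_eq_lintegral_ofReal hi2 (Eventually.of_forall fun _ => sq_nonneg _),
      ENNReal.ofReal_le_ofReal_iff hX] at hle
    exact hle
  have hi : Integrable (fun z : ℝ × ℝ => Rterm n ε (u z.1 z.2) (uxxx z.1 z.2)) μ := by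
    refine ((integrable_const (1 : ℝ)).add hi2).mono' hm.aestronglyMeasurable
      (Eventually.of_forall fun z => ?_)
    rw [Real.norm_eq_abs, Pi.add_apply, ← sq_abs]
    nlinarith [sq_nonneg (|Rterm n ε (u z.1 z.2) (uxxx z.1 z.2)| - 1)]
  refine ⟨hi, fun e he => ?_⟩
  rw [← integral_prod (fun z : ℝ × ℝ => |Rterm n ε (u z.1 z.2) (uxxx z.1 z.2)|) hi.abs]
  calc ∫ z, |Rterm n ε (u z.1 z.2) (uxxx z.1 z.2)| ∂μ
      ≤ ∫ z, (e + e⁻¹ * Rterm n ε (u z.1 z.2) (uxxx z.1 z.2) ^ 2) ∂μ := by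
        refine integral_mono hi.abs ((integrable_const e).add (hi2.const_mul _)) fun z => ?_
        change |Rterm n ε (u z.1 z.2) (uxxx z.1 z.2)| ≤
          e + e⁻¹ * Rterm n ε (u z.1 z.2) (uxxx z.1 z.2) ^ 2
        set r := Rterm n ε (u z.1 z.2) (uxxx z.1 z.2)
        have : e + e⁻¹ * r ^ 2 - |r| = e⁻¹ * ((e - |r|) ^ 2 + e * |r|) := by
          rw [← sq_abs r]; field_simp; ring
        have h3 : 0 ≤ e⁻¹ * ((e - |r|) ^ 2 + e * |r|) := by positivity
        linarith
    _ ≤ _ := by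
        rw [integral_add (integrable_const e) (hi2.const_mul _), integral_const_mul]
        have hμ : μ.real univ = S * (β - α) := by
          rw [measureReal_def, ← univ_prod_univ, Measure.prod_prod]
          simp [hS.le, hαβ.le]
        rw [integral_const, hμ, smul_eq_mul, mul_comm]
        gcongr

lemma isTest₂_mul {U : Set ℝ} {θ φ : ℝ → ℝ} {V : Set ℝ} (hθ : IsTest U θ) (hφ : IsTest V φ) :
    IsTest₂ univ fun t x => θ t * φ x := by
  refine ⟨(hθ.1.comp contDiff_fst).mul (hφ.1.comp contDiff_snd), ?_, subset_univ _⟩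
  refine HasCompactSupport.of_support_subset_isCompact (hθ.2.1.prod hφ.2.1) fun z hz => ?_
  have : θ z.1 * φ z.2 ≠ 0 := hz
  exact ⟨subset_closure (left_ne_zero_of_mul this), subset_closure (right_ne_zero_of_mul this)⟩

lemma IsTest.exists_bound {U : Set ℝ} {φ : ℝ → ℝ} (hφ : IsTest U φ) : ∃ L, ∀ x, |φ x| ≤ L :=
  hφ.2.1.exists_bound_of_continuous hφ.continuous

lemma integrableOn_integral_mul {S : ℝ} {R : ℝ → ℝ → ℝ}
    (hR : Integrable (fun z : ℝ × ℝ => R z.1 z.2)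
      ((volume.restrict (Ioo 0 S)).prod (volume.restrict (Ioo α β))))
    {φ : ℝ → ℝ} (hφ : Continuous φ) {L : ℝ} (hL : ∀ x, |φ x| ≤ L) :
    IntegrableOn (fun t => ∫ x in Ioo α β, R t x * φ x) (Ioo 0 S) := by
  have hm : AEStronglyMeasurable (fun z : ℝ × ℝ => φ z.2)
    ((volume.restrict (Ioo 0 S)).prod (volume.restrict (Ioo α β))) :=
    (hφ.comp continuous_snd).aestronglyMeasurable
  exact (hR.mul_bdd (c := L) hm (Eventually.of_forall fun z => hL z.2)).integral_prod_left

lemma integrableOn_mul_of_isTest {f θ : ℝ → ℝ} (hθ : IsTest (Ioi 0) θ) (g : ℝ → ℝ)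
    (hg : ∀ S, 0 < S → IntegrableOn g (Ioo 0 S)) (hf : ∀ t, f t = θ t * g t) :
    IntegrableOn f (Ioi 0) := by
  obtain ⟨L, hL⟩ := hθ.exists_bound
  obtain ⟨S, hS⟩ := hθ.2.1.isCompact.bddAbove
  have h1 : IntegrableOn f (Ioo 0 (max S 0 + 1)) := by
    have := (hg (max S 0 + 1) (by positivity)).bdd_mul (c := L)
      hθ.continuous.aestronglyMeasurable (Eventually.of_forall hL)
    exact this.congr (Eventually.of_forall fun t => (hf t).symm)
  refine h1.of_forall_sdiff_eq_zero measurableSet_Ioi fun t ht => ?_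
  have : t ∉ tsupport θ := fun h => ht.2 ⟨ht.1, (hS h).trans_lt (by
    linarith [le_max_left S 0])⟩
  rw [hf, image_eq_zero_of_notMem_tsupport this, zero_mul]

/-- The evolution of the pairing of the density with a test function. -/
lemma IsSolution.pairing_sub (hu : IsSolution n ε α β uin duin u ux uxx uxxx) (hn : 0 < n)
    (hn3 : n < 3) (hε : ε ∈ Ioo (0 : ℝ) 1) (hαβ : α < β)
    (hduin : MemLp duin 2 (volume.restrict (Ioo α β)))
    (hR : ∀ S > 0, Integrable (fun z : ℝ × ℝ => Rterm n ε (u z.1 z.2) (uxxx z.1 z.2))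
      ((volume.restrict (Ioo 0 S)).prod (volume.restrict (Ioo α β))))
    {φ : ℝ → ℝ} (hφ : IsTest (Ioo α β) φ) {t : ℝ} (ht : 0 < t) :
    pairing n ε α β u φ t - ∫ x in Ioo α β, Beps n ε (uin x) * φ x =
      (∫ s in Ioo 0 t, ∫ x in Ioo α β, Tterm (u s x) (ux s x) (uxxx s x) * φ x) -
      ∫ s in Ioo 0 t, ∫ x in Ioo α β, Rterm n ε (u s x) (uxxx s x) * deriv φ x := by
  set F : ℝ → ℝ := fun s => ∫ x in Ioo α β, Tterm (u s x) (ux s x) (uxxx s x) * φ x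
  set G : ℝ → ℝ := fun s => ∫ x in Ioo α β, Rterm n ε (u s x) (uxxx s x) * deriv φ x
  obtain ⟨L, hL⟩ := hφ.exists_bound
  obtain ⟨L', hL'⟩ := hφ.deriv.exists_bound
  have hF : ∀ S, 0 < S → IntegrableOn F (Ioo 0 S) := fun S hS =>
    integrableOn_integral_mul (R := fun s x => Tterm (u s x) (ux s x) (uxxx s x))
      (hu.integrable_Tterm hduin hS) hφ.continuous hL
  have hG : ∀ S, 0 < S → IntegrableOn G (Ioo 0 S) := fun S hS =>
    integrableOn_integral_mul (R := fun s x => Rterm n ε (u s x) (uxxx s x))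
      (hR S hS) hφ.continuous_deriv hL'
  have hc := hu.continuousOn_pairing hn hn3 hε hαβ hduin hφ.continuous
  have hloc : LocallyIntegrableOn (fun s => F s - G s) (Ioi 0) := fun s hs =>
    ⟨Ioo 0 (s + 1), mem_nhdsWithin_of_mem_nhds (Ioo_mem_nhds hs (by linarith)),
      (hF (s + 1) (by linarith [mem_Ioi.1 hs])).sub (hG (s + 1) (by linarith [mem_Ioi.1 hs]))⟩
  -- Products `θ(t) φ(x)` with `θ` supported in positive times turn the equation for `ρ^ε` into a
  -- weak derivative in time of the pairing.
  have hw : HasWeakDeriv (Ioi 0) (pairing n ε α β u φ) fun s => F s - G s := by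
    refine ⟨(hc.mono Ioi_subset_Ici_self).locallyIntegrableOn measurableSet_Ioi, hloc,
      fun θ hθ => ?_⟩
    have h := hu.rho_equation _ (isTest₂_mul hθ hφ)
    have h0 : θ 0 = 0 := hθ.eq_zero (by simp)
    have e1 : ∀ s x : ℝ, deriv (fun s => θ s * φ x) s = deriv θ s * φ x := fun s x =>
      deriv_mul_const ((hθ.1.differentiable (by simp)) s) _
    have e2 : ∀ s x : ℝ, deriv (fun x => θ s * φ x) x = θ s * deriv φ x := fun s x =>
      deriv_const_mul _ ((hφ.1.differentiable (by simp)) x)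
    have e3 : ∀ c : ℝ, ∀ f g : ℝ → ℝ, ∫ x in Ioo α β, f x * (c * g x) =
        c * ∫ x in Ioo α β, f x * g x := fun c f g => by
      rw [← integral_const_mul]; congr 1; ext x; ring
    simp only [e1, e2, e3, h0, zero_mul, mul_zero, integral_zero, zero_add] at h
    change (∫ s in Ioi 0, deriv θ s * pairing n ε α β u φ s) + (∫ s in Ioi 0, θ s * F s) -
      (∫ s in Ioi 0, θ s * G s) = 0 at h
    simp only [mul_comm (pairing n ε α β u φ _), mul_comm _ (θ _), mul_sub]
    rw [integral_sub (integrableOn_mul_of_isTest hθ F hF fun _ => rfl)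
      (integrableOn_mul_of_isTest hθ G hG fun _ => rfl)]
    linarith
  have hI : IntervalIntegrable (fun s => F s - G s) volume 0 t := by
    rw [intervalIntegrable_iff_integrableOn_Ioo_of_le ht.le]
    exact (hF t ht).sub (hG t ht)
  -- Such test functions do not see the initial value. It is recovered by letting the lower time
  -- tend to zero, using continuity of the pairing.
  have hlim1 : Tendsto (fun a => pairing n ε α β u φ t - pairing n ε α β u φ a) (𝓝[>] 0)
      (𝓝 (pairing n ε α β u φ t - pairing n ε α β u φ 0)) :=
    (((hc 0 self_mem_Ici).mono Ioi_subset_Ici_self).tendsto).const_sub _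
  have hlim2 : Tendsto (fun a => ∫ s in a..t, (F s - G s)) (𝓝[>] 0)
      (𝓝 (∫ s in (0 : ℝ)..t, (F s - G s))) := by
    have := intervalIntegral.continuousOn_primitive_interval_left
      ((intervalIntegrable_iff' (by simp)).1 hI) 0 left_mem_uIcc
    rw [uIcc_of_le ht.le] at this
    exact (this.mono_of_mem_nhdsWithin (Icc_mem_nhdsGT ht)).tendsto
  have heq := tendsto_nhds_unique (hlim1.congr' ?_) hlim2
  · have hz : pairing n ε α β u φ 0 = ∫ x in Ioo α β, Beps n ε (uin x) * φ x :=
      setIntegral_congr_fun measurableSet_Ioo fun x hx => by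
        simp only [hu.initial x (Ioo_subset_Icc_self hx)]
    rw [← hz, heq, intervalIntegral.integral_of_le ht.le, integral_Ioc_eq_integral_Ioo,
      integral_sub (hF t ht) (hG t ht)]
  · filter_upwards [Ioo_mem_nhdsGT ht] with a ha
    exact (hw.eq_add_integral (hc.mono Ioi_subset_Ici_self) ha.2.le
      (fun x hx => ha.1.trans_le hx.1)).2

end Solution

lemma integrableOn_mul_test {α β : ℝ} {f : ℝ → ℝ} (hf : IntegrableOn f (Ioo α β))
    {φ : ℝ → ℝ} (hφ : IsTest (Ioo α β) φ) : IntegrableOn (fun x => f x * φ x) (Ioo α β) := by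
  obtain ⟨L, hL⟩ := hφ.exists_bound
  exact hf.mul_bdd (c := L) hφ.continuous.aestronglyMeasurable (Eventually.of_forall hL)

/-! ### Families of solutions -/

/-- The hypotheses of the sharp-interface limit: a family of solutions whose densities converge. -/
structure ConvergentFamily (n α β T p : ℝ) (uin duin : ℝ → ℝ) (ε : ℕ → ℝ)
    (u ux uxx uxxx : ℕ → ℝ → ℝ → ℝ) (ρ : ℝ → ℝ → ℝ) : Prop where
  n_pos : 0 < n
  n_lt : n < 3
  lt : α < β
  pos : 0 < T
  one_le : 1 ≤ p
  cont_uin : ContinuousOn uin (Icc α β)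
  uin_nonneg : ∀ x ∈ Icc α β, 0 ≤ uin x
  memLp : MemLp duin 2 (volume.restrict (Ioo α β))
  eps_mem : ∀ k, ε k ∈ Ioo (0 : ℝ) 1
  eps_tendsto : Tendsto ε atTop (𝓝 0)
  sol : ∀ k, IsSolution n (ε k) α β uin duin (u k) (ux k) (uxx k) (uxxx k)
  integrable : IntegrableOn (Function.uncurry ρ) (Ioo 0 T ×ˢ Ioo α β)
  lim : Tendsto (fun k => ∫⁻ t in Ioo 0 T,
      (negNorm α β (fun x => Beps n (ε k) (u k t x) - ρ t x)) ^ p) atTop (𝓝 0)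

namespace ConvergentFamily

variable {n α β T p : ℝ} {uin duin : ℝ → ℝ} {ε : ℕ → ℝ} {u ux uxx uxxx : ℕ → ℝ → ℝ → ℝ}
  {ρ : ℝ → ℝ → ℝ}

lemma comp (H : ConvergentFamily n α β T p uin duin ε u ux uxx uxxx ρ) {σ : ℕ → ℕ}
    (hσ : StrictMono σ) : ConvergentFamily n α β T p uin duin (fun k => ε (σ k))
      (fun k => u (σ k)) (fun k => ux (σ k)) (fun k => uxx (σ k)) (fun k => uxxx (σ k)) ρ :=
  ⟨H.n_pos, H.n_lt, H.lt, H.pos, H.one_le, H.cont_uin, H.uin_nonneg, H.memLp, fun _ => H.eps_mem _,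
    H.eps_tendsto.comp hσ.tendsto_atTop, fun _ => H.sol _, H.integrable,
    H.lim.comp hσ.tendsto_atTop⟩

lemma tendsto_log (H : ConvergentFamily n α β T p uin duin ε u ux uxx uxxx ρ) :
    Tendsto (fun k => |Real.log (ε k)|) atTop atTop :=
  tendsto_abs_log H.eps_mem H.eps_tendsto

/-- The flux `R` vanishes in the limit. -/
lemma tendsto_Rterm (H : ConvergentFamily n α β T p uin duin ε u ux uxx uxxx ρ) :
    (∀ k, ∀ S > 0, Integrable (fun z : ℝ × ℝ => Rterm n (ε k) (u k z.1 z.2) (uxxx k z.1 z.2))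
      ((volume.restrict (Ioo 0 S)).prod (volume.restrict (Ioo α β)))) ∧
    Tendsto (fun k => ∫ t in Ioo 0 T, ∫ x in Ioo α β, |Rterm n (ε k) (u k t x) (uxxx k t x)|)
      atTop (𝓝 0) := by
  obtain ⟨K, hK0, hK⟩ := exists_sq_Rterm_le H.n_pos H.n_lt
  refine ⟨fun k S hS => ((H.sol k).integral_abs_Rterm_le (H.eps_mem k) H.lt H.memLp hK0
    (hK _ (H.eps_mem k)) hS).1, ?_⟩
  set Y := K * (1 + supBound α β uin duin) * ∫ x in Ioo α β, duin x ^ 2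
  -- The parameter `e = |ln ε|^(-1/2)` balances the two terms `e` and `e⁻¹ / |ln ε|` of the bound
  -- for `R`.
  have hlim : Tendsto (fun k => (√|Real.log (ε k)|)⁻¹ * (T * (β - α) + Y)) atTop (𝓝 0) := by
    simpa using ((tendsto_inv_atTop_zero.comp
      (Real.tendsto_sqrt_atTop.comp H.tendsto_log)).mul_const (T * (β - α) + Y))
  refine squeeze_zero (fun k => integral_nonneg fun t => integral_nonneg fun x => abs_nonneg _)
    (fun k => ?_) hlim
  have hl := abs_log_pos (H.eps_mem k)
  have hs := Real.sqrt_pos.2 hl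
  refine (((H.sol k).integral_abs_Rterm_le (H.eps_mem k) H.lt H.memLp hK0
    (hK _ (H.eps_mem k)) H.pos).2 _ (inv_pos.2 hs)).trans (le_of_eq ?_)
  have h2 : |Real.log (ε k)| = √|Real.log (ε k)| ^ 2 := (Real.sq_sqrt hl.le).symm
  set r := √|Real.log (ε k)|
  rw [h2, inv_inv]
  simp only [Y]
  field_simp

lemma tendsto_dissip (H : ConvergentFamily n α β T p uin duin ε u ux uxx uxxx ρ) :
    Tendsto (fun k => ∫⁻ t in Ioo 0 T, dissip α β (u k t) (uxxx k t)) atTop (𝓝 0) := by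
  refine tendsto_of_tendsto_of_tendsto_of_le_of_le tendsto_const_nhds ?_ (fun _ => zero_le)
    fun k => (H.sol k).lintegral_dissip_le (H.eps_mem k) H.memLp H.pos
  simpa using ENNReal.tendsto_ofReal (H.tendsto_log.const_div_atTop (∫ x in Ioo α β, duin x ^ 2))

lemma slice_integrable (H : ConvergentFamily n α β T p uin duin ε u ux uxx uxxx ρ) :
    ∀ᵐ t ∂volume.restrict (Ioo 0 T), IntegrableOn (ρ t) (Ioo α β) := by
  have := H.integrable
  rw [IntegrableOn, restrict_prod_eq] at this
  exact this.prod_right_ae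

/-- The densities are eventually bounded. -/
lemma eventually_abs_Beps_le (H : ConvergentFamily n α β T p uin duin ε u ux uxx uxxx ρ) {e : ℝ}
    (he : 0 < e) : ∀ᶠ k in atTop, ∀ t, 0 ≤ t → ∀ x ∈ Icc α β,
      0 ≤ Beps n (ε k) (u k t x) ∧ Beps n (ε k) (u k t x) ≤ 1 + e := by
  have hM := one_le_supBound (uin := uin) (duin := duin) H.lt
  obtain ⟨C, hC0, hC⟩ := exists_Beps_le H.n_pos H.n_lt hM
  have hlim : Tendsto (fun k => C / |Real.log (ε k)|) atTop (𝓝 0) :=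
    H.tendsto_log.const_div_atTop C
  filter_upwards [hlim.eventually_le_const he] with k hk t ht x hx
  have h0 := (H.sol k).nonneg t ht x hx
  exact ⟨Beps_nonneg H.n_pos H.n_lt (H.eps_mem k) h0, (hC _ (H.eps_mem k) _
    ⟨h0, (H.sol k).le_supBound_of_nonneg H.lt H.memLp ht x hx⟩).trans (by linarith)⟩

lemma integrable_Beps (H : ConvergentFamily n α β T p uin duin ε u ux uxx uxxx ρ) (k : ℕ) {t : ℝ}
    (ht : 0 ≤ t) {φ : ℝ → ℝ} (hφ : Continuous φ) :
    IntegrableOn (fun x => Beps n (ε k) (u k t x) * φ x) (Ioo α β) :=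
  Slice.integrable_of_continuousOn ((((H.sol k).continuousOn_Beps H.n_pos H.n_lt (H.eps_mem k)).comp
    (f := fun x => (t, x)) (by fun_prop) fun x hx => ⟨ht, hx⟩).mul hφ.continuousOn)

/-- Each density is eventually bounded by `2`, so a uniformly small change of the test function
changes the pairing little. The factor `c` scales `φ` into the unit ball in which `D` is dense. -/
lemma tendsto_pairing_of_dense (H : ConvergentFamily n α β T p uin duin ε u ux uxx uxxx ρ)
    {D : Set (ℝ → ℝ)} (hDt : ∀ χ ∈ D, IsTest (Ioo α β) χ)
    (hD : ∀ φ : ℝ → ℝ, IsTest (Ioo α β) φ → (∀ x, |φ x| ≤ 1 ∧ |deriv φ x| ≤ 1) →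
      ∀ e > 0, ∃ χ ∈ D, ∀ x ∈ Icc α β, |φ x - χ x| ≤ e) {t : ℝ} (ht : 0 < t)
    (hρ : IntegrableOn (ρ t) (Ioo α β))
    (hlim : ∀ χ ∈ D, Tendsto (fun k => ∫ x in Ioo α β, (Beps n (ε k) (u k t x) - ρ t x) * χ x)
      atTop (𝓝 0)) {φ : ℝ → ℝ} (hφ : IsTest (Ioo α β) φ) :
    Tendsto (fun k => pairing n (ε k) α β (u k) φ t) atTop (𝓝 (∫ x in Ioo α β, ρ t x * φ x)) := by
  obtain ⟨L, hL⟩ := hφ.exists_bound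
  obtain ⟨L', hL'⟩ := hφ.deriv.exists_bound
  have hL0 : 0 ≤ L := (abs_nonneg _).trans (hL 0)
  have hL0' : 0 ≤ L' := (abs_nonneg _).trans (hL' 0)
  set c := (1 + L + L')⁻¹
  have hc : 0 < c := by positivity
  have hcL : c * (1 + L + L') = 1 := inv_mul_cancel₀ (by positivity)
  have hφc : IsTest (Ioo α β) fun x => c * φ x :=
    ⟨contDiff_const.mul hφ.1, hφ.2.1.mul_left, (closure_mono fun x hx => right_ne_zero_of_mul hx).trans hφ.2.2⟩
  have hbd : ∀ x, |c * φ x| ≤ 1 ∧ |deriv (fun x => c * φ x) x| ≤ 1 := fun x => by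
    rw [deriv_const_mul _ ((hφ.1.differentiable (by simp)) x), abs_mul, abs_mul, abs_of_pos hc, ← hcL]
    exact ⟨mul_le_mul_of_nonneg_left (by linarith [hL x]) hc.le,
      mul_le_mul_of_nonneg_left (by linarith [hL' x]) hc.le⟩
  set Q := ∫ x in Ioo α β, (2 + |ρ t x|)
  have hQi : IntegrableOn (fun x => 2 + |ρ t x|) (Ioo α β) := (integrable_const 2).add hρ.abs
  have hQ : 0 ≤ Q := integral_nonneg fun x => by positivity
  have key : Tendsto (fun k => ∫ x in Ioo α β, (Beps n (ε k) (u k t x) - ρ t x) * (c * φ x))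
      atTop (𝓝 0) := by
    refine Metric.tendsto_nhds.2 fun δ hδ => ?_
    have he : 0 < δ / (2 * (Q + 1)) := by positivity
    obtain ⟨χ, hχD, hχ⟩ := hD _ hφc hbd _ he
    filter_upwards [H.eventually_abs_Beps_le one_pos,
      (hlim χ hχD).eventually (Metric.ball_mem_nhds 0 (half_pos hδ))] with k hk1 hk2
    rw [dist_zero_right, Real.norm_eq_abs] at hk2
    rw [dist_zero_right, Real.norm_eq_abs]
    have i1 := ((H.integrable_Beps k ht.le (hDt χ hχD).continuous).sub
      (integrableOn_mul_test hρ (hDt χ hχD)))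
    have i2 := ((H.integrable_Beps k ht.le hφc.continuous).sub (integrableOn_mul_test hρ hφc))
    have heq : ∫ x in Ioo α β, (Beps n (ε k) (u k t x) - ρ t x) * (c * φ x) =
        (∫ x in Ioo α β, (Beps n (ε k) (u k t x) - ρ t x) * χ x) +
        ∫ x in Ioo α β, (Beps n (ε k) (u k t x) - ρ t x) * (c * φ x - χ x) := by
      rw [← integral_add]
      · congr 1; ext x; ring
      · refine i1.congr (Eventually.of_forall fun x => ?_)
        simp only [Pi.sub_apply]; ring
      · refine (i2.sub i1).congr (Eventually.of_forall fun x => ?_)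
        simp only [Pi.sub_apply]; ring
    have hle : |∫ x in Ioo α β, (Beps n (ε k) (u k t x) - ρ t x) * (c * φ x - χ x)| ≤
        ∫ x in Ioo α β, (2 + |ρ t x|) * (δ / (2 * (Q + 1))) := by
      refine abs_setIntegral_le measurableSet_Ioo (hQi.mul_const _) fun x hx => ?_
      have hx' := Ioo_subset_Icc_self hx
      obtain ⟨b1, b2⟩ := hk1 t ht.le x hx'
      rw [abs_mul]
      refine mul_le_mul ((abs_sub _ _).trans ?_) (hχ x hx') (abs_nonneg _) (by positivity)
      rw [abs_of_nonneg b1]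
      linarith
    rw [integral_mul_const] at hle
    have h3 : Q * (δ / (2 * (Q + 1))) ≤ δ / 2 := by
      rw [mul_div_assoc', div_le_div_iff₀ (by positivity) (by positivity)]
      nlinarith
    rw [heq]
    exact (abs_add_le _ _).trans_lt (by linarith)
  have h4 := (key.const_mul c⁻¹).add_const (∫ x in Ioo α β, ρ t x * φ x)
  rw [mul_zero, zero_add] at h4
  refine h4.congr fun k => ?_
  have i3 := H.integrable_Beps k ht.le hφ.continuous
  have i4 := integrableOn_mul_test hρ hφ
  have : ∫ x in Ioo α β, (Beps n (ε k) (u k t x) - ρ t x) * (c * φ x) =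
      c * ((∫ x in Ioo α β, Beps n (ε k) (u k t x) * φ x) - ∫ x in Ioo α β, ρ t x * φ x) := by
    rw [← integral_sub i3 i4, ← integral_const_mul]
    congr 1; ext x; ring
  rw [this, inv_mul_cancel_left₀ hc.ne', sub_add_cancel, pairing]

end ConvergentFamily

namespace ConvergentFamily

variable {n α β T p : ℝ} {uin duin : ℝ → ℝ} {ε : ℕ → ℝ} {u ux uxx uxxx : ℕ → ℝ → ℝ → ℝ}
  {ρ : ℝ → ℝ → ℝ}

/-- Along a subsequence, the dissipation and the densities converge at almost every time. -/
lemma exists_subseq (H : ConvergentFamily n α β T p uin duin ε u ux uxx uxxx ρ) :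
    ∃ σ : ℕ → ℕ, StrictMono σ ∧ ∀ᵐ t ∂volume.restrict (Ioo 0 T),
      Tendsto (fun k => dissip α β (u (σ k) t) (uxxx (σ k) t)) atTop (𝓝 0) ∧
      ∀ φ : ℝ → ℝ, IsTest (Ioo α β) φ → Tendsto (fun k => pairing n (ε (σ k)) α β (u (σ k)) φ t)
        atTop (𝓝 (∫ x in Ioo α β, ρ t x * φ x)) := by
  obtain ⟨D, hDS, hDc, hD⟩ := exists_countable_dense_tests α β
    {φ | IsTest (Ioo α β) φ ∧ ∀ x, |φ x| ≤ 1 ∧ |deriv φ x| ≤ 1} fun φ hφ => hφ.1.continuous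
  have := hDc.to_subtype
  -- The value `none` stands for the dissipation and `some χ` for the pairing with `χ`. The latter,
  -- raised to the power `p`, is dominated by the dual norm, which is a supremum over such `χ`.
  let g : Option D → ℕ → ℝ → ℝ≥0∞ := fun i k t => i.elim (dissip α β (u k t) (uxxx k t))
    fun χ => ENNReal.ofReal |∫ x in Ioo α β, (Beps n (ε k) (u k t x) - ρ t x) * χ.1 x| ^ p
  have hp0 : 0 < p := one_pos.trans_le H.one_le
  have hm : ∀ i k, AEMeasurable (g i k) (volume.restrict (Ioo 0 T)) := by
    rintro (_ | χ) k
    · exact (H.sol k).aemeasurable_dissip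
    · have h1 : AEMeasurable (fun z : ℝ × ℝ => Beps n (ε k) (u k z.1 z.2))
          ((volume.restrict (Ioo 0 T)).prod (volume.restrict (Ioo α β))) := by
        rw [← restrict_prod_eq]
        exact (((H.sol k).continuousOn_Beps H.n_pos H.n_lt (H.eps_mem k)).mono
          (prod_mono (fun t ht => ht.1.le) Ioo_subset_Icc_self)).aemeasurable
          (measurableSet_Ioo.prod measurableSet_Ioo)
      have h2 : AEMeasurable (fun z : ℝ × ℝ => ρ z.1 z.2)
          ((volume.restrict (Ioo 0 T)).prod (volume.restrict (Ioo α β))) := by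
        have := H.integrable
        rw [IntegrableOn, restrict_prod_eq] at this
        exact this.aemeasurable
      have h3 : AEMeasurable (fun z : ℝ × ℝ => χ.1 z.2)
          ((volume.restrict (Ioo 0 T)).prod (volume.restrict (Ioo α β))) :=
        ((hDS χ.2).1.continuous.comp continuous_snd).aemeasurable
      have h4 := ((h1.sub h2).mul h3).aestronglyMeasurable.integral_prod_right'
      exact (h4.aemeasurable.norm.ennreal_ofReal).pow_const p
  have hlim : ∀ i, Tendsto (fun k => ∫⁻ t in Ioo 0 T, g i k t) atTop (𝓝 0) := by
    rintro (_ | χ)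
    · exact H.tendsto_dissip
    · refine tendsto_of_tendsto_of_tendsto_of_le_of_le tendsto_const_nhds H.lim
        (fun _ => zero_le) fun k => lintegral_mono fun t => ?_
      exact ENNReal.rpow_le_rpow (le_iSup (fun φ : {φ : ℝ → ℝ // IsTest (Ioo α β) φ ∧
        ∀ x, |φ x| ≤ 1 ∧ |deriv φ x| ≤ 1} => ENNReal.ofReal
          |∫ x in Ioo α β, (Beps n (ε k) (u k t x) - ρ t x) * φ.1 x|) ⟨χ.1, hDS χ.2⟩) hp0.le
  obtain ⟨σ, hσ, hae⟩ := exists_subseq_ae_tendsto_zero hm hlim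
  refine ⟨σ, hσ, ?_⟩
  filter_upwards [hae, H.slice_integrable, ae_restrict_mem measurableSet_Ioo] with t ht hρ htT
  refine ⟨ht none, fun φ hφ => ?_⟩
  refine (H.comp hσ).tendsto_pairing_of_dense (fun χ hχ => (hDS hχ).1)
    (fun φ h1 h2 e he => hD φ ⟨h1, h2⟩ e he) htT.1 hρ (fun χ hχ => ?_) hφ
  have h5 := ht (some ⟨χ, hχ⟩)
  have h6 := (ENNReal.continuous_rpow_const (y := 1 / p)).tendsto 0 |>.comp h5
  rw [ENNReal.zero_rpow_of_pos (by positivity)] at h6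
  have h7 : Tendsto (fun k => ENNReal.ofReal
      |∫ x in Ioo α β, (Beps n (ε (σ k)) (u (σ k) t x) - ρ t x) * χ x|) atTop (𝓝 0) := by
    refine h6.congr fun k => ?_
    change (ENNReal.ofReal _ ^ p) ^ (1 / p) = _
    rw [← ENNReal.rpow_mul, mul_one_div_cancel hp0.ne', ENNReal.rpow_one]
  have h8 := (ENNReal.tendsto_toReal ENNReal.zero_ne_top).comp h7
  refine (tendsto_zero_iff_abs_tendsto_zero _).2 ?_
  refine h8.congr fun k => ?_
  simp

/-! ### The limit density at a fixed time -/

section Time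

variable {t : ℝ}

/-- The approximate densities lie in `[0, 1 + o(1)]`, and both bounds survive testing with
non-negative functions. -/
lemma rho_mem_Icc (H : ConvergentFamily n α β T p uin duin ε u ux uxx uxxx ρ) (ht : 0 < t)
    (hρ : IntegrableOn (ρ t) (Ioo α β)) (hlim : ∀ φ : ℝ → ℝ, IsTest (Ioo α β) φ →
      Tendsto (fun k => pairing n (ε k) α β (u k) φ t) atTop (𝓝 (∫ x in Ioo α β, ρ t x * φ x))) :
    ∀ᵐ x ∂volume.restrict (Ioo α β), 0 ≤ ρ t x ∧ ρ t x ≤ 1 := by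
  have h0 : ∀ᵐ x ∂volume.restrict (Ioo α β), 0 ≤ ρ t x := by
    refine ae_nonneg_of_integral_test_nonneg hρ fun φ hφ hφ0 => ge_of_tendsto (hlim φ hφ) ?_
    filter_upwards [H.eventually_abs_Beps_le one_pos] with k hk
    exact setIntegral_nonneg (μ := volume) measurableSet_Ioo fun x hx =>
      mul_nonneg (hk t ht.le x (Ioo_subset_Icc_self hx)).1 (hφ0 x)
  have h1 : ∀ᵐ x ∂volume.restrict (Ioo α β), 0 ≤ 1 - ρ t x := by
    refine ae_nonneg_of_integral_test_nonneg ((integrable_const 1).sub hρ) fun φ hφ hφ0 => ?_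
    have hi := integrableOn_mul_test hρ hφ
    have hφi : IntegrableOn φ (Ioo α β) := hφ.integrable.integrableOn
    have heq : ∫ x in Ioo α β, (1 - ρ t x) * φ x =
        (∫ x in Ioo α β, φ x) - ∫ x in Ioo α β, ρ t x * φ x := by
      rw [← integral_sub hφi hi]
      congr 1; ext x; ring
    rw [heq, sub_nonneg]
    have hφ1 : 0 ≤ ∫ x in Ioo α β, φ x := integral_nonneg hφ0
    refine le_of_forall_pos_le_add fun δ hδ => ?_
    set e := δ / ((∫ x in Ioo α β, φ x) + 1)
    have he : 0 < e := by positivity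
    refine le_of_tendsto (hlim φ hφ) ?_
    filter_upwards [H.eventually_abs_Beps_le he] with k hk
    have h2 : pairing n (ε k) α β (u k) φ t ≤ ∫ x in Ioo α β, (1 + e) * φ x :=
      setIntegral_mono_on (H.integrable_Beps k ht.le hφ.continuous) (hφi.const_mul _)
        measurableSet_Ioo fun x hx =>
        mul_le_mul_of_nonneg_right (hk t ht.le x (Ioo_subset_Icc_self hx)).2 (hφ0 x)
    rw [integral_const_mul, add_mul, one_mul] at h2
    have h3 : e * (∫ x in Ioo α β, φ x) ≤ δ := by
      rw [div_mul_eq_mul_div, div_le_iff₀ (by positivity)]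
      nlinarith
    linarith
  filter_upwards [h0, h1] with x hx0 hx1 using ⟨hx0, by linarith⟩

/-- Near a point with `w > 0` the solutions eventually stay above `w x / 4`, so their densities are
at least `B^ε (w x / 4)`, which tends to `1`. With `ρ ≤ 1` this gives `ρ = 1` near the point. -/
lemma posSet_subset_wetSet (H : ConvergentFamily n α β T p uin duin ε u ux uxx uxxx ρ) (ht : 0 < t)
    (hρ : IntegrableOn (ρ t) (Ioo α β)) (hlim : ∀ φ : ℝ → ℝ, IsTest (Ioo α β) φ →
      Tendsto (fun k => pairing n (ε k) α β (u k) φ t) atTop (𝓝 (∫ x in Ioo α β, ρ t x * φ x)))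
    {σ : ℕ → ℕ} (hσ : Tendsto σ atTop atTop) {w : ℝ → ℝ}
    (hw : TendstoUniformlyOn (fun k => u (σ k) t) w atTop (Ioo α β)) :
    posSet α β w ⊆ wetSet α β (ρ t) := by
  intro x hx
  have hc : ContinuousOn w (Ioo α β) := hw.continuousOn (Eventually.of_forall fun k =>
    ((H.sol (σ k)).cont_slice ht.le).mono Ioo_subset_Icc_self).frequently
  have hx2 : 0 < w x / 2 := half_pos hx.2
  have hopen : IsOpen {y ∈ Ioo α β | w x / 2 < w y} :=
    hc.isOpen_inter_preimage isOpen_Ioo isOpen_Ioi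
  obtain ⟨r, hr, hrs⟩ := Metric.isOpen_iff.1 hopen x ⟨hx.1, by linarith [hx.2]⟩
  have hball : Metric.ball x r ⊆ Ioo α β := fun y hy => (hrs hy).1
  have hmem := H.rho_mem_Icc ht hρ hlim
  have hneg : ∀ᵐ y ∂volume.restrict (Ioo (x - r) (x + r)), 0 ≤ ρ t y - 1 := by
    have hsub : Ioo (x - r) (x + r) ⊆ Ioo α β := by rwa [← Real.ball_eq_Ioo]
    have hρ' := hρ.mono_set hsub
    refine ae_nonneg_of_integral_test_nonneg (hρ'.sub (integrable_const 1)) fun φ hφ hφ0 => ?_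
    have hφ' := hφ.mono hsub
    have hi := integrableOn_mul_test hρ hφ'
    have hφi : IntegrableOn φ (Ioo α β) := hφ.integrable.integrableOn
    have heq : ∫ y in Ioo (x - r) (x + r), (ρ t y - 1) * φ y =
        (∫ y in Ioo α β, ρ t y * φ y) - ∫ y in Ioo α β, φ y := by
      rw [← integral_sub hi hφi]
      refine (setIntegral_eq_of_subset_of_forall_sdiff_eq_zero measurableSet_Ioo hsub
        fun y hy => ?_).symm.trans (by congr 1; ext y; ring)
      simp [hφ.eq_zero hy.2]
    rw [heq, sub_nonneg]
    have hB : Tendsto (fun k => Beps n (ε (σ k)) (w x / 4)) atTop (𝓝 1) :=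
      (tendsto_Beps H.n_pos H.n_lt H.eps_mem H.eps_tendsto (by linarith)).comp hσ
    have h1 : Tendsto (fun k => Beps n (ε (σ k)) (w x / 4) * ∫ y in Ioo α β, φ y) atTop
        (𝓝 (∫ y in Ioo α β, φ y)) := by simpa using hB.mul_const (∫ y in Ioo α β, φ y)
    refine le_of_tendsto_of_tendsto h1 ((hlim φ hφ').comp hσ) ?_
    filter_upwards [Metric.tendstoUniformlyOn_iff.1 hw (w x / 4) (by linarith)] with k hk
    simp only [Function.comp, pairing]
    rw [← integral_const_mul]
    refine setIntegral_mono_on (hφi.const_mul _) (H.integrable_Beps _ ht.le hφ.continuous)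
      measurableSet_Ioo fun y hy => ?_
    by_cases hyr : y ∈ Ioo (x - r) (x + r)
    · refine mul_le_mul_of_nonneg_right ?_ (hφ0 y)
      refine Beps_mono H.n_pos H.n_lt (H.eps_mem _) (by linarith) ?_
      have h2 := hk y hy
      rw [Real.dist_eq] at h2
      have h3 := (hrs (by rwa [Real.ball_eq_Ioo])).2 
      linarith [(abs_lt.1 h2).2, h3]
    · simp [hφ.eq_zero hyr]
  refine ⟨hx.1, r, hr, ?_⟩
  rw [inter_eq_left.2 hball, Real.ball_eq_Ioo]
  rw [Real.ball_eq_Ioo] at hball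
  refine integral_eq_zero_of_ae ?_
  filter_upwards [hneg, ae_restrict_of_ae_restrict_of_subset hball hmem] with y h1 h2
  simp only [Pi.zero_apply]
  linarith [h2.2]

end Time

end ConvergentFamily

/-- A sequence of evolutions of regular profiles whose densities converge to `ρ`, recorded through
the limit of the time-integrated source terms. -/
structure ProfileLimit (α β T m : ℝ) (u ux uxx uxxx : ℕ → ℝ → ℝ → ℝ) (ρ : ℝ → ℝ → ℝ)
    (ρ₀ : ℝ → ℝ) : Prop where
  lt : α < β
  slice : ∀ᵐ t ∂volume.restrict (Ioo 0 T), ∀ k, Slice α β (u k t) (ux k t) (uxx k t) (uxxx k t)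
  dissip : ∀ᵐ t ∂volume.restrict (Ioo 0 T),
    Tendsto (fun k => dissip α β (u k t) (uxxx k t)) atTop (𝓝 0)
  holder : ∃ C, ∀ k, ∀ t ∈ Ioo 0 T, ∀ x ∈ Icc α β, ∀ y ∈ Icc α β,
    |u k t x - u k t y| ≤ C * √|x - y|
  bound : ∃ M, 0 < M ∧ ∀ k, ∀ t ∈ Ioo 0 T, ∀ x ∈ Icc α β, u k t x ≤ M
  energy : ∃ E, 0 ≤ E ∧ ∀ k, ∀ t ∈ Ioo 0 T, ∫ x in Ioo α β, ux k t x ^ 2 ≤ E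
  mass : ∀ k, ∀ t ∈ Ioo 0 T, ∫ x in Ioo α β, u k t x = m
  mass_pos : 0 < m
  dens : ∀ᵐ t ∂volume.restrict (Ioo 0 T), IntegrableOn (ρ t) (Ioo α β) ∧
    ∀ᵐ x ∂volume.restrict (Ioo α β), 0 ≤ ρ t x ∧ ρ t x ≤ 1
  posSet_subset : ∀ᵐ t ∂volume.restrict (Ioo 0 T), ∀ (σ : ℕ → ℕ) (w : ℝ → ℝ),
    Tendsto σ atTop atTop → TendstoUniformlyOn (fun k => u (σ k) t) w atTop (Ioo α β) →
    posSet α β w ⊆ wetSet α β (ρ t)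
  conn : ∀ᵐ t ∂volume.restrict (Ioo 0 T), IsConnected (wetSet α β (ρ t))
  flux_integrable : ∀ φ : ℝ → ℝ, IsTest (Ioo α β) φ → ∀ k,
    IntegrableOn (fun t => Tfun α β (u k t) (ux k t) (uxx k t) φ) (Ioo 0 T)
  balance : ∀ φ : ℝ → ℝ, IsTest (Ioo α β) φ → ∀ᵐ t ∂volume.restrict (Ioo 0 T),
    Tendsto (fun k => ∫ s in Ioo 0 t, Tfun α β (u k s) (ux k s) (uxx k s) φ) atTop
      (𝓝 ((∫ x in Ioo α β, ρ t x * φ x) - ∫ x in Ioo α β, ρ₀ x * φ x))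

/-! ### From families of solutions to limits of profiles -/

namespace ConvergentFamily

variable {n α β T p : ℝ} {uin duin : ℝ → ℝ} {ε : ℕ → ℝ} {u ux uxx uxxx : ℕ → ℝ → ℝ → ℝ}
  {ρ : ℝ → ℝ → ℝ}

lemma tendsto_initial (H : ConvergentFamily n α β T p uin duin ε u ux uxx uxxx ρ) {φ : ℝ → ℝ}
    (hφ : Continuous φ) :
    Tendsto (fun k => ∫ x in Ioo α β, Beps n (ε k) (uin x) * φ x) atTop
      (𝓝 (∫ x in Ioo α β, (posSet α β uin).indicator 1 x * φ x)) := by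
  have hi : IntegrableOn (fun x => 2 * |φ x|) (Ioo α β) :=
    Slice.integrable_of_continuousOn (by fun_prop)
  refine tendsto_integral_filter_of_dominated_convergence _ ?_ ?_ hi ?_
  · refine Eventually.of_forall fun k => ?_
    have := H.integrable_Beps k le_rfl hφ
    refine (this.congr_fun (fun x hx => ?_) measurableSet_Ioo).aestronglyMeasurable
    simp only [(H.sol k).initial x (Ioo_subset_Icc_self hx)]
  · filter_upwards [H.eventually_abs_Beps_le one_pos] with k hk
    filter_upwards [ae_restrict_mem measurableSet_Ioo] with x hx
    have hx' := Ioo_subset_Icc_self hx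
    have := hk 0 le_rfl x hx'
    rw [(H.sol k).initial x hx'] at this
    rw [norm_mul, Real.norm_of_nonneg this.1, Real.norm_eq_abs]
    exact mul_le_mul_of_nonneg_right (by linarith [this.2]) (abs_nonneg _)
  · filter_upwards [ae_restrict_mem measurableSet_Ioo] with x hx
    refine Tendsto.mul_const _ ?_
    by_cases hp : x ∈ posSet α β uin
    · rw [indicator_of_mem hp]
      exact tendsto_Beps H.n_pos H.n_lt H.eps_mem H.eps_tendsto hp.2
    · rw [indicator_of_notMem hp]
      have : uin x = 0 := le_antisymm (not_lt.1 fun h => hp ⟨hx, h⟩)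
        (H.uin_nonneg x (Ioo_subset_Icc_self hx))
      simp [this, Beps_zero]

lemma ae_Tfun_eq (H : ConvergentFamily n α β T p uin duin ε u ux uxx uxxx ρ) (k : ℕ) :
    ∀ᵐ t ∂volume.restrict (Ioo 0 T), ∀ φ : ℝ → ℝ, ContDiff ℝ ∞ φ →
      ∫ x in Ioo α β, Tterm (u k t x) (ux k t x) (uxxx k t x) * φ x =
        Tfun α β (u k t) (ux k t) (uxx k t) φ :=
  ae_restrict_of_ae_restrict_of_subset Ioo_subset_Ioi_self (H.sol k).T_formula

lemma balance (H : ConvergentFamily n α β T p uin duin ε u ux uxx uxxx ρ) {φ : ℝ → ℝ}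
    (hφ : IsTest (Ioo α β) φ) {t : ℝ} (ht : t ∈ Ioo 0 T)
    (hlim : Tendsto (fun k => pairing n (ε k) α β (u k) φ t) atTop
      (𝓝 (∫ x in Ioo α β, ρ t x * φ x))) :
    Tendsto (fun k => ∫ s in Ioo 0 t, Tfun α β (u k s) (ux k s) (uxx k s) φ) atTop
      (𝓝 ((∫ x in Ioo α β, ρ t x * φ x) -
        ∫ x in Ioo α β, (posSet α β uin).indicator 1 x * φ x)) := by
  obtain ⟨hR, hRlim⟩ := H.tendsto_Rterm
  obtain ⟨L, hL⟩ := hφ.deriv.exists_bound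
  have hsub : Ioo 0 t ⊆ Ioo 0 T := Ioo_subset_Ioo_right ht.2.le
  have h1 : Tendsto (fun k => ∫ s in Ioo 0 t, ∫ x in Ioo α β,
      Rterm n (ε k) (u k s x) (uxxx k s x) * deriv φ x) atTop (𝓝 0) := by
    have h2 := hRlim.mul_const L
    rw [zero_mul] at h2
    refine squeeze_zero_norm (fun k => ?_) h2
    have hRT := hR k T (ht.1.trans ht.2)
    have hi : IntegrableOn (fun s => (∫ x in Ioo α β, |Rterm n (ε k) (u k s x) (uxxx k s x)|) * L)
        (Ioo 0 T) := (hRT.abs.integral_prod_left).mul_const L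
    rw [← integral_mul_const]
    refine (norm_integral_le_of_norm_le (hi.mono_set hsub) ?_).trans (setIntegral_mono_set hi ?_
      hsub.eventuallyLE)
    · filter_upwards [ae_restrict_of_ae_restrict_of_subset hsub hRT.prod_right_ae] with s hs
      rw [← integral_mul_const]
      refine norm_integral_le_of_norm_le (hs.abs.mul_const L) (Eventually.of_forall fun x => ?_)
      rw [norm_mul]
      exact mul_le_mul_of_nonneg_left (hL x) (norm_nonneg _)
    · exact Eventually.of_forall fun s => mul_nonneg (integral_nonneg fun x => abs_nonneg _)
        ((abs_nonneg _).trans (hL 0))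
  have h3 := (hlim.sub (H.tendsto_initial hφ.continuous)).add h1
  rw [add_zero] at h3
  refine h3.congr fun k => ?_
  have h4 := (H.sol k).pairing_sub H.n_pos H.n_lt (H.eps_mem k) H.lt H.memLp (hR k) hφ ht.1
  rw [h4, sub_add_cancel]
  refine integral_congr_ae ?_
  filter_upwards [ae_restrict_of_ae_restrict_of_subset hsub (H.ae_Tfun_eq k)] with s hs
  exact hs φ hφ.1

/-- With zero mass all solutions vanish at time `t`, hence so do their densities, and `ρ ≤ 0`. The
integral of `1 - ρ` over any small ball is then positive, and nothing is wet. -/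
lemma mass_pos (H : ConvergentFamily n α β T p uin duin ε u ux uxx uxxx ρ) {t : ℝ} (ht : 0 < t)
    (hρ : IntegrableOn (ρ t) (Ioo α β)) (hne : (wetSet α β (ρ t)).Nonempty)
    (hlim : ∀ φ : ℝ → ℝ, IsTest (Ioo α β) φ →
      Tendsto (fun k => pairing n (ε k) α β (u k) φ t) atTop (𝓝 (∫ x in Ioo α β, ρ t x * φ x))) :
    0 < ∫ x in Ioo α β, uin x := by
  refine (integral_nonneg_of_ae ((ae_restrict_mem measurableSet_Ioo).mono fun x hx =>
    H.uin_nonneg x (Ioo_subset_Icc_self hx))).lt_of_ne fun h0 => ?_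
  have hu0 : ∀ k, ∀ x ∈ Ioo α β, u k t x = 0 := fun k x hx => by
    have hc := ((H.sol k).cont_slice ht.le)
    have h1 := (H.sol k).mass t ht
    rw [← h0, setIntegral_eq_zero_iff_of_nonneg_ae ((ae_restrict_mem measurableSet_Ioo).mono
      fun x hx => (H.sol k).nonneg t ht.le x (Ioo_subset_Icc_self hx))
      (Slice.integrable_of_continuousOn hc)] at h1
    exact Measure.eqOn_Ioo_of_ae_eq volume h1 (hc.mono Ioo_subset_Icc_self) continuousOn_const hx
  have hz : ∀ φ : ℝ → ℝ, IsTest (Ioo α β) φ → ∫ x in Ioo α β, ρ t x * φ x = 0 := fun φ hφ => by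
    refine tendsto_nhds_unique (hlim φ hφ) (tendsto_const_nhds.congr fun k => ?_)
    refine (setIntegral_eq_zero_of_forall_eq_zero fun x hx => ?_).symm
    rw [hu0 k x hx, Beps_zero, zero_mul]
  have hle : ∀ᵐ x ∂volume.restrict (Ioo α β), 0 ≤ -ρ t x :=
    ae_nonneg_of_integral_test_nonneg hρ.neg fun φ hφ _ => by
      simp [hz φ hφ, integral_neg]
  obtain ⟨x, hx, r, hr, hint⟩ := hne
  have hopen : IsOpen (Metric.ball x r ∩ Ioo α β) := Metric.isOpen_ball.inter isOpen_Ioo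
  have hsub : Metric.ball x r ∩ Ioo α β ⊆ Ioo α β := inter_subset_right
  have hfin : volume (Metric.ball x r ∩ Ioo α β) ≠ ⊤ :=
    ((measure_mono hsub).trans_lt measure_Ioo_lt_top).ne
  have h2 : 0 < volume.real (Metric.ball x r ∩ Ioo α β) :=
    ENNReal.toReal_pos (hopen.measure_pos volume ⟨x, Metric.mem_ball_self hr, hx⟩).ne' hfin
  have h3 : ∫ y in Metric.ball x r ∩ Ioo α β, (1 : ℝ) ≤
      ∫ y in Metric.ball x r ∩ Ioo α β, (1 - ρ t y) := by
    refine integral_mono_ae (integrableOn_const hfin)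
      ((integrableOn_const hfin).sub (hρ.mono_set hsub)) ?_
    filter_upwards [ae_restrict_of_ae_restrict_of_subset hsub hle] with y hy
    linarith
  rw [hint, setIntegral_const, smul_eq_mul, mul_one] at h3
  linarith

lemma exists_profileLimit (H : ConvergentFamily n α β T p uin duin ε u ux uxx uxxx ρ)
    (hconn : ∀ᵐ t ∂volume.restrict (Ioo 0 T), IsConnected (wetSet α β (ρ t))) :
    ∃ σ : ℕ → ℕ, StrictMono σ ∧
      (∀ᵐ t ∂volume.restrict (Ioo 0 T), ∀ φ : ℝ → ℝ, IsTest (Ioo α β) φ →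
        Tendsto (fun k => pairing n (ε (σ k)) α β (u (σ k)) φ t) atTop
          (𝓝 (∫ x in Ioo α β, ρ t x * φ x))) ∧
      ProfileLimit α β T (∫ x in Ioo α β, uin x) (fun k => u (σ k)) (fun k => ux (σ k))
        (fun k => uxx (σ k)) (fun k => uxxx (σ k)) ρ ((posSet α β uin).indicator 1) := by
  obtain ⟨σ, hσ, hae⟩ := H.exists_subseq
  have H' := H.comp hσ
  have hmem : ∀ᵐ t ∂volume.restrict (Ioo 0 T), t ∈ Ioo 0 T := ae_restrict_mem measurableSet_Ioo
  refine ⟨σ, hσ, hae.mono fun t ht => ht.2, ?_⟩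
  refine ⟨H.lt, ae_all_iff.2 fun k => ae_restrict_of_ae_restrict_of_subset Ioo_subset_Ioi_self
    (H'.sol k).ae_slice, hae.mono fun t ht => ht.1,
    ⟨_, fun k t ht => (H'.sol k).holder H.lt H.memLp ht.1⟩,
    ⟨_, one_pos.trans_le (one_le_supBound H.lt),
      fun k t ht => (H'.sol k).le_supBound H.lt H.memLp ht.1⟩,
    ⟨_, integral_nonneg fun _ => sq_nonneg _,
      fun k t ht => ((H'.sol k).integral_sq_le H.memLp ht.1).2⟩,
    fun k t ht => (H'.sol k).mass t ht.1, ?_, ?_, ?_, hconn, fun φ hφ k => ?_, fun φ hφ => ?_⟩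
  · have : (volume.restrict (Ioo 0 T)) ≠ 0 := by simp [H.pos]
    have : (ae (volume.restrict (Ioo 0 T))).NeBot := ae_neBot.2 this
    obtain ⟨t, h1, h2, h3, h4⟩ := (hae.and (H.slice_integrable.and (hconn.and hmem))).exists
    exact H'.mass_pos h4.1 h2 h3.nonempty h1.2
  · filter_upwards [hae, H.slice_integrable, hmem] with t h1 h2 h3
    exact ⟨h2, H'.rho_mem_Icc h3.1 h2 h1.2⟩
  · filter_upwards [hae, H.slice_integrable, hmem] with t h1 h2 h3 τ w hτ hw
    exact H'.posSet_subset_wetSet h3.1 h2 h1.2 hτ hw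
  · obtain ⟨L, hL⟩ := hφ.exists_bound
    refine Integrable.congr (integrableOn_integral_mul
      (R := fun s x => Tterm (u (σ k) s x) (ux (σ k) s x) (uxxx (σ k) s x))
      ((H'.sol k).integrable_Tterm H.memLp H.pos) hφ.continuous hL) ?_
    filter_upwards [H'.ae_Tfun_eq k] with t ht using ht φ hφ.1
  · filter_upwards [hae, hmem] with t h1 h2
    exact H'.balance hφ h2 (h1.2 φ hφ)

end ConvergentFamily

/-! ### The wet set -/

section WetSet

variable {α β : ℝ} {f : ℝ → ℝ}

lemma wetSet_subset : wetSet α β f ⊆ Ioo α β := fun _ hx => hx.1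

/-- For `f ≤ 1` the integral of `1 - f` vanishes only if `f = 1` almost everywhere. Integrability
matters here, since otherwise the integral could vanish by its default value. -/
lemma mem_wetSet_iff (hf : IntegrableOn f (Ioo α β))
    (h1 : ∀ᵐ x ∂volume.restrict (Ioo α β), f x ≤ 1) {x : ℝ} :
    x ∈ wetSet α β f ↔ x ∈ Ioo α β ∧
      ∃ r > 0, ∀ᵐ y ∂volume.restrict (Metric.ball x r ∩ Ioo α β), f y = 1 := by
  refine and_congr_right fun hx => exists_congr fun r => and_congr_right fun hr => ?_
  have hsub : Metric.ball x r ∩ Ioo α β ⊆ Ioo α β := inter_subset_right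
  have hfin : volume (Metric.ball x r ∩ Ioo α β) ≠ ⊤ :=
    ((measure_mono hsub).trans_lt measure_Ioo_lt_top).ne
  have hi : IntegrableOn (fun y => 1 - f y) (Metric.ball x r ∩ Ioo α β) :=
    (integrableOn_const hfin).sub (hf.mono_set hsub)
  rw [setIntegral_eq_zero_iff_of_nonneg_ae ((ae_restrict_of_ae_restrict_of_subset hsub h1).mono
    fun y hy => sub_nonneg.2 hy) hi]
  refine eventually_congr (Eventually.of_forall fun y => ?_)
  simp only [Pi.zero_apply]
  constructor <;> intro h <;> linarith

lemma isOpen_wetSet (hf : IntegrableOn f (Ioo α β))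
    (h1 : ∀ᵐ x ∂volume.restrict (Ioo α β), f x ≤ 1) : IsOpen (wetSet α β f) := by
  rw [Metric.isOpen_iff]
  intro x hx
  obtain ⟨hxI, r, hr, hx1⟩ := (mem_wetSet_iff hf h1).1 hx
  obtain ⟨r', hr', hs'⟩ := Metric.isOpen_iff.1
    ((Metric.isOpen_ball (x := x) (ε := r)).inter isOpen_Ioo) x ⟨Metric.mem_ball_self hr, hxI⟩
  refine ⟨r', hr', fun y hy => (mem_wetSet_iff hf h1).2 ⟨(hs' hy).2, r' - dist y x, ?_, ?_⟩⟩
  · exact sub_pos.2 hy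
  · refine ae_restrict_of_ae_restrict_of_subset (fun z hz => ?_) hx1
    refine hs' ?_
    have := hz.1
    rw [Metric.mem_ball] at this ⊢
    linarith [dist_triangle z y x]

lemma ae_eq_one_on_wetSet (hf : IntegrableOn f (Ioo α β))
    (h1 : ∀ᵐ x ∂volume.restrict (Ioo α β), f x ≤ 1) :
    ∀ᵐ x ∂volume.restrict (wetSet α β f), f x = 1 := by
  rw [ae_restrict_iff' (isOpen_wetSet hf h1).measurableSet, ae_iff]
  refine measure_null_of_locally_null _ fun x hx => ?_
  simp only [Classical.not_imp, mem_ofPred_eq] at hx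
  obtain ⟨hxI, r, hr, hx1⟩ := (mem_wetSet_iff hf h1).1 hx.1
  rw [ae_restrict_iff' (Metric.isOpen_ball.inter isOpen_Ioo).measurableSet, ae_iff] at hx1
  refine ⟨{y | ¬(y ∈ Metric.ball x r ∩ Ioo α β → f y = 1)}, ?_, hx1⟩
  filter_upwards [self_mem_nhdsWithin,
    mem_nhdsWithin_of_mem_nhds (Metric.ball_mem_nhds x hr)] with y hy hyr
  simp only [Classical.not_imp] at hy ⊢
  exact ⟨⟨hyr, wetSet_subset hy.1⟩, hy.2⟩

end WetSet

/-! ### Countable families of cut-off functions -/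

/-- Centres and radii of rational balls compactly contained in `(α,β)`. -/
def RatBall (α β : ℝ) : Type :=
  {q : ℚ × ℚ // 0 < q.2 ∧ Metric.closedBall (q.1 : ℝ) (2 * q.2) ⊆ Ioo α β}

instance (α β : ℝ) : Countable (RatBall α β) := by
  unfold RatBall
  infer_instance

/-- The cut-off function of a rational ball. -/
noncomputable def RatBall.bump {α β : ℝ} (q : RatBall α β) : ContDiffBump (q.1.1 : ℝ) where
  rIn := q.1.2
  rOut := 2 * q.1.2
  rIn_pos := by exact_mod_cast q.2.1
  rIn_lt_rOut := by
    have : (0 : ℝ) < q.1.2 := by exact_mod_cast q.2.1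
    linarith

namespace RatBall

variable {α β : ℝ} (q : RatBall α β)

lemma isTest : IsTest (Ioo α β) q.bump :=
  ⟨q.bump.contDiff, q.bump.hasCompactSupport, by rw [q.bump.tsupport_eq]; exact q.2.2⟩

lemma exists_mem {U : Set ℝ} (hU : IsOpen U) (hs : U ⊆ Ioo α β) {x : ℝ} (hx : x ∈ U) :
    ∃ q : RatBall α β, tsupport q.bump ⊆ U ∧ q.bump x = 1 := by
  obtain ⟨δ, hδ, hδU⟩ := Metric.isOpen_iff.1 hU x hx
  obtain ⟨r, hr0, hr⟩ := exists_rat_btwn (show (0 : ℝ) < δ / 4 by positivity)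
  obtain ⟨c, hc1, hc2⟩ := exists_rat_btwn (show x - r < x by linarith)
  have hcx : dist x (c : ℝ) ≤ r := by
    rw [Real.dist_eq, abs_of_pos (by linarith)]
    linarith
  have hsub : Metric.closedBall (c : ℝ) (2 * r) ⊆ U := fun y hy => hδU (by
    rw [Metric.mem_closedBall] at hy
    rw [Metric.mem_ball]
    have := dist_triangle y c x
    rw [dist_comm (c : ℝ) x] at this
    linarith)
  refine ⟨⟨(c, r), by exact_mod_cast hr0, hsub.trans hs⟩, ?_, ?_⟩
  · rw [ContDiffBump.tsupport_eq]; exact hsub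
  · exact ContDiffBump.one_of_mem_closedBall _ hcx

end RatBall

lemma exists_countable_dense_times {T : ℝ} {P : ℝ → Prop}
    (h : ∀ᵐ t ∂volume.restrict (Ioo 0 T), P t) :
    ∃ D : Set ℝ, D.Countable ∧ (∀ t ∈ D, t ∈ Ioo 0 T ∧ P t) ∧
      ∀ a b, 0 ≤ a → a < b → b ≤ T → ∃ t ∈ D, t ∈ Ioo a b := by
  obtain ⟨D, hDc, hD⟩ := TopologicalSpace.exists_countable_dense {t // t ∈ Ioo 0 T ∧ P t}
  refine ⟨(↑) '' D, hDc.image _, ?_, fun a b ha hab hb => ?_⟩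
  · rintro _ ⟨t, -, rfl⟩
    exact t.2
  · have hsub : Ioo a b ⊆ Ioo 0 T := Ioo_subset_Ioo ha hb
    have h1 := ae_restrict_of_ae_restrict_of_subset hsub h
    have hne : (volume.restrict (Ioo a b)) ≠ 0 := by simp [hab]
    have : (ae (volume.restrict (Ioo a b))).NeBot := ae_neBot.2 hne
    obtain ⟨t, ht, htI⟩ := (h1.and (ae_restrict_mem measurableSet_Ioo)).exists
    obtain ⟨s, hs, hsD⟩ := hD.inter_open_nonempty _ (isOpen_Ioo.preimage continuous_subtype_val)
      ⟨⟨t, hsub htI, ht⟩, htI⟩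
    exact ⟨s, ⟨s, hsD, rfl⟩, hs⟩

/-! ### Sign of the source term and monotonicity of the density -/

namespace ProfileLimit

variable {α β T m : ℝ} {u ux uxx uxxx : ℕ → ℝ → ℝ → ℝ} {ρ : ℝ → ℝ → ℝ} {ρ₀ : ℝ → ℝ}

lemma exists_subseq_limit (H : ProfileLimit α β T m u ux uxx uxxx ρ ρ₀) {t : ℝ} (ht : t ∈ Ioo 0 T)
    (hS : ∀ k, Slice α β (u k t) (ux k t) (uxx k t) (uxxx k t)) (τ : ℕ → ℕ) :
    ∃ κ : ℕ → ℕ, StrictMono κ ∧ ∃ w : ℝ → ℝ,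
      TendstoUniformlyOn (fun k => u (τ (κ k)) t) w atTop (Icc α β) := by
  obtain ⟨C, hC⟩ := H.holder
  obtain ⟨M, -, hM⟩ := H.bound
  refine exists_subseq_tendstoUniformlyOn H.lt.le (f := fun k => u (τ k) t) (M := M) (C := C)
    (fun k x hx => ?_) fun k => hC _ t ht
  rw [abs_of_nonneg ((hS _).nonneg x hx)]
  exact hM _ t ht x hx

/-- By Arzelà-Ascoli every subsequence has a further one with a limit profile, and the bound for
limits of profiles applies to that one. -/
lemma eventually_neg_le (H : ProfileLimit α β T m u ux uxx uxxx ρ ρ₀) {η : ℝ → ℝ}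
    (hη : IsTest (Ioo α β) η) (hη0 : ∀ x, 0 ≤ η x) : ∀ᵐ t ∂volume.restrict (Ioo 0 T),
      ∀ e > 0, ∀ᶠ k in atTop, -e ≤ Tfun α β (u k t) (ux k t) (uxx k t) fun x => η x ^ 2 := by
  obtain ⟨M, hM0, hM⟩ := H.bound
  obtain ⟨E, hE0, hE⟩ := H.energy
  filter_upwards [H.slice, H.dissip, ae_restrict_mem measurableSet_Ioo] with t hS hD ht e he
  by_contra hcon
  rw [not_eventually] at hcon
  obtain ⟨τ, hτ, hlt⟩ := extraction_of_frequently_atTop hcon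
  obtain ⟨κ, hκ, w, hw⟩ := H.exists_subseq_limit ht hS τ
  have hL : SliceLimit α β (fun k => u (τ (κ k)) t) (fun k => ux (τ (κ k)) t)
      (fun k => uxx (τ (κ k)) t) (fun k => uxxx (τ (κ k)) t) w :=
    ⟨fun k => hS _, hD.comp (hτ.comp hκ).tendsto_atTop, hw.mono Ioo_subset_Icc_self⟩
  obtain ⟨k, hk⟩ := (hL.eventually_neg_le_Tfun H.lt hη hη0 hM0 hE0 (fun k => hE _ t ht)
    (fun k => hM _ t ht) he).exists
  exact hlt _ hk

/-- The negative part of the source term. -/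
lemma tendsto_negPart (H : ProfileLimit α β T m u ux uxx uxxx ρ ρ₀) {η : ℝ → ℝ}
    (hη : IsTest (Ioo α β) η) (hη0 : ∀ x, 0 ≤ η x) :
    Tendsto (fun k => ∫ t in Ioo 0 T,
      max (-Tfun α β (u k t) (ux k t) (uxx k t) fun x => η x ^ 2) 0) atTop (𝓝 0) := by
  obtain ⟨M, hM0, hM⟩ := H.bound
  obtain ⟨E, hE0, hE⟩ := H.energy
  -- The uniform lower bound `-K` dominates the negative parts, so their pointwise convergence in
  -- time implies convergence in `L¹`.
  obtain ⟨K, hK0, hK⟩ := exists_le_Tfun_sq H.lt hM0 hE0 hη.1 hη0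
  have h := tendsto_integral_of_dominated_convergence (μ := volume.restrict (Ioo 0 T))
    (F := fun k t => max (-Tfun α β (u k t) (ux k t) (uxx k t) fun x => η x ^ 2) 0)
    (f := fun _ => (0 : ℝ)) (fun _ => K)
    (fun k => ((H.flux_integrable _ hη.sq k).neg.sup (integrable_const 0)).aestronglyMeasurable)
    (integrable_const K) (fun k => ?_) ?_
  · simpa using h
  · filter_upwards [H.slice, ae_restrict_mem measurableSet_Ioo] with t hS ht
    rw [Real.norm_of_nonneg (le_max_right _ _)]
    refine max_le ?_ hK0
    have h1 := hK _ _ _ _ (hS k) (hM k t ht) (hE k t ht)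
    have h2 : 0 ≤ ∫ x in Ioo α β, u k t x * uxx k t x ^ 2 * η x ^ 2 :=
      setIntegral_nonneg (μ := volume) measurableSet_Ioo fun x hx =>
        mul_nonneg (mul_nonneg ((hS k).nonneg x (Ioo_subset_Icc_self hx)) (sq_nonneg _))
          (sq_nonneg _)
    linarith
  · filter_upwards [H.eventually_neg_le hη hη0] with t ht
    rw [Metric.tendsto_nhds]
    intro e he
    filter_upwards [ht (e / 2) (half_pos he)] with k hk
    rw [dist_zero_right, Real.norm_of_nonneg (le_max_right _ _)]
    exact max_lt (by linarith) he

/-- The integral of the source over `(s, t)` tends to the increment `yt - ys`, and its negative part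
tends to zero, so the increment is non-negative. Since `|F| = F + 2 F⁻`, a vanishing increment
forces convergence of the source to zero in `L¹`. -/
lemma le_of_balance (H : ProfileLimit α β T m u ux uxx uxxx ρ ρ₀) {η : ℝ → ℝ}
    (hη : IsTest (Ioo α β) η) (hη0 : ∀ x, 0 ≤ η x) {s t : ℝ} (hs : s ∈ Ioo 0 T) (ht : t ∈ Ioo 0 T)
    (hst : s < t) {y₀ ys yt : ℝ}
    (bs : Tendsto (fun k => ∫ r in Ioo 0 s, Tfun α β (u k r) (ux k r) (uxx k r) fun x => η x ^ 2)
      atTop (𝓝 (ys - y₀)))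
    (bt : Tendsto (fun k => ∫ r in Ioo 0 t, Tfun α β (u k r) (ux k r) (uxx k r) fun x => η x ^ 2)
      atTop (𝓝 (yt - y₀))) :
    ys ≤ yt ∧ (yt ≤ ys → Tendsto (fun k => ∫⁻ r in Ioo s t,
      ENNReal.ofReal |Tfun α β (u k r) (ux k r) (uxx k r) fun x => η x ^ 2|) atTop (𝓝 0)) := by
  set F : ℕ → ℝ → ℝ := fun k r => Tfun α β (u k r) (ux k r) (uxx k r) fun x => η x ^ 2
  have hN := H.tendsto_negPart hη hη0
  have hF : ∀ k, IntegrableOn (F k) (Ioo 0 T) := fun k => H.flux_integrable _ hη.sq k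
  have hNi : ∀ k, IntegrableOn (fun r => max (-F k r) 0) (Ioo 0 T) := fun k =>
    (hF k).neg.sup (integrable_const 0)
  have hsub : Ioo s t ⊆ Ioo 0 T := Ioo_subset_Ioo hs.1.le ht.2.le
  have hd : ∀ k, ∫ r in Ioo s t, F k r = (∫ r in Ioo 0 t, F k r) - ∫ r in Ioo 0 s, F k r := by
    intro k
    have h1 : ∀ a b, 0 ≤ a → a ≤ b → b < T → IntervalIntegrable (F k) volume a b :=
      fun a b ha hab hb => (intervalIntegrable_iff_integrableOn_Ioo_of_le hab).2
        ((hF k).mono_set (Ioo_subset_Ioo ha hb.le))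
    have h2 := intervalIntegral.integral_add_adjacent_intervals (h1 0 s le_rfl hs.1.le hs.2)
      (h1 s t hs.1.le hst.le ht.2)
    rw [intervalIntegral.integral_of_le hs.1.le, intervalIntegral.integral_of_le hst.le,
      intervalIntegral.integral_of_le ht.1.le] at h2
    simp only [integral_Ioc_eq_integral_Ioo] at h2
    linarith
  have hlim : Tendsto (fun k => ∫ r in Ioo s t, F k r) atTop (𝓝 (yt - ys)) := by
    have := bt.sub bs
    rw [sub_sub_sub_cancel_right] at this
    exact this.congr fun k => (hd k).symm
  have hNle : ∀ k, ∫ r in Ioo s t, max (-F k r) 0 ≤ ∫ r in Ioo 0 T, max (-F k r) 0 := fun k =>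
    setIntegral_mono_set (hNi k) (Eventually.of_forall fun r => le_max_right _ _) hsub.eventuallyLE
  have hN0 : ∀ k, 0 ≤ ∫ r in Ioo s t, max (-F k r) 0 := fun k =>
    integral_nonneg fun r => le_max_right _ _
  have hN' : Tendsto (fun k => ∫ r in Ioo s t, max (-F k r) 0) atTop (𝓝 0) :=
    squeeze_zero hN0 hNle hN
  constructor
  · have h3 := hN'.neg
    rw [neg_zero] at h3
    refine sub_nonneg.1 (le_of_tendsto_of_tendsto' h3 hlim fun k => ?_)
    rw [← integral_neg]
    refine setIntegral_mono ((hNi k).mono_set hsub).neg ((hF k).mono_set hsub) fun r => ?_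
    linarith [le_max_left (-F k r) 0]
  · intro hle
    have h4 := hlim.add (hN'.const_mul 2)
    have h5 : Tendsto (fun k => ENNReal.ofReal
        ((∫ r in Ioo s t, F k r) + 2 * ∫ r in Ioo s t, max (-F k r) 0)) atTop (𝓝 0) := by
      have := ENNReal.tendsto_ofReal h4
      rwa [mul_zero, add_zero, ENNReal.ofReal_of_nonpos (by linarith)] at this
    refine h5.congr fun k => ?_
    have hFi := (hF k).mono_set hsub
    rw [← integral_const_mul, ← integral_add hFi (((hNi k).mono_set hsub).const_mul 2),
      ← ofReal_integral_eq_lintegral_ofReal hFi.abs (Eventually.of_forall fun r => abs_nonneg _)]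
    congr 2
    ext r
    rcases le_total 0 (F k r) with h | h
    · rw [max_eq_right (by linarith), abs_of_nonneg h]; ring
    · rw [max_eq_left (by linarith), abs_of_nonpos h]; ring

end ProfileLimit

/-! ### Saturation of the density -/

section Saturation

variable {α β : ℝ} {f g : ℝ → ℝ}

lemma integral_mul_le_of_le_one (hf : IntegrableOn f (Ioo α β))
    (h1 : ∀ᵐ x ∂volume.restrict (Ioo α β), f x ≤ 1) {φ : ℝ → ℝ} (hφ : IsTest (Ioo α β) φ)
    (hφ0 : ∀ x, 0 ≤ φ x) : ∫ x in Ioo α β, f x * φ x ≤ ∫ x in Ioo α β, φ x := by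
  refine setIntegral_mono_ae_restrict (integrableOn_mul_test hf hφ) hφ.integrable.integrableOn ?_
  filter_upwards [h1] with x hx
  exact mul_le_of_le_one_left (hφ0 x) hx

lemma integral_mul_eq_of_tsupport_subset (hf : IntegrableOn f (Ioo α β))
    (h1 : ∀ᵐ x ∂volume.restrict (Ioo α β), f x ≤ 1) {φ : ℝ → ℝ}
    (hs : tsupport φ ⊆ wetSet α β f) :
    ∫ x in Ioo α β, f x * φ x = ∫ x in Ioo α β, φ x := by
  refine integral_congr_ae ?_
  have h := ae_eq_one_on_wetSet hf h1
  rw [ae_restrict_iff' (isOpen_wetSet hf h1).measurableSet] at h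
  filter_upwards [ae_restrict_of_ae h] with x hx
  by_cases hxs : x ∈ tsupport φ
  · rw [hx (hs hxs), one_mul]
  · simp [image_eq_zero_of_notMem_tsupport hxs]

/-- Equality in the bound by `1` means that `(1 - f) φ` vanishes almost everywhere, so `f = 1`
wherever `φ > 0`, in particular on a ball around `x`. -/
lemma mem_wetSet_of_integral_le (hf : IntegrableOn f (Ioo α β))
    (h1 : ∀ᵐ x ∂volume.restrict (Ioo α β), f x ≤ 1) {φ : ℝ → ℝ} (hφ : IsTest (Ioo α β) φ)
    (hφ0 : ∀ x, 0 ≤ φ x) (hle : ∫ x in Ioo α β, φ x ≤ ∫ x in Ioo α β, f x * φ x) {x : ℝ}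
    (hx : 0 < φ x) : x ∈ wetSet α β f := by
  have hi := integrableOn_mul_test hf hφ
  have hφi : IntegrableOn φ (Ioo α β) := hφ.integrable.integrableOn
  have hxI : x ∈ Ioo α β := by
    by_contra h
    exact hx.ne' (hφ.eq_zero h)
  have h0 : ∫ x in Ioo α β, (φ x - f x * φ x) = 0 := by
    rw [integral_sub hφi hi]
    linarith [integral_mul_le_of_le_one hf h1 hφ hφ0]
  rw [setIntegral_eq_zero_iff_of_nonneg_ae (h1.mono fun y hy =>
    sub_nonneg.2 (mul_le_of_le_one_left (hφ0 y) hy)) (hφi.sub hi)] at h0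
  obtain ⟨r, hr, hrs⟩ := Metric.isOpen_iff.1 (isOpen_lt continuous_const hφ.continuous) x hx
  refine (mem_wetSet_iff hf h1).2 ⟨hxI, r, hr, ?_⟩
  have hm : MeasurableSet (Metric.ball x r ∩ Ioo α β) :=
    (Metric.isOpen_ball.inter isOpen_Ioo).measurableSet
  filter_upwards [ae_restrict_of_ae_restrict_of_subset inter_subset_right h0,
    ae_restrict_mem hm] with y hy hyr
  have hpos : 0 < φ y := hrs hyr.1
  have : φ y * (1 - f y) = 0 := by
    simp only [Pi.zero_apply] at hy
    linarith
  linarith [(mul_eq_zero.1 this).resolve_left hpos.ne']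

end Saturation

/-! ### Growth of the wet set and its identification with the positivity set -/

namespace ProfileLimit

variable {α β T m : ℝ} {u ux uxx uxxx : ℕ → ℝ → ℝ → ℝ} {ρ : ℝ → ℝ → ℝ} {ρ₀ : ℝ → ℝ}

/-- The times at which the balance of mass holds for all cut-off functions. -/
structure GoodTime (α β T : ℝ) (u ux uxx : ℕ → ℝ → ℝ → ℝ) (ρ : ℝ → ℝ → ℝ) (ρ₀ : ℝ → ℝ)
    (t : ℝ) : Prop where
  integrable : IntegrableOn (ρ t) (Ioo α β)
  le_one : ∀ᵐ x ∂volume.restrict (Ioo α β), ρ t x ≤ 1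
  conn : IsConnected (wetSet α β (ρ t))
  balance : ∀ q : RatBall α β,
    Tendsto (fun k => ∫ s in Ioo 0 t, Tfun α β (u k s) (ux k s) (uxx k s) fun x => q.bump x ^ 2)
      atTop (𝓝 ((∫ x in Ioo α β, ρ t x * q.bump x ^ 2) - ∫ x in Ioo α β, ρ₀ x * q.bump x ^ 2))

lemma ae_goodTime (H : ProfileLimit α β T m u ux uxx uxxx ρ ρ₀) :
    ∀ᵐ t ∂volume.restrict (Ioo 0 T), GoodTime α β T u ux uxx ρ ρ₀ t := by
  filter_upwards [H.dens, H.conn, ae_all_iff.2 fun q : RatBall α β => H.balance _ q.isTest.sq]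
    with t h1 h2 h3
  exact ⟨h1.1, h1.2.mono fun x hx => hx.2, h2, h3⟩

/-- The wet sets increase in time, and there is no source inside. -/
lemma wetSet_mono (H : ProfileLimit α β T m u ux uxx uxxx ρ ρ₀) {s t : ℝ} (hs : s ∈ Ioo 0 T)
    (ht : t ∈ Ioo 0 T) (hst : s < t) (gs : GoodTime α β T u ux uxx ρ ρ₀ s)
    (gt : GoodTime α β T u ux uxx ρ ρ₀ t) :
    wetSet α β (ρ s) ⊆ wetSet α β (ρ t) ∧ ∀ q : RatBall α β,
      tsupport q.bump ⊆ wetSet α β (ρ s) → Tendsto (fun k => ∫⁻ r in Ioo s t,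
        ENNReal.ofReal |Tfun α β (u k r) (ux k r) (uxx k r) fun x => q.bump x ^ 2|) atTop (𝓝 0) := by
  -- Inside the wet set the density is saturated: the pairing has its largest possible value at time
  -- `s` and can neither drop nor grow afterwards.
  have key : ∀ q : RatBall α β, tsupport q.bump ⊆ wetSet α β (ρ s) →
      (∫ x in Ioo α β, ρ s x * q.bump x ^ 2 = ∫ x in Ioo α β, q.bump x ^ 2) := fun q hq =>
    integral_mul_eq_of_tsupport_subset gs.integrable gs.le_one
      ((closure_mono fun x hx => by simpa using hx).trans hq)
  constructor
  · intro x hx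
    obtain ⟨q, hq, hqx⟩ := RatBall.exists_mem (isOpen_wetSet gs.integrable gs.le_one)
      wetSet_subset hx
    have h1 := (H.le_of_balance q.isTest (fun x => q.bump.nonneg) hs ht hst (gs.balance q)
      (gt.balance q)).1
    rw [key q hq] at h1
    exact mem_wetSet_of_integral_le gt.integrable gt.le_one q.isTest.sq (fun x => sq_nonneg _) h1
      (by rw [hqx]; norm_num)
  · intro q hq
    refine (H.le_of_balance q.isTest (fun x => q.bump.nonneg) hs ht hst (gs.balance q)
      (gt.balance q)).2 ?_
    rw [key q hq]
    exact integral_mul_le_of_le_one gt.integrable gt.le_one q.isTest.sq fun x => sq_nonneg _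

/-- At almost every time, points of the wet set have been wet before. -/
lemma ae_exists_earlier (H : ProfileLimit α β T m u ux uxx uxxx ρ ρ₀) {D : Set ℝ}
    (hDG : ∀ t ∈ D, t ∈ Ioo 0 T ∧ GoodTime α β T u ux uxx ρ ρ₀ t)
    (hD : ∀ a b, 0 ≤ a → a < b → b ≤ T → ∃ t ∈ D, t ∈ Ioo a b) :
    ∀ᵐ t ∂volume.restrict (Ioo 0 T), ∀ x ∈ wetSet α β (ρ t), ∃ s ∈ D, s < t ∧
      x ∈ wetSet α β (ρ s) := by
  -- By monotonicity a good time after the infimum of `A q` again belongs to `A q`. So the infimum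
  -- is the only time at which `q` may be wet for the first time, and the countably many infima are
  -- negligible.
  let A : ℚ → Set ℝ := fun q => {t | t ∈ Ioo 0 T ∧ GoodTime α β T u ux uxx ρ ρ₀ t ∧
    (q : ℝ) ∈ wetSet α β (ρ t)}
  have hnull : ∀ᵐ t ∂volume.restrict (Ioo 0 T), ∀ q, t ≠ sInf (A q) :=
    ae_all_iff.2 fun q => ae_restrict_of_ae (by simp [ae_iff])
  filter_upwards [H.ae_goodTime, hnull, ae_restrict_mem measurableSet_Ioo] with t gt hnt ht x hx
  have hbelow : ∀ q, BddBelow (A q) := fun q => ⟨0, fun s hs => hs.1.1.le⟩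
  have hq : ∀ q : ℚ, (q : ℝ) ∈ wetSet α β (ρ t) → ∃ a, 0 ≤ a ∧ a < t ∧ ∀ s ∈ D, a < s →
      (q : ℝ) ∈ wetSet α β (ρ s) := by
    intro q hqt
    have hmem : t ∈ A q := ⟨ht, gt, hqt⟩
    have hlt : sInf (A q) < t := (csInf_le (hbelow q) hmem).lt_of_ne (hnt q).symm
    obtain ⟨a, ha, hat⟩ := (csInf_lt_iff (hbelow q) ⟨t, hmem⟩).1 hlt
    exact ⟨a, ha.1.1.le, hat, fun s hs has =>
      (H.wetSet_mono ha.1 (hDG s hs).1 has ha.2.1 (hDG s hs).2).1 ha.2.2⟩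
  obtain ⟨r, hr, hrs⟩ := Metric.isOpen_iff.1 (isOpen_wetSet gt.integrable gt.le_one) x hx
  -- The exceptional times are controlled for rational points only. A general point lies between two
  -- wet rational points, and the connectedness of the earlier wet set covers it.
  obtain ⟨q₁, h1, h1'⟩ := exists_rat_btwn (show x - r < x by linarith)
  obtain ⟨q₂, h2, h2'⟩ := exists_rat_btwn (show x < x + r by linarith)
  rw [Real.ball_eq_Ioo] at hrs
  obtain ⟨a₁, p1, l1, s1⟩ := hq q₁ (hrs ⟨h1, by linarith⟩)
  obtain ⟨a₂, p2, l2, s2⟩ := hq q₂ (hrs ⟨by linarith, h2'⟩)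
  obtain ⟨s, hsD, hs⟩ := hD (max a₁ a₂) t (le_max_of_le_left p1) (max_lt l1 l2) ht.2.le
  exact ⟨s, hsD, hs.2, (hDG s hsD).2.conn.isPreconnected.Icc_subset
    (s1 s hsD ((le_max_left _ _).trans_lt hs.1)) (s2 s hsD ((le_max_right _ _).trans_lt hs.1))
    ⟨h1'.le, h2.le⟩⟩

/-- Along a subsequence, all limits of the profiles are positive exactly in the wet set, which is
a single interval. -/
theorem exists_subseq_posSet_eq (H : ProfileLimit α β T m u ux uxx uxxx ρ ρ₀) :
    ∃ σ : ℕ → ℕ, StrictMono σ ∧ ∀ᵐ t ∂volume.restrict (Ioo 0 T), ∀ (τ : ℕ → ℕ) (w : ℝ → ℝ),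
      Tendsto τ atTop atTop → TendstoUniformlyOn (fun k => u (σ (τ k)) t) w atTop (Icc α β) →
      ∃ a b, IsComp (posSet α β w) a b ∧ wetSet α β (ρ t) = Ioo a b ∧ posSet α β w = Ioo a b := by
  obtain ⟨M, hM0, hM⟩ := H.bound
  obtain ⟨E, hE0, hE⟩ := H.energy
  obtain ⟨D, hDc, hDG, hD⟩ := exists_countable_dense_times H.ae_goodTime
  have := hDc.to_subtype
  -- Countably many triples of a ball and two times, the ball being wet at the first time. For each
  -- of them the source converges to zero in `L¹` between the two times, and one subsequence makes
  -- all of these converge pointwise.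
  let ι := {i : RatBall α β × D × D // (i.2.1 : ℝ) < i.2.2 ∧
    tsupport i.1.bump ⊆ wetSet α β (ρ i.2.1)}
  let g : ι → ℕ → ℝ → ℝ≥0∞ := fun i k => (Ioo (i.1.2.1 : ℝ) i.1.2.2).indicator fun r =>
    ENNReal.ofReal |Tfun α β (u k r) (ux k r) (uxx k r) fun x => i.1.1.bump x ^ 2|
  have hgm : ∀ i k, AEMeasurable (g i k) (volume.restrict (Ioo 0 T)) := fun i k =>
    ((H.flux_integrable _ i.1.1.isTest.sq k).aemeasurable.norm.ennreal_ofReal).indicator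
      measurableSet_Ioo
  have hg : ∀ i, Tendsto (fun k => ∫⁻ t in Ioo 0 T, g i k t) atTop (𝓝 0) := by
    rintro ⟨⟨q, s, t⟩, hst, hq⟩
    have hs := hDG s s.2
    have ht := hDG t t.2
    refine ((H.wetSet_mono hs.1 ht.1 hst hs.2 ht.2).2 q hq).congr fun k => ?_
    rw [lintegral_indicator measurableSet_Ioo, Measure.restrict_restrict measurableSet_Ioo,
      inter_eq_left.2 (Ioo_subset_Ioo hs.1.1.le ht.1.2.le)]
  obtain ⟨σ, hσ, hae⟩ := exists_subseq_ae_tendsto_zero hgm hg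
  refine ⟨σ, hσ, ?_⟩
  filter_upwards [hae, H.ae_exists_earlier hDG hD, H.ae_goodTime, H.slice, H.dissip,
    H.posSet_subset, ae_restrict_mem measurableSet_Ioo] with t hlim hearly gt hS hdis hpos ht
    τ w hτ hw
  have hστ : Tendsto (fun k => σ (τ k)) atTop atTop := hσ.tendsto_atTop.comp hτ
  have hwI := hw.mono Ioo_subset_Icc_self
  have hL : SliceLimit α β (fun k => u (σ (τ k)) t) (fun k => ux (σ (τ k)) t)
      (fun k => uxx (σ (τ k)) t) (fun k => uxxx (σ (τ k)) t) w := ⟨fun k => hS _, hdis.comp hστ, hwI⟩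
  have hsub : posSet α β w ⊆ wetSet α β (ρ t) := hpos _ w hστ hwI
  -- end points of components are not in the wet set
  have hend : ∀ a b, IsComp (posSet α β w) a b → a ∉ wetSet α β (ρ t) ∧ b ∉ wetSet α β (ρ t) := by
    intro a b hab
    suffices h : ∀ x ∈ wetSet α β (ρ t), ∃ q : RatBall α β, q.bump x = 1 ∧
        q.bump a = 0 ∧ q.bump b = 0 by
      constructor
      · intro ha
        obtain ⟨q, h1, h2, -⟩ := h a ha
        simp [h2] at h1
      · intro hb
        obtain ⟨q, h1, -, h2⟩ := h b hb
        simp [h2] at h1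
    intro x hx
    obtain ⟨s, hsD, hst, hxs⟩ := hearly x hx
    have hs := hDG s hsD
    obtain ⟨q, hq, hqx⟩ := RatBall.exists_mem (isOpen_wetSet hs.2.integrable hs.2.le_one)
      wetSet_subset hxs
    -- A later time from the countable set is needed so that `t` lies strictly inside an interval of
    -- the family.
    obtain ⟨t', ht'D, ht'⟩ := hD t T ht.1.le ht.2 le_rfl
    have h1 := (hlim ⟨⟨q, ⟨s, hsD⟩, ⟨t', ht'D⟩⟩, hst.trans ht'.1, hq⟩).comp hτ
    have h2 : Tendsto (fun k => ENNReal.ofReal |Tfun α β (u (σ (τ k)) t) (ux (σ (τ k)) t)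
        (uxx (σ (τ k)) t) fun x => q.bump x ^ 2|) atTop (𝓝 0) := by
      refine h1.congr fun k => ?_
      have hm : t ∈ Ioo s t' := ⟨hst, ht'.1⟩
      simp only [Function.comp, g]
      rw [indicator_of_mem hm]
    have h3 : Tendsto (fun k => Tfun α β (u (σ (τ k)) t) (ux (σ (τ k)) t)
        (uxx (σ (τ k)) t) fun x => q.bump x ^ 2) atTop (𝓝 0) := by
      refine (tendsto_zero_iff_abs_tendsto_zero _).2 ?_
      refine ((ENNReal.tendsto_toReal ENNReal.zero_ne_top).comp h2).congr fun k => ?_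
      simp
    exact ⟨q, hqx, hL.eq_zero_of_tendsto_Tfun hw H.lt q.isTest (fun x => q.bump.nonneg) hM0 hE0
      (fun k => hE _ t ht) (fun k => hM _ t ht) h3 hab⟩
  -- the limit does not vanish
  have hne : (posSet α β w).Nonempty := by
    by_contra hempty
    rw [not_nonempty_iff_eq_empty] at hempty
    have hw0 : ∀ x ∈ Ioo α β, w x = 0 := fun x hx => hL.eq_zero hx (by simp [hempty])
    have hβα : 0 < β - α := sub_pos.2 H.lt
    have hm := H.mass_pos
    obtain ⟨k, hk⟩ := (Metric.tendstoUniformlyOn_iff.1 hwI (m / (2 * (β - α)))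
      (by positivity)).exists
    have h4 := setIntegral_mono_on (Slice.integrable_of_continuousOn (hS (σ (τ k))).cont)
      (integrableOn_const (C := m / (2 * (β - α))) measure_Ioo_lt_top.ne)
      measurableSet_Ioo fun x hx => by
        have := hk x hx
        rw [hw0 x hx, dist_zero_left] at this
        exact (le_abs_self _).trans this.le
    rw [H.mass _ t ht, setIntegral_const, Real.volume_real_Ioo_of_le H.lt.le, smul_eq_mul] at h4
    have h5 : (β - α) * (m / (2 * (β - α))) = m / 2 := by field_simp
    linarith
  obtain ⟨x, hx⟩ := hne
  obtain ⟨a, b, hab, hxab, -, -⟩ := exists_isComp hL.isOpen TannerLaw.posSet_subset hx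
  obtain ⟨ha, hb⟩ := hend a b hab
  -- A wet point outside `(a, b)` would, by connectedness, make the end point between it and `x`
  -- wet.
  have hwet : wetSet α β (ρ t) = Ioo a b := by
    refine Subset.antisymm (fun y hy => ?_) (hab.subset.trans hsub)
    constructor
    · by_contra! hya
      exact ha (gt.conn.isPreconnected.Icc_subset hy (hsub hx) ⟨hya, hxab.1.le⟩)
    · by_contra! hyb
      exact hb (gt.conn.isPreconnected.Icc_subset (hsub hx) hy ⟨hxab.2.le, hyb⟩)
  exact ⟨a, b, hab, hwet, (hsub.trans hwet.subset).antisymm hab.subset⟩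

end ProfileLimit

/-! ### The droplet profile on an interval -/

/-- The parabola of mass `m` on `(a,b)`. -/
noncomputable def parabola (a b m x : ℝ) : ℝ := 6 * m / (b - a) ^ 3 * ((x - a) * (b - x))

/-- The derivative of the parabola of mass `m` on `(a,b)`. -/
noncomputable def parabolaDeriv (a b m x : ℝ) : ℝ := 6 * m / (b - a) ^ 3 * (a + b - 2 * x)

/-- The droplet of mass `m` on `(a,b)`. -/
noncomputable def droplet (a b m : ℝ) : ℝ → ℝ := (Ioo a b).indicator (parabola a b m)

/-- The derivative of the droplet of mass `m` on `(a,b)`. -/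
noncomputable def dropletDeriv (a b m : ℝ) : ℝ → ℝ := (Ioo a b).indicator (parabolaDeriv a b m)

section Droplet

variable {a b m : ℝ}

lemma hasDerivAt_parabola (x : ℝ) :
    HasDerivAt (parabola a b m) (parabolaDeriv a b m x) x := by
  unfold parabola parabolaDeriv
  have h := (((hasDerivAt_id x).sub_const a).mul ((hasDerivAt_id x).const_sub b)).const_mul
    (6 * m / (b - a) ^ 3)
  refine h.congr_deriv ?_
  simp only [id]
  ring

lemma hasDerivAt_parabolaDeriv (x : ℝ) :
    HasDerivAt (parabolaDeriv a b m) (-(12 * m / (b - a) ^ 3)) x := by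
  unfold parabolaDeriv
  have h := (((hasDerivAt_id x).const_mul 2).const_sub (a + b)).const_mul (6 * m / (b - a) ^ 3)
  refine h.congr_deriv ?_
  ring

lemma continuous_parabola : Continuous (parabola a b m) := by
  unfold parabola; fun_prop

lemma continuous_parabolaDeriv : Continuous (parabolaDeriv a b m) := by
  unfold parabolaDeriv; fun_prop

lemma parabola_left : parabola a b m a = 0 := by simp [parabola]

lemma parabola_right : parabola a b m b = 0 := by simp [parabola]

lemma integral_parabola (hab : a < b) : ∫ x in a..b, parabola a b m x = m := by
  have h : ∀ x ∈ uIcc a b, HasDerivAt (fun x => 6 * m / (b - a) ^ 3 *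
      ((x - a) ^ 2 / 2 * (b - a) - (x - a) ^ 3 / 3)) (parabola a b m x) x := fun x _ => by
    have h1 := (hasDerivAt_id x).sub_const a
    have h2 := ((((h1.fun_pow 2).div_const 2).mul_const (b - a)).sub
      ((h1.fun_pow 3).div_const 3)).const_mul (6 * m / (b - a) ^ 3)
    refine h2.congr_deriv ?_
    simp only [parabola, id]
    push_cast
    ring
  rw [intervalIntegral.integral_eq_sub_of_hasDerivAt h
    (continuous_parabola.intervalIntegrable _ _)]
  have := (sub_pos.2 hab).ne'
  field_simp
  ring

lemma continuous_droplet (hab : a < b) : Continuous (droplet a b m) := by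
  refine continuous_indicator (fun x hx => ?_) continuous_parabola.continuousOn
  rw [frontier_Ioo hab] at hx
  rcases hx with rfl | rfl
  · exact parabola_left
  · exact parabola_right

variable {α β : ℝ}

lemma setIntegral_indicator_mul (h : Icc a b ⊆ Ioo α β) (f g : ℝ → ℝ) :
    ∫ x in Ioo α β, (Ioo a b).indicator f x * g x = ∫ x in Ioo a b, f x * g x := by
  have : ∀ x, (Ioo a b).indicator f x * g x = (Ioo a b).indicator (fun x => f x * g x) x :=
    fun x => (indicator_mul_left (Ioo a b) f g).symm
  simp_rw [this]
  rw [setIntegral_indicator measurableSet_Ioo, inter_eq_right.2 (Ioo_subset_Icc_self.trans h)]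

lemma integral_dropletDeriv_mul (hab : a < b) (h : Icc a b ⊆ Ioo α β) {g : ℝ → ℝ}
    (hg : ContDiff ℝ ∞ g) :
    ∫ x in Ioo α β, dropletDeriv a b m x * g x = -∫ x in Ioo α β, droplet a b m x * deriv g x := by
  unfold droplet dropletDeriv
  rw [setIntegral_indicator_mul h, setIntegral_indicator_mul h, ← integral_Ioc_eq_integral_Ioo,
    ← integral_Ioc_eq_integral_Ioo, ← intervalIntegral.integral_of_le hab.le,
    ← intervalIntegral.integral_of_le hab.le,
    intervalIntegral.integral_mul_deriv_eq_deriv_mul (u := parabola a b m) (v := g)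
      (fun x _ => hasDerivAt_parabola x)
      (fun x _ => (hg.differentiable (by simp) x).hasDerivAt)
      (continuous_parabolaDeriv.intervalIntegrable _ _)
      ((hg.continuous_deriv (by simp)).intervalIntegrable _ _), parabola_left, parabola_right]
  ring

lemma integral_droplet (hab : a < b) (h : Icc a b ⊆ Ioo α β) :
    ∫ x in Ioo α β, droplet a b m x = m := by
  have := setIntegral_indicator_mul h (parabola a b m) fun _ => 1
  simp only [mul_one] at this
  rw [droplet, this, ← integral_Ioc_eq_integral_Ioo, ← intervalIntegral.integral_of_le hab.le,
    integral_parabola hab]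

lemma memLp_dropletDeriv : MemLp (dropletDeriv a b m) 2 (volume.restrict (Ioo α β)) := by
  refine MemLp.indicator measurableSet_Ioo ?_
  obtain ⟨C, hC⟩ := isCompact_Icc.exists_bound_of_continuousOn
    (continuous_parabolaDeriv (a := a) (b := b) (m := m)).continuousOn (s := Icc α β)
  refine MemLp.of_bound continuous_parabolaDeriv.aestronglyMeasurable C ?_
  filter_upwards [ae_restrict_mem measurableSet_Ioo] with x hx using hC x (Ioo_subset_Icc_self hx)

lemma hasWeakDeriv_droplet (hab : a < b) (h : Icc a b ⊆ Ioo α β) :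
    HasWeakDeriv (Ioo α β) (droplet a b m) (dropletDeriv a b m) := by
  refine ⟨(continuous_droplet hab).locallyIntegrable.locallyIntegrableOn _, ?_, fun φ hφ => ?_⟩
  · exact IntegrableOn.locallyIntegrableOn
      ((memLp_dropletDeriv (α := α) (β := β)).integrable (by simp))
  · rw [integral_dropletDeriv_mul hab h hφ.1, neg_neg]

lemma isProfile_droplet (hab : a < b) (h : Icc a b ⊆ Ioo α β) (hm : 0 < m) :
    IsProfile α β m (Ioo a b) (droplet a b m) := by
  have heq : ∀ x ∈ Ioo a b, droplet a b m =ᶠ[𝓝 x] parabola a b m := fun x hx => by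
    filter_upwards [isOpen_Ioo.mem_nhds hx] with y hy using indicator_of_mem hy _
  refine ⟨(continuous_droplet hab).continuousOn, ⟨12 * m / (b - a) ^ 3, parabolaDeriv a b m,
    fun x hx => ⟨(hasDerivAt_parabola x).congr_of_eventuallyEq (heq x hx),
      hasDerivAt_parabolaDeriv x⟩⟩, fun x hx => ?_, fun x hx => indicator_of_notMem hx.2 _,
    integral_droplet hab h⟩
  rw [droplet, indicator_of_mem hx, parabola]
  have h1 := sub_pos.2 hx.1
  have h2 := sub_pos.2 hx.2
  have h3 := sub_pos.2 hab
  positivity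

end Droplet

/-! ### Weak convergence of the derivatives -/

lemma integral_sq_le_of_eLpNorm_le {μ : Measure ℝ} {f : ℝ → ℝ} (hf : MemLp f 2 μ) {δ : ℝ}
    (hδ : 0 ≤ δ) (h : eLpNorm f 2 μ ≤ ENNReal.ofReal δ) : ∫ x, f x ^ 2 ∂μ ≤ δ ^ 2 := by
  rw [hf.eLpNorm_eq_integral_rpow_norm (by simp) (by simp), ENNReal.ofReal_le_ofReal_iff hδ] at h
  have h0 : 0 ≤ ∫ x, ‖f x‖ ^ (2 : ℝ≥0∞).toReal ∂μ := integral_nonneg fun x => by positivity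
  have h1 := (Real.rpow_inv_le_iff_of_pos h0 hδ (by simp)).1 h
  simpa using h1

/-- Bounded sequences converge weakly as soon as they do against smooth functions. -/
lemma tendsto_integral_mul_of_smooth {α β : ℝ} {f : ℕ → ℝ → ℝ} {g : ℝ → ℝ} {E : ℝ}
    (hf : ∀ k, MemLp (f k) 2 (volume.restrict (Ioo α β)))
    (hE : ∀ k, ∫ x in Ioo α β, f k x ^ 2 ≤ E) (hg : MemLp g 2 (volume.restrict (Ioo α β)))
    (h : ∀ φ : ℝ → ℝ, ContDiff ℝ ∞ φ → Tendsto (fun k => ∫ x in Ioo α β, f k x * φ x) atTop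
      (𝓝 (∫ x in Ioo α β, g x * φ x))) {q : ℝ → ℝ} (hq : MemLp q 2 (volume.restrict (Ioo α β))) :
    Tendsto (fun k => ∫ x in Ioo α β, f k x * q x) atTop (𝓝 (∫ x in Ioo α β, g x * q x)) := by
  set μ := volume.restrict (Ioo α β)
  have hE0 : 0 ≤ E := (integral_nonneg fun _ => sq_nonneg _).trans (hE 0)
  set E' := max E (∫ x, g x ^ 2 ∂μ)
  -- Young's inequality with parameter `δ`. It is used for every `f k` and for `g`, hence the common
  -- bound `E'`.
  have key : ∀ F : ℝ → ℝ, MemLp F 2 μ → ∫ x, F x ^ 2 ∂μ ≤ E' → ∀ φ : ℝ → ℝ, MemLp φ 2 μ →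
      ∀ δ > 0, ∫ x, (q - φ) x ^ 2 ∂μ ≤ δ ^ 2 →
      |(∫ x, F x * q x ∂μ) - ∫ x, F x * φ x ∂μ| ≤ δ * (E' + 1) := by
    intro F hF hFE φ hφ δ hδ hd
    have hFq : Integrable (fun x => F x * q x) μ := hF.integrable_mul hq
    have hFφ : Integrable (fun x => F x * φ x) μ := hF.integrable_mul hφ
    rw [← integral_sub hFq hFφ]
    have hi : Integrable (fun x => δ * F x ^ 2 + δ⁻¹ * (q - φ) x ^ 2) μ :=
      (hF.integrable_sq.const_mul δ).add ((hq.sub hφ).integrable_sq.const_mul δ⁻¹)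
    calc |∫ x, (F x * q x - F x * φ x) ∂μ|
        ≤ ∫ x, (δ * F x ^ 2 + δ⁻¹ * (q - φ) x ^ 2) ∂μ := by
          refine norm_integral_le_of_norm_le (f := fun x => F x * q x - F x * φ x) hi
            (Eventually.of_forall fun x => ?_)
          rw [← mul_sub, norm_mul, Real.norm_eq_abs, Real.norm_eq_abs, Pi.sub_apply,
            ← sq_abs (F x), ← sq_abs (q x - φ x)]
          have : δ * |F x| ^ 2 + δ⁻¹ * |q x - φ x| ^ 2 - |F x| * |q x - φ x| =
              δ⁻¹ * ((δ * |F x| - |q x - φ x|) ^ 2 + δ * |F x| * |q x - φ x|) := by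
            field_simp; ring
          have h3 : 0 ≤ δ⁻¹ * ((δ * |F x| - |q x - φ x|) ^ 2 + δ * |F x| * |q x - φ x|) := by
            positivity
          linarith
      _ = δ * (∫ x, F x ^ 2 ∂μ) + δ⁻¹ * ∫ x, (q - φ) x ^ 2 ∂μ := by
          rw [integral_add (hF.integrable_sq.const_mul δ)
            ((hq.sub hφ).integrable_sq.const_mul δ⁻¹), integral_const_mul, integral_const_mul]
      _ ≤ δ * E' + δ⁻¹ * δ ^ 2 := by gcongr
      _ = δ * (E' + 1) := by field_simp
  have hE1 : 0 < E' + 1 := by linarith [le_max_left E (∫ x, g x ^ 2 ∂μ)]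
  refine Metric.tendsto_nhds.2 fun e he => ?_
  set δ := e / (4 * (E' + 1))
  have hδ : 0 < δ := by positivity
  obtain ⟨φ, hφc, hφs, hφ⟩ := hq.exist_eLpNorm_sub_le (by simp) (by simp) hδ
  have hφm : MemLp φ 2 μ := hφs.continuous.memLp_of_hasCompactSupport hφc
  have hd := integral_sq_le_of_eLpNorm_le (hq.sub hφm) hδ.le hφ
  have hδE : δ * (E' + 1) = e / 4 := by simp only [δ]; field_simp
  filter_upwards [Metric.tendsto_nhds.1 (h φ hφs) (e / 4) (by positivity)] with k hk
  have h1 := key (f k) (hf k) ((hE k).trans (le_max_left _ _)) φ hφm δ hδ hd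
  have h2 := key g hg (le_max_right _ _) φ hφm δ hδ hd
  rw [hδE] at h1 h2
  rw [Real.dist_eq] at hk ⊢
  rw [abs_lt] at hk ⊢
  rw [abs_le] at h1 h2
  constructor <;> linarith [hk.1, hk.2, h1.1, h1.2, h2.1, h2.2]

lemma tendsto_integral_mul_of_unif {α β : ℝ} {v : ℕ → ℝ → ℝ} {w h : ℝ → ℝ}
    (hv : ∀ k, ContinuousOn (v k) (Icc α β)) (hw : ContinuousOn w (Icc α β))
    (hu : TendstoUniformlyOn v w atTop (Icc α β)) (hh : IntegrableOn h (Ioo α β)) :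
    Tendsto (fun k => ∫ x in Ioo α β, v k x * h x) atTop (𝓝 (∫ x in Ioo α β, w x * h x)) := by
  obtain ⟨C, hC⟩ := isCompact_Icc.exists_bound_of_continuousOn hw
  refine tendsto_integral_filter_of_dominated_convergence (fun x => (C + 1) * |h x|)
    (Eventually.of_forall fun k => ?_) ?_ (hh.abs.const_mul _) ?_
  · exact (((hv k).mono Ioo_subset_Icc_self).aestronglyMeasurable measurableSet_Ioo).mul
      hh.aestronglyMeasurable
  · filter_upwards [Metric.tendstoUniformlyOn_iff.1 hu 1 one_pos] with k hk
    filter_upwards [ae_restrict_mem measurableSet_Ioo] with x hx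
    rw [norm_mul]
    refine mul_le_mul_of_nonneg_right ?_ (abs_nonneg _)
    have h1 := hk x (Ioo_subset_Icc_self hx)
    have h2 := hC x (Ioo_subset_Icc_self hx)
    rw [dist_comm, dist_eq_norm] at h1
    have := norm_sub_norm_le (v k x) (w x)
    linarith
  · filter_upwards [ae_restrict_mem measurableSet_Ioo] with x hx
    exact (hu.tendsto_at (Ioo_subset_Icc_self hx)).mul_const _

lemma Slice.integral_deriv_mul {α β : ℝ} {v v₁ v₂ v₃ : ℝ → ℝ} (S : Slice α β v v₁ v₂ v₃)
    (hαβ : α < β) {g : ℝ → ℝ} (hg : ContDiff ℝ ∞ g) :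
    ∫ x in Ioo α β, v₁ x * g x = v β * g β - v α * g α - ∫ x in Ioo α β, v x * deriv g x := by
  rw [← integral_Ioc_eq_integral_Ioo, ← integral_Ioc_eq_integral_Ioo,
    ← intervalIntegral.integral_of_le hαβ.le, ← intervalIntegral.integral_of_le hαβ.le]
  have h := intervalIntegral.integral_mul_deriv_eq_deriv_mul_of_hasDerivAt (a := α) (b := β)
    (u := v) (v := g) (u' := v₁) (v' := deriv g) ?_ ?_ ?_ ?_ ?_ ?_
  · rw [h]; ring
  · rw [uIcc_of_le hαβ.le]; exact S.cont
  · exact hg.continuous.continuousOn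
  · rw [min_eq_left hαβ.le, max_eq_right hαβ.le]; exact S.hasDerivAt
  · exact fun x _ => (hg.differentiable (by simp) x).hasDerivAt
  · refine ContinuousOn.intervalIntegrable ?_
    rw [uIcc_of_le hαβ.le]; exact S.cont₁
  · exact (hg.continuous_deriv (by simp)).intervalIntegrable _ _

/-! ### Convergence to the droplet profile -/

section FixedTime

variable {α β : ℝ} {v v₁ v₂ v₃ : ℕ → ℝ → ℝ} {w : ℝ → ℝ}

lemma SliceLimit.continuousOn_Icc (H : SliceLimit α β v v₁ v₂ v₃ w)
    (hu : TendstoUniformlyOn v w atTop (Icc α β)) : ContinuousOn w (Icc α β) :=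
  hu.continuousOn (Eventually.of_forall fun k => (H.slice k).cont).frequently

/-- A quadratic vanishing at `a` and `b` is a multiple of `(x - a) (b - x)`, and uniform convergence
preserves the mass, which fixes the multiple. -/
lemma SliceLimit.eqOn_droplet (H : SliceLimit α β v v₁ v₂ v₃ w) (hαβ : α < β)
    (hu : TendstoUniformlyOn v w atTop (Icc α β)) {a b m : ℝ} (hc : IsComp (posSet α β w) a b)
    (hP : posSet α β w = Ioo a b) (hs : Icc a b ⊆ Ioo α β)
    (hm : ∀ k, ∫ x in Ioo α β, v k x = m) : EqOn w (droplet a b m) (Icc α β) := by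
  have hab := hc.lt
  have hba := sub_pos.2 hab
  have hcont := H.continuousOn_Icc hu
  have ha := (H.compPoly_left hc (hs (left_mem_Icc.2 hab.le))).1
  have hb := (H.compPoly_right hc (hs (right_mem_Icc.2 hab.le))).1
  set K := deriv (deriv w) ((a + b) / 2)
  set A := compSlope w a b a
  have hb' := compPoly_eq w a b b a
  rw [ha, hb, zero_add] at hb'
  have hA : A = -(K / 2 * (b - a)) := by
    have : (A + K / 2 * (b - a)) * (b - a) = 0 := by linarith
    linarith [(mul_eq_zero.1 this).resolve_right hba.ne']
  set m' := -(K / 12 * (b - a) ^ 3)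
  have heq : EqOn w (droplet a b m') (Ioo α β) := fun x hx => by
    by_cases hxab : x ∈ Ioo a b
    · rw [(H.eqOn_comp hc x hxab).1, compPoly_eq w a b x a, ha, droplet, indicator_of_mem hxab,
        parabola]
      change 0 + A * (x - a) + K / 2 * (x - a) ^ 2 = _
      rw [hA]
      simp only [m']
      field_simp
      ring
    · rw [droplet, indicator_of_notMem hxab, H.eq_zero hx (by rwa [hP])]
  have hmm : m' = m := by
    have h1 := tendsto_integral_mul_of_unif (fun k => (H.slice k).cont) hcont hu
      (h := fun _ => 1) (integrableOn_const (by simp))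
    simp only [mul_one, hm] at h1
    rw [← tendsto_nhds_unique h1 tendsto_const_nhds, setIntegral_congr_fun measurableSet_Ioo heq,
      integral_droplet hab hs]
  rw [hmm] at heq
  exact heq.of_subset_closure hcont (continuous_droplet hab).continuousOn Ioo_subset_Icc_self
    (closure_Ioo hαβ.ne).ge

/-- Every subsequence has a further subsequence with a uniform limit, and that limit is always the
same droplet. -/
lemma tendstoUniformlyOn_droplet (hαβ : α < β)
    (hS : ∀ k, Slice α β (v k) (v₁ k) (v₂ k) (v₃ k))
    (hD : Tendsto (fun k => dissip α β (v k) (v₃ k)) atTop (𝓝 0)) {a b m : ℝ}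
    (hs : Icc a b ⊆ Ioo α β) (hm : ∀ k, ∫ x in Ioo α β, v k x = m)
    (hcpt : ∀ τ : ℕ → ℕ, ∃ κ : ℕ → ℕ, StrictMono κ ∧ ∃ w : ℝ → ℝ,
      TendstoUniformlyOn (fun k => v (τ (κ k))) w atTop (Icc α β))
    (hcore : ∀ (τ : ℕ → ℕ) (w : ℝ → ℝ), Tendsto τ atTop atTop →
      TendstoUniformlyOn (fun k => v (τ k)) w atTop (Icc α β) →
      IsComp (posSet α β w) a b ∧ posSet α β w = Ioo a b) :
    TendstoUniformlyOn v (droplet a b m) atTop (Icc α β) := by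
  rw [Metric.tendstoUniformlyOn_iff]
  intro e he
  by_contra hcon
  rw [not_eventually] at hcon
  obtain ⟨τ, hτ, hlt⟩ := extraction_of_frequently_atTop hcon
  obtain ⟨κ, hκ, w, hw⟩ := hcpt τ
  have hτκ := (hτ.comp hκ).tendsto_atTop
  obtain ⟨hc, hP⟩ := hcore _ w hτκ hw
  have hL : SliceLimit α β (fun k => v (τ (κ k))) (fun k => v₁ (τ (κ k)))
      (fun k => v₂ (τ (κ k))) (fun k => v₃ (τ (κ k))) w :=
    ⟨fun k => hS _, hD.comp hτκ, hw.mono Ioo_subset_Icc_self⟩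
  have heq := hL.eqOn_droplet hαβ hw hc hP hs fun k => hm _
  obtain ⟨k, hk⟩ := (Metric.tendstoUniformlyOn_iff.1 hw e he).exists
  exact hlt (κ k) fun x hx => heq hx ▸ hk x hx

/-- The slopes are bounded in `L²`, so testing with smooth functions suffices. After integration by
parts the boundary values of `v k` tend to those of the droplet, which are zero because its support
is interior. -/
lemma tendstoH1Weakly_droplet (hαβ : α < β)
    (hS : ∀ k, Slice α β (v k) (v₁ k) (v₂ k) (v₃ k)) {a b m E : ℝ} (hab : a < b)
    (hs : Icc a b ⊆ Ioo α β) (hE : ∀ k, ∫ x in Ioo α β, v₁ k x ^ 2 ≤ E)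
    (hu : TendstoUniformlyOn v (droplet a b m) atTop (Icc α β)) :
    TendstoH1Weakly α β v v₁ (droplet a b m) (dropletDeriv a b m) := by
  have hcont := (continuous_droplet (m := m) hab).continuousOn (s := Icc α β)
  have hunif := fun h hh => tendsto_integral_mul_of_unif (h := h) (fun k => (hS k).cont) hcont hu hh
  refine fun h hh => ⟨hunif h (hh.integrable (by simp)), ?_⟩
  have hmem : ∀ k, MemLp (v₁ k) 2 (volume.restrict (Ioo α β)) := fun k => by
    obtain ⟨C, hC⟩ := isCompact_Icc.exists_bound_of_continuousOn (hS k).cont₁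
    exact MemLp.of_bound (((hS k).cont₁.mono Ioo_subset_Icc_self).aestronglyMeasurable
      measurableSet_Ioo) C ((ae_restrict_mem measurableSet_Ioo).mono fun x hx =>
        hC x (Ioo_subset_Icc_self hx))
  refine tendsto_integral_mul_of_smooth hmem hE memLp_dropletDeriv (fun φ hφ => ?_) hh
  have hα : droplet a b m α = 0 := indicator_of_notMem
    (fun h => lt_irrefl α (hs (Ioo_subset_Icc_self h)).1) _
  have hβ : droplet a b m β = 0 := indicator_of_notMem
    (fun h => lt_irrefl β (hs (Ioo_subset_Icc_self h)).2) _
  have h1 := (((hu.tendsto_at (right_mem_Icc.2 hαβ.le)).mul_const (φ β)).sub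
    ((hu.tendsto_at (left_mem_Icc.2 hαβ.le)).mul_const (φ α))).sub
    (hunif (deriv φ) (Slice.integrable_of_continuousOn
      (hφ.continuous_deriv (by simp)).continuousOn))
  rw [hα, hβ] at h1
  rw [integral_dropletDeriv_mul hab hs hφ]
  simp only [zero_mul, sub_zero, zero_sub] at h1
  exact h1.congr fun k => ((hS k).integral_deriv_mul hαβ hφ).symm

end FixedTime

/-- Convergence to the droplet profiles on the wet sets. -/
theorem ProfileLimit.exists_subseq_droplet {α β T m : ℝ} {u ux uxx uxxx : ℕ → ℝ → ℝ → ℝ}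
    {ρ : ℝ → ℝ → ℝ} {ρ₀ : ℝ → ℝ} (H : ProfileLimit α β T m u ux uxx uxxx ρ ρ₀)
    (hcl : ∀ᵐ t ∂volume.restrict (Ioo 0 T), closure (wetSet α β (ρ t)) ⊆ Ioo α β) :
    ∃ (σ : ℕ → ℕ) (w wx : ℝ → ℝ → ℝ), StrictMono σ ∧
      ∀ᵐ t ∂volume.restrict (Ioo 0 T), IsProfile α β m (wetSet α β (ρ t)) (w t) ∧
        HasWeakDeriv (Ioo α β) (w t) (wx t) ∧ MemLp (wx t) 2 (volume.restrict (Ioo α β)) ∧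
        TendstoUniformlyOn (fun k => u (σ k) t) (w t) atTop (Ioo α β) ∧
        TendstoH1Weakly α β (fun k => u (σ k) t) (fun k => ux (σ k) t) (w t) (wx t) := by
  obtain ⟨σ, hσ, hcore⟩ := H.exists_subseq_posSet_eq
  obtain ⟨E, hE0, hE⟩ := H.energy
  -- The end points are read off from the wet set as infimum and supremum, so the limit is defined
  -- for all `t` before any time is fixed.
  refine ⟨σ, fun t => droplet (sInf (wetSet α β (ρ t))) (sSup (wetSet α β (ρ t))) m,
    fun t => dropletDeriv (sInf (wetSet α β (ρ t))) (sSup (wetSet α β (ρ t))) m, hσ, ?_⟩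
  filter_upwards [hcore, hcl, H.slice, H.dissip, ae_restrict_mem measurableSet_Ioo]
    with t hcore hcl hS hD ht
  obtain ⟨κ, hκ, w, hw⟩ := H.exists_subseq_limit ht hS σ
  obtain ⟨a, b, hc, hwet, -⟩ := hcore κ w hκ.tendsto_atTop hw
  have hab := hc.lt
  rw [hwet, closure_Ioo hab.ne] at hcl
  rw [hwet, csInf_Ioo hab, csSup_Ioo hab]
  have hu : TendstoUniformlyOn (fun k => u (σ k) t) (droplet a b m) atTop (Icc α β) := by
    refine tendstoUniformlyOn_droplet H.lt (fun k => hS _) (hD.comp hσ.tendsto_atTop) hcl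
      (fun k => H.mass _ t ht) (fun τ => H.exists_subseq_limit ht hS fun k => σ (τ k)) fun τ w hτ hw => ?_
    obtain ⟨a', b', hc', hwet', hP'⟩ := hcore τ w hτ hw
    rw [hwet] at hwet'
    have h1 : a = a' := by rw [← csInf_Ioo hab, hwet', csInf_Ioo hc'.lt]
    have h2 : b = b' := by rw [← csSup_Ioo hab, hwet', csSup_Ioo hc'.lt]
    subst h1 h2
    exact ⟨hc', hP'⟩
  exact ⟨isProfile_droplet hab hcl H.mass_pos, hasWeakDeriv_droplet hab hcl, memLp_dropletDeriv,
    hu.mono Ioo_subset_Icc_self,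
    tendstoH1Weakly_droplet H.lt (fun k => hS _) hab hcl (fun k => hE _ t ht) hu⟩

/-! ### Convergence of the source terms without concentration -/

/-- The limit of the source is now needed for test functions that are not squares. A cut-off equal
to one on the support of `φ` provides the weight in the convergence of the cubic term. -/
lemma IsTest.exists_cutoff {α β : ℝ} (hαβ : α < β) {φ : ℝ → ℝ} (hφ : IsTest (Ioo α β) φ) :
    ∃ η : ℝ → ℝ, IsTest (Ioo α β) η ∧ (∀ x, 0 ≤ η x ∧ η x ≤ 1) ∧ ∀ x ∈ tsupport φ, η x = 1 := by
  obtain ⟨a, b, ha, hab, hb, hs⟩ := hφ.exists_Icc hαβ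
  have hδ : 0 < min (a - α) (β - b) / 2 := by
    have := lt_min (sub_pos.2 ha) (sub_pos.2 hb)
    linarith
  let η : ContDiffBump ((a + b) / 2) :=
    ⟨(b - a) / 2, (b - a) / 2 + min (a - α) (β - b) / 2, by linarith, by linarith⟩
  refine ⟨η, ⟨η.contDiff, η.hasCompactSupport, ?_⟩, fun x => ⟨η.nonneg, η.le_one⟩, fun x hx =>
    η.one_of_mem_closedBall ?_⟩
  · rw [η.tsupport_eq, Real.closedBall_eq_Icc]
    have h1 := min_le_left (a - α) (β - b)
    have h2 := min_le_right (a - α) (β - b)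
    refine Icc_subset_Ioo ?_ ?_ <;> simp only [η] <;> linarith
  · rw [Real.closedBall_eq_Icc]
    have := hs hx
    simp only [η]
    exact ⟨by linarith [this.1], by linarith [this.2]⟩

section FixedTime

variable {α β : ℝ} {v v₁ v₂ v₃ : ℕ → ℝ → ℝ} {w : ℝ → ℝ}

/-- Semicontinuity holds for the non-negative weights `L + φ` and `L - φ`. As the total integrals
converge, the two lower bounds become a lower and an upper bound for the weight `φ`. -/
lemma SliceLimit.tendsto_energy_mul (H : SliceLimit α β v v₁ v₂ v₃ w)
    (hX : Tendsto (fun k => ∫ x in Ioo α β, v k x * v₂ k x ^ 2) atTop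
      (𝓝 (∫ x in posSet α β w, w x * deriv (deriv w) x ^ 2))) {φ : ℝ → ℝ}
    (hφ : Continuous φ) :
    IntegrableOn (fun x => w x * deriv (deriv w) x ^ 2 * φ x) (posSet α β w) ∧
    Tendsto (fun k => ∫ x in Ioo α β, v k x * v₂ k x ^ 2 * φ x) atTop
      (𝓝 (∫ x in posSet α β w, w x * deriv (deriv w) x ^ 2 * φ x)) := by
  obtain ⟨L, hL⟩ := isCompact_Icc.exists_bound_of_continuousOn (hφ.continuousOn (s := Icc α β))
  set A := ∫ x in posSet α β w, w x * deriv (deriv w) x ^ 2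
  have hφL : ∀ x ∈ Ioo α β, |φ x| ≤ L := fun x hx => hL x (Ioo_subset_Icc_self hx)
  have hXle : ∃ᶠ k in atTop, ∫ x in Ioo α β, v k x * v₂ k x ^ 2 * 1 ≤ A + 1 := by
    refine Eventually.frequently ?_
    simp only [mul_one]
    exact hX.eventually_le_const (by linarith)
  have hA : IntegrableOn (fun x => w x * deriv (deriv w) x ^ 2) (posSet α β w) := by
    simpa using (H.liminf_energy (φ := fun _ => 1) continuous_const (fun _ _ => zero_le_one)
      hXle).1
  have hAφ : IntegrableOn (fun x => w x * deriv (deriv w) x ^ 2 * φ x) (posSet α β w) := by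
    refine hA.mul_bdd (c := L) hφ.aestronglyMeasurable ?_
    filter_upwards [ae_restrict_mem H.isOpen.measurableSet] with x hx
    exact hφL x (posSet_subset hx)
  refine ⟨hAφ, ?_⟩
  have hvi : ∀ k, IntegrableOn (fun x => v k x * v₂ k x ^ 2 * φ x) (Ioo α β) := fun k =>
    (H.slice k).integrable_mul_sq hφ.continuousOn
  have hv : ∀ k, IntegrableOn (fun x => v k x * v₂ k x ^ 2) (Ioo α β) := fun k =>
    (H.slice k).integrable
  -- the lower bound, for `φ` and for `-φ`
  have key : ∀ c : ℝ, (c = 1 ∨ c = -1) → ∀ e > 0, ∀ᶠ k in atTop,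
      c * (∫ x in posSet α β w, w x * deriv (deriv w) x ^ 2 * φ x) - e ≤
        c * ∫ x in Ioo α β, v k x * v₂ k x ^ 2 * φ x := by
    intro c hc e he
    have hcφ : ∀ x ∈ Ioo α β, 0 ≤ L + c * φ x := fun x hx => by
      have := abs_le.1 (hφL x hx)
      rcases hc with rfl | rfl <;> linarith [this.1, this.2]
    have hs : ∀ k, ∫ x in Ioo α β, v k x * v₂ k x ^ 2 * (L + c * φ x) =
        L * (∫ x in Ioo α β, v k x * v₂ k x ^ 2) +
          c * ∫ x in Ioo α β, v k x * v₂ k x ^ 2 * φ x := fun k => by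
      rw [← integral_const_mul, ← integral_const_mul, ← integral_add ((hv k).const_mul L)
        ((hvi k).const_mul c)]
      congr 1; ext x; ring
    have hs' : ∫ x in posSet α β w, w x * deriv (deriv w) x ^ 2 * (L + c * φ x) =
        L * A + c * ∫ x in posSet α β w, w x * deriv (deriv w) x ^ 2 * φ x := by
      rw [← integral_const_mul, ← integral_const_mul, ← integral_add (hA.const_mul L)
        (hAφ.const_mul c)]
      congr 1; ext x; ring
    have hbd : ∀ k, ∫ x in Ioo α β, v k x * v₂ k x ^ 2 * (L + c * φ x) ≤
        (L + L) * ∫ x in Ioo α β, v k x * v₂ k x ^ 2 := fun k => by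
      rw [← integral_const_mul]
      refine setIntegral_mono_on ((H.slice k).integrable_mul_sq (by fun_prop))
        ((hv k).const_mul _) measurableSet_Ioo fun x hx => ?_
      have h0 := mul_nonneg ((H.slice k).nonneg x (Ioo_subset_Icc_self hx)) (sq_nonneg (v₂ k x))
      have h1 := abs_le.1 (hφL x hx)
      rw [mul_comm]
      refine mul_le_mul_of_nonneg_right ?_ h0
      rcases hc with rfl | rfl <;> linarith [h1.1, h1.2]
    have hev : ∀ᶠ k in atTop, (L + L) * ∫ x in Ioo α β, v k x * v₂ k x ^ 2 ≤ (L + L) * A + 1 :=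
      (hX.const_mul (L + L)).eventually_le_const (by linarith)
    have h2 := (H.liminf_energy (φ := fun x => L + c * φ x) (by fun_prop) hcφ
      (X := (L + L) * A + 1) (hev.mono fun k hk => (hbd k).trans hk).frequently).2 (e / 2)
      (half_pos he)
    filter_upwards [h2, (hX.const_mul L).eventually_le_const
      (show L * A < L * A + e / 2 by linarith)] with k h3 h4
    rw [hs, hs'] at h3
    linarith
  refine Metric.tendsto_nhds.2 fun e he => ?_
  filter_upwards [key 1 (Or.inl rfl) (e / 2) (half_pos he),
    key (-1) (Or.inr rfl) (e / 2) (half_pos he)] with k h1 h2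
  rw [Real.dist_eq, abs_lt]
  constructor <;> linarith

/-- Without loss in the second order term all three terms converge, so the inequality of the
semicontinuity argument becomes an equality. -/
lemma SliceLimit.tendsto_Tfun (H : SliceLimit α β v v₁ v₂ v₃ w) (hαβ : α < β) {E M : ℝ}
    (hE : ∀ k, ∫ x in Ioo α β, v₁ k x ^ 2 ≤ E) (hM : ∀ k, ∀ x ∈ Icc α β, v k x ≤ M)
    (hX : Tendsto (fun k => ∫ x in Ioo α β, v k x * v₂ k x ^ 2) atTop
      (𝓝 (∫ x in posSet α β w, w x * deriv (deriv w) x ^ 2))) {φ : ℝ → ℝ}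
    (hφ : IsTest (Ioo α β) φ) :
    Tendsto (fun k => Tfun α β (v k) (v₁ k) (v₂ k) φ) atTop
      (𝓝 (∫ x in posSet α β w, limitDensity w φ x)) := by
  obtain ⟨η, hη, hη0, hη1⟩ := hφ.exists_cutoff hαβ
  obtain ⟨L, hL⟩ := hφ.deriv.exists_bound
  have hL0 : 0 ≤ L := (abs_nonneg _).trans (hL 0)
  obtain ⟨X, hXb⟩ := hX.bddAbove_range
  obtain ⟨i1, l1⟩ := H.tendsto_energy_mul hX hφ.continuous
  obtain ⟨i2, l2⟩ := H.tendsto_cube hαβ hη (fun x => (hη0 x).1) hE (X := X) (fun k => by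
      refine le_trans ?_ (hXb (mem_range_self k))
      refine setIntegral_mono_on ((H.slice k).integrable_mul_sq
        (by have := hη.continuous; fun_prop)) (H.slice k).integrable measurableSet_Ioo
        fun x hx => ?_
      exact mul_le_of_le_one_right (mul_nonneg ((H.slice k).nonneg x (Ioo_subset_Icc_self hx))
        (sq_nonneg _)) (pow_le_one₀ (hη0 x).1 (hη0 x).2))
    hφ.continuous_deriv hL0 fun x => by
      by_cases hx : x ∈ tsupport φ
      · rw [hη1 x hx, mul_one]; exact hL x
      · have : deriv φ x = 0 := image_eq_zero_of_notMem_tsupport fun h =>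
          hx (tsupport_deriv_subset (𝕜 := ℝ) h)
        rw [this, abs_zero]
        exact mul_nonneg hL0 (hη0 x).1
  obtain ⟨i3, l3⟩ := H.tendsto_sq (K := tsupport φ) hφ.2.1 hφ.2.2 hE hM
    hφ.deriv.continuous_deriv fun x hx => image_eq_zero_of_notMem_tsupport fun h => hx
      (tsupport_deriv_subset (𝕜 := ℝ) (tsupport_deriv_subset (𝕜 := ℝ) h))
  have h := (l1.sub (l2.const_mul (5 / 6))).sub (l3.const_mul (1 / 2))
  have heq : ∫ x in posSet α β w, limitDensity w φ x =
      (∫ x in posSet α β w, w x * deriv (deriv w) x ^ 2 * φ x) -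
      5 / 6 * (∫ x in posSet α β w, deriv w x ^ 3 * deriv φ x) -
      1 / 2 * ∫ x in posSet α β w, w x * deriv w x ^ 2 * deriv (deriv φ) x := by
    have i12 : IntegrableOn (fun x => w x * deriv (deriv w) x ^ 2 * φ x -
        5 / 6 * (deriv w x ^ 3 * deriv φ x)) (posSet α β w) := i1.sub (i2.const_mul _)
    rw [← integral_const_mul, ← integral_const_mul, ← integral_sub i1 (i2.const_mul _),
      ← integral_sub i12 (i3.const_mul _)]
    rfl
  rw [heq]
  exact h

/-- Lower semicontinuity of the energy dissipation. -/
lemma SliceLimit.lintegral_le_liminf (H : SliceLimit α β v v₁ v₂ v₃ w) :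
    ∫⁻ x in posSet α β w, ENNReal.ofReal (w x * deriv (deriv w) x ^ 2) ≤
      liminf (fun k => ∫⁻ x in Ioo α β, ENNReal.ofReal (v k x * v₂ k x ^ 2)) atTop := by
  have hm := H.isOpen.measurableSet
  have hae : ∀ k, ∀ᵐ x ∂volume.restrict (posSet α β w),
      v k x * deriv (v₁ k) x ^ 2 = v k x * v₂ k x ^ 2 := fun k => by
    filter_upwards [ae_restrict_of_ae_restrict_of_subset posSet_subset (H.slice k).mul_deriv_ae,
      ae_restrict_mem hm] with x hx hxp
    by_cases hv : v k x = 0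
    · simp [hv]
    · rw [mul_left_cancel₀ hv hx]
  calc ∫⁻ x in posSet α β w, ENNReal.ofReal (w x * deriv (deriv w) x ^ 2)
      = ∫⁻ x in posSet α β w,
          liminf (fun k => ENNReal.ofReal (v k x * deriv (v₁ k) x ^ 2)) atTop := by
        refine setLIntegral_congr_fun hm fun x hx => ?_
        have h1 := (H.unif.tendsto_at (posSet_subset hx)).mul ((H.tendsto₂ hx).pow 2)
        exact (ENNReal.tendsto_ofReal h1).liminf_eq.symm
    _ ≤ liminf (fun k => ∫⁻ x in posSet α β w, ENNReal.ofReal (v k x * deriv (v₁ k) x ^ 2))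
          atTop := by
        refine lintegral_liminf_le' fun k => ?_
        have h2 := ((H.slice k).integrable.mono_set posSet_subset).aemeasurable.ennreal_ofReal
          (μ := volume.restrict (posSet α β w))
        exact h2.congr ((hae k).mono fun x hx => by simp only [hx])
    _ ≤ _ := by
        refine liminf_le_liminf (Eventually.of_forall fun k => ?_)
        refine le_trans (le_of_eq (lintegral_congr_ae ((hae k).mono fun x hx => by
          simp only [hx]))) (lintegral_mono_set posSet_subset)

end FixedTime

/-- Scheffé's lemma, with a dominated subsequence; the limit is not assumed to be measurable. -/
lemma exists_subseq_dominated {Ω : Type*} [MeasurableSpace Ω] {μ : Measure Ω}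
    {g : ℕ → Ω → ℝ≥0∞} {f : Ω → ℝ≥0∞} (hg : ∀ k, AEMeasurable (g k) μ)
    (hle : ∀ᵐ t ∂μ, f t ≤ liminf (fun k => g k t) atTop)
    (hlim : Tendsto (fun k => ∫⁻ t, g k t ∂μ) atTop (𝓝 (∫⁻ t, f t ∂μ)))
    (hf : ∫⁻ t, f t ∂μ ≠ ⊤) :
    ∃ σ : ℕ → ℕ, StrictMono σ ∧ (∀ᵐ t ∂μ, Tendsto (fun k => g (σ k) t) atTop (𝓝 (f t))) ∧
      ∃ G : Ω → ℝ≥0∞, AEMeasurable G μ ∧ ∫⁻ t, G t ∂μ ≠ ⊤ ∧ ∀ᵐ t ∂μ, ∀ k, g (σ k) t ≤ G t := by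
  set l : Ω → ℝ≥0∞ := fun t => liminf (fun k => g k t) atTop
  have hl : AEMeasurable l μ := by
    refine ⟨fun t => liminf (fun k => (hg k).mk _ t) atTop,
      Measurable.liminf fun k => (hg k).measurable_mk, ?_⟩
    filter_upwards [ae_all_iff.2 fun k => (hg k).ae_eq_mk] with t ht
    simp only [l, ht]
  have hlf : ∫⁻ t, l t ∂μ ≤ ∫⁻ t, f t ∂μ :=
    (lintegral_liminf_le' hg).trans hlim.liminf_eq.le
  -- the limit is almost everywhere equal to the measurable function `l`
  obtain ⟨h, hhm, hhf, hhe⟩ := exists_measurable_le_lintegral_eq μ f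
  have hfl : f =ᵐ[μ] l := by
    have hhl : h =ᵐ[μ] l := ae_eq_of_ae_le_of_lintegral_le
      (hle.mono fun t ht => (hhf t).trans ht) (hhe ▸ hf) hl (hhe ▸ hlf)
    filter_upwards [hhl, hle] with t h1 h2
    exact le_antisymm h2 (h1 ▸ hhf t)
  have hfm : AEMeasurable f μ := hl.congr hfl.symm
  have hfin : ∀ᵐ t ∂μ, f t < ⊤ := ae_lt_top' hfm hf
  have h1 : Tendsto (fun k => ∫⁻ t, (f t - g k t) ∂μ) atTop (𝓝 0) := by
    have := tendsto_lintegral_of_dominated_convergence' (μ := μ) (F := fun k t => f t - g k t)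
      (f := fun _ => 0) f (fun k => hfm.sub (hg k))
      (fun k => Eventually.of_forall fun t => tsub_le_self) hf ?_
    · simpa using this
    · filter_upwards [hle, hfin] with t ht htop
      refine ENNReal.tendsto_nhds_zero.2 fun e he => ?_
      rcases eq_or_ne (f t) 0 with h0 | h0
      · simp [h0]
      have hlt : f t - e < liminf (fun k => g k t) atTop :=
        (ENNReal.sub_lt_self htop.ne h0 he.ne').trans_le ht
      filter_upwards [eventually_lt_of_lt_liminf hlt] with k hk
      exact tsub_le_iff_tsub_le.1 hk.le
  -- With truncated subtraction, `g - f = g + (f - g) - f` after integration. The integrals of `g`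
  -- converge by assumption, and those of `f - g` tend to zero by dominated convergence.
  have h2 : Tendsto (fun k => ∫⁻ t, (g k t - f t) ∂μ) atTop (𝓝 0) := by
    have h3 : ∀ k, ∫⁻ t, (g k t - f t) ∂μ =
        ((∫⁻ t, g k t ∂μ) + ∫⁻ t, (f t - g k t) ∂μ) - ∫⁻ t, f t ∂μ := fun k => by
      refine ENNReal.eq_sub_of_add_eq hf ?_
      rw [← lintegral_add_right' _ hfm, ← lintegral_add_left' (hg k)]
      refine lintegral_congr fun t => ?_
      rcases le_total (g k t) (f t) with h | h
      · rw [tsub_eq_zero_of_le h, zero_add, add_tsub_cancel_of_le h]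
      · rw [tsub_eq_zero_of_le h, add_zero, tsub_add_cancel_of_le h]
    simp_rw [h3]
    have h4 := ENNReal.Tendsto.sub (hlim.add h1) (tendsto_const_nhds (x := ∫⁻ t, f t ∂μ))
      (Or.inr hf)
    rwa [add_zero, tsub_self] at h4
  have h5 : Tendsto (fun k => ∫⁻ t, ((g k t - f t) + (f t - g k t)) ∂μ) atTop (𝓝 0) := by
    have := h2.add h1
    rw [add_zero] at this
    exact this.congr fun k => (lintegral_add_left' ((hg k).sub hfm) _).symm
  have hev : ∀ j : ℕ, ∀ᶠ k in atTop,
      ∫⁻ t, ((g k t - f t) + (f t - g k t)) ∂μ ≤ 2⁻¹ ^ j := fun j =>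
    h5.eventually_le_const (ENNReal.pow_pos (by simp) j)
  -- Along a subsequence the distances to `f` are summable in `L¹`. The sum yields both the a.e.
  -- convergence and, added to `f`, the majorant.
  obtain ⟨σ, hσ, hp⟩ := extraction_forall_of_eventually hev
  have hdm : ∀ k, AEMeasurable (fun t => (g (σ k) t - f t) + (f t - g (σ k) t)) μ := fun k =>
    ((hg _).sub hfm).add (hfm.sub (hg _))
  have hfinS : ∫⁻ t, ∑' k, ((g (σ k) t - f t) + (f t - g (σ k) t)) ∂μ ≠ ⊤ := by
    rw [lintegral_tsum hdm]
    refine ne_top_of_le_ne_top ?_ (ENNReal.tsum_le_tsum hp)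
    rw [ENNReal.tsum_geometric]
    simp
  refine ⟨σ, hσ, ?_, fun t => f t + ∑' k, ((g (σ k) t - f t) + (f t - g (σ k) t)),
    hfm.add (AEMeasurable.tsum hdm), ?_, Eventually.of_forall fun t k => ?_⟩
  · filter_upwards [ae_lt_top' (AEMeasurable.tsum hdm) hfinS, hfin] with t ht hft
    have h6 := ENNReal.tendsto_atTop_zero_of_tsum_ne_top ht.ne
    refine (ENNReal.tendsto_nhds hft.ne).2 fun e he => ?_
    filter_upwards [ENNReal.tendsto_nhds_zero.1 h6 e he] with k hk
    refine ⟨?_, ?_⟩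
    · exact tsub_le_iff_left.2 (tsub_le_iff_right.1 (le_add_self.trans hk))
    · exact tsub_le_iff_left.1 (le_self_add.trans hk)
  · rw [lintegral_add_left' hfm]
    exact ENNReal.add_ne_top.2 ⟨hf, hfinS⟩
  · have h7 : g (σ k) t - f t ≤ ∑' k, ((g (σ k) t - f t) + (f t - g (σ k) t)) :=
      le_self_add.trans (ENNReal.le_tsum (f := fun k => (g (σ k) t - f t) + (f t - g (σ k) t)) k)
    exact tsub_le_iff_left.1 h7

/-! ### Test functions of two variables -/

namespace IsTest₂

variable {W : Set (ℝ × ℝ)} {ψ : ℝ → ℝ → ℝ}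

lemma mono (h : IsTest₂ W ψ) {V : Set (ℝ × ℝ)} (hV : W ⊆ V) : IsTest₂ V ψ :=
  ⟨h.1, h.2.1, h.2.2.trans hV⟩

lemma eq_zero (h : IsTest₂ W ψ) {t x : ℝ} (hz : (t, x) ∉ W) : ψ t x = 0 :=
  image_eq_zero_of_notMem_tsupport (f := Function.uncurry ψ) (x := (t, x)) fun h' => hz (h.2.2 h')

lemma exists_bound (h : IsTest₂ W ψ) : ∃ L, ∀ t x, |ψ t x| ≤ L := by
  obtain ⟨L, hL⟩ := h.2.1.exists_bound_of_continuous h.1.continuous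
  exact ⟨L, fun t x => hL (t, x)⟩

lemma slice {I J : Set ℝ} (h : IsTest₂ (I ×ˢ J) ψ) (t : ℝ) : IsTest J (ψ t) := by
  have hsub : tsupport (ψ t) ⊆ {x | (t, x) ∈ tsupport (Function.uncurry ψ)} :=
    closure_minimal (fun x hx => subset_tsupport (Function.uncurry ψ)
      (show (t, x) ∈ Function.support (Function.uncurry ψ) from hx))
      ((isClosed_tsupport _).preimage (by fun_prop : Continuous fun x : ℝ => (t, x)))
  refine ⟨h.1.comp (contDiff_const.prodMk contDiff_id), ?_, fun x hx => (h.2.2 (hsub hx)).2⟩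
  exact HasCompactSupport.of_support_subset_isCompact (h.2.1.isCompact.image continuous_snd)
    fun x hx => ⟨(t, x), hsub (subset_tsupport _ hx), rfl⟩

lemma fderiv_apply (h : IsTest₂ W ψ) (e : ℝ × ℝ) :
    IsTest₂ W fun t x => fderiv ℝ (Function.uncurry ψ) (t, x) e := by
  have hsub : tsupport (fun z => fderiv ℝ (Function.uncurry ψ) z e) ⊆
      tsupport (Function.uncurry ψ) := by
    refine subset_trans (closure_mono (t := Function.support (fderiv ℝ (Function.uncurry ψ)))
      fun z hz h0 => hz ?_) (tsupport_fderiv_subset ℝ)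
    simp [h0]
  have heq : Function.uncurry (fun t x => fderiv ℝ (Function.uncurry ψ) (t, x) e) =
      fun z => fderiv ℝ (Function.uncurry ψ) z e := rfl
  refine ⟨?_, ?_, ?_⟩
  · rw [heq]
    exact (h.1.fderiv_right (by simp)).clm_apply contDiff_const
  · rw [heq]
    exact HasCompactSupport.of_support_subset_isCompact h.2.1 ((subset_tsupport _).trans hsub)
  · rw [heq]
    exact hsub.trans h.2.2

lemma deriv_snd_eq (h : IsTest₂ W ψ) (t x : ℝ) :
    deriv (ψ t) x = fderiv ℝ (Function.uncurry ψ) (t, x) (0, 1) := by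
  have h1 : HasDerivAt (fun y : ℝ => (t, y)) ((0 : ℝ), (1 : ℝ)) x :=
    (hasDerivAt_const x t).prodMk (hasDerivAt_id x)
  exact (((h.1.differentiable (by simp)) (t, x)).hasFDerivAt.comp_hasDerivAt x h1).deriv

lemma deriv_fst_eq (h : IsTest₂ W ψ) (t x : ℝ) :
    deriv (fun s => ψ s x) t = fderiv ℝ (Function.uncurry ψ) (t, x) (1, 0) := by
  have h1 : HasDerivAt (fun y : ℝ => (y, x)) ((1 : ℝ), (0 : ℝ)) t :=
    (hasDerivAt_id t).prodMk (hasDerivAt_const t x)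
  exact (((h.1.differentiable (by simp)) (t, x)).hasFDerivAt.comp_hasDerivAt t h1).deriv

lemma deriv_snd (h : IsTest₂ W ψ) : IsTest₂ W fun t x => deriv (ψ t) x := by
  simp_rw [h.deriv_snd_eq]
  exact h.fderiv_apply _

lemma deriv_fst (h : IsTest₂ W ψ) : IsTest₂ W fun t x => deriv (fun s => ψ s x) t := by
  simp_rw [h.deriv_fst_eq]
  exact h.fderiv_apply _

lemma setIntegral_Ioi_eq {T : ℝ} {J : Set ℝ} (h : IsTest₂ (Iio T ×ˢ J) ψ) (f : ℝ → ℝ → ℝ)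
    (I : Set ℝ) : ∫ t in Ioi (0 : ℝ), ∫ x in I, f t x * ψ t x =
      ∫ t in Ioo 0 T, ∫ x in I, f t x * ψ t x := by
  refine setIntegral_eq_of_subset_of_forall_sdiff_eq_zero measurableSet_Ioi Ioo_subset_Ioi_self
    fun t ht => ?_
  have : ∀ x, ψ t x = 0 := fun x => h.eq_zero fun h' => ht.2 ⟨ht.1, h'.1⟩
  simp [this]

end IsTest₂

/-! ### The contact line -/

/-- The zero-dimensional Hausdorff measure gives mass one to each of the two end points. -/
lemma setIntegral_frontier_Ioo {a b : ℝ} (hab : a < b) (f : ℝ → ℝ) :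
    ∫ x in frontier (Ioo a b), f x ∂(Measure.hausdorffMeasure 0) = f a + f b := by
  have h1 : ∀ c : ℝ, (Measure.hausdorffMeasure 0 : Measure ℝ) {c} = 1 := fun c =>
    Measure.hausdorffMeasure_zero_singleton c
  have h2 : ∀ c : ℝ, ∫ x in {c}, f x ∂(Measure.hausdorffMeasure 0) = f c := fun c => by
    rw [Measure.restrict_singleton, h1, one_smul, integral_dirac]
  have h3 : ∀ c : ℝ, IntegrableOn f {c} (Measure.hausdorffMeasure 0) := fun c => by
    rw [IntegrableOn, Measure.restrict_singleton, h1, one_smul]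
    exact integrable_dirac (by simp)
  rw [frontier_Ioo hab, ← singleton_union, setIntegral_union (by simpa using hab.ne)
    (measurableSet_singleton b) (h3 a) (h3 b), h2, h2]

section FixedTime

variable {α β : ℝ} {v v₁ v₂ v₃ : ℕ → ℝ → ℝ} {w : ℝ → ℝ}

lemma hasDerivAt_compPoly (w : ℝ → ℝ) (a b x : ℝ) :
    HasDerivAt (compPoly w a b) (compSlope w a b x) x := by
  unfold compPoly compSlope
  have h := (((hasDerivAt_id x).sub_const ((a + b) / 2)).const_mul
    (deriv w ((a + b) / 2))).const_add (w ((a + b) / 2)) |>.add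
    ((((hasDerivAt_id x).sub_const ((a + b) / 2)).fun_pow 2).const_mul
      (deriv (deriv w) ((a + b) / 2) / 2))
  refine h.congr_deriv ?_
  simp only [id]
  push_cast
  ring

lemma SliceLimit.eqOn_Icc (H : SliceLimit α β v v₁ v₂ v₃ w) {a b : ℝ}
    (hc : IsComp (posSet α β w) a b) : ∀ x ∈ Icc a b, x ∈ Ioo α β → w x = compPoly w a b x := by
  intro x hx hxI
  by_cases hxo : x ∈ Ioo a b
  · exact (H.eqOn_comp hc x hxo).1
  · have : x = a ∨ x = b := by
      by_contra! hne
      exact hxo ⟨hx.1.lt_of_ne hne.1.symm, hx.2.lt_of_ne hne.2⟩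
    rcases this with rfl | rfl
    · rw [H.eq_zero hxI hc.left, (H.compPoly_left hc hxI).1]
    · rw [H.eq_zero hxI hc.right, (H.compPoly_right hc hxI).1]

lemma SliceLimit.slope_eq (H : SliceLimit α β v v₁ v₂ v₃ w) {a b : ℝ}
    (hc : IsComp (posSet α β w) a b) (hP : posSet α β w = Ioo a b) {x : ℝ} (hx : x ∈ Icc a b)
    (hxI : x ∈ Ioo α β) : slope α β w x = compSlope w a b x := by
  rw [slope, hP, closure_Ioo hc.lt.ne]
  have h1 : w =ᶠ[𝓝[Icc a b] x] compPoly w a b := by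
    filter_upwards [self_mem_nhdsWithin, mem_nhdsWithin_of_mem_nhds (isOpen_Ioo.mem_nhds hxI)]
      with y hy hyI using H.eqOn_Icc hc y hy hyI
  rw [h1.derivWithin_eq (H.eqOn_Icc hc x hx hxI)]
  exact (hasDerivAt_compPoly w a b x).hasDerivWithinAt.derivWithin
    (uniqueDiffOn_Icc hc.lt x hx)

/-- The limit of the source terms is Tanner's law. -/
lemma SliceLimit.setIntegral_limitDensity_eq (H : SliceLimit α β v v₁ v₂ v₃ w) {a b : ℝ}
    (hc : IsComp (posSet α β w) a b) (hP : posSet α β w = Ioo a b) {φ : ℝ → ℝ}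
    (hφ : IsTest (Ioo α β) φ) :
    ∫ x in posSet α β w, limitDensity w φ x =
      1 / 3 * ∫ x in frontier (posSet α β w), |slope α β w x| ^ 3 * φ x
        ∂(Measure.hausdorffMeasure 0) := by
  have hl : |slope α β w a| ^ 3 * φ a = compSlope w a b a ^ 3 * φ a := by
    by_cases ha : a ∈ Ioo α β
    · rw [H.slope_eq hc hP (left_mem_Icc.2 hc.lt.le) ha, abs_of_nonneg (H.compPoly_left hc ha).2]
    · rw [hφ.eq_zero ha, mul_zero, mul_zero]
  have hr : |slope α β w b| ^ 3 * φ b = -(compSlope w a b b ^ 3 * φ b) := by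
    by_cases hb : b ∈ Ioo α β
    · rw [H.slope_eq hc hP (right_mem_Icc.2 hc.lt.le) hb,
        abs_of_nonpos (H.compPoly_right hc hb).2]
      ring
    · rw [hφ.eq_zero hb, mul_zero, mul_zero, neg_zero]
  have h1 := H.setIntegral_comp hc hφ
  rw [hP, h1, setIntegral_frontier_Ioo hc.lt, hl, hr, sub_eq_add_neg]

end FixedTime

/-! ### Passage to the limit in time -/

/-- A sequence of evolutions of regular profiles that converges to `w` at almost every time,
without concentration of the energy dissipation. -/
structure NoConcentration (α β T : ℝ) (u ux uxx uxxx : ℕ → ℝ → ℝ → ℝ) (ρ w : ℝ → ℝ → ℝ) :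
    Prop where
  lt : α < β
  slice : ∀ᵐ t ∂volume.restrict (Ioo 0 T), SliceLimit α β (fun k => u k t) (fun k => ux k t)
    (fun k => uxx k t) (fun k => uxxx k t) (w t)
  bound : ∃ M, 0 < M ∧ ∀ k, ∀ t ∈ Ioo 0 T, ∀ x ∈ Icc α β, u k t x ≤ M
  energy : ∃ E, 0 ≤ E ∧ ∀ k, ∀ t ∈ Ioo 0 T, ∫ x in Ioo α β, ux k t x ^ 2 ≤ E
  comp : ∀ᵐ t ∂volume.restrict (Ioo 0 T), ∃ a b, IsComp (posSet α β (w t)) a b ∧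
    wetSet α β (ρ t) = Ioo a b ∧ posSet α β (w t) = Ioo a b
  conv : ∀ᵐ t ∂volume.restrict (Ioo 0 T),
    Tendsto (fun k => ∫⁻ x in Ioo α β, ENNReal.ofReal (u k t x * uxx k t x ^ 2)) atTop
      (𝓝 (∫⁻ x in posSet α β (w t), ENNReal.ofReal (w t x * deriv (deriv (w t)) x ^ 2)))
  dom : ∃ G : ℝ → ℝ≥0∞, AEMeasurable G (volume.restrict (Ioo 0 T)) ∧
    ∫⁻ t in Ioo 0 T, G t ≠ ⊤ ∧ ∀ᵐ t ∂volume.restrict (Ioo 0 T), ∀ k,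
      ∫⁻ x in Ioo α β, ENNReal.ofReal (u k t x * uxx k t x ^ 2) ≤ G t

lemma Slice.integral_eq_toReal {α β : ℝ} {v v₁ v₂ v₃ : ℝ → ℝ} (S : Slice α β v v₁ v₂ v₃) :
    ∫ x in Ioo α β, v x * v₂ x ^ 2 =
      (∫⁻ x in Ioo α β, ENNReal.ofReal (v x * v₂ x ^ 2)).toReal :=
  integral_eq_lintegral_of_nonneg_ae ((ae_restrict_mem measurableSet_Ioo).mono fun x hx =>
    mul_nonneg (S.nonneg x (Ioo_subset_Icc_self hx)) (sq_nonneg _)) S.integrable.1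

lemma SliceLimit.integral_eq_toReal {α β : ℝ} {v v₁ v₂ v₃ : ℕ → ℝ → ℝ} {w : ℝ → ℝ}
    (H : SliceLimit α β v v₁ v₂ v₃ w) :
    ∫ x in posSet α β w, w x * deriv (deriv w) x ^ 2 =
      (∫⁻ x in posSet α β w, ENNReal.ofReal (w x * deriv (deriv w) x ^ 2)).toReal :=
  integral_eq_lintegral_of_nonneg_ae ((ae_restrict_mem H.isOpen.measurableSet).mono fun _ hx =>
    mul_nonneg hx.2.le (sq_nonneg _))
    (((H.cont.mono posSet_subset).mul (H.contOn₂.pow 2)).aestronglyMeasurable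
      H.isOpen.measurableSet)

namespace NoConcentration

variable {α β T : ℝ} {u ux uxx uxxx : ℕ → ℝ → ℝ → ℝ} {ρ w : ℝ → ℝ → ℝ}

/-- Dominated convergence in time: the majorant of the second order term bounds the source, and the
pointwise limit comes from `SliceLimit.tendsto_Tfun`. -/
lemma tendsto_setIntegral_Tfun (H : NoConcentration α β T u ux uxx uxxx ρ w) {ψ : ℝ → ℝ → ℝ}
    (hψ : ∀ t, IsTest (Ioo α β) (ψ t)) {L : ℝ}
    (hL : ∀ t x, |ψ t x| ≤ L ∧ |deriv (ψ t) x| ≤ L ∧ |deriv (deriv (ψ t)) x| ≤ L)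
    (hm : ∀ k, AEStronglyMeasurable (fun t => Tfun α β (u k t) (ux k t) (uxx k t) (ψ t))
      (volume.restrict (Ioo 0 T))) :
    IntegrableOn (fun t => ∫ x in posSet α β (w t), limitDensity (w t) (ψ t) x) (Ioo 0 T) ∧
    ∀ s ≤ T, Tendsto (fun k => ∫ t in Ioo 0 s, Tfun α β (u k t) (ux k t) (uxx k t) (ψ t)) atTop
      (𝓝 (∫ t in Ioo 0 s, ∫ x in posSet α β (w t), limitDensity (w t) (ψ t) x)) := by
  obtain ⟨M, hM0, hM⟩ := H.bound
  obtain ⟨E, hE0, hE⟩ := H.energy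
  obtain ⟨G, hGm, hGi, hG⟩ := H.dom
  have hL0 : 0 ≤ L := (abs_nonneg _).trans (hL 0 0).1
  obtain ⟨K, hK0, hK⟩ := exists_abs_Tfun_le H.lt hM0 hE0 hL0
  have hbi : IntegrableOn (fun t => K * (1 + (G t).toReal)) (Ioo 0 T) :=
    (((integrable_const 1).add (integrable_toReal_of_lintegral_ne_top hGm hGi))).const_mul K
  have hGfin : ∀ᵐ t ∂volume.restrict (Ioo 0 T), G t < ⊤ := ae_lt_top' hGm hGi
  have hb : ∀ᵐ t ∂volume.restrict (Ioo 0 T), ∀ k,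
      ‖Tfun α β (u k t) (ux k t) (uxx k t) (ψ t)‖ ≤ K * (1 + (G t).toReal) := by
    filter_upwards [hG, hGfin, H.slice, ae_restrict_mem measurableSet_Ioo] with t h1 h2 h3 ht k
    refine (hK _ _ _ _ (h3.slice k) (hM k t ht) (hE k t ht) _ (hψ t).1
      fun x _ => hL t x).trans ?_
    rw [(h3.slice k).integral_eq_toReal]
    have := ENNReal.toReal_mono h2.ne (h1 k)
    gcongr
  have hlim : ∀ᵐ t ∂volume.restrict (Ioo 0 T),
      Tendsto (fun k => Tfun α β (u k t) (ux k t) (uxx k t) (ψ t)) atTop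
        (𝓝 (∫ x in posSet α β (w t), limitDensity (w t) (ψ t) x)) := by
    filter_upwards [hG, hGfin, H.slice, H.conv, ae_restrict_mem measurableSet_Ioo]
      with t h1 h2 h3 h4 ht
    refine h3.tendsto_Tfun H.lt (fun k => hE k t ht) (fun k => hM k t ht) ?_ (hψ t)
    rw [h3.integral_eq_toReal]
    have hfin := ((le_of_tendsto' h4 h1).trans_lt h2).ne
    refine ((ENNReal.tendsto_toReal hfin).comp h4).congr fun k => ?_
    exact (h3.slice k).integral_eq_toReal.symm
  constructor
  · refine Integrable.mono' hbi (aestronglyMeasurable_of_tendsto_ae _ hm hlim) ?_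
    filter_upwards [hb, hlim] with t h1 h2
    exact le_of_tendsto' h2.norm h1
  · intro s hs
    have hsub : Ioo 0 s ⊆ Ioo 0 T := Ioo_subset_Ioo_right hs
    exact tendsto_integral_of_dominated_convergence _ (fun k => (hm k).mono_set hsub)
      (hbi.mono_set hsub) (fun k => ae_restrict_of_ae_restrict_of_subset hsub
        (hb.mono fun t ht => ht k)) (ae_restrict_of_ae_restrict_of_subset hsub hlim)

/-- The density is the indicator function of the wet set. -/
lemma rho_eq_indicator (H : NoConcentration α β T u ux uxx uxxx ρ w) {m : ℝ} {uin : ℝ → ℝ}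
    (huin : ContinuousOn uin (Icc α β))
    (HP : ProfileLimit α β T m u ux uxx uxxx ρ ((posSet α β uin).indicator 1)) :
    ∀ᵐ t ∂volume.restrict (Ioo 0 T),
      ρ t =ᵐ[volume.restrict (Ioo α β)] (wetSet α β (ρ t)).indicator 1 := by
  have hflux : ∀ (q : RatBall α β), ∀ s ≤ T,
      Tendsto (fun k => ∫ t in Ioo 0 s, Tfun α β (u k t) (ux k t) (uxx k t) fun x =>
        q.bump x ^ 2) atTop (𝓝 (∫ t in Ioo 0 s, ∫ x in posSet α β (w t),
          limitDensity (w t) (fun x => q.bump x ^ 2) x)) := fun q => by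
    have hq := q.isTest.sq
    obtain ⟨L₀, hL₀⟩ := hq.exists_bound
    obtain ⟨L₁, hL₁⟩ := hq.deriv.exists_bound
    obtain ⟨L₂, hL₂⟩ := hq.deriv.deriv.exists_bound
    exact (H.tendsto_setIntegral_Tfun (ψ := fun _ x => q.bump x ^ 2) (fun _ => hq)
      (L := max L₀ (max L₁ L₂)) (fun _ x => ⟨(hL₀ x).trans (le_max_left _ _),
        (hL₁ x).trans ((le_max_left _ _).trans (le_max_right _ _)),
        (hL₂ x).trans ((le_max_right _ _).trans (le_max_right _ _))⟩)
      fun k => (HP.flux_integrable _ hq k).aestronglyMeasurable).2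
  have hgood := HP.ae_goodTime
  filter_upwards [hgood, HP.dens, H.comp, ae_restrict_mem measurableSet_Ioo] with t gt hρ hcomp ht
  have hopen := isOpen_wetSet gt.integrable gt.le_one
  -- no source away from the closure of the wet set
  have hbal : ∀ q : RatBall α β, tsupport q.bump ⊆ Ioo α β \ closure (wetSet α β (ρ t)) →
      ∫ x in Ioo α β, ρ t x * q.bump x ^ 2 =
        ∫ x in Ioo α β, (posSet α β uin).indicator 1 x * q.bump x ^ 2 := by
    intro q hq
    -- At earlier times the wet interval is contained in the present wet set, so its end points lie
    -- in the closure of the latter, where the bump vanishes. The source of the limit lives at those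
    -- end points only.
    have hz : ∫ s in Ioo 0 t, ∫ x in posSet α β (w s),
        limitDensity (w s) (fun x => q.bump x ^ 2) x = 0 := by
      refine integral_eq_zero_of_ae ?_
      have hsub : Ioo 0 t ⊆ Ioo 0 T := Ioo_subset_Ioo_right ht.2.le
      filter_upwards [ae_restrict_of_ae_restrict_of_subset hsub hgood,
        ae_restrict_of_ae_restrict_of_subset hsub H.slice,
        ae_restrict_of_ae_restrict_of_subset hsub H.comp, ae_restrict_mem measurableSet_Ioo]
        with s gs hs hcomp hst
      obtain ⟨a, b, hc, hwet, hP⟩ := hcomp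
      have hmono := (HP.wetSet_mono (hsub hst) ht hst.2 gs gt).1
      rw [hwet] at hmono
      have hcl := closure_mono hmono
      rw [closure_Ioo hc.lt.ne] at hcl
      have hend : ∀ x ∈ Icc a b, q.bump x = 0 := fun x hx => by
        by_contra hne
        exact (hq (subset_tsupport _ hne)).2 (hcl hx)
      rw [hP, hs.setIntegral_comp hc q.isTest.sq]
      simp [hend a (left_mem_Icc.2 hc.lt.le), hend b (right_mem_Icc.2 hc.lt.le)]
    have h1 := hflux q t ht.2.le
    rw [hz] at h1
    exact sub_eq_zero.1 (tendsto_nhds_unique (gt.balance q) h1)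
  have hOo : IsOpen (Ioo α β \ closure (wetSet α β (ρ t))) := isOpen_Ioo.sdiff isClosed_closure
  -- the initial support is contained in the closure of the wet set
  have hinit : ∀ y ∈ posSet α β uin, y ∈ closure (wetSet α β (ρ t)) := by
    intro y hy
    by_contra hycl
    have hPo : IsOpen (posSet α β uin) := isOpen_posSet (huin.mono Ioo_subset_Icc_self)
    obtain ⟨q, hq, hqy⟩ := RatBall.exists_mem (hPo.inter hOo)
      (inter_subset_left.trans posSet_subset) ⟨hy, hy.1, hycl⟩
    have h2 := hbal q (hq.trans inter_subset_right)
    have h3 : ∫ x in Ioo α β, (posSet α β uin).indicator 1 x * q.bump x ^ 2 =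
        ∫ x in Ioo α β, q.bump x ^ 2 := by
      congr 1
      ext x
      by_cases hx : x ∈ tsupport q.bump
      · rw [indicator_of_mem (hq hx).1]; simp
      · simp [image_eq_zero_of_notMem_tsupport hx]
    refine hycl (subset_closure (mem_wetSet_of_integral_le gt.integrable gt.le_one q.isTest.sq
      (fun x => sq_nonneg _) (h3.symm.trans h2.symm).le ?_))
    rw [hqy]; norm_num
  -- the density vanishes away from the closure of the wet set
  have hzero : ∀ᵐ x ∂volume, x ∈ Ioo α β \ closure (wetSet α β (ρ t)) → ρ t x = 0 := by
    rw [ae_iff]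
    refine measure_null_of_locally_null _ fun x hx => ?_
    simp only [Classical.not_imp, mem_ofPred_eq] at hx
    obtain ⟨q, hq, hqx⟩ := RatBall.exists_mem hOo sdiff_subset hx.1
    have h2 := hbal q hq
    have h3 : ∫ x in Ioo α β, (posSet α β uin).indicator 1 x * q.bump x ^ 2 = 0 := by
      refine integral_eq_zero_of_ae (Eventually.of_forall fun y => ?_)
      by_cases hy : y ∈ tsupport q.bump
      · have : y ∉ posSet α β uin := fun h => (hq hy).2 (hinit y h)
        simp [indicator_of_notMem this]
      · simp [image_eq_zero_of_notMem_tsupport hy]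
    rw [h3, setIntegral_eq_zero_iff_of_nonneg_ae (hρ.2.mono fun y hy =>
      mul_nonneg hy.1 (sq_nonneg _)) (integrableOn_mul_test gt.integrable q.isTest.sq),
      EventuallyEq, ae_restrict_iff' measurableSet_Ioo, ae_iff] at h2
    refine ⟨_, ?_, h2⟩
    have hcont := q.isTest.continuous
    filter_upwards [self_mem_nhdsWithin, mem_nhdsWithin_of_mem_nhds
      ((isOpen_lt continuous_const hcont).mem_nhds (show (0 : ℝ) < q.bump x by rw [hqx]; simp))]
      with y hy hyq
    have hyq' : (0 : ℝ) < q.bump y := hyq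
    simp only [Classical.not_imp, Pi.zero_apply] at hy ⊢
    exact ⟨hy.1.1, mul_ne_zero hy.2 (pow_pos hyq' 2).ne'⟩
  have hone := ae_eq_one_on_wetSet gt.integrable gt.le_one
  rw [ae_restrict_iff' hopen.measurableSet] at hone
  obtain ⟨a, b, -, hab, -⟩ := hcomp
  rw [EventuallyEq, ae_restrict_iff' measurableSet_Ioo]
  -- The wet set is an interval, so its closure adds two points, which form a null set.
  have hne : ∀ c : ℝ, ∀ᵐ x ∂volume, x ≠ c := fun c => by simp [ae_iff]
  filter_upwards [hzero, hone, hne a, hne b] with x h0 h1 ha hb hx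
  by_cases hxw : x ∈ wetSet α β (ρ t)
  · rw [indicator_of_mem hxw, h1 hxw]; rfl
  · rw [indicator_of_notMem hxw]
    refine h0 ⟨hx, fun hcl => hxw ?_⟩
    rw [hab] at hcl ⊢
    have := closure_minimal Ioo_subset_Icc_self isClosed_Icc hcl
    exact ⟨this.1.lt_of_ne ha.symm, this.2.lt_of_ne hb⟩

end NoConcentration

lemma ProfileLimit.comp {α β T m : ℝ} {u ux uxx uxxx : ℕ → ℝ → ℝ → ℝ} {ρ : ℝ → ℝ → ℝ} {ρ₀ : ℝ → ℝ}
    (H : ProfileLimit α β T m u ux uxx uxxx ρ ρ₀) {σ : ℕ → ℕ} (hσ : StrictMono σ) :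
    ProfileLimit α β T m (fun k => u (σ k)) (fun k => ux (σ k)) (fun k => uxx (σ k))
      (fun k => uxxx (σ k)) ρ ρ₀ where
  lt := H.lt
  slice := H.slice.mono fun _ ht k => ht (σ k)
  dissip := H.dissip.mono fun _ ht => ht.comp hσ.tendsto_atTop
  holder := H.holder.imp fun _ hC k => hC (σ k)
  bound := H.bound.imp fun _ hM => ⟨hM.1, fun k => hM.2 (σ k)⟩
  energy := H.energy.imp fun _ hE => ⟨hE.1, fun k => hE.2 (σ k)⟩
  mass := fun k => H.mass (σ k)
  mass_pos := H.mass_pos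
  dens := H.dens
  posSet_subset := H.posSet_subset.mono fun _ ht τ w hτ hw =>
    ht (fun k => σ (τ k)) w (hσ.tendsto_atTop.comp hτ) hw
  conn := H.conn
  flux_integrable := fun φ hφ k => H.flux_integrable φ hφ (σ k)
  balance := fun φ hφ => (H.balance φ hφ).mono fun _ ht => ht.comp hσ.tendsto_atTop

namespace ConvergentFamily

variable {n α β T p : ℝ} {uin duin : ℝ → ℝ} {ε : ℕ → ℝ} {u ux uxx uxxx : ℕ → ℝ → ℝ → ℝ}
  {ρ w : ℝ → ℝ → ℝ}

/-- Measurability in time is inherited from the integral of `T^ε` itself, which is jointly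
measurable and agrees with `Tfun` at a.e. time. -/
lemma aestronglyMeasurable_flux (H : ConvergentFamily n α β T p uin duin ε u ux uxx uxxx ρ)
    (k : ℕ) {ψ : ℝ → ℝ → ℝ} (hψ : Continuous (Function.uncurry ψ))
    (hψt : ∀ t, ContDiff ℝ ∞ (ψ t)) :
    AEStronglyMeasurable (fun t => Tfun α β (u k t) (ux k t) (uxx k t) (ψ t))
      (volume.restrict (Ioo 0 T)) := by
  have h1 := ((H.sol k).integrable_Tterm H.memLp H.pos).aestronglyMeasurable.mul
    (hψ.aestronglyMeasurable)
  refine h1.integral_prod_right'.congr ?_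
  filter_upwards [H.ae_Tfun_eq k] with t ht
  exact ht _ (hψt t)

lemma tendsto_integral_Beps_mul (H : ConvergentFamily n α β T p uin duin ε u ux uxx uxxx ρ)
    (hpair : ∀ᵐ t ∂volume.restrict (Ioo 0 T), ∀ φ : ℝ → ℝ, IsTest (Ioo α β) φ →
      Tendsto (fun k => pairing n (ε k) α β (u k) φ t) atTop (𝓝 (∫ x in Ioo α β, ρ t x * φ x)))
    {χ : ℝ → ℝ → ℝ} (hχ : IsTest₂ (Iio T ×ˢ Ioo α β) χ) :
    Tendsto (fun k => ∫ t in Ioo 0 T, ∫ x in Ioo α β, Beps n (ε k) (u k t x) * χ t x) atTop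
      (𝓝 (∫ t in Ioo 0 T, ∫ x in Ioo α β, ρ t x * χ t x)) := by
  obtain ⟨L, hL⟩ := hχ.exists_bound
  refine tendsto_integral_filter_of_dominated_convergence (fun _ => ∫ x in Ioo α β, (2 * L))
    (Eventually.of_forall fun k => ?_) ?_ (integrable_const _)
    (hpair.mono fun t ht => ht _ (hχ.slice t))
  · have h1 : AEStronglyMeasurable (fun z : ℝ × ℝ => Beps n (ε k) (u k z.1 z.2))
        ((volume.restrict (Ioo 0 T)).prod (volume.restrict (Ioo α β))) := by
      rw [← restrict_prod_eq]
      exact (((H.sol k).continuousOn_Beps H.n_pos H.n_lt (H.eps_mem k)).mono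
        (prod_mono (fun t ht => ht.1.le) Ioo_subset_Icc_self)).aestronglyMeasurable
        (measurableSet_Ioo.prod measurableSet_Ioo)
    exact (h1.mul hχ.1.continuous.aestronglyMeasurable).integral_prod_right'
  · filter_upwards [H.eventually_abs_Beps_le one_pos] with k hk
    filter_upwards [ae_restrict_mem measurableSet_Ioo] with t ht
    refine abs_setIntegral_le measurableSet_Ioo (integrableOn_const measure_Ioo_lt_top.ne)
      fun x hx => ?_
    obtain ⟨b1, b2⟩ := hk t ht.1.le x (Ioo_subset_Icc_self hx)
    rw [abs_mul, abs_of_nonneg b1]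
    exact mul_le_mul (by linarith) (hL t x) (abs_nonneg _) (by norm_num)

lemma tendsto_integral_Rterm_mul (H : ConvergentFamily n α β T p uin duin ε u ux uxx uxxx ρ)
    {χ : ℝ → ℝ → ℝ} (hχ : IsTest₂ (Iio T ×ˢ Ioo α β) χ) :
    Tendsto (fun k => ∫ t in Ioo 0 T, ∫ x in Ioo α β,
      Rterm n (ε k) (u k t x) (uxxx k t x) * χ t x) atTop (𝓝 0) := by
  obtain ⟨L, hL⟩ := hχ.exists_bound
  obtain ⟨hR, hRlim⟩ := H.tendsto_Rterm
  have h2 := hRlim.mul_const L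
  rw [zero_mul] at h2
  refine squeeze_zero_norm (fun k => ?_) h2
  have hRT := hR k T H.pos
  rw [← integral_mul_const]
  refine norm_integral_le_of_norm_le (hRT.abs.integral_prod_left.mul_const L) ?_
  filter_upwards [hRT.prod_right_ae] with s hs
  rw [← integral_mul_const]
  refine norm_integral_le_of_norm_le (hs.abs.mul_const L) (Eventually.of_forall fun x => ?_)
  rw [norm_mul]
  exact mul_le_mul_of_nonneg_left (hL s x) (norm_nonneg _)

/-- The limit density solves Tanner's law. -/
lemma solvesTannerLaw (H : ConvergentFamily n α β T p uin duin ε u ux uxx uxxx ρ)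
    (hpair : ∀ᵐ t ∂volume.restrict (Ioo 0 T), ∀ φ : ℝ → ℝ, IsTest (Ioo α β) φ →
      Tendsto (fun k => pairing n (ε k) α β (u k) φ t) atTop (𝓝 (∫ x in Ioo α β, ρ t x * φ x)))
    (HN : NoConcentration α β T u ux uxx uxxx ρ w) : SolvesTannerLaw α β T uin w ρ := by
  intro ψ hψ
  obtain ⟨L₀, hL₀⟩ := hψ.exists_bound
  obtain ⟨L₁, hL₁⟩ := hψ.deriv_snd.exists_bound
  obtain ⟨L₂, hL₂⟩ := hψ.deriv_snd.deriv_snd.exists_bound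
  obtain ⟨hSi, hS⟩ := HN.tendsto_setIntegral_Tfun (fun t => hψ.slice t) (L := max L₀ (max L₁ L₂))
    (fun t x => ⟨(hL₀ t x).trans (le_max_left _ _),
      (hL₁ t x).trans ((le_max_left _ _).trans (le_max_right _ _)),
      (hL₂ t x).trans ((le_max_right _ _).trans (le_max_right _ _))⟩)
    (fun k => H.aestronglyMeasurable_flux k hψ.1.continuous fun t => (hψ.slice t).1)
  have hae : ∀ᵐ t ∂volume.restrict (Ioo 0 T),
      ∫ x in posSet α β (w t), limitDensity (w t) (ψ t) x =
        1 / 3 * ∫ x in frontier (posSet α β (w t)), |slope α β (w t) x| ^ 3 * ψ t x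
          ∂(Measure.hausdorffMeasure 0) := by
    filter_upwards [HN.slice, HN.comp] with t h1 h2
    obtain ⟨a, b, hc, -, hP⟩ := h2
    exact h1.setIntegral_limitDensity_eq hc hP (hψ.slice t)
  constructor
  · refine (hSi.const_mul 3).congr (hae.mono fun t ht => ?_)
    simp only [ht]
    ring
  have hA := H.tendsto_initial (hψ.slice 0).continuous
  have hB := H.tendsto_integral_Beps_mul hpair hψ.deriv_fst
  have hC := hS T le_rfl
  have hD := H.tendsto_integral_Rterm_mul hψ.deriv_snd
  have heq : ∀ k, (∫ x in Ioo α β, Beps n (ε k) (uin x) * ψ 0 x) +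
      (∫ t in Ioo 0 T, ∫ x in Ioo α β, Beps n (ε k) (u k t x) * deriv (fun s => ψ s x) t) +
      (∫ t in Ioo 0 T, Tfun α β (u k t) (ux k t) (uxx k t) (ψ t)) -
      (∫ t in Ioo 0 T, ∫ x in Ioo α β, Rterm n (ε k) (u k t x) (uxxx k t x) * deriv (ψ t) x) =
      0 := fun k => by
    have h := (H.sol k).rho_equation ψ (hψ.mono (subset_univ _))
    rw [hψ.deriv_fst.setIntegral_Ioi_eq (fun t x => Beps n (ε k) (u k t x)),
      hψ.setIntegral_Ioi_eq (fun t x => Tterm (u k t x) (ux k t x) (uxxx k t x)),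
      hψ.deriv_snd.setIntegral_Ioi_eq (fun t x => Rterm n (ε k) (u k t x) (uxxx k t x))] at h
    have h2 : ∫ t in Ioo 0 T, ∫ x in Ioo α β, Tterm (u k t x) (ux k t x) (uxxx k t x) * ψ t x =
        ∫ t in Ioo 0 T, Tfun α β (u k t) (ux k t) (uxx k t) (ψ t) :=
      integral_congr_ae ((H.ae_Tfun_eq k).mono fun t ht => ht _ (hψ.slice t).1)
    rwa [h2] at h
  have hlim := ((hA.add hB).add hC).sub hD
  simp only [heq] at hlim
  have h0 := tendsto_nhds_unique hlim tendsto_const_nhds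
  rw [← integral_congr_ae hae]
  linarith

end ConvergentFamily

/-! ### The two conclusions for families of solutions -/

namespace ConvergentFamily

variable {n α β T p : ℝ} {uin duin : ℝ → ℝ} {ε : ℕ → ℝ} {u ux uxx uxxx : ℕ → ℝ → ℝ → ℝ}
  {ρ : ℝ → ℝ → ℝ}

/-- Convergence to the droplet profiles. -/
theorem exists_subseq_droplet (H : ConvergentFamily n α β T p uin duin ε u ux uxx uxxx ρ)
    (hconn : ∀ᵐ t ∂volume.restrict (Ioo 0 T), IsConnected (wetSet α β (ρ t)))
    (hcl : ∀ᵐ t ∂volume.restrict (Ioo 0 T), closure (wetSet α β (ρ t)) ⊆ Ioo α β) :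
    ∃ (σ : ℕ → ℕ) (w wx : ℝ → ℝ → ℝ), StrictMono σ ∧
      ∀ᵐ t ∂volume.restrict (Ioo 0 T),
        IsProfile α β (∫ x in Ioo α β, uin x) (wetSet α β (ρ t)) (w t) ∧
        HasWeakDeriv (Ioo α β) (w t) (wx t) ∧ MemLp (wx t) 2 (volume.restrict (Ioo α β)) ∧
        TendstoUniformlyOn (fun k => u (σ k) t) (w t) atTop (Ioo α β) ∧
        TendstoH1Weakly α β (fun k => u (σ k) t) (fun k => ux (σ k) t) (w t) (wx t) := by
  obtain ⟨σ, hσ, -, HP⟩ := H.exists_profileLimit hconn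
  obtain ⟨τ, w, wx, hτ, h⟩ := HP.exists_subseq_droplet hcl
  exact ⟨fun k => σ (τ k), w, wx, hσ.comp hτ, h⟩

/-- The entropy inequality bounds the energy term by the integral of the density at time `T`, which
is eventually at most `2 (β - α)`. It makes the limit of the energy terms finite. -/
lemma lintegral_energy_le (H : ConvergentFamily n α β T p uin duin ε u ux uxx uxxx ρ) :
    ∀ᶠ k in atTop, ∫⁻ t in Ioo 0 T, ∫⁻ x in Ioo α β, ENNReal.ofReal (u k t x * uxx k t x ^ 2) ≤
      ENNReal.ofReal ((β - α) * 2) := by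
  filter_upwards [H.eventually_abs_Beps_le one_pos] with k hk
  refine (le_self_add.trans ((H.sol k).entropy T H.pos)).trans (ENNReal.ofReal_le_ofReal ?_)
  have hi := H.integrable_Beps k H.pos.le (φ := fun _ => 1) continuous_const
  simp only [mul_one] at hi
  have h1 := setIntegral_mono_on hi (integrableOn_const (C := (2 : ℝ)) measure_Ioo_lt_top.ne)
    measurableSet_Ioo fun x hx => by
      linarith [(hk T H.pos.le x (Ioo_subset_Icc_self hx)).2]
  rwa [setIntegral_const, Real.volume_real_Ioo_of_le H.lt.le, smul_eq_mul] at h1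

/-- Tanner's law in the limit without concentration of the energy dissipation. -/
theorem rho_eq_indicator_and_solvesTannerLaw
    (H : ConvergentFamily n α β T p uin duin ε u ux uxx uxxx ρ)
    (hconn : ∀ᵐ t ∂volume.restrict (Ioo 0 T), IsConnected (wetSet α β (ρ t)))
    {σ : ℕ → ℕ} {w : ℝ → ℝ → ℝ} (hσ : StrictMono σ)
    (hw : ∀ᵐ t ∂volume.restrict (Ioo 0 T),
      TendstoUniformlyOn (fun k => u (σ k) t) (w t) atTop (Ioo α β))
    (hX : Tendsto (fun k => ∫⁻ t in Ioo 0 T, ∫⁻ x in Ioo α β,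
        ENNReal.ofReal (u (σ k) t x * uxx (σ k) t x ^ 2)) atTop
      (𝓝 (∫⁻ t in Ioo 0 T, ∫⁻ x in posSet α β (w t),
        ENNReal.ofReal (w t x * iteratedDeriv 2 (w t) x ^ 2)))) :
    (∀ᵐ t ∂volume.restrict (Ioo 0 T),
      ρ t =ᵐ[volume.restrict (Ioo α β)] (wetSet α β (ρ t)).indicator 1) ∧
    SolvesTannerLaw α β T uin w ρ := by
  simp only [iteratedDeriv_succ, iteratedDeriv_zero] at hX
  -- The conclusions concern `ρ` and `w` only, so passing to further subsequences is free. They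
  -- successively give convergence at a.e. time, the identification of the positivity sets, and a
  -- majorant for the energy.
  obtain ⟨σ₁, hσ₁, hpair₁, HP₁⟩ := (H.comp hσ).exists_profileLimit hconn
  obtain ⟨σ₂, hσ₂, hcore₂⟩ := HP₁.exists_subseq_posSet_eq
  have hσ₁₂ : StrictMono fun k => σ₁ (σ₂ k) := hσ₁.comp hσ₂
  have H₂ := (H.comp hσ).comp hσ₁₂
  have HP₂ := HP₁.comp hσ₂
  have hw₂ := hw.mono fun t ht => fun s hs => hσ₁₂.tendsto_atTop.eventually (ht s hs)
  have hX₂ := hX.comp hσ₁₂.tendsto_atTop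
  have hslice : ∀ᵐ t ∂volume.restrict (Ioo 0 T),
      SliceLimit α β (fun k => u (σ (σ₁ (σ₂ k))) t) (fun k => ux (σ (σ₁ (σ₂ k))) t)
        (fun k => uxx (σ (σ₁ (σ₂ k))) t) (fun k => uxxx (σ (σ₁ (σ₂ k))) t) (w t) := by
    filter_upwards [HP₂.slice, HP₂.dissip, hw₂] with t h1 h2 h3 using ⟨h1, h2, h3⟩
  have hgm : ∀ k, AEMeasurable (fun t => ∫⁻ x in Ioo α β,
      ENNReal.ofReal (u (σ (σ₁ (σ₂ k))) t x * uxx (σ (σ₁ (σ₂ k))) t x ^ 2))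
      (volume.restrict (Ioo 0 T)) := fun k => by
    obtain ⟨m0, -, m2, -⟩ := (H₂.sol k).aemeasurable (S := T)
    exact ((m0.mul (m2.pow_const 2)).ennreal_ofReal).lintegral_prod_right'
  have hfin : ∫⁻ t in Ioo 0 T, ∫⁻ x in posSet α β (w t),
      ENNReal.ofReal (w t x * deriv (deriv (w t)) x ^ 2) ≠ ⊤ :=
    ((le_of_tendsto hX₂ H₂.lintegral_energy_le).trans_lt ENNReal.ofReal_lt_top).ne
  obtain ⟨σ₃, hσ₃, hconv, G, hGm, hGi, hG⟩ := exists_subseq_dominated hgm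
    (hslice.mono fun t ht => ht.lintegral_le_liminf) hX₂ hfin
  have HP₃ := HP₂.comp hσ₃
  have HN : NoConcentration α β T (fun k => u (σ (σ₁ (σ₂ (σ₃ k)))))
      (fun k => ux (σ (σ₁ (σ₂ (σ₃ k))))) (fun k => uxx (σ (σ₁ (σ₂ (σ₃ k)))))
      (fun k => uxxx (σ (σ₁ (σ₂ (σ₃ k))))) ρ w := by
    refine ⟨H.lt, hslice.mono fun t ht => ht.comp hσ₃.tendsto_atTop, HP₃.bound, HP₃.energy, ?_,
      hconv, G, hGm, hGi, hG⟩
    filter_upwards [hcore₂, HP₂.slice, hw₂, ae_restrict_mem measurableSet_Ioo]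
      with t hcore hS hwt ht
    -- Uniform convergence to `w t` is assumed in the open interval only. A compactness limit on the
    -- closed interval agrees with `w t` inside and has the same positivity set.
    obtain ⟨κ, hκ, w', hw'⟩ := HP₂.exists_subseq_limit ht hS id
    obtain ⟨a, b, hc, hwet, hP⟩ := hcore κ w' hκ.tendsto_atTop hw'
    have heq : ∀ x ∈ Ioo α β, w' x = w t x := fun x hx =>
      tendsto_nhds_unique (hw'.tendsto_at (Ioo_subset_Icc_self hx))
        ((TendstoUniformlyOn.tendsto_at hwt hx).comp hκ.tendsto_atTop)
    have hpos : posSet α β w' = posSet α β (w t) := by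
      ext x
      exact and_congr_right fun hx => by rw [heq x hx]
    rw [hpos] at hc hP
    exact ⟨a, b, hc, hwet, hP⟩
  refine ⟨HN.rho_eq_indicator H.cont_uin HP₃, (H₂.comp hσ₃).solvesTannerLaw ?_ HN⟩
  filter_upwards [hpair₁] with t ht φ hφ
  exact (ht φ hφ).comp (hσ₂.comp hσ₃).tendsto_atTop

end ConvergentFamily

end TannerLaw

theorem theorem5 (n α β T p : ℝ) (hn : 0 < n) (hn3 : n < 3) (hαβ : α < β) (hT : 0 < T)
    (hp : 1 ≤ p)
    -- the initial datum, non-negative and in `H¹(α,β)`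
    (uin duin : ℝ → ℝ) (huin : ContinuousOn uin (Icc α β)) (huin0 : ∀ x ∈ Icc α β, 0 ≤ uin x)
    (hduin : TannerLaw.HasWeakDeriv (Ioo α β) uin duin)
    (hduin2 : MemLp duin 2 (volume.restrict (Ioo α β)))
    -- the solutions `u^{ε_k}`, with their derivatives in `x`
    (ε : ℕ → ℝ) (hε : ∀ k, ε k ∈ Ioo (0 : ℝ) 1) (hε0 : Tendsto ε atTop (𝓝 0))
    (u ux uxx uxxx : ℕ → ℝ → ℝ → ℝ)
    (hu : ∀ k, TannerLaw.IsSolution n (ε k) α β uin duin (u k) (ux k) (uxx k) (uxxx k))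
    -- `ρ^{ε_k} = B^{ε_k}(u^{ε_k})` converges to `ρ` in `L^p(0,T; W^{-1,1}(α,β))`
    (ρ : ℝ → ℝ → ℝ) (hρ : IntegrableOn (Function.uncurry ρ) (Ioo 0 T ×ˢ Ioo α β))
    (hρlim : Tendsto (fun k => ∫⁻ t in Ioo 0 T,
      (TannerLaw.negNorm α β (fun x => TannerLaw.Beps n (ε k) (u k t x) - ρ t x)) ^ p)
      atTop (𝓝 0))
    -- `Σ(t)` is a single interval for a.e. `t`
    (hSigma : ∀ᵐ t ∂(volume.restrict (Ioo 0 T)), IsConnected (TannerLaw.wetSet α β (ρ t))) :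
    -- if `Σ(t)` is compactly contained in `(α,β)`, then a subsequence converges for a.e. `t`
    -- to the droplet profile on `Σ(t)`
    ((∀ᵐ t ∂(volume.restrict (Ioo 0 T)), closure (TannerLaw.wetSet α β (ρ t)) ⊆ Ioo α β) →
      ∃ (σ : ℕ → ℕ) (w wx : ℝ → ℝ → ℝ), StrictMono σ ∧
        ∀ᵐ t ∂(volume.restrict (Ioo 0 T)),
          TannerLaw.IsProfile α β (∫ x in Ioo α β, uin x) (TannerLaw.wetSet α β (ρ t)) (w t) ∧
          TannerLaw.HasWeakDeriv (Ioo α β) (w t) (wx t) ∧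
          MemLp (wx t) 2 (volume.restrict (Ioo α β)) ∧
          TendstoUniformlyOn (fun k => u (σ k) t) (w t) atTop (Ioo α β) ∧
          TannerLaw.TendstoH1Weakly α β (fun k => u (σ k) t) (fun k => ux (σ k) t)
            (w t) (wx t)) ∧
    -- whenever a subsequence converges to `w(t)` for a.e. `t`, without concentration,
    -- `ρ` is an indicator function and solves Tanner's law
    (∀ (σ : ℕ → ℕ) (w : ℝ → ℝ → ℝ), StrictMono σ →
      (∀ᵐ t ∂(volume.restrict (Ioo 0 T)),
        TendstoUniformlyOn (fun k => u (σ k) t) (w t) atTop (Ioo α β)) →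
      Tendsto (fun k => ∫⁻ t in Ioo 0 T, ∫⁻ x in Ioo α β,
          ENNReal.ofReal (u (σ k) t x * (uxx (σ k) t x) ^ 2)) atTop
        (𝓝 (∫⁻ t in Ioo 0 T, ∫⁻ x in TannerLaw.posSet α β (w t),
          ENNReal.ofReal (w t x * (iteratedDeriv 2 (w t) x) ^ 2))) →
      (∀ᵐ t ∂(volume.restrict (Ioo 0 T)),
        ρ t =ᵐ[volume.restrict (Ioo α β)] (TannerLaw.wetSet α β (ρ t)).indicator 1) ∧
      TannerLaw.SolvesTannerLaw α β T uin w ρ) := by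
  have H : TannerLaw.ConvergentFamily n α β T p uin duin ε u ux uxx uxxx ρ :=
    ⟨hn, hn3, hαβ, hT, hp, huin, huin0, hduin2, hε, hε0, hu, hρ, hρlim⟩
  exact ⟨H.exists_subseq_droplet hSigma, fun σ w hσ hw hX =>
    H.rho_eq_indicator_and_solvesTannerLaw hSigma hσ hw hX⟩
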